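/- **Setting.** Let $\mathcal G(V\cup U)$ be a finite DAG with observed vertices $V$ and latent vertices $U$. A causal model on it consists of jointly independent errors $\epsilon_i$ and measurable structural equations $V_i=f_i(\mathrm{pa}(V_i),\epsilon_i)$, $i\in V\cup U$; all state spaces and the underlying probability space are standard Borel, the state spaces carry $\sigma$-finite reference measures (fixed for $V$; the latent state spaces may vary with the model), and sums below are integrals with respect to these. For $A,I\subseteq V$ and a value $a$ of $I$, $A(a)$ denotes the potential outcomes of $A$ under $\mathrm{do}(I=a)$, and $p(A\,\|\,a)$ is their law. The CADMG $\mathcal G(R,S)$ is the latent projection of $\mathcal G(V\cup U)$ onto $R\cup S$ with all edges into $S$ removed; $\mathrm{de}$ denotes descendants in it (a vertex is a descendant of itself). Equations between densities hold up to null sets, and "for all values" is understood in the same sense. **The operation.** Let $R,S\subseteq V$ be disjoint, $B\in R$, and let $W,Z\subseteq R\setminus\{B\}$ be disjoint. Put $$W^*=\mathrm{de}(B)\cap W,\quad Z^*=\mathrm{de}(B)\cap Z,\quad \tilde W=W\setminus W^*,\quad \tilde Z=Z\setminus Z^*,$$ $$O=\mathrm{de}(B)\setminus(W\cup Z\cup\{B\}),\qquad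 X=R\setminus(O\cup\{B\}\cup Z\cup W),$$ so that $O\cup\tilde W\cup\tilde Z\cup X=R\setminus(Z^*\cup W^*\cup\{B\})$. Fix a value $s$ of $S$. *Common conditions* for a set $U^*\subseteq U$: 1. under $\mathrm{do}(S=s)$ all variables in $(V\setminus S)\cup U$ have a joint density with respect to the product reference measure; 2. (ignorability) $O(s,b)\perp B(s)\mid U^*(s),\tilde W(s),\tilde Z(s),X(s)$ for all $b$; 3. (outcome-inducing proxy) $W(s)\perp (Z(s),B(s))\mid U^*(s),X(s)$; 4. (treatment-inducing proxy) $O(s)\perp Z(s)\mid \tilde W(s),B(s),U^*(s),X(s)$; 5. (latent positivity) for all $b$, $p(b\mid U^*,\tilde W,\tilde Z,X\,\|\,s)>0$ almost surely. *Outcome variant.* (i) There is a measurable extended outcome bridge function $h$, i.e. $\sum_{w'}h(o,w,w',b,x)\,p(w'\mid z,b,x\,\|\,s)=p(o,w\mid z,b,x\,\|\,s)$; (ii) completeness of $Z$: for all $b,x$ and all $g\in L^2(U^*(s))$ for which the sums converge absolutely, $\sum_{u}g(u)\,p(u\mid b,z,x\,\|\,s)=0$ for $P_{Z(s)}$-almost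 every $z$ if and only if $g(U^*(s))=0$ almost surely. *Treatment variant.* (i) $p(b\mid w,x\,\|\,s)>0$ for all $b$ and almost all $(w,x)$, and there is a measurable extended treatment bridge function $q$, i.e. $\sum_{z'}q(z,z',b,x)\,p(z'\mid w,b,x\,\|\,s)=p(z\mid w,x\,\|\,s)/p(b\mid w,x\,\|\,s)$; (ii) completeness of $W$: as above with $W$ in place of $Z$. A bridge function $h$ (resp. $q$) is called *sufficiently integrable* if, for almost all values of the other arguments, $\sum_{w^*}\sum_{w'}|h(o,(\tilde w,w^*),w',b,x)|$ weighted by $p(w'\mid z,b,x\,\|\,s)$ and by $p(w',\tilde z,x\,\|\,s)$ is finite (resp. $\sum_{z^*}\sum_{z'}|q((\tilde z,z^*),z',b,x)|$ weighted by $p(z'\mid w,b,x\,\|\,s)$ and by $p(o,\tilde w,z',b,x\,\|\,s)$ is finite), and the function of $u$ $$p(o,\tilde w\mid b,u,x\,\|\,s)-\sum_{w^*}\sum_{w'}h(o,(\tilde w,w^*),w',b,x)\,p(w'\mid u,x\,\|\,s)$$ $$\Bigl(\text{resp. } \frac{p(\tilde z\mid u,x\,\|\,s)}{p(b\mid u,x\,\|\,s)}-\sum_{z^*}\sum_{z'}q((\tilde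 z,z^*),z',b,x)\,p(z'\mid b,u,x\,\|\,s)\Bigr)$$ lies in $L^2(U^*(s))$. It is called *bounded* if for almost all $(o,\tilde w,b,x)$ the function $w'\mapsto\sum_{w^*}|h(o,(\tilde w,w^*),w',b,x)|$ is essentially bounded (resp. for almost all $(\tilde z,b,x)$ the function $z'\mapsto\sum_{z^*}|q((\tilde z,z^*),z',b,x)|$ is). Condition 1 and all integrability and boundedness conditions hold automatically if all state spaces are finite with counting measure. **Proposition.** The kernel operation $\mathtt{Ebf}_{W,Z}(B)$ is valid: from $p(R\,\|\,S)$ it identifies $p(R\setminus(Z^*\cup W^*\cup\{B\})\,\|\,S\cup\{B\})$. Precisely, for every value $s$ of $S$: (a) Suppose that two causal models on $\mathcal G(V\cup U)$ have the same kernel $p(R\,\|\,s)$, and that each of them satisfies, for some $U^*\subseteq U$ that may depend on the model, the common conditions together with the outcome variant or the treatment variant (the two models need not satisfy the same one), with a sufficiently integrable and bounded bridge function. Then for almost every $b$ they have the same kernel $p(R\setminus(Z^*\cup W^*\cup\{B\})\,\|\,s,b)$. (b) If a causal model satisfies the common conditions and the outcome variant (ii) for $U^*$, then for every sufficiently integrable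 extended outcome bridge function $h$ and almost every $b$, $$p(o,\tilde w,\tilde z,x\,\|\,s,b)=\sum_{w^*}\sum_{w'}h(o,(\tilde w,w^*),w',b,x)\,p(w',\tilde z,x\,\|\,s).$$ (c) If a causal model satisfies the common conditions and the treatment variant (ii) for $U^*$, and $p(b\mid w,x\,\|\,s)>0$ as in the treatment variant (i), then for every sufficiently integrable extended treatment bridge function $q$ and almost every $b$, $$p(o,\tilde w,\tilde z,x\,\|\,s,b)=\sum_{z^*}\sum_{z'}q((\tilde z,z^*),z',b,x)\,p(o,\tilde w,z',b,x\,\|\,s).$$ -/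

import Mathlib

open MeasureTheory ProbabilityTheory

/-! ## Causal models -/

section Causal

universe u

/-- The state space of a vertex: observed vertices `v : V` have state space `X v`, latent vertices
`k : U` have state space `XU k`. -/
def State {V U : Type*} (X : V → Type u) (XU : U → Type u) : V ⊕ U → Type u
  | .inl v => X v
  | .inr k => XU k

instance State.measurableSpace {V U : Type*} (X : V → Type u) (XU : U → Type u)
    [hX : ∀ v, MeasurableSpace (X v)] [hXU : ∀ k, MeasurableSpace (XU k)] :
    ∀ i, MeasurableSpace (State X XU i)
  | .inl v => hX v
  | .inr k => hXU k

/-- A nonparametric structural equation model with independent errors whose causal graph is the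
hidden variable DAG `G` on the observed vertices `V` and the latent vertices `U`. The state spaces
`X` of the observed variables are fixed; the state spaces of the latent variables, their reference
measures, the errors and the structural equations belong to the model. -/
structure CausalModel {V U : Type*} (G : Digraph (V ⊕ U)) (X : V → Type u)
    [∀ v, MeasurableSpace (X v)] where
  /-- the causal graph has no directed cycle -/
  acyclic : ∀ i, ¬ Relation.TransGen G.Adj i i
  /-- state spaces of the latent variables -/
  XU : U → Type u
  [measXU : ∀ k, MeasurableSpace (XU k)]
  [borelXU : ∀ k, StandardBorelSpace (XU k)]
  /-- dominating (reference) measures for the latent variables -/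
  ν : ∀ k, Measure (XU k)
  [sigmaFinite_ν : ∀ k, SigmaFinite (ν k)]
  /-- the underlying probability space -/
  Ω : Type u
  [measΩ : MeasurableSpace Ω]
  [borelΩ : StandardBorelSpace Ω]
  P : Measure Ω
  [probP : IsProbabilityMeasure P]
  /-- the error variables, jointly independent -/
  Err : V ⊕ U → Type u
  [measErr : ∀ i, MeasurableSpace (Err i)]
  ε : ∀ i, Ω → Err i
  measurable_ε : ∀ i, Measurable (ε i)
  indep_ε : iIndepFun ε P
  /-- the structural equations: `f i` maps the values of the parents of `i` and the error of `i`
  to the value of `i` -/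
  f : ∀ i, (∀ j : {j // G.Adj j i}, State X XU j) → Err i → State X XU i
  measurable_f : ∀ i, Measurable fun t : (∀ j : {j // G.Adj j i}, State X XU j) × Err i =>
    f i t.1 t.2

attribute [instance] CausalModel.measXU CausalModel.borelXU CausalModel.sigmaFinite_ν
  CausalModel.measΩ CausalModel.borelΩ CausalModel.probP CausalModel.measErr

/-- Values of the block `A` of variables. -/
abbrev Blk {ι : Type*} (X : ι → Type u) (A : Finset ι) : Type _ := ∀ i : A, X i

/-- The product reference measure on the block `A`. -/
noncomputable abbrev refM {ι : Type*} {X : ι → Type u} [∀ i, MeasurableSpace (X i)]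
    (μ : ∀ i, Measure (X i)) (A : Finset ι) : Measure (Blk X A) :=
  Measure.pi fun i : A => μ i

/-- The value of the block `C` composed of the value `y` of the block `A` and, on `C \ A`, the value
`y'` of the block `A'`. -/
def glue {ι : Type*} [DecidableEq ι] {X : ι → Type u} {A A' C : Finset ι} (hC : C ⊆ A ∪ A')
    (y : Blk X A) (y' : Blk X A') : Blk X C := fun i =>
  if h : (i : ι) ∈ A then y ⟨i, h⟩
  else y' ⟨i, (Finset.mem_union.1 (hC i.2)).resolve_left h⟩

/-! ## Densities -/

/-- The (real-valued) density `p(y)` of the random variable `Y` with respect to `m`. -/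
noncomputable def dens {Ω α : Type*} [MeasurableSpace Ω] [MeasurableSpace α] (P : Measure Ω)
    (Y : Ω → α) (m : Measure α) (y : α) : ℝ :=
  (pdf Y P m y).toReal

/-- The conditional density `p(y | t) = p(y, t) / p(t)` of `Y` given `T = t` (it is `0` where
`p(t) = 0`). -/
noncomputable def condDens {Ω α β : Type*} [MeasurableSpace Ω] [MeasurableSpace α]
    [MeasurableSpace β] (P : Measure Ω) (Y : Ω → α) (T : Ω → β) (mY : Measure α) (mT : Measure β)
    (y : α) (t : β) : ℝ :=
  dens P (fun ω => (Y ω, T ω)) (mY.prod mT) (y, t) / dens P T mT t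

/-! ## Potential outcomes and kernels -/

theorem CausalModel.wf {V U : Type*} [Finite V] [Finite U] {G : Digraph (V ⊕ U)}
    {X : V → Type u} [∀ v, MeasurableSpace (X v)] (M : CausalModel G X) : WellFounded G.Adj := by
  have : Std.Irrefl (Relation.TransGen G.Adj) := ⟨M.acyclic⟩
  have h : WellFounded (Relation.TransGen G.Adj) :=
    Finite.wellFounded_of_trans_of_irrefl _
  exact Subrelation.wf (fun h => Relation.TransGen.single h) h

namespace CausalModel

variable {V U : Type*} [Fintype V] [DecidableEq V] [Fintype U] {G : Digraph (V ⊕ U)}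
  {X : V → Type u} [∀ v, MeasurableSpace (X v)]

/-- One step of the recursion that defines the potential outcomes under `do(I = a)`: intervened
variables are set to the constant `a`, the others follow their structural equation. -/
noncomputable def step (M : CausalModel G X) (I : Finset V) (a : ∀ v, X v) (ω : M.Ω) :
    ∀ i : V ⊕ U, (∀ j, G.Adj j i → State X M.XU j) → State X M.XU i
  | .inl v, rec => if v ∈ I then a v else M.f (.inl v) (fun j => rec j j.2) (M.ε (.inl v) ω)
  | .inr k, rec => M.f (.inr k) (fun j => rec j j.2) (M.ε (.inr k) ω)

/-- The potential outcomes of all variables under the intervention `do(I = a)` on the set `I` of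
observed variables. Only the values `a v` with `v ∈ I` matter. -/
noncomputable def po (M : CausalModel G X) (I : Finset V) (a : ∀ v, X v) (ω : M.Ω) :
    ∀ i : V ⊕ U, State X M.XU i :=
  M.wf.fix (M.step I a ω)

theorem po_eq (M : CausalModel G X) (I : Finset V) (a : ∀ v, X v) (ω : M.Ω) (i : V ⊕ U) :
    M.po I a ω i = M.step I a ω i (fun j _ => M.po I a ω j) :=
  M.wf.fix_eq _ i

theorem measurable_po (M : CausalModel G X) (I : Finset V) (a : ∀ v, X v) (i : V ⊕ U) :
    Measurable fun ω => M.po I a ω i := by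
  induction i using M.wf.induction with
  | _ i ih =>
    have h : Measurable fun ω => M.f i (fun j => M.po I a ω j) (M.ε i ω) :=
      (M.measurable_f i).comp
        ((measurable_pi_lambda (fun ω (j : {j // G.Adj j i}) => M.po I a ω j)
          fun j => ih j j.2).prodMk (M.measurable_ε i))
    cases i with
    | inl v =>
      by_cases hv : v ∈ I
      · have e : (fun ω => M.po I a ω (.inl v)) = fun _ => (a v : State X M.XU (.inl v)) := by
          funext ω
          rw [po_eq]
          exact if_pos hv
        rw [e]
        exact measurable_const
      · have e : (fun ω => M.po I a ω (.inl v)) =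
            fun ω => M.f (.inl v) (fun j => M.po I a ω j) (M.ε (.inl v) ω) := by
          funext ω
          rw [po_eq]
          simp [step, hv]
        rw [e]
        exact h
    | inr k =>
      have e : (fun ω => M.po I a ω (.inr k)) =
          fun ω => M.f (.inr k) (fun j => M.po I a ω j) (M.ε (.inr k) ω) := by
        funext ω
        rw [po_eq]
        simp [step]
      rw [e]
      exact h

/-- The potential outcome of the observed variable `v` under `do(I = a)`. -/
noncomputable def obs1 (M : CausalModel G X) (I : Finset V) (a : ∀ v, X v) (v : V) (ω : M.Ω) :
    X v :=
  M.po I a ω (.inl v)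

/-- The potential outcomes of the block `A` of observed variables under `do(I = a)`. -/
noncomputable def obs (M : CausalModel G X) (I : Finset V) (a : ∀ v, X v) (A : Finset V)
    (ω : M.Ω) : Blk X A :=
  fun v => M.obs1 I a v ω

/-- The potential outcomes of the block `A` of latent variables under `do(I = a)`. -/
noncomputable def lat (M : CausalModel G X) (I : Finset V) (a : ∀ v, X v) (A : Finset U)
    (ω : M.Ω) : Blk M.XU A :=
  fun k => M.po I a ω (.inr k)

theorem measurable_obs1 (M : CausalModel G X) (I : Finset V) (a : ∀ v, X v) (v : V) :
    Measurable (M.obs1 I a v) :=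
  M.measurable_po I a (.inl v)

theorem measurable_obs (M : CausalModel G X) (I : Finset V) (a : ∀ v, X v) (A : Finset V) :
    Measurable (M.obs I a A) :=
  measurable_pi_lambda _ fun v => M.measurable_obs1 I a v

theorem measurable_lat (M : CausalModel G X) (I : Finset V) (a : ∀ v, X v) (A : Finset U) :
    Measurable (M.lat I a A) :=
  measurable_pi_lambda _ fun k => M.measurable_po I a (.inr k)

/-- The interventional kernel `p(A ‖ I)` at the value `a` of `I`: the law of the potential outcomes
of the block `A` under `do(I = a)`. -/
noncomputable def kernel (M : CausalModel G X) (I : Finset V) (a : ∀ v, X v) (A : Finset V) :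
    Measure (Blk X A) :=
  M.P.map (M.obs I a A)

/-- Under `do(I = a)` all variables that are not intervened on, observed and latent, have a joint
density with respect to the product of the reference measures. -/
def HasJointDensity (M : CausalModel G X) (μ : ∀ v, Measure (X v)) (I : Finset V)
    (a : ∀ v, X v) : Prop :=
  M.P.map (fun ω => (M.obs I a Iᶜ ω, M.lat I a Finset.univ ω)) ≪
    (refM μ Iᶜ).prod (refM M.ν Finset.univ)

end CausalModel

/-! ## Descendants in the conditional ADMG -/

/-- `LatentEdge G K i j`: there is a directed path from `i` to `j` in `G` all of whose non-endpoint
vertices lie outside `K`. For `i j ∈ K` this is the directed edge `i → j` of the latent projection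
of `G` onto `K`. -/
inductive LatentEdge {ι : Type*} (G : Digraph ι) (K : Set ι) : ι → ι → Prop
  | edge {i j : ι} : G.Adj i j → LatentEdge G K i j
  | cons {i k j : ι} : G.Adj i k → k ∉ K → LatentEdge G K k j → LatentEdge G K i j

/-- The directed edges of the conditional ADMG `G(R, S)` on the vertex set `R ∪ S`: the latent
projection of the hidden variable DAG onto `R ∪ S`, with the edges into `S` removed. (Bidirected
edges play no role for descendants.) -/
def cadmgEdge {V U : Type*} [DecidableEq V] (G : Digraph (V ⊕ U)) (R S : Finset V) (v w : V) :
    Prop :=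
  v ∈ R ∪ S ∧ w ∈ R ∪ S ∧ w ∉ S ∧ LatentEdge G {i | ∃ k ∈ R ∪ S, i = Sum.inl k} (.inl v) (.inl w)

/-- `w` is a descendant of `v` in `G(R, S)`; every vertex is a descendant of itself. -/
def cadmgDesc {V U : Type*} [DecidableEq V] (G : Digraph (V ⊕ U)) (R S : Finset V) (v w : V) :
    Prop :=
  Relation.ReflTransGen (cadmgEdge G R S) v w

/-! ## The extended bridge function kernel operation -/

/-- The arguments of the kernel operation: the input kernel `p(R ‖ S)`, the treatment `B`, the
outcome-inducing proxies `W` and the treatment-inducing proxies `Z`. -/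
structure EbfArgs (V : Type*) where
  R : Finset V
  S : Finset V
  B : V
  W : Finset V
  Z : Finset V
  disjoint_RS : Disjoint R S
  B_mem : B ∈ R
  W_sub : W ⊆ R
  Z_sub : Z ⊆ R
  B_notMem_W : B ∉ W
  B_notMem_Z : B ∉ Z
  disjoint_WZ : Disjoint W Z

namespace EbfArgs

variable {V U : Type*} [DecidableEq V]

open Classical in
/-- The descendants of `B` in `G(R, S)`. -/
noncomputable def de (d : EbfArgs V) (G : Digraph (V ⊕ U)) : Finset V :=
  d.R.filter fun v => cadmgDesc G d.R d.S d.B v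

/-- `W*`, the outcome-inducing proxies that descend from `B`. -/
noncomputable def Ws (d : EbfArgs V) (G : Digraph (V ⊕ U)) : Finset V := d.de G ∩ d.W

/-- `Z*`, the treatment-inducing proxies that descend from `B`. -/
noncomputable def Zs (d : EbfArgs V) (G : Digraph (V ⊕ U)) : Finset V := d.de G ∩ d.Z

/-- `W \ W*`. -/
noncomputable def Wt (d : EbfArgs V) (G : Digraph (V ⊕ U)) : Finset V := d.W \ d.Ws G

/-- `Z \ Z*`. -/
noncomputable def Zt (d : EbfArgs V) (G : Digraph (V ⊕ U)) : Finset V := d.Z \ d.Zs G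

/-- The outcome variables `O`: the descendants of `B` other than `B` and the proxies. -/
noncomputable def O (d : EbfArgs V) (G : Digraph (V ⊕ U)) : Finset V :=
  d.de G \ (d.W ∪ d.Z ∪ {d.B})

/-- The covariates `X`: all remaining variables of `R`. -/
noncomputable def C (d : EbfArgs V) (G : Digraph (V ⊕ U)) : Finset V :=
  d.R \ (d.O G ∪ {d.B} ∪ d.Z ∪ d.W)

/-- The random variables of the output kernel, `R \ (Z* ∪ W* ∪ {B})`. -/
noncomputable def out (d : EbfArgs V) (G : Digraph (V ⊕ U)) : Finset V :=
  d.R \ (d.Zs G ∪ d.Ws G ∪ {d.B})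

theorem W_sub_union (d : EbfArgs V) (G : Digraph (V ⊕ U)) : d.W ⊆ d.Wt G ∪ d.Ws G := by
  intro v hv
  by_cases h : v ∈ d.Ws G <;> simp [Wt, h, hv]

theorem Z_sub_union (d : EbfArgs V) (G : Digraph (V ⊕ U)) : d.Z ⊆ d.Zt G ∪ d.Zs G := by
  intro v hv
  by_cases h : v ∈ d.Zs G <;> simp [Zt, h, hv]

end EbfArgs

namespace CausalModel

variable {V U : Type*} [Fintype V] [DecidableEq V] [Fintype U] {G : Digraph (V ⊕ U)}
  {X : V → Type u} [∀ v, MeasurableSpace (X v)]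

/-! Below, `Us` is the set `U*` of latent confounders, `a` gives the value `s` of the intervention
set `S`, and `xW`, `xZ`, … denote values of the blocks `W`, `Z`, …. -/

/-- Valid outcome-inducing proxy: `W(s) ⟂ (Z(s), B(s)) | U*(s), X(s)`. -/
def ValidOutcomeProxy (M : CausalModel G X) (d : EbfArgs V) (a : ∀ v, X v) (Us : Finset U) :
    Prop :=
  CondIndepFun
    (MeasurableSpace.comap (fun ω => (M.lat d.S a Us ω, M.obs d.S a (d.C G) ω)) inferInstance)
    ((M.measurable_lat d.S a Us).prodMk (M.measurable_obs d.S a (d.C G))).comap_le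
    (M.obs d.S a d.W) (fun ω => (M.obs d.S a d.Z ω, M.obs1 d.S a d.B ω)) M.P

/-- Valid treatment-inducing proxy: `O(s) ⟂ Z(s) | (W \ W*)(s), B(s), U*(s), X(s)`. -/
def ValidTreatmentProxy (M : CausalModel G X) (d : EbfArgs V) (a : ∀ v, X v) (Us : Finset U) :
    Prop :=
  CondIndepFun
    (MeasurableSpace.comap (fun ω => (M.obs d.S a (d.Wt G) ω, M.obs1 d.S a d.B ω,
      M.lat d.S a Us ω, M.obs d.S a (d.C G) ω)) inferInstance)
    ((M.measurable_obs d.S a (d.Wt G)).prodMk ((M.measurable_obs1 d.S a d.B).prodMk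
      ((M.measurable_lat d.S a Us).prodMk (M.measurable_obs d.S a (d.C G))))).comap_le
    (M.obs d.S a (d.O G)) (M.obs d.S a d.Z) M.P

/-- Ignorability: `O(s, b) ⟂ B(s) | U*(s), (W \ W*)(s), (Z \ Z*)(s), X(s)` for all `b`. -/
def Ignorability (M : CausalModel G X) (d : EbfArgs V) (a : ∀ v, X v) (Us : Finset U) : Prop :=
  ∀ b : X d.B, CondIndepFun
    (MeasurableSpace.comap (fun ω => (M.lat d.S a Us ω, M.obs d.S a (d.Wt G) ω,
      M.obs d.S a (d.Zt G) ω, M.obs d.S a (d.C G) ω)) inferInstance)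
    ((M.measurable_lat d.S a Us).prodMk ((M.measurable_obs d.S a (d.Wt G)).prodMk
      ((M.measurable_obs d.S a (d.Zt G)).prodMk (M.measurable_obs d.S a (d.C G))))).comap_le
    (M.obs (insert d.B d.S) (Function.update a d.B b) (d.O G)) (M.obs1 d.S a d.B) M.P

/-- Latent positivity: `p(b | U*, W \ W*, Z \ Z*, X ‖ s) > 0` almost surely, for (almost) all
`b`. -/
def LatentPositivity (M : CausalModel G X) (μ : ∀ v, Measure (X v)) (d : EbfArgs V)
    (a : ∀ v, X v) (Us : Finset U) : Prop :=
  let T := fun ω => (M.lat d.S a Us ω, M.obs d.S a (d.Wt G) ω, M.obs d.S a (d.Zt G) ω,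
    M.obs d.S a (d.C G) ω)
  let mT := (refM M.ν Us).prod ((refM μ (d.Wt G)).prod ((refM μ (d.Zt G)).prod (refM μ (d.C G))))
  ∀ᵐ b ∂μ d.B, ∀ᵐ t ∂M.P.map T, 0 < condDens M.P (M.obs1 d.S a d.B) T (μ d.B) mT b t

/-- The conditions common to both variants of the operation: existence of joint densities,
ignorability, the two proxy conditions and latent positivity. -/
structure EbfCommon (M : CausalModel G X) (μ : ∀ v, Measure (X v)) (d : EbfArgs V)
    (a : ∀ v, X v) (Us : Finset U) : Prop where
  density : M.HasJointDensity μ d.S a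
  ignorability : M.Ignorability d a Us
  outcomeProxy : M.ValidOutcomeProxy d a Us
  treatmentProxy : M.ValidTreatmentProxy d a Us
  positivity : M.LatentPositivity μ d a Us

/-- The conditional density `p(u* | b, y, x ‖ s)`, where `y` is a value of the block `A` of
proxies. -/
noncomputable def latDens (M : CausalModel G X) (μ : ∀ v, Measure (X v)) (d : EbfArgs V)
    (a : ∀ v, X v) (Us : Finset U) (A : Finset V) (u : Blk M.XU Us) (b : X d.B) (y : Blk X A)
    (x : Blk X (d.C G)) : ℝ :=
  condDens M.P (M.lat d.S a Us)
    (fun ω => (M.obs1 d.S a d.B ω, M.obs d.S a A ω, M.obs d.S a (d.C G) ω))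
    (refM M.ν Us) ((μ d.B).prod ((refM μ A).prod (refM μ (d.C G)))) u (b, y, x)

/-- Completeness of the block `A` of proxies for `U*`: for all `b`, `x` and all `g ∈ L²(U*)` one has
`∑_u g(u) p(u | b, A, x ‖ s) = 0` almost surely if and only if `g(U*) = 0` almost surely. Among the
`g ∈ L²(U*)` only those are used for which the integral converges absolutely. -/
def Complete (M : CausalModel G X) (μ : ∀ v, Measure (X v)) (d : EbfArgs V)
    (a : ∀ v, X v) (Us : Finset U) (A : Finset V) : Prop :=
  ∀ᵐ t ∂M.P.map (fun ω => (M.obs1 d.S a d.B ω, M.obs d.S a (d.C G) ω)),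
    ∀ g : Blk M.XU Us → ℝ, Measurable g → MemLp g 2 (M.P.map (M.lat d.S a Us)) →
      (∀ᵐ y ∂M.P.map (M.obs d.S a A),
        Integrable (fun u => g u * M.latDens μ d a Us A u t.1 y t.2) (refM M.ν Us)) →
      ((∀ᵐ y ∂M.P.map (M.obs d.S a A),
          ∫ u, g u * M.latDens μ d a Us A u t.1 y t.2 ∂refM M.ν Us = 0) ↔
        ∀ᵐ u ∂M.P.map (M.lat d.S a Us), g u = 0)

/-! ### Outcome bridge functions -/

/-- The type of extended outcome bridge functions `h(o, w, w', b, x)`. -/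
abbrev OutcomeFun (X : V → Type u) (G : Digraph (V ⊕ U)) (d : EbfArgs V) :=
  Blk X (d.O G) → Blk X d.W → Blk X d.W → X d.B → Blk X (d.C G) → ℝ

/-- The conditional density `p(w | z, b, x ‖ s)`. -/
noncomputable def densWgZ (M : CausalModel G X) (μ : ∀ v, Measure (X v)) (d : EbfArgs V)
    (a : ∀ v, X v) (w : Blk X d.W) (z : Blk X d.Z) (b : X d.B) (x : Blk X (d.C G)) : ℝ :=
  condDens M.P (M.obs d.S a d.W)
    (fun ω => (M.obs d.S a d.Z ω, M.obs1 d.S a d.B ω, M.obs d.S a (d.C G) ω))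
    (refM μ d.W) ((refM μ d.Z).prod ((μ d.B).prod (refM μ (d.C G)))) w (z, b, x)

/-- `h` is an extended outcome bridge function:
`∑_{w'} h(o, w, w', b, x) p(w' | z, b, x ‖ s) = p(o, w | z, b, x ‖ s)`. -/
def IsOutcomeBridge (M : CausalModel G X) (μ : ∀ v, Measure (X v)) (d : EbfArgs V)
    (a : ∀ v, X v) (h : OutcomeFun X G d) : Prop :=
  (Measurable fun t : Blk X (d.O G) × Blk X d.W × Blk X d.W × X d.B × Blk X (d.C G) =>
    h t.1 t.2.1 t.2.2.1 t.2.2.2.1 t.2.2.2.2) ∧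
  ∀ᵐ t ∂((refM μ (d.O G)).prod (refM μ d.W)).prod
      ((refM μ d.Z).prod ((μ d.B).prod (refM μ (d.C G)))),
    Integrable (fun w' => h t.1.1 t.1.2 w' t.2.2.1 t.2.2.2 *
      M.densWgZ μ d a w' t.2.1 t.2.2.1 t.2.2.2) (refM μ d.W) ∧
    ∫ w', h t.1.1 t.1.2 w' t.2.2.1 t.2.2.2 *
        M.densWgZ μ d a w' t.2.1 t.2.2.1 t.2.2.2 ∂refM μ d.W =
      condDens M.P (fun ω => (M.obs d.S a (d.O G) ω, M.obs d.S a d.W ω))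
        (fun ω => (M.obs d.S a d.Z ω, M.obs1 d.S a d.B ω, M.obs d.S a (d.C G) ω))
        ((refM μ (d.O G)).prod (refM μ d.W))
        ((refM μ d.Z).prod ((μ d.B).prod (refM μ (d.C G)))) t.1 t.2

/-- The joint density `p(w, z̃, x ‖ s)`, with `z̃` a value of `Z \ Z*`. -/
noncomputable def densWZt (M : CausalModel G X) (μ : ∀ v, Measure (X v)) (d : EbfArgs V)
    (a : ∀ v, X v) (w : Blk X d.W) (z : Blk X (d.Zt G)) (x : Blk X (d.C G)) : ℝ :=
  dens M.P
    (fun ω => (M.obs d.S a d.W ω, M.obs d.S a (d.Zt G) ω, M.obs d.S a (d.C G) ω))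
    ((refM μ d.W).prod ((refM μ (d.Zt G)).prod (refM μ (d.C G)))) (w, z, x)

/-- The residual
`p(o, w̃ | b, u, x ‖ s) - ∑_{w*} ∑_{w'} h(o, (w̃, w*), w', b, x) p(w' | u, x ‖ s)`
as a function of `u`, with `w̃` a value of `W \ W*` and `w*` a value of `W*`. -/
noncomputable def outcomeResidual (M : CausalModel G X) (μ : ∀ v, Measure (X v)) (d : EbfArgs V)
    (a : ∀ v, X v) (Us : Finset U) (h : OutcomeFun X G d) (o : Blk X (d.O G))
    (w : Blk X (d.Wt G)) (b : X d.B) (x : Blk X (d.C G)) (u : Blk M.XU Us) : ℝ :=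
  condDens M.P (fun ω => (M.obs d.S a (d.O G) ω, M.obs d.S a (d.Wt G) ω))
      (fun ω => (M.obs1 d.S a d.B ω, M.lat d.S a Us ω, M.obs d.S a (d.C G) ω))
      ((refM μ (d.O G)).prod (refM μ (d.Wt G)))
      ((μ d.B).prod ((refM M.ν Us).prod (refM μ (d.C G)))) (o, w) (b, u, x) -
    ∫ ws, ∫ w', h o (glue (d.W_sub_union G) w ws) w' b x *
      condDens M.P (M.obs d.S a d.W)
        (fun ω => (M.lat d.S a Us ω, M.obs d.S a (d.C G) ω))
        (refM μ d.W) ((refM M.ν Us).prod (refM μ (d.C G))) w' (u, x)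
      ∂refM μ d.W ∂refM μ (d.Ws G)

/-- `h` is sufficiently integrable: the integrals in which it occurs converge absolutely and the
residual lies in `L²(U*)`. -/
def OutcomeIntegrable (M : CausalModel G X) (μ : ∀ v, Measure (X v)) (d : EbfArgs V)
    (a : ∀ v, X v) (Us : Finset U) (h : OutcomeFun X G d) : Prop :=
  ∀ᵐ t ∂((refM μ (d.O G)).prod (refM μ (d.Wt G))).prod ((μ d.B).prod (refM μ (d.C G))),
    (∀ᵐ z ∂refM μ d.Z, Integrable (fun r : Blk X (d.Ws G) × Blk X d.W =>
      h t.1.1 (glue (d.W_sub_union G) t.1.2 r.1) r.2 t.2.1 t.2.2 *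
        M.densWgZ μ d a r.2 z t.2.1 t.2.2) ((refM μ (d.Ws G)).prod (refM μ d.W))) ∧
    (∀ᵐ z ∂refM μ (d.Zt G), Integrable (fun r : Blk X (d.Ws G) × Blk X d.W =>
      h t.1.1 (glue (d.W_sub_union G) t.1.2 r.1) r.2 t.2.1 t.2.2 *
        M.densWZt μ d a r.2 z t.2.2) ((refM μ (d.Ws G)).prod (refM μ d.W))) ∧
    MemLp (M.outcomeResidual μ d a Us h t.1.1 t.1.2 t.2.1 t.2.2) 2 (M.P.map (M.lat d.S a Us))

/-- `h` is bounded in `w'` after summation over `w*`. -/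
def OutcomeBounded (μ : ∀ v, Measure (X v)) (d : EbfArgs V) (h : OutcomeFun X G d) : Prop :=
  ∀ᵐ t ∂((refM μ (d.O G)).prod (refM μ (d.Wt G))).prod ((μ d.B).prod (refM μ (d.C G))),
    ∃ K : NNReal, ∀ᵐ w' ∂refM μ d.W,
      ∫⁻ ws, ‖h t.1.1 (glue (d.W_sub_union G) t.1.2 ws) w' t.2.1 t.2.2‖ₑ ∂refM μ (d.Ws G) ≤ K

/-! ### Treatment bridge functions -/

/-- The type of extended treatment bridge functions `q(z, z', b, x)`. -/
abbrev TreatmentFun (X : V → Type u) (G : Digraph (V ⊕ U)) (d : EbfArgs V) :=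
  Blk X d.Z → Blk X d.Z → X d.B → Blk X (d.C G) → ℝ

/-- The conditional density `p(z | w, b, x ‖ s)`. -/
noncomputable def densZgW (M : CausalModel G X) (μ : ∀ v, Measure (X v)) (d : EbfArgs V)
    (a : ∀ v, X v) (z : Blk X d.Z) (w : Blk X d.W) (b : X d.B) (x : Blk X (d.C G)) : ℝ :=
  condDens M.P (M.obs d.S a d.Z)
    (fun ω => (M.obs d.S a d.W ω, M.obs1 d.S a d.B ω, M.obs d.S a (d.C G) ω))
    (refM μ d.Z) ((refM μ d.W).prod ((μ d.B).prod (refM μ (d.C G)))) z (w, b, x)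

/-- The conditional density `p(b | w, x ‖ s)`. -/
noncomputable def densBgW (M : CausalModel G X) (μ : ∀ v, Measure (X v)) (d : EbfArgs V)
    (a : ∀ v, X v) (b : X d.B) (w : Blk X d.W) (x : Blk X (d.C G)) : ℝ :=
  condDens M.P (M.obs1 d.S a d.B)
    (fun ω => (M.obs d.S a d.W ω, M.obs d.S a (d.C G) ω))
    (μ d.B) ((refM μ d.W).prod (refM μ (d.C G))) b (w, x)

/-- `q` is an extended treatment bridge function: `p(b | w, x ‖ s) > 0` and
`∑_{z'} q(z, z', b, x) p(z' | w, b, x ‖ s) = p(z | w, x ‖ s) / p(b | w, x ‖ s)`. -/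
def IsTreatmentBridge (M : CausalModel G X) (μ : ∀ v, Measure (X v)) (d : EbfArgs V)
    (a : ∀ v, X v) (q : TreatmentFun X G d) : Prop :=
  (∀ᵐ b ∂μ d.B, ∀ᵐ t ∂M.P.map (fun ω => (M.obs d.S a d.W ω, M.obs d.S a (d.C G) ω)),
    0 < M.densBgW μ d a b t.1 t.2) ∧
  (Measurable fun t : Blk X d.Z × Blk X d.Z × X d.B × Blk X (d.C G) =>
    q t.1 t.2.1 t.2.2.1 t.2.2.2) ∧
  ∀ᵐ t ∂(refM μ d.Z).prod ((refM μ d.W).prod ((μ d.B).prod (refM μ (d.C G)))),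
    Integrable (fun z' => q t.1 z' t.2.2.1 t.2.2.2 *
      M.densZgW μ d a z' t.2.1 t.2.2.1 t.2.2.2) (refM μ d.Z) ∧
    ∫ z', q t.1 z' t.2.2.1 t.2.2.2 *
        M.densZgW μ d a z' t.2.1 t.2.2.1 t.2.2.2 ∂refM μ d.Z =
      condDens M.P (M.obs d.S a d.Z)
        (fun ω => (M.obs d.S a d.W ω, M.obs d.S a (d.C G) ω))
        (refM μ d.Z) ((refM μ d.W).prod (refM μ (d.C G))) t.1 (t.2.1, t.2.2.2) /
      M.densBgW μ d a t.2.2.1 t.2.1 t.2.2.2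

/-- The joint density `p(o, w̃, z, b, x ‖ s)`, with `w̃` a value of `W \ W*`. -/
noncomputable def densOWtZ (M : CausalModel G X) (μ : ∀ v, Measure (X v)) (d : EbfArgs V)
    (a : ∀ v, X v) (o : Blk X (d.O G)) (w : Blk X (d.Wt G)) (z : Blk X d.Z) (b : X d.B)
    (x : Blk X (d.C G)) : ℝ :=
  dens M.P
    (fun ω => (M.obs d.S a (d.O G) ω, M.obs d.S a (d.Wt G) ω, M.obs d.S a d.Z ω,
      M.obs1 d.S a d.B ω, M.obs d.S a (d.C G) ω))
    ((refM μ (d.O G)).prod ((refM μ (d.Wt G)).prod ((refM μ d.Z).prod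
      ((μ d.B).prod (refM μ (d.C G)))))) (o, w, z, b, x)

/-- The residual
`p(z̃ | u, x ‖ s) / p(b | u, x ‖ s) - ∑_{z*} ∑_{z'} q((z̃, z*), z', b, x) p(z' | b, u, x ‖ s)`
as a function of `u`, with `z̃` a value of `Z \ Z*` and `z*` a value of `Z*`. -/
noncomputable def treatmentResidual (M : CausalModel G X) (μ : ∀ v, Measure (X v))
    (d : EbfArgs V) (a : ∀ v, X v) (Us : Finset U) (q : TreatmentFun X G d)
    (z : Blk X (d.Zt G)) (b : X d.B) (x : Blk X (d.C G)) (u : Blk M.XU Us) : ℝ :=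
  condDens M.P (M.obs d.S a (d.Zt G))
      (fun ω => (M.lat d.S a Us ω, M.obs d.S a (d.C G) ω))
      (refM μ (d.Zt G)) ((refM M.ν Us).prod (refM μ (d.C G))) z (u, x) /
    condDens M.P (M.obs1 d.S a d.B)
      (fun ω => (M.lat d.S a Us ω, M.obs d.S a (d.C G) ω))
      (μ d.B) ((refM M.ν Us).prod (refM μ (d.C G))) b (u, x) -
    ∫ zs, ∫ z', q (glue (d.Z_sub_union G) z zs) z' b x *
      condDens M.P (M.obs d.S a d.Z)
        (fun ω => (M.obs1 d.S a d.B ω, M.lat d.S a Us ω, M.obs d.S a (d.C G) ω))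
        (refM μ d.Z) ((μ d.B).prod ((refM M.ν Us).prod (refM μ (d.C G)))) z' (b, u, x)
      ∂refM μ d.Z ∂refM μ (d.Zs G)

/-- `q` is sufficiently integrable: the integrals in which it occurs converge absolutely and the
residual lies in `L²(U*)`. -/
def TreatmentIntegrable (M : CausalModel G X) (μ : ∀ v, Measure (X v)) (d : EbfArgs V)
    (a : ∀ v, X v) (Us : Finset U) (q : TreatmentFun X G d) : Prop :=
  ∀ᵐ t ∂(refM μ (d.Zt G)).prod ((μ d.B).prod (refM μ (d.C G))),
    (∀ᵐ w ∂refM μ d.W, Integrable (fun r : Blk X (d.Zs G) × Blk X d.Z =>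
      q (glue (d.Z_sub_union G) t.1 r.1) r.2 t.2.1 t.2.2 *
        M.densZgW μ d a r.2 w t.2.1 t.2.2) ((refM μ (d.Zs G)).prod (refM μ d.Z))) ∧
    (∀ᵐ y ∂(refM μ (d.O G)).prod (refM μ (d.Wt G)),
      Integrable (fun r : Blk X (d.Zs G) × Blk X d.Z =>
        q (glue (d.Z_sub_union G) t.1 r.1) r.2 t.2.1 t.2.2 *
          M.densOWtZ μ d a y.1 y.2 r.2 t.2.1 t.2.2) ((refM μ (d.Zs G)).prod (refM μ d.Z))) ∧
    MemLp (M.treatmentResidual μ d a Us q t.1 t.2.1 t.2.2) 2 (M.P.map (M.lat d.S a Us))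

/-- `q` is bounded in `z'` after summation over `z*`. -/
def TreatmentBounded (μ : ∀ v, Measure (X v)) (d : EbfArgs V) (q : TreatmentFun X G d) : Prop :=
  ∀ᵐ t ∂(refM μ (d.Zt G)).prod ((μ d.B).prod (refM μ (d.C G))),
    ∃ K : NNReal, ∀ᵐ z' ∂refM μ d.Z,
      ∫⁻ zs, ‖q (glue (d.Z_sub_union G) t.1 zs) z' t.2.1 t.2.2‖ₑ ∂refM μ (d.Zs G) ≤ K

/-! ### Conditions and output of the operation -/

/-- The conditions of the kernel operation at the value `s` of `S`: for some set `U*` of latent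
variables the common conditions hold, together with an extended outcome bridge function and
completeness of `Z`, or an extended treatment bridge function and completeness of `W`. The bridge
functions are sufficiently integrable and bounded. -/
def EbfConditions (M : CausalModel G X) (μ : ∀ v, Measure (X v)) (d : EbfArgs V)
    (a : ∀ v, X v) : Prop :=
  ∃ Us : Finset U, M.EbfCommon μ d a Us ∧
    ((∃ h : OutcomeFun X G d, M.IsOutcomeBridge μ d a h ∧ M.OutcomeIntegrable μ d a Us h ∧
        OutcomeBounded μ d h) ∧ M.Complete μ d a Us d.Z ∨
     (∃ q : TreatmentFun X G d, M.IsTreatmentBridge μ d a q ∧ M.TreatmentIntegrable μ d a Us q ∧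
        TreatmentBounded μ d q) ∧ M.Complete μ d a Us d.W)

/-- The output kernel `p(O ∪ (W \ W*) ∪ (Z \ Z*) ∪ X ‖ s, b)`, as the joint law of the four
blocks. -/
noncomputable def outLaw (M : CausalModel G X) (d : EbfArgs V) (a : ∀ v, X v) (b : X d.B) :
    Measure (Blk X (d.O G) × Blk X (d.Wt G) × Blk X (d.Zt G) × Blk X (d.C G)) :=
  let I := insert d.B d.S
  let a' := Function.update a d.B b
  M.P.map fun ω => (M.obs I a' (d.O G) ω, M.obs I a' (d.Wt G) ω, M.obs I a' (d.Zt G) ω,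
    M.obs I a' (d.C G) ω)

/-- The reference measure of `outLaw`. -/
noncomputable def outRef (μ : ∀ v, Measure (X v)) (G : Digraph (V ⊕ U)) (d : EbfArgs V) :
    Measure (Blk X (d.O G) × Blk X (d.Wt G) × Blk X (d.Zt G) × Blk X (d.C G)) :=
  (refM μ (d.O G)).prod ((refM μ (d.Wt G)).prod ((refM μ (d.Zt G)).prod (refM μ (d.C G))))

end CausalModel
end Causal

/-! Write `w̃`, `w*` for the parts of the outcome-inducing proxies outside and inside the
descendants of `B`, similarly `z̃`, `z*`, and `u` for the latent confounders. All densities are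
taken under `do(S = s)`.

Outcome variant. Consider the residual `r(u) = p(o,w̃|b,u,x) - ∑_{w*} ∑_{w'} h p(w'|u,x)` and
integrate it against `p(u|b,z,x)`. Since `W ⟂ (Z,B) | U,X`, the density `p(w'|z,b,x)` is the mixture
of the `p(w'|u,x)`. Since also `(O,W̃) ⟂ Z | B,U,X`, the density `p(o,w̃|z,b,x)` is the mixture of
the `p(o,w̃|b,u,x)`. The bridge equation, summed over `w*`, therefore says that `r` integrates to
zero for almost every `z`, and completeness gives `r = 0` (`ae_bridgeResidual_eq_zero`). On the
causal side, ignorability, positivity and the proxy conditions give `p(o,w̃,z̃,x‖s,b) = ∫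
p(o,w̃|b,u,x) p(u,z̃,x) du` (`ProxySystem.lintegral_Ob`). Replacing the first factor by the double
sum and using `p(w',z̃,x) = ∫ p(w'|u,x) p(u,z̃,x) du` yields the formula
(`lintegral_latent_eq_of_residual`).

Treatment variant. The same scheme works for `p(z̃|u,x)/p(b|u,x) - ∑_{z*} ∑_{z'} q p(z'|b,u,x)`,
integrated against `p(u|b,w,x)`. The causal side is now the inverse probability weighting formula `∫
p(o,w̃,b,u,x) p(z̃|u,x)/p(b|u,x) du` (`ProxySystem.lintegral_Ob_eq_weight`).

Ignorability is delicate when `{B = b}` is a null set: it concerns one potential outcome `O(s,b)` at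
a time, whereas the observed outcome is `O(s,B)`. The structural equations give a change of measure
from random `B` to a fixed value, because `B` has a density given the other non-descendants and the
errors of the descendants are independent. What remains is an identity known for every `b` and
almost every `b'`, wanted for almost every `b = b'`. For each `b` it is a closed condition on a pair
of points of the separable space `L¹` indexed by `b'`, and a map into a second countable space takes
almost all its values in its essential range (`lintegral_of_ignorability`).

Two models. Bridge equations involve only the kernel `p(R‖s)`, so a bridge function of one model is
one for the other. If both models satisfy the same variant, boundedness puts the transferred
residual in `L²`, and one formula serves both models. If the variants differ, inserting the bridge
equation for `q` into the formula of `h`, and that for `h` into the formula of `q`, produces the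
same sum of `h q p(w',z',b,x)` in two orders. Boundedness justifies Fubini
(`integral_integral_bounded_swap`). -/

/-! ### Densities, conditional densities and their integrals -/

section DensityLemmas

open scoped ENNReal

/-- The conditional density as an extended nonnegative number. -/
noncomputable def econdDens {Ω α β : Type*} [MeasurableSpace Ω] [MeasurableSpace α]
    [MeasurableSpace β] (P : Measure Ω) (Y : Ω → α) (T : Ω → β) (mY : Measure α) (mT : Measure β)
    (y : α) (t : β) : ℝ≥0∞ :=
  ENNReal.ofReal (condDens P Y T mY mT y t)

variable {Ω α β γ : Type*} [MeasurableSpace Ω] [MeasurableSpace α] [MeasurableSpace β]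
  [MeasurableSpace γ]

section Basic

variable (P : Measure Ω) (Y : Ω → α) (T : Ω → β) (mY : Measure α) (mT : Measure β)

@[fun_prop]
theorem measurable_dens : Measurable (dens P Y mY) :=
  (measurable_pdf Y P mY).ennreal_toReal

theorem dens_nonneg (y : α) : 0 ≤ dens P Y mY y := ENNReal.toReal_nonneg

@[fun_prop]
theorem Measurable.condDens {δ : Type*} [MeasurableSpace δ] {f : δ → α} {g : δ → β}
    (hf : Measurable f) (hg : Measurable g) :
    Measurable fun x => condDens P Y T mY mT (f x) (g x) := by
  unfold _root_.condDens
  exact ((measurable_dens P _ _).comp (hf.prodMk hg)).div ((measurable_dens P T mT).comp hg)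

theorem condDens_nonneg (y : α) (t : β) : 0 ≤ condDens P Y T mY mT y t :=
  div_nonneg (dens_nonneg _ _ _ _) (dens_nonneg _ _ _ _)

theorem condDens_eq_zero {t : β} (ht : dens P T mT t = 0) (y : α) :
    condDens P Y T mY mT y t = 0 := by
  simp [condDens, ht]

@[fun_prop]
theorem Measurable.econdDens {δ : Type*} [MeasurableSpace δ] {f : δ → α} {g : δ → β}
    (hf : Measurable f) (hg : Measurable g) :
    Measurable fun x => econdDens P Y T mY mT (f x) (g x) :=
  (hf.condDens P Y T mY mT hg).ennreal_ofReal

theorem econdDens_ne_top (y : α) (t : β) : econdDens P Y T mY mT y t ≠ ∞ := ENNReal.ofReal_ne_top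

end Basic

variable {P : Measure Ω} {Y : Ω → α} {T : Ω → β} {mY : Measure α} {mT : Measure β}

/-- The law is finite, so its Radon–Nikodym derivative is finite almost everywhere and `toReal`
loses nothing. -/
theorem map_eq_withDensity_dens [IsFiniteMeasure P] [SigmaFinite mY]
    (h : P.map Y ≪ mY) : P.map Y = mY.withDensity fun y => ENNReal.ofReal (dens P Y mY y) := by
  have h1 : mY.withDensity (pdf Y P mY) = P.map Y := Measure.withDensity_rnDeriv_eq _ _ h
  rw [← h1]
  refine withDensity_congr_ae ?_
  filter_upwards [Measure.rnDeriv_lt_top (P.map Y) mY] with y hy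
  exact (ENNReal.ofReal_toReal hy.ne).symm

theorem lintegral_comp_dens [IsFiniteMeasure P] [SigmaFinite mY] (hY : Measurable Y)
    (h : P.map Y ≪ mY) {φ : α → ℝ≥0∞} (hφ : Measurable φ) :
    ∫⁻ ω, φ (Y ω) ∂P = ∫⁻ y, φ y * ENNReal.ofReal (dens P Y mY y) ∂mY := by
  rw [← lintegral_map hφ hY, map_eq_withDensity_dens h,
    lintegral_withDensity_eq_lintegral_mul _ (by fun_prop) hφ]
  simp [mul_comm]

/-- Passage between almost sure statements and statements for the reference measure; the guard `dens
≠ 0` is the price. -/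
theorem ae_map_iff_dens [IsFiniteMeasure P] [SigmaFinite mY] (h : P.map Y ≪ mY) {p : α → Prop} :
    (∀ᵐ y ∂P.map Y, p y) ↔ ∀ᵐ y ∂mY, dens P Y mY y ≠ 0 → p y := by
  rw [map_eq_withDensity_dens h, ae_withDensity_iff (by fun_prop)]
  refine Filter.eventually_congr (Filter.Eventually.of_forall fun y => ?_)
  have := dens_nonneg P Y mY y
  simp only [ne_eq, ENNReal.ofReal_eq_zero, not_le]
  exact ⟨fun h h' => h (lt_of_le_of_ne this (Ne.symm h')), fun h h' => h h'.ne'⟩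

/-- The device behind the density identities of this file: compute both test integrals as the same
expectation, then remove the test function. -/
theorem eq_of_withDensity_lintegral_eq {m : Measure α} [SigmaFinite m] {f g : α → ℝ≥0∞}
    (hf : Measurable f) (hg : Measurable g)
    (h : ∀ φ : α → ℝ≥0∞, Measurable φ → ∫⁻ y, φ y * f y ∂m = ∫⁻ y, φ y * g y ∂m) : f =ᵐ[m] g := by
  rw [← withDensity_eq_iff_of_sigmaFinite hf.aemeasurable hg.aemeasurable]
  refine Measure.ext_of_lintegral _ fun φ hφ => ?_
  rw [lintegral_withDensity_eq_lintegral_mul _ hf hφ, lintegral_withDensity_eq_lintegral_mul _ hg hφ]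
  simpa [mul_comm] using h φ hφ

theorem ac_fst {mY : Measure α} {mT : Measure β} [SFinite mT] (hY : Measurable Y) (hT : Measurable T)
    (h : P.map (fun ω => (Y ω, T ω)) ≪ mY.prod mT) : P.map Y ≪ mY := by
  have := h.map measurable_fst
  rw [Measure.map_map measurable_fst (hY.prodMk hT)] at this
  exact this.trans Measure.quasiMeasurePreserving_fst.absolutelyContinuous

theorem ac_snd {mY : Measure α} {mT : Measure β} [SFinite mT] (hY : Measurable Y) (hT : Measurable T)
    (h : P.map (fun ω => (Y ω, T ω)) ≪ mY.prod mT) : P.map T ≪ mT := by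
  have := h.map measurable_snd
  rw [Measure.map_map measurable_snd (hY.prodMk hT)] at this
  exact this.trans Measure.quasiMeasurePreserving_snd.absolutelyContinuous

/-- The law of `T` does not charge the zero set of `p(t)`, so the joint law does not charge its
preimage. This makes the convention `0 / 0 = 0` in `condDens` harmless: `p(y|t) p(t) = p(y,t)`
survives where `p(t) = 0`. -/
theorem dens_eq_zero_of_snd [IsFiniteMeasure P] [SigmaFinite mY] [SigmaFinite mT]
    (hY : Measurable Y) (hT : Measurable T)
    (h : P.map (fun ω => (Y ω, T ω)) ≪ mY.prod mT) :
    ∀ᵐ t ∂mT, dens P T mT t = 0 →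
      ∀ᵐ y ∂mY, dens P (fun ω => (Y ω, T ω)) (mY.prod mT) (y, t) = 0 := by
  have hN : MeasurableSet {t | dens P T mT t = 0} :=
    measurable_dens P T mT (measurableSet_singleton 0)
  have h0 : P.map T {t | dens P T mT t = 0} = 0 := by
    have : ∀ᵐ t ∂P.map T, dens P T mT t ≠ 0 :=
      (ae_map_iff_dens (ac_snd hY hT h)).2 (Filter.Eventually.of_forall fun t ht => ht)
    simpa [ae_iff] using this
  have h1 : ∀ᵐ z ∂P.map (fun ω => (Y ω, T ω)), dens P T mT z.2 ≠ 0 := by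
    rw [ae_map_iff (hY.prodMk hT).aemeasurable (p := fun z : α × β => dens P T mT z.2 ≠ 0)
      (measurable_snd hN).compl]
    rw [Measure.map_apply hT hN] at h0
    simpa [ae_iff] using h0
  rw [ae_map_iff_dens h] at h1
  have h2 := Measure.ae_ae_of_ae_prod
    ((Measure.measurePreserving_swap (μ := mT) (ν := mY)).quasiMeasurePreserving.ae h1)
  filter_upwards [h2] with t ht h3
  filter_upwards [ht] with y hy
  by_contra hne
  exact hy hne h3

/-- Integration with the conditional density. -/
theorem lintegral_condDens [IsFiniteMeasure P] [SigmaFinite mY] [SigmaFinite mT]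
    (hY : Measurable Y) (hT : Measurable T)
    (h : P.map (fun ω => (Y ω, T ω)) ≪ mY.prod mT) {φ : α → β → ℝ≥0∞}
    (hφ : Measurable (Function.uncurry φ)) :
    ∫⁻ ω, φ (Y ω) (T ω) ∂P =
      ∫⁻ ω, ∫⁻ y, φ y (T ω) * econdDens P Y T mY mT y (T ω) ∂mY ∂P := by
  have e1 := lintegral_comp_dens (hY.prodMk hT) h hφ
  have hm : Measurable fun t => ∫⁻ y, φ y t * econdDens P Y T mY mT y t ∂mY := by fun_prop
  have e2 := lintegral_comp_dens hT (ac_snd hY hT h) hm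
  simp only [Function.uncurry_apply_pair] at e1
  rw [e1, e2, lintegral_prod_symm' _ (by fun_prop)]
  refine lintegral_congr_ae ?_
  filter_upwards [dens_eq_zero_of_snd hY hT h] with t ht
  rw [← lintegral_mul_const _ (by fun_prop)]
  by_cases h0 : dens P T mT t = 0
  · simp only [h0, ENNReal.ofReal_zero, mul_zero, lintegral_zero]
    rw [lintegral_eq_zero_iff (by fun_prop)]
    filter_upwards [ht h0] with y hy
    simp [hy]
  · refine lintegral_congr fun y => ?_
    simp only [Function.uncurry_apply_pair]
    rw [mul_assoc, econdDens, ← ENNReal.ofReal_mul (condDens_nonneg _ _ _ _ _ _ _), condDens,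
      div_mul_cancel₀ _ h0]

/-- Countability turns "for each set, almost every `b`" into "almost every `b`, for all sets". The
whole space is included so that rectangles built from two such systems generate the product. -/
theorem exists_countable_isPiSystem_generateFrom (α : Type*) [m : MeasurableSpace α]
    [MeasurableSpace.CountablyGenerated α] :
    ∃ C : Set (Set α), C.Countable ∧ IsPiSystem C ∧ m = MeasurableSpace.generateFrom C ∧
      Set.univ ∈ C := by
  refine ⟨generateSetAlgebra (MeasurableSpace.countableGeneratingSet α),
    countable_generateSetAlgebra (MeasurableSpace.countable_countableGeneratingSet),
    fun s hs t ht _ => isSetAlgebra_generateSetAlgebra.inter_mem hs ht, ?_,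
    isSetAlgebra_generateSetAlgebra.univ_mem⟩
  rw [generateFrom_generateSetAlgebra_eq, MeasurableSpace.generateFrom_countableGeneratingSet]

/-- Two families of measures are almost everywhere equal if their integrals agree. -/
theorem ae_eq_of_forall_setLIntegral_apply_eq {m : Measure β} [SigmaFinite m]
    [MeasurableSpace.CountablyGenerated α] {κ₁ κ₂ : β → Measure α} [∀ b, IsFiniteMeasure (κ₁ b)]
    (h₁ : ∀ s, MeasurableSet s → Measurable fun b => κ₁ b s)
    (h₂ : ∀ s, MeasurableSet s → Measurable fun b => κ₂ b s)
    (h : ∀ s A, MeasurableSet s → MeasurableSet A → ∫⁻ b in A, κ₁ b s ∂m = ∫⁻ b in A, κ₂ b s ∂m) :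
    ∀ᵐ b ∂m, κ₁ b = κ₂ b := by
  have hs : ∀ s, MeasurableSet s → ∀ᵐ b ∂m, κ₁ b s = κ₂ b s := fun s hs =>
    ae_eq_of_forall_setLIntegral_eq_of_sigmaFinite (h₁ s hs) (h₂ s hs) fun A hA _ => h s A hs hA
  obtain ⟨C, hC, hpi, hgen, -⟩ := exists_countable_isPiSystem_generateFrom α
  have hCm : ∀ s ∈ C, MeasurableSet s := fun s hs =>
    hgen ▸ MeasurableSpace.measurableSet_generateFrom hs
  have hall : ∀ᵐ b ∂m, ∀ s ∈ C, κ₁ b s = κ₂ b s := (ae_ball_iff hC).2 fun s hsC => hs s (hCm s hsC)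
  filter_upwards [hall, hs _ MeasurableSet.univ] with b hb hu
  exact ext_of_generate_finite C hgen hpi hb hu

/-- Integration of one of two conditionally independent variables with its conditional density. -/
theorem lintegral_condDens_of_condIndepFun [StandardBorelSpace Ω] [IsProbabilityMeasure P]
    [StandardBorelSpace α] [StandardBorelSpace γ]
    [SigmaFinite mY] [SigmaFinite mT] {V : Ω → γ}
    (hY : Measurable Y) (hT : Measurable T) (hV : Measurable V)
    (h : P.map (fun ω => (Y ω, T ω)) ≪ mY.prod mT)
    (hci : CondIndepFun (MeasurableSpace.comap T inferInstance) hT.comap_le Y V P)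
    {φ : α → γ → β → ℝ≥0∞} (hφ : Measurable fun x : α × γ × β => φ x.1 x.2.1 x.2.2) :
    ∫⁻ ω, φ (Y ω) (V ω) (T ω) ∂P =
      ∫⁻ ω, ∫⁻ y, φ y (V ω) (T ω) * econdDens P Y T mY mT y (T ω) ∂mY ∂P := by
  obtain ⟨ω₀⟩ : Nonempty Ω := nonempty_of_isProbabilityMeasure P
  have : Nonempty α := ⟨Y ω₀⟩
  have : Nonempty γ := ⟨V ω₀⟩
  -- The regular conditional distribution of `Y` given `T` is the kernel with density `p(y|t)`: both
  -- have the same integrals over rectangles.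
  have hk : ∀ᵐ t ∂P.map T, condDistrib Y T P t =
      mY.withDensity fun y => econdDens P Y T mY mT y t := by
    have : IsProbabilityMeasure (P.map T) := Measure.isProbabilityMeasure_map hT.aemeasurable
    refine ae_eq_of_forall_setLIntegral_apply_eq (fun s hs => Kernel.measurable_coe _ hs) ?_ ?_
    · intro s hs
      have : Measurable fun t => ∫⁻ y in s, econdDens P Y T mY mT y t ∂mY := by fun_prop
      simpa [withDensity_apply _ hs] using this
    · intro s A hs hA
      have e := lintegral_condDens (φ := fun y t => s.indicator 1 y * A.indicator 1 t) hY hT h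
        (((measurable_one.indicator hs).comp measurable_fst).mul
          ((measurable_one.indicator hA).comp measurable_snd))
      have e1 : ∫⁻ t in A, condDistrib Y T P t s ∂P.map T = P.map (fun ω => (T ω, Y ω)) (A ×ˢ s) := by
        rw [← compProd_map_condDistrib hY.aemeasurable, Measure.compProd_apply_prod hA hs]
      have e2 : ∫⁻ t in A, mY.withDensity (fun y => econdDens P Y T mY mT y t) s ∂P.map T =
          ∫⁻ ω, ∫⁻ y, s.indicator 1 y * A.indicator 1 (T ω) *
            econdDens P Y T mY mT y (T ω) ∂mY ∂P := by
        simp_rw [withDensity_apply _ hs]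
        rw [← lintegral_indicator hA, lintegral_map (Measurable.indicator (by fun_prop) hA) hT]
        refine lintegral_congr fun ω => ?_
        by_cases hω : T ω ∈ A
        · simp only [hω, Set.indicator_of_mem, Pi.one_apply, mul_one]
          rw [← lintegral_indicator hs]
          refine lintegral_congr fun y => ?_
          by_cases hy : y ∈ s <;> simp [hy]
        · simp [hω]
      rw [e1, e2, ← e, Measure.map_apply (by fun_prop) (hA.prod hs)]
      rw [← lintegral_indicator_one ((hT.prodMk hY) (hA.prod hs))]
      refine lintegral_congr fun ω => ?_
      by_cases hω : T ω ∈ A <;> by_cases hy : Y ω ∈ s <;> simp [hω, hy, Set.indicator]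
  -- Conditional independence in kernel form: conditioning `Y` on `(T, V)` gives the kernel for `T`
  -- alone.
  have hci' := (condIndepFun_iff_condDistrib_prod_ae_eq_prodMkRight hY hV hT).1 hci.symm
  have hφ' : Measurable fun x : (β × γ) × α => φ x.2 x.1.2 x.1.1 :=
    hφ.comp (f := fun x : (β × γ) × α => (x.2, x.1.2, x.1.1)) (by fun_prop)
  have e1 : ∫⁻ ω, φ (Y ω) (V ω) (T ω) ∂P =
      ∫⁻ z, ∫⁻ y, φ y z.2 z.1 ∂condDistrib Y (fun ω => (T ω, V ω)) P z
        ∂P.map (fun ω => (T ω, V ω)) := by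
    rw [← Measure.lintegral_compProd hφ', compProd_map_condDistrib hY.aemeasurable,
      lintegral_map hφ' (by fun_prop)]
  have hm : Measurable fun z : β × γ => ∫⁻ y, φ y z.2 z.1 * econdDens P Y T mY mT y z.1 ∂mY := by
    refine Measurable.lintegral_prod_right (f := fun z y => _) (hφ'.mul (by fun_prop))
  have e2 := lintegral_map (μ := P) (g := fun ω => (T ω, V ω)) hm (by fun_prop)
  rw [e1, ← e2]
  have hk' : ∀ᵐ z ∂P.map (fun ω => (T ω, V ω)), condDistrib Y T P z.1 =
      mY.withDensity fun y => econdDens P Y T mY mT y z.1 := by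
    have : P.map T = (P.map (fun ω => (T ω, V ω))).map Prod.fst := by
      rw [Measure.map_map (by fun_prop) (by fun_prop)]; rfl
    rw [this] at hk
    exact ae_of_ae_map measurable_fst.aemeasurable hk
  refine lintegral_congr_ae ?_
  filter_upwards [hk', hci'] with z hz hz'
  rw [hz', Kernel.prodMkRight_apply, hz, lintegral_withDensity_eq_lintegral_mul _ (by fun_prop)]
  · simp [mul_comm]
  · exact hφ.comp (f := fun y => (y, z.2, z.1)) (by fun_prop)

end DensityLemmas

/-! ### Identities on the diagonal, and ignorability for a treatment that need not be discrete -/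

section Diagonal

open scoped ENNReal

/-- If for every `b` almost all values of `r` lie in the closed set `C b`, then almost surely
`r b` lies in `C b`. -/
theorem ae_mem_of_forall_ae_mem_isClosed {β F : Type*} [MeasurableSpace β] [TopologicalSpace F]
    [SecondCountableTopology F] {η : Measure β} {r : β → F} {C : β → Set F}
    (hC : ∀ b, IsClosed (C b)) (h : ∀ b, ∀ᵐ b' ∂η, r b' ∈ C b) : ∀ᵐ b ∂η, r b ∈ C b := by
  -- Almost every `r b` lies in the essential range: only countably many basic open sets have to be
  -- avoided. If `r b` were outside `C b`, a basic neighbourhood of it inside `(C b)ᶜ` would have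
  -- null preimage. How `C b` varies with `b` plays no role.
  have h1 : ∀ᵐ b ∂η, ∀ s ∈ TopologicalSpace.countableBasis F, η (r ⁻¹' s) = 0 → r b ∉ s := by
    refine (ae_ball_iff (TopologicalSpace.countable_countableBasis F)).2 fun s _ => ?_
    by_cases hs : η (r ⁻¹' s) = 0
    · filter_upwards [measure_eq_zero_iff_ae_notMem.1 hs] with b hb _ using hb
    · exact Filter.Eventually.of_forall fun b hb => absurd hb hs
  filter_upwards [h1] with b hb
  by_contra hne
  obtain ⟨s, hs, hbs, hsC⟩ := (TopologicalSpace.isBasis_countableBasis F).exists_subset_of_mem_open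
    (show r b ∈ (C b)ᶜ from hne) (hC b).isOpen_compl
  refine hb s hs ?_ hbs
  exact measure_mono_null (fun b' hb' => hsC hb') (h b)

/-- Pairing `L¹` with a function bounded by `1` is a contraction. Hence an equation between two such
pairings defines a closed set, as the essential range argument needs. -/
theorem continuous_integral_mul_bounded {Ω : Type*} [MeasurableSpace Ω] {P : Measure Ω}
    {φ : Ω → ℝ} (hφ : Measurable φ) (h1 : ∀ ω, |φ ω| ≤ 1) :
    Continuous fun f : Lp ℝ 1 P => ∫ ω, f ω * φ ω ∂P := by
  have hint : ∀ f : Lp ℝ 1 P, Integrable (fun ω => f ω * φ ω) P := fun f =>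
    (L1.integrable_coeFn f).mul_bdd (c := 1) hφ.aestronglyMeasurable
      (Filter.Eventually.of_forall h1)
  refine LipschitzWith.continuous (K := 1) (LipschitzWith.of_dist_le_mul fun f g => ?_)
  rw [Real.dist_eq, ← integral_sub (hint f) (hint g), NNReal.coe_one, one_mul, L1.dist_eq_integral_dist]
  refine (abs_integral_le_integral_abs).trans (integral_mono_of_nonneg
    (Filter.Eventually.of_forall fun ω => abs_nonneg _) ?_ (Filter.Eventually.of_forall fun ω => ?_))
  · exact ((L1.integrable_coeFn f).sub (L1.integrable_coeFn g)).norm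
  · show |f ω * φ ω - g ω * φ ω| ≤ dist (f ω) (g ω)
    rw [← sub_mul, abs_mul, Real.dist_eq]
    exact mul_le_of_le_one_right (abs_nonneg _) (h1 ω)

/-- An identity between integrals that holds for every `b` and almost every `b'` holds almost
everywhere on the diagonal. -/
theorem ae_lintegral_mul_eq_of_forall_ae {β Ω : Type*} [MeasurableSpace β] [MeasurableSpace Ω]
    {P : Measure Ω} [IsSeparable P] {η : Measure β} {r₁ r₂ φ₁ φ₂ : β → Ω → ℝ≥0∞}
    (hr₁ : ∀ b, Measurable (r₁ b)) (hr₂ : ∀ b, Measurable (r₂ b))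
    (hφ₁ : ∀ b, Measurable (φ₁ b)) (hφ₂ : ∀ b, Measurable (φ₂ b))
    (hb₁ : ∀ b ω, φ₁ b ω ≤ 1) (hb₂ : ∀ b ω, φ₂ b ω ≤ 1)
    (hi₁ : ∀ᵐ b ∂η, ∫⁻ ω, r₁ b ω ∂P ≠ ∞) (hi₂ : ∀ᵐ b ∂η, ∫⁻ ω, r₂ b ω ∂P ≠ ∞)
    (h : ∀ b, ∀ᵐ b' ∂η, ∫⁻ ω, r₁ b' ω * φ₁ b ω ∂P = ∫⁻ ω, r₂ b' ω * φ₂ b ω ∂P) :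
    ∀ᵐ b ∂η, ∫⁻ ω, r₁ b ω * φ₁ b ω ∂P = ∫⁻ ω, r₂ b ω * φ₂ b ω ∂P := by
  classical
  have : Fact ((1 : ℝ≥0∞) ≠ ∞) := ⟨ENNReal.one_ne_top⟩
  have key : ∀ {r φ : Ω → ℝ≥0∞} (hr : Measurable r) (hφ : Measurable φ) (hb : ∀ ω, φ ω ≤ 1)
      (hi : ∫⁻ ω, r ω ∂P ≠ ∞),
      ∫⁻ ω, r ω * φ ω ∂P ≠ ∞ ∧ ∫ ω, ((integrable_toReal_of_lintegral_ne_top hr.aemeasurable hi).toL1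
        (fun ω => (r ω).toReal) : Lp ℝ 1 P) ω * (φ ω).toReal ∂P = (∫⁻ ω, r ω * φ ω ∂P).toReal := by
    intro r φ hr hφ hb hi
    have hfin : ∫⁻ ω, r ω * φ ω ∂P ≠ ∞ :=
      ne_top_of_le_ne_top hi (lintegral_mono fun ω => mul_le_of_le_one_right' (hb ω))
    refine ⟨hfin, ?_⟩
    rw [← integral_toReal (f := fun ω => r ω * φ ω) (hr.mul hφ).aemeasurable
      (ae_lt_top (hr.mul hφ) hfin)]
    refine integral_congr_ae ?_
    filter_upwards [Integrable.coeFn_toL1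
      (integrable_toReal_of_lintegral_ne_top hr.aemeasurable hi)] with ω hω
    rw [hω, ENNReal.toReal_mul]
  -- The functions `r b` as points of `L¹`. The default `0` is used only where the integral
  -- diverges, that is for a null set of `b`.
  let toL : (β → Ω → ℝ≥0∞) → β → Lp ℝ 1 P := fun r b =>
    if hi : Measurable (r b) ∧ ∫⁻ ω, r b ω ∂P ≠ ∞ then
      (integrable_toReal_of_lintegral_ne_top hi.1.aemeasurable hi.2).toL1
        (fun ω => (r b ω).toReal) else 0
  -- The test functions are frozen at `b` and the pair is left free, so the identity off the
  -- diagonal says that the pair at `b'` lies in `C b`.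
  let C : β → Set (Lp ℝ 1 P × Lp ℝ 1 P) := fun b =>
    {x | ∫ ω, x.1 ω * (φ₁ b ω).toReal ∂P = ∫ ω, x.2 ω * (φ₂ b ω).toReal ∂P}
  have habs : ∀ {x : ℝ≥0∞}, x ≤ 1 → |x.toReal| ≤ 1 := fun {x} hx => by
    rw [abs_of_nonneg ENNReal.toReal_nonneg]
    exact ENNReal.toReal_le_of_le_ofReal zero_le_one (by simpa using hx)
  have hC : ∀ b, IsClosed (C b) := fun b => isClosed_eq
    ((continuous_integral_mul_bounded (hφ₁ b).ennreal_toReal fun ω => habs (hb₁ b ω)).comp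
      continuous_fst)
    ((continuous_integral_mul_bounded (hφ₂ b).ennreal_toReal fun ω => habs (hb₂ b ω)).comp
      continuous_snd)
  have hiff : ∀ b b', ∫⁻ ω, r₁ b' ω ∂P ≠ ∞ → ∫⁻ ω, r₂ b' ω ∂P ≠ ∞ →
      ((toL r₁ b', toL r₂ b') ∈ C b ↔
        ∫⁻ ω, r₁ b' ω * φ₁ b ω ∂P = ∫⁻ ω, r₂ b' ω * φ₂ b ω ∂P) := by
    intro b b' h1 h2
    obtain ⟨f1, e1⟩ := key (hr₁ b') (hφ₁ b) (hb₁ b) h1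
    obtain ⟨f2, e2⟩ := key (hr₂ b') (hφ₂ b) (hb₂ b) h2
    simp only [C, toL, Set.mem_ofPred_eq]
    rw [dif_pos ⟨hr₁ b', h1⟩, dif_pos ⟨hr₂ b', h2⟩, e1, e2, ENNReal.toReal_eq_toReal_iff' f1 f2]
  have := ae_mem_of_forall_ae_mem_isClosed (r := fun b => (toL r₁ b, toL r₂ b)) hC fun b => by
    filter_upwards [h b, hi₁, hi₂] with b' hb' h1 h2 using (hiff b b' h1 h2).2 hb'
  filter_upwards [this, hi₁, hi₂] with b hb h1 h2 using (hiff b b h1 h2).1 hb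

theorem ext_prod_of_generate {α β : Type*} {mα : MeasurableSpace α} {mβ : MeasurableSpace β}
    {C : Set (Set α)} {D : Set (Set β)} (hC : mα = MeasurableSpace.generateFrom C)
    (hD : mβ = MeasurableSpace.generateFrom D) (hC' : IsPiSystem C) (hD' : IsPiSystem D)
    (hCu : Set.univ ∈ C) (hDu : Set.univ ∈ D) {μ ν : Measure (α × β)} [IsFiniteMeasure μ]
    (h : ∀ s ∈ C, ∀ t ∈ D, μ (s ×ˢ t) = ν (s ×ˢ t)) : μ = ν := by
  refine ext_of_generate_finite (Set.image2 (· ×ˢ ·) C D) ?_ (hC'.prod hD') ?_ ?_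
  · refine (generateFrom_eq_prod hC.symm hD.symm ?_ ?_).symm
    · exact ⟨fun _ => Set.univ, fun _ => hCu, Set.iUnion_const _⟩
    · exact ⟨fun _ => Set.univ, fun _ => hDu, Set.iUnion_const _⟩
  · rintro _ ⟨s, hs, t, ht, rfl⟩
    exact h s hs t ht
  · simpa using h _ hCu _ hDu

/-- Ignorability with a treatment `B` that need not be discrete. `Ob b` and `Tb b` are the potential
outcomes under `B = b`, which are related to the factual ones by a change of measure with
density `ρ b`. -/
theorem lintegral_of_ignorability {Ω 𝓑 𝓞 𝓣 : Type*} [MeasurableSpace Ω] [StandardBorelSpace Ω]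
    [MeasurableSpace 𝓑] [StandardBorelSpace 𝓑] [MeasurableSpace 𝓞] [StandardBorelSpace 𝓞]
    [MeasurableSpace 𝓣] [StandardBorelSpace 𝓣] {P : Measure Ω} [IsProbabilityMeasure P]
    {η : Measure 𝓑} [SigmaFinite η] {mT : Measure 𝓣} [SigmaFinite mT]
    {B : Ω → 𝓑} {O : Ω → 𝓞} {T : Ω → 𝓣} {Ob : 𝓑 → Ω → 𝓞} {Tb : 𝓑 → Ω → 𝓣} {ρ : 𝓑 → Ω → ℝ≥0∞}
    (hB : Measurable B) (hT : Measurable T)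
    (hOb : Measurable (Function.uncurry Ob)) (hTb : Measurable (Function.uncurry Tb))
    (hρ : Measurable (Function.uncurry ρ))
    (hac : P.map (fun ω => (B ω, T ω)) ≪ η.prod mT)
    (hswap : ∀ b₀, ∀ φ : 𝓑 × 𝓞 × 𝓣 → ℝ≥0∞, Measurable φ →
      ∫⁻ ω, φ (B ω, Ob b₀ ω, T ω) ∂P = ∫⁻ b, ∫⁻ ω, φ (b, Ob b₀ ω, Tb b ω) * ρ b ω ∂P ∂η)
    (hdiag : ∀ φ : 𝓑 × 𝓞 × 𝓣 → ℝ≥0∞, Measurable φ →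
      ∫⁻ ω, φ (B ω, O ω, T ω) ∂P = ∫⁻ b, ∫⁻ ω, φ (b, Ob b ω, Tb b ω) * ρ b ω ∂P ∂η)
    (hign : ∀ b, CondIndepFun (MeasurableSpace.comap T inferInstance) hT.comap_le (Ob b) B P)
    {φ : 𝓑 × 𝓞 × 𝓣 → ℝ≥0∞} (hφ : Measurable φ) :
    ∫⁻ ω, φ (B ω, O ω, T ω) ∂P =
      ∫⁻ b, ∫⁻ ω, φ (b, Ob b ω, T ω) * econdDens P B T η mT b (T ω) ∂P ∂η := by
  obtain ⟨ω₀⟩ : Nonempty Ω := nonempty_of_isProbabilityMeasure P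
  have : Nonempty 𝓑 := ⟨B ω₀⟩
  have : Nonempty 𝓞 := ⟨Ob (B ω₀) ω₀⟩
  have hOb' : ∀ b, Measurable (Ob b) := fun b => hOb.comp measurable_prodMk_left
  have hTb' : ∀ b, Measurable (Tb b) := fun b => hTb.comp measurable_prodMk_left
  have hρ' : ∀ b, Measurable (ρ b) := fun b => hρ.comp measurable_prodMk_left
  have hOb2 : Measurable fun x : 𝓑 × Ω => Ob x.1 x.2 := hOb
  have hTb2 : Measurable fun x : 𝓑 × Ω => Tb x.1 x.2 := hTb
  have hρ2 : Measurable fun x : 𝓑 × Ω => ρ x.1 x.2 := hρ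
  obtain ⟨CO, hCO, hCOpi, hCOgen, hCOu⟩ := exists_countable_isPiSystem_generateFrom 𝓞
  obtain ⟨CT, hCT, hCTpi, hCTgen, hCTu⟩ := exists_countable_isPiSystem_generateFrom 𝓣
  have hCOm : ∀ s ∈ CO, MeasurableSet s := fun s hs =>
    hCOgen ▸ MeasurableSpace.measurableSet_generateFrom hs
  have hCTm : ∀ s ∈ CT, MeasurableSet s := fun s hs =>
    hCTgen ▸ MeasurableSpace.measurableSet_generateFrom hs
  -- Ignorability at a fixed `b`: against functions of `(B, T)`, the event `Ob b ∈ A` may be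
  -- replaced by its conditional probability given `T`.
  have hcd : ∀ b, ∀ A, MeasurableSet A → ∀ ψ : 𝓑 × 𝓣 → ℝ≥0∞, Measurable ψ →
      ∫⁻ ω, A.indicator 1 (Ob b ω) * ψ (B ω, T ω) ∂P =
        ∫⁻ ω, condDistrib (Ob b) T P (T ω) A * ψ (B ω, T ω) ∂P := by
    intro b A hA ψ hψ
    have hci := (condIndepFun_iff_condDistrib_prod_ae_eq_prodMkRight (hOb' b) hB hT).1 (hign b).symm
    have hm : Measurable fun x : (𝓣 × 𝓑) × 𝓞 => A.indicator (1 : 𝓞 → ℝ≥0∞) x.2 * ψ (x.1.2, x.1.1) :=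
      ((measurable_one.indicator hA).comp measurable_snd).mul (by fun_prop)
    have e1 : ∫⁻ ω, A.indicator 1 (Ob b ω) * ψ (B ω, T ω) ∂P =
        ∫⁻ z, ∫⁻ y, A.indicator 1 y * ψ (z.2, z.1) ∂condDistrib (Ob b) (fun ω => (T ω, B ω)) P z
          ∂P.map (fun ω => (T ω, B ω)) := by
      rw [← Measure.lintegral_compProd hm, compProd_map_condDistrib (hOb' b).aemeasurable,
        lintegral_map hm (by fun_prop)]
    have hk : Measurable fun t => condDistrib (Ob b) T P t A := Kernel.measurable_coe _ hA
    have hm2 : Measurable fun z : 𝓣 × 𝓑 => condDistrib (Ob b) T P z.1 A * ψ (z.2, z.1) := by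
      fun_prop
    have e2 := lintegral_map (μ := P) (g := fun ω => (T ω, B ω)) hm2 (by fun_prop)
    rw [e1, ← e2]
    refine lintegral_congr_ae ?_
    filter_upwards [hci] with z hz
    rw [hz, Kernel.prodMkRight_apply, lintegral_mul_const _ (measurable_one.indicator hA),
      lintegral_indicator_one hA]
  have hcd' : ∀ b, ∀ A, MeasurableSet A → ∀ ψ : 𝓣 → ℝ≥0∞, Measurable ψ →
      ∫⁻ ω, A.indicator 1 (Ob b ω) * ψ (T ω) ∂P =
        ∫⁻ ω, condDistrib (Ob b) T P (T ω) A * ψ (T ω) ∂P := fun b A hA ψ hψ =>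
    hcd b A hA (fun x => ψ x.2) (by fun_prop)
  -- The total mass is `1`, so `ρ b` is integrable for almost every `b` and defines a point of `L¹`;
  -- likewise for the conditional density below.
  have hfin₁ : ∫⁻ b, ∫⁻ ω, ρ b ω ∂P ∂η ≠ ∞ := by
    have := hdiag (fun _ => 1) measurable_const
    simp only [lintegral_one, measure_univ, one_mul] at this
    simp [← this]
  have hfin₂ : ∫⁻ b, ∫⁻ ω, econdDens P B T η mT b (T ω) ∂P ∂η ≠ ∞ := by
    have := lintegral_condDens (φ := fun _ _ => 1) hB hT hac measurable_const
    rw [lintegral_lintegral_swap (by fun_prop)]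
    simp only [lintegral_one, measure_univ, one_mul] at this
    simp [← this]
  have hm₁ : Measurable fun b => ∫⁻ ω, ρ b ω ∂P := hρ.lintegral_prod_right
  have hm₂ : Measurable fun b => ∫⁻ ω, econdDens P B T η mT b (T ω) ∂P := by fun_prop
  -- The diagonal argument for one rectangle. What varies with the integration variable is `ρ b
  -- 1_C(Tb b)` on one side and `p(b|T) 1_C(T)` on the other; the test functions `1_A(Ob b)` and
  -- `P(Ob b ∈ A | T)` carry the value that is frozen first.
  have hrect : ∀ A ∈ CO, ∀ C ∈ CT, ∀ᵐ b ∂η,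
      ∫⁻ ω, (ρ b ω * C.indicator 1 (Tb b ω)) * A.indicator 1 (Ob b ω) ∂P =
      ∫⁻ ω, (econdDens P B T η mT b (T ω) * C.indicator 1 (T ω)) *
        condDistrib (Ob b) T P (T ω) A ∂P := by
    intro A hA C hC
    have hA := hCOm A hA
    have hC := hCTm C hC
    have hA1 : Measurable (A.indicator (1 : 𝓞 → ℝ≥0∞)) := measurable_one.indicator hA
    have hC1 : Measurable (C.indicator (1 : 𝓣 → ℝ≥0∞)) := measurable_one.indicator hC
    have hleA : ∀ x, A.indicator (1 : 𝓞 → ℝ≥0∞) x ≤ 1 :=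
      fun x => Set.indicator_le_self' (fun _ _ => zero_le) x
    have hleC : ∀ x, C.indicator (1 : 𝓣 → ℝ≥0∞) x ≤ 1 :=
      fun x => Set.indicator_le_self' (fun _ _ => zero_le) x
    refine ae_lintegral_mul_eq_of_forall_ae
      (r₁ := fun b ω => ρ b ω * C.indicator 1 (Tb b ω))
      (r₂ := fun b ω => econdDens P B T η mT b (T ω) * C.indicator 1 (T ω))
      (φ₁ := fun b ω => A.indicator 1 (Ob b ω))
      (φ₂ := fun b ω => condDistrib (Ob b) T P (T ω) A)
      (fun b => (hρ' b).mul (hC1.comp (hTb' b))) (fun b => by fun_prop)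
      (fun b => hA1.comp (hOb' b)) (fun b => (Kernel.measurable_coe _ hA).comp hT)
      (fun b ω => hleA _) (fun b ω => prob_le_one) ?_ ?_ ?_
    · filter_upwards [ae_lt_top hm₁ hfin₁] with b hb
      exact ne_top_of_le_ne_top hb.ne (lintegral_mono fun ω => mul_le_of_le_one_right' (hleC _))
    · filter_upwards [ae_lt_top hm₂ hfin₂] with b hb
      exact ne_top_of_le_ne_top hb.ne (lintegral_mono fun ω => mul_le_of_le_one_right' (hleC _))
    -- Off the diagonal: with the outcome frozen at `b₀`, both sides integrate over any `D ⊆ 𝓑` to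
    -- the probability of `B ∈ D`, `Ob b₀ ∈ A`, `T ∈ C`, the left by `hswap`, the right by
    -- ignorability and disintegration of `B`.
    · intro b₀
      have hk : Measurable fun t => condDistrib (Ob b₀) T P t A := Kernel.measurable_coe _ hA
      have hO₀ := hOb' b₀
      refine ae_eq_of_forall_setLIntegral_eq_of_sigmaFinite ?_ ?_ fun D hD _ => ?_
      · exact Measurable.lintegral_prod_right (f := fun b ω => _)
          ((hρ2.mul (hC1.comp hTb2)).mul (hA1.comp (hO₀.comp measurable_snd)))
      · fun_prop
      have hD1 : Measurable (D.indicator (1 : 𝓑 → ℝ≥0∞)) := measurable_one.indicator hD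
      have e1 := hswap b₀ (fun x => D.indicator 1 x.1 * (A.indicator 1 x.2.1 * C.indicator 1 x.2.2))
        (by fun_prop)
      have e2 := hcd b₀ A hA (fun x => D.indicator 1 x.1 * C.indicator 1 x.2) (by fun_prop)
      have e3 := lintegral_condDens (φ := fun b t => D.indicator 1 b * C.indicator 1 t *
        condDistrib (Ob b₀) T P t A) hB hT hac (by fun_prop)
      have hind : ∀ F : 𝓑 → ℝ≥0∞, ∫⁻ b in D, F b ∂η = ∫⁻ b, D.indicator 1 b * F b ∂η := by
        intro F
        rw [← lintegral_indicator hD]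
        refine lintegral_congr fun b => ?_
        by_cases hb : b ∈ D <;> simp [hb]
      rw [hind, hind]
      calc _ = ∫⁻ b, ∫⁻ ω, D.indicator 1 b * (A.indicator 1 (Ob b₀ ω) * C.indicator 1 (Tb b ω)) *
              ρ b ω ∂P ∂η := by
            refine lintegral_congr fun b => ?_
            rw [← lintegral_const_mul]
            · refine lintegral_congr fun ω => ?_
              ring
            · exact ((hρ' b).mul (hC1.comp (hTb' b))).mul (hA1.comp hO₀)
        _ = ∫⁻ ω, D.indicator 1 (B ω) * C.indicator 1 (T ω) *
              condDistrib (Ob b₀) T P (T ω) A ∂P := by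
            rw [← e1]
            simp only at e2
            calc _ = _ := lintegral_congr fun ω => by ring
              _ = _ := e2
              _ = _ := lintegral_congr fun ω => by ring
        _ = _ := by
            rw [e3, lintegral_lintegral_swap (by fun_prop)]
            refine lintegral_congr fun b => ?_
            rw [← lintegral_const_mul _ (by fun_prop)]
            refine lintegral_congr fun ω => ?_
            ring
  have hall := (ae_ball_iff hCO).2 fun A hA => (ae_ball_iff hCT).2 fun C hC => hrect A hA C hC
  rw [hdiag φ hφ]
  refine lintegral_congr_ae ?_
  filter_upwards [hall, ae_lt_top hm₁ hfin₁] with b hb hfb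
  have hρb := hρ' b
  have hOb := hOb' b
  have hTb := hTb' b
  have hfm : IsFiniteMeasure (P.withDensity (ρ b)) := isFiniteMeasure_withDensity hfb.ne
  -- For this `b` all rectangles from the two countable systems are available at once, so two finite
  -- measures agree and arbitrary `φ (b, ·)` can be integrated.
  have hmeas : (P.withDensity (ρ b)).map (fun ω => (Ob b ω, Tb b ω)) =
      (P.withDensity fun ω => econdDens P B T η mT b (T ω)).map (fun ω => (Ob b ω, T ω)) := by
    refine ext_prod_of_generate hCOgen hCTgen hCOpi hCTpi hCOu hCTu fun A hA C hC => ?_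
    have hAm := hCOm A hA
    have hCm := hCTm C hC
    have hC1 : Measurable (C.indicator (1 : 𝓣 → ℝ≥0∞)) := measurable_one.indicator hCm
    have e := hcd' b A hAm (fun t => econdDens P B T η mT b t * C.indicator 1 t) (by fun_prop)
    have e' := hb A hA C hC
    rw [Measure.map_apply (by fun_prop) (hAm.prod hCm), Measure.map_apply (by fun_prop)
      (hAm.prod hCm), withDensity_apply _ ((hOb.prodMk hTb) (hAm.prod hCm)),
      withDensity_apply _ ((hOb.prodMk hT) (hAm.prod hCm)),
      ← lintegral_indicator ((hOb.prodMk hTb) (hAm.prod hCm)),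
      ← lintegral_indicator ((hOb.prodMk hT) (hAm.prod hCm))]
    calc _ = ∫⁻ ω, (ρ b ω * C.indicator 1 (Tb b ω)) * A.indicator 1 (Ob b ω) ∂P := by
          refine lintegral_congr fun ω => ?_
          by_cases h1 : Ob b ω ∈ A <;> by_cases h2 : Tb b ω ∈ C <;> simp [h1, h2, Set.indicator]
      _ = ∫⁻ ω, A.indicator 1 (Ob b ω) * (econdDens P B T η mT b (T ω) * C.indicator 1 (T ω)) ∂P := by
          rw [e', e]
          exact lintegral_congr fun ω => mul_comm _ _
      _ = _ := by
          refine lintegral_congr fun ω => ?_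
          by_cases h1 : Ob b ω ∈ A <;> by_cases h2 : T ω ∈ C <;> simp [h1, h2, Set.indicator]
  have hφb : Measurable fun y : 𝓞 × 𝓣 => φ (b, y) := by fun_prop
  have e := congrArg (fun ν : Measure (𝓞 × 𝓣) => ∫⁻ y, φ (b, y) ∂ν) hmeas
  rw [lintegral_map hφb (by fun_prop), lintegral_map hφb (by fun_prop),
    lintegral_withDensity_eq_lintegral_mul _ hρb (by fun_prop),
    lintegral_withDensity_eq_lintegral_mul _ (by fun_prop) (by fun_prop)] at e
  simpa [mul_comm] using e

end Diagonal

/-! ### Effects of an intervention, and structural equations below the treatment -/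

section CausalLemmas

open scoped ENNReal

universe u

/-! ### Potential outcomes and directed paths -/

/-- `LatentEdge` grows at its source, whereas the paths below are followed from `B` and grow at
their target. -/
theorem LatentEdge.snoc {ι : Type*} {G : Digraph ι} {K : Set ι} {i k j : ι}
    (h : LatentEdge G K i k) (hk : k ∉ K) (hkj : G.Adj k j) : LatentEdge G K i j := by
  induction h with
  | edge h => exact .cons h hk (.edge hkj)
  | cons h hl _ ih => exact .cons h hl (ih hk hkj)

/-- There is a directed path from `B` to `i` that does not enter `S`. -/
def ReachAvoiding {V U : Type*} (G : Digraph (V ⊕ U)) (S : Finset V) (B : V) (i : V ⊕ U) : Prop :=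
  Relation.ReflTransGen (fun j k => G.Adj j k ∧ ∀ v ∈ S, k ≠ Sum.inl v) (.inl B) i

/-- Cut the path at its visits to `R ∪ S`: the pieces are edges of the latent projection, and none
ends in `S`. The induction remembers the last visited vertex `u` of `R ∪ S` and the latent piece
that leads from it to the current vertex. -/
theorem ReachAvoiding.cadmgDesc {V U : Type*} [DecidableEq V] {G : Digraph (V ⊕ U)}
    {R S : Finset V} {B v : V} (hB : B ∈ R) (h : ReachAvoiding G S B (.inl v)) (hv : v ∈ R) :
    cadmgDesc G R S B v := by
  have key : ∀ j, ReachAvoiding G S B j → ∃ u ∈ R ∪ S, _root_.cadmgDesc G R S B u ∧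
      (j = .inl u ∨ (LatentEdge G {i | ∃ k ∈ R ∪ S, i = Sum.inl k} (.inl u) j ∧
        j ∉ {i | ∃ k ∈ R ∪ S, i = Sum.inl k})) := by
    intro j hj
    induction hj with
    | refl => exact ⟨B, Finset.mem_union_left _ hB, .refl, .inl rfl⟩
    | @tail j k _ hjk ih =>
      obtain ⟨u, hu, hBu, hj⟩ := ih
      have he : LatentEdge G {i | ∃ k ∈ R ∪ S, i = Sum.inl k} (.inl u) k := by
        rcases hj with rfl | ⟨hj, hjK⟩
        · exact .edge hjk.1
        · exact hj.snoc hjK hjk.1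
      by_cases hk : k ∈ {i : V ⊕ U | ∃ k ∈ R ∪ S, i = Sum.inl k}
      · obtain ⟨w, hw, rfl⟩ := hk
        exact ⟨w, hw, hBu.tail ⟨hu, hw, fun hS => hjk.2 w hS rfl, he⟩, .inl rfl⟩
      · exact ⟨u, hu, hBu, .inr ⟨he, hk⟩⟩
  obtain ⟨u, hu, hBu, h' | ⟨-, h'⟩⟩ := key _ h
  · cases h'
    exact hBu
  · exact absurd ⟨v, Finset.mem_union_left _ hv, rfl⟩ h'

namespace CausalModel

variable {V U : Type*} [Fintype V] [DecidableEq V] [Fintype U] {G : Digraph (V ⊕ U)}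
  {X : V → Type u} [∀ v, MeasurableSpace (X v)]

section Consistency

variable (M : CausalModel G X) {S : Finset V} {B : V} (a : ∀ v, X v)

theorem po_inl_of_mem {I : Finset V} {v : V} (hv : v ∈ I) (ω : M.Ω) :
    M.po I a ω (.inl v) = a v := by
  rw [po_eq]
  exact if_pos hv

theorem po_inl_of_notMem {I : Finset V} {v : V} (hv : v ∉ I) (ω : M.Ω) :
    M.po I a ω (.inl v) = M.f (.inl v) (fun j => M.po I a ω j) (M.ε (.inl v) ω) := by
  rw [po_eq]
  exact if_neg hv

theorem po_inr {I : Finset V} (k : U) (ω : M.Ω) :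
    M.po I a ω (.inr k) = M.f (.inr k) (fun j => M.po I a ω j) (M.ε (.inr k) ω) := by
  rw [po_eq]
  rfl

/-- An intervention has no effect on variables that cannot be reached. -/
theorem po_insert_of_not_reachAvoiding (hBS : B ∉ S) (b : X B) (ω : M.Ω) (i : V ⊕ U)
    (hi : ¬ ReachAvoiding G S B i) :
    M.po (insert B S) (Function.update a B b) ω i = M.po S a ω i := by
  induction i using M.wf.induction with
  | _ i ih =>
    have hpar : (∀ v ∈ S, i ≠ .inl v) → ∀ j, G.Adj j i →
        M.po (insert B S) (Function.update a B b) ω j = M.po S a ω j := fun hS j hj =>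
      ih j hj fun hr => hi (hr.tail ⟨hj, hS⟩)
    cases i with
    | inl v =>
      have hvB : v ≠ B := by
        rintro rfl
        exact hi .refl
      by_cases hv : v ∈ S
      · rw [po_inl_of_mem _ _ hv, po_inl_of_mem _ _ (Finset.mem_insert_of_mem hv),
          Function.update_of_ne hvB]
      · rw [po_inl_of_notMem _ _ hv, po_inl_of_notMem _ _ (by simp [hvB, hv])]
        congr 1
        funext j
        exact hpar (fun w hw h => hv (Sum.inl.inj h ▸ hw)) j j.2
    | inr k =>
      rw [po_inr, po_inr]
      congr 1
      funext j
      exact hpar (fun w _ h => by cases h) j j.2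

/-- Consistency. -/
theorem po_insert_of_eq (hBS : B ∉ S) (b : X B) (ω : M.Ω) (hb : M.obs1 S a B ω = b) (i : V ⊕ U) :
    M.po (insert B S) (Function.update a B b) ω i = M.po S a ω i := by
  induction i using M.wf.induction with
  | _ i ih =>
    cases i with
    | inl v =>
      by_cases hvB : v = B
      · subst hvB
        rw [po_inl_of_mem _ _ (Finset.mem_insert_self _ _), Function.update_self]
        exact hb.symm
      by_cases hv : v ∈ S
      · rw [po_inl_of_mem _ _ hv, po_inl_of_mem _ _ (Finset.mem_insert_of_mem hv),
          Function.update_of_ne hvB]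
      · rw [po_inl_of_notMem _ _ hv, po_inl_of_notMem _ _ (by simp [hvB, hv])]
        congr 1
        funext j
        exact ih j j.2
    | inr k =>
      rw [po_inr, po_inr]
      congr 1
      funext j
      exact ih j j.2

end Consistency

/-! ### Potential outcomes as functions of the non-descendants and of the errors -/

open Classical in
/-- The strict descendants of `B`. -/
noncomputable def strictDesc (G : Digraph (V ⊕ U)) (B : V) : Finset (V ⊕ U) :=
  Finset.univ.filter fun i => Relation.TransGen G.Adj (.inl B) i

omit [DecidableEq V] in
theorem mem_strictDesc {B : V} {i : V ⊕ U} :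
    i ∈ strictDesc G B ↔ Relation.TransGen G.Adj (.inl B) i := by
  simp [strictDesc]

/-- The values of the vertices other than `B` and its strict descendants. -/
abbrev NonDesc (M : CausalModel G X) (B : V) : Type _ :=
  ∀ i : {i : V ⊕ U // i ∉ strictDesc G B ∧ i ≠ .inl B}, State X M.XU i

/-- The errors of the strict descendants of `B`. -/
abbrev DescErr (M : CausalModel G X) (B : V) : Type _ := ∀ i : strictDesc G B, M.Err i

section Hybrid

variable (M : CausalModel G X) (S : Finset V) (B : V) (a : ∀ v, X v)

open Classical in
/-- One step of the recursion that defines `hybrid`. -/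
noncomputable def hybridStep (b : X B) (y : M.NonDesc B) (e : M.DescErr B) :
    ∀ i : V ⊕ U, (∀ j, G.Adj j i → State X M.XU j) → State X M.XU i
  | .inl v, rec =>
    if hv : v ∈ insert B S then Function.update a B b v
    else if h : Sum.inl v ∈ strictDesc G B then M.f (.inl v) (fun j => rec j j.2) (e ⟨_, h⟩)
    else y ⟨.inl v, h, fun h' => hv (Sum.inl.inj h' ▸ Finset.mem_insert_self _ _)⟩
  | .inr k, rec =>
    if h : Sum.inr k ∈ strictDesc G B then M.f (.inr k) (fun j => rec j j.2) (e ⟨_, h⟩)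
    else y ⟨.inr k, h, by simp⟩

/-- The values of all variables, computed from the value of `B`, the values of the other
non-descendants of `B` and the errors of the strict descendants of `B`. -/
noncomputable def hybrid (b : X B) (y : M.NonDesc B) (e : M.DescErr B) :
    ∀ i : V ⊕ U, State X M.XU i :=
  M.wf.fix (M.hybridStep S B a b y e)

theorem hybrid_eq (b : X B) (y : M.NonDesc B) (e : M.DescErr B) (i : V ⊕ U) :
    M.hybrid S B a b y e i = M.hybridStep S B a b y e i (fun j _ => M.hybrid S B a b y e j) :=
  M.wf.fix_eq _ i

variable {S B} in
theorem hybrid_of_mem {v : V} (hv : v ∈ insert B S) (b : X B) (y : M.NonDesc B)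
    (e : M.DescErr B) : M.hybrid S B a b y e (.inl v) = Function.update a B b v :=
  (M.hybrid_eq S B a b y e _).trans (dif_pos hv)

variable {S B} in
theorem hybrid_of_mem_strictDesc {i : V ⊕ U} (hi : i ∈ strictDesc G B)
    (hI : ∀ v ∈ insert B S, i ≠ .inl v) (b : X B) (y : M.NonDesc B) (e : M.DescErr B) :
    M.hybrid S B a b y e i = M.f i (fun j => M.hybrid S B a b y e j) (e ⟨i, hi⟩) := by
  refine (M.hybrid_eq S B a b y e _).trans ?_
  cases i with
  | inl v => exact (dif_neg fun h => hI v h rfl).trans (dif_pos hi)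
  | inr k => exact dif_pos hi

variable {S B} in
theorem hybrid_of_notMem_strictDesc {i : V ⊕ U} (hi : i ∉ strictDesc G B)
    (hI : ∀ v ∈ insert B S, i ≠ .inl v) (b : X B) (y : M.NonDesc B) (e : M.DescErr B) :
    M.hybrid S B a b y e i = y ⟨i, hi, hI B (Finset.mem_insert_self _ _)⟩ := by
  refine (M.hybrid_eq S B a b y e _).trans ?_
  cases i with
  | inl v => exact (dif_neg fun h => hI v h rfl).trans (dif_neg hi)
  | inr k => exact dif_neg hi

/-- Joint measurability in the treatment value too, which `measurable_po` does not give because it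
fixes the intervention value. The integrals over `b` depend on it. -/
theorem measurable_hybrid (i : V ⊕ U) :
    Measurable fun x : X B × M.NonDesc B × M.DescErr B => M.hybrid S B a x.1 x.2.1 x.2.2 i := by
  induction i using M.wf.induction with
  | _ i ih =>
    by_cases hI : ∀ v ∈ insert B S, i ≠ .inl v
    · by_cases hi : i ∈ strictDesc G B
      · have he : Measurable fun x : X B × M.NonDesc B × M.DescErr B => x.2.2 ⟨i, hi⟩ :=
          (measurable_pi_apply (⟨i, hi⟩ : strictDesc G B)).comp
            (measurable_snd.comp measurable_snd)
        simp only [hybrid_of_mem_strictDesc M a hi hI]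
        exact (M.measurable_f i).comp
          ((measurable_pi_lambda (fun (x : X B × M.NonDesc B × M.DescErr B)
            (j : {j // G.Adj j i}) => M.hybrid S B a x.1 x.2.1 x.2.2 j) fun j => ih j j.2).prodMk he)
      · simp only [hybrid_of_notMem_strictDesc M a hi hI]
        exact (measurable_pi_apply _).comp (measurable_fst.comp measurable_snd)
    · push Not at hI
      obtain ⟨v, hv, rfl⟩ := hI
      simp only [hybrid_of_mem M a hv]
      by_cases hvB : v = B
      · subst hvB
        simp only [Function.update_self]
        exact measurable_fst
      · simp only [Function.update_of_ne hvB]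
        exact measurable_const

/-- The non-descendants of `B` under `do(S = a)`. -/
noncomputable def nonDesc (ω : M.Ω) : M.NonDesc B := fun i => M.po S a ω i

/-- The errors of the strict descendants of `B`. -/
noncomputable def descErr (ω : M.Ω) : M.DescErr B := fun i => M.ε i ω

theorem measurable_nonDesc : Measurable (M.nonDesc S B a) :=
  measurable_pi_lambda _ fun i => M.measurable_po S a i

omit [DecidableEq V] in
theorem measurable_descErr : Measurable (M.descErr B) :=
  measurable_pi_lambda _ fun i => M.measurable_ε i

variable {S B}

omit [DecidableEq V] in
theorem not_reachAvoiding_of_nonDesc {i : V ⊕ U} (h : i ∉ strictDesc G B) (h' : i ≠ .inl B) :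
    ¬ ReachAvoiding G S B i := by
  intro hr
  refine h (mem_strictDesc.2 ?_)
  have hr' : Relation.ReflTransGen G.Adj (.inl B) i := 
    Relation.ReflTransGen.mono (fun _ _ h => h.1) _ _ hr
  rcases Relation.reflTransGen_iff_eq_or_transGen.1 hr' with h1 | h1
  · exact absurd h1 h'
  · exact h1

/-- The non-descendants do not react to `B = b`, so their values under `do(S = a)` are the right
input, and the strict descendants are recomputed from unchanged errors. All potential outcomes thus
become one function of `b` and of randomness that does not depend on `b`. -/
theorem hybrid_eq_po (hBS : B ∉ S) (b : X B) (ω : M.Ω) (i : V ⊕ U) :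
    M.hybrid S B a b (M.nonDesc S B a ω) (M.descErr B ω) i =
      M.po (insert B S) (Function.update a B b) ω i := by
  induction i using M.wf.induction with
  | _ i ih =>
    by_cases hI : ∀ v ∈ insert B S, i ≠ .inl v
    · by_cases hi : i ∈ strictDesc G B
      · rw [hybrid_of_mem_strictDesc M a hi hI]
        have hpo : M.po (insert B S) (Function.update a B b) ω i =
            M.f i (fun j => M.po (insert B S) (Function.update a B b) ω j) (M.ε i ω) := by
          cases i with
          | inl v => exact po_inl_of_notMem _ _ (fun h => hI v h rfl) ω
          | inr k => exact po_inr _ _ k ω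
        rw [hpo]
        congr 1
        funext j
        exact ih j j.2
      · rw [hybrid_of_notMem_strictDesc M a hi hI]
        exact (M.po_insert_of_not_reachAvoiding a hBS b ω _
          (not_reachAvoiding_of_nonDesc hi (hI B (Finset.mem_insert_self _ _)))).symm
    · push Not at hI
      obtain ⟨v, hv, rfl⟩ := hI
      rw [hybrid_of_mem M a hv, po_inl_of_mem _ _ hv]

/-- Consistency: inserting the factual treatment returns the factual values. -/
theorem hybrid_self (hBS : B ∉ S) (ω : M.Ω) (i : V ⊕ U) :
    M.hybrid S B a (M.obs1 S a B ω) (M.nonDesc S B a ω) (M.descErr B ω) i = M.po S a ω i := by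
  rw [hybrid_eq_po M a hBS, po_insert_of_eq M a hBS _ ω rfl]

/-- The errors of the strict descendants of `B` are independent of `B` and of the other
non-descendants. -/
theorem indepFun_descErr :
    IndepFun (fun ω => (M.obs1 S a B ω, M.nonDesc S B a ω)) (M.descErr B) M.P := by
  classical
  let F : M.Ω → ∀ i : ((strictDesc G B)ᶜ : Finset (V ⊕ U)), M.Err i := fun ω i => M.ε i ω
  have hind : IndepFun F (M.descErr B) M.P :=
    M.indep_ε.indepFun_finset _ _ disjoint_compl_left M.measurable_ε
  -- The parents of a vertex outside `strictDesc G B` are outside it as well, so induction along the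
  -- graph involves only the errors outside.
  have hm : ∀ i, i ∉ strictDesc G B → ∃ g : (∀ i : ((strictDesc G B)ᶜ : Finset (V ⊕ U)), M.Err i) →
      State X M.XU i, Measurable g ∧ ∀ ω, M.po S a ω i = g (F ω) := by
    intro i hi
    induction i using M.wf.induction with
    | _ i ih =>
      have hpar : ∀ j, G.Adj j i → j ∉ strictDesc G B := fun j hj hjD =>
        hi (mem_strictDesc.2 ((mem_strictDesc.1 hjD).tail hj))
      choose g hg hge using fun j : {j // G.Adj j i} => ih j j.2 (hpar j j.2)
      have hf : ∃ g : (∀ i : ((strictDesc G B)ᶜ : Finset (V ⊕ U)), M.Err i) → State X M.XU i,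
          Measurable g ∧ ∀ ω, M.f i (fun j => M.po S a ω j) (M.ε i ω) = g (F ω) := by
        refine ⟨fun x => M.f i (fun j => g j x) (x ⟨i, Finset.mem_compl.2 hi⟩), ?_, fun ω => ?_⟩
        · exact (M.measurable_f i).comp
            ((measurable_pi_lambda _ hg).prodMk (measurable_pi_apply _))
        · congr 1
          funext j
          exact hge j ω
      cases i with
      | inl v =>
        by_cases hv : v ∈ S
        · simp only [po_inl_of_mem _ _ hv]
          exact ⟨fun _ => a v, measurable_const, fun _ => rfl⟩
        · simp only [po_inl_of_notMem _ _ hv]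
          exact hf
      | inr k =>
        simp only [po_inr]
        exact hf
  -- Acyclicity lets `B` itself be computed from the errors outside its strict descendants.
  have hB : Sum.inl B ∉ strictDesc G B := fun h => M.acyclic _ (mem_strictDesc.1 h)
  obtain ⟨gB, hgB, hgBe⟩ := hm _ hB
  choose g hg hge using fun i : {i : V ⊕ U // i ∉ strictDesc G B ∧ i ≠ .inl B} => hm i i.2.1
  have e : (fun ω => (M.obs1 S a B ω, M.nonDesc S B a ω)) =
      (fun x => ((gB x, fun i => g i x) : X B × M.NonDesc B)) ∘ F :=
    funext fun ω => Prod.ext (hgBe ω) (funext fun i => hge i ω)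
  rw [e]
  exact hind.comp (ψ := id) (hgB.prodMk (measurable_pi_lambda _ hg)) measurable_id

end Hybrid

end CausalModel

end CausalLemmas

/-! ### Blocks of variables and their product measures -/

section Blocks

open scoped ENNReal

universe u

variable {ι : Type*} [DecidableEq ι] {X : ι → Type u} [∀ i, MeasurableSpace (X i)]

theorem measurable_glue {A A' C : Finset ι} (hC : C ⊆ A ∪ A') :
    Measurable fun p : Blk X A × Blk X A' => glue hC p.1 p.2 := by
  refine measurable_pi_lambda _ fun i => ?_
  by_cases h : (i : ι) ∈ A
  · simp only [glue, dif_pos h]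
    fun_prop
  · simp only [glue, dif_neg h]
    fun_prop

omit [∀ i, MeasurableSpace (X i)] in
theorem restrict₂_glue_left {A A' C : Finset ι} (hC : C ⊆ A ∪ A') (hA : A ⊆ C)
    (y : Blk X A) (y' : Blk X A') : Finset.restrict₂ (π := X) hA (glue hC y y') = y := by
  funext i
  simp [glue, Finset.restrict₂]

omit [∀ i, MeasurableSpace (X i)] in
theorem restrict₂_glue_right {A A' C : Finset ι} (hC : C ⊆ A ∪ A') (hA' : A' ⊆ C)
    (hd : Disjoint A A') (y : Blk X A) (y' : Blk X A') :
    Finset.restrict₂ (π := X) hA' (glue hC y y') = y' := by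
  funext i
  have h : (i : ι) ∉ A := Finset.disjoint_right.1 hd i.2
  simp [glue, Finset.restrict₂, h]

/-- A box in the block `C` pulls back to a product of two boxes, and its measure is a product over
the disjoint union of the index sets. -/
theorem measurePreserving_glue (μ : ∀ i, Measure (X i)) [∀ i, SigmaFinite (μ i)]
    {A A' C : Finset ι} (hC : C ⊆ A ∪ A') (hA : A ⊆ C) (hA' : A' ⊆ C) (hd : Disjoint A A') :
    MeasurePreserving (fun p : Blk X A × Blk X A' => glue hC p.1 p.2)
      ((refM μ A).prod (refM μ A')) (refM μ C) := by
  refine ⟨measurable_glue hC, (Measure.pi_eq fun s hs => ?_).symm⟩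
  rw [Measure.map_apply (measurable_glue hC) (MeasurableSet.univ_pi hs)]
  have hpre : (fun p : Blk X A × Blk X A' => glue hC p.1 p.2) ⁻¹' Set.univ.pi s =
      (Set.univ.pi fun i : A => s ⟨i, hA i.2⟩) ×ˢ (Set.univ.pi fun i : A' => s ⟨i, hA' i.2⟩) := by
    ext p
    simp only [Set.mem_preimage, Set.mem_univ_pi, Set.mem_prod]
    constructor
    · intro h
      refine ⟨fun i => ?_, fun i => ?_⟩
      · have := h ⟨i, hA i.2⟩
        simpa [glue] using this
      · have := h ⟨i, hA' i.2⟩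
        have hi : (i : ι) ∉ A := Finset.disjoint_right.1 hd i.2
        simpa [glue, hi] using this
    · rintro ⟨h1, h2⟩ i
      by_cases hi : (i : ι) ∈ A
      · simpa [glue, hi] using h1 ⟨i, hi⟩
      · simpa [glue, hi] using h2 ⟨i, (Finset.mem_union.1 (hC i.2)).resolve_left hi⟩
  rw [hpre, Measure.prod_prod, Measure.pi_pi, Measure.pi_pi]
  -- Extension to all of `ι`, so that products over three different subtypes become products over
  -- finsets of one type.
  let F : ι → ℝ≥0∞ := fun i => if h : i ∈ C then μ i (s ⟨i, h⟩) else 1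
  have e1 : ∏ i : A, μ i (s ⟨i, hA i.2⟩) = ∏ i ∈ A, F i := by
    rw [← Finset.prod_coe_sort A F]
    exact Finset.prod_congr rfl fun i _ => by simp [F, hA i.2]
  have e2 : ∏ i : A', μ i (s ⟨i, hA' i.2⟩) = ∏ i ∈ A', F i := by
    rw [← Finset.prod_coe_sort A' F]
    exact Finset.prod_congr rfl fun i _ => by simp [F, hA' i.2]
  have e3 : ∏ i : C, μ i (s i) = ∏ i ∈ C, F i := by
    rw [← Finset.prod_coe_sort C F]
    exact Finset.prod_congr rfl fun i _ => by simp [F]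
  rw [e1, e2, e3, ← Finset.prod_union hd]
  congr 1
  exact (hC.antisymm (Finset.union_subset hA hA')).symm

theorem measurePreserving_restrict₂_sdiff (μ : ∀ i, Measure (X i)) [∀ i, SigmaFinite (μ i)]
    {A C : Finset ι} (hA : A ⊆ C) :
    MeasurePreserving (fun y : Blk X C => ((Finset.restrict₂ (π := X) hA y : Blk X A),
      (Finset.restrict₂ (π := X) (Finset.sdiff_subset (s := C) (t := A)) y : Blk X (C \ A))))
      (refM μ C) ((refM μ A).prod (refM μ (C \ A))) := by
  have hC : C ⊆ A ∪ (C \ A) := by simp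
  have hm : Measurable (fun y : Blk X C => ((Finset.restrict₂ (π := X) hA y : Blk X A),
      (Finset.restrict₂ (π := X) (Finset.sdiff_subset (s := C) (t := A)) y : Blk X (C \ A)))) :=
    (Finset.measurable_restrict₂ hA).prodMk (Finset.measurable_restrict₂ _)
  refine ⟨hm, ?_⟩
  rw [← (measurePreserving_glue μ hC hA Finset.sdiff_subset Finset.disjoint_sdiff).map_eq,
    Measure.map_map hm (measurable_glue hC)]
  convert Measure.map_id
  ext1 p
  exact Prod.ext (restrict₂_glue_left hC hA _ _)
    (restrict₂_glue_right hC Finset.sdiff_subset Finset.disjoint_sdiff _ _)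

/-- Only null sets are respected, since the forgotten factor need not have mass one. Absolute
continuity needs no more. -/
theorem quasiMeasurePreserving_restrict₂ (μ : ∀ i, Measure (X i)) [∀ i, SigmaFinite (μ i)]
    {A C : Finset ι} (hA : A ⊆ C) :
    Measure.QuasiMeasurePreserving (Finset.restrict₂ (π := X) hA) (refM μ C) (refM μ A) :=
  QuasiMeasurePreserving.fst (measurePreserving_restrict₂_sdiff μ hA).quasiMeasurePreserving

/-- Splits off one block and leaves the remaining coordinates to `f`; iterated, it splits off
several disjoint blocks. -/
theorem quasiMeasurePreserving_restrict₂_prod (μ : ∀ i, Measure (X i)) [∀ i, SigmaFinite (μ i)]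
    {A C : Finset ι} (hA : A ⊆ C) {β : Type*} [MeasurableSpace β] {m : Measure β} [SFinite m]
    {f : Blk X (C \ A) → β} (hf : Measure.QuasiMeasurePreserving f (refM μ (C \ A)) m) :
    Measure.QuasiMeasurePreserving (fun y : Blk X C => ((Finset.restrict₂ (π := X) hA y : Blk X A),
      f (Finset.restrict₂ (π := X) (Finset.sdiff_subset (s := C) (t := A)) y)))
      (refM μ C) ((refM μ A).prod m) :=
  (QuasiMeasurePreserving.prodMap (Measure.QuasiMeasurePreserving.id _) hf).comp
    (measurePreserving_restrict₂_sdiff μ hA).quasiMeasurePreserving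

theorem quasiMeasurePreserving_apply_prod (μ : ∀ i, Measure (X i)) [∀ i, SigmaFinite (μ i)]
    {i : ι} {C : Finset ι} (hi : i ∈ C) {β : Type*} [MeasurableSpace β] {m : Measure β} [SFinite m]
    {f : Blk X (C \ {i}) → β} (hf : Measure.QuasiMeasurePreserving f (refM μ (C \ {i})) m) :
    Measure.QuasiMeasurePreserving (fun y : Blk X C => (y ⟨i, hi⟩,
      f (Finset.restrict₂ (π := X) (Finset.sdiff_subset (s := C) (t := {i})) y)))
      (refM μ C) ((μ i).prod m) := by
  have h1 : MeasurePreserving (fun y : Blk X {i} => y ⟨i, Finset.mem_singleton_self i⟩)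
      (refM μ {i}) (μ i) :=
    measurePreserving_piUnique (X := fun j : ({i} : Finset ι) => X j) fun j => μ j
  exact (QuasiMeasurePreserving.prodMap h1.quasiMeasurePreserving (Measure.QuasiMeasurePreserving.id m)).comp
    (quasiMeasurePreserving_restrict₂_prod μ (Finset.singleton_subset_iff.2 hi) hf)

end Blocks

/-! ### Change of measure to a fixed treatment value -/

section Swap

open scoped ENNReal

variable {Ω α β γ : Type*} [MeasurableSpace Ω] [MeasurableSpace α] [MeasurableSpace β]
  [MeasurableSpace γ] {P : Measure Ω} {Y : Ω → α} {T : Ω → β} {mY : Measure α} {mT : Measure β}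

theorem ac_of_quasiMeasurePreserving {m : Measure α} {m' : Measure β} (hY : Measurable Y)
    (h : P.map Y ≪ m) {f : α → β} (hf : Measure.QuasiMeasurePreserving f m m') :
    P.map (fun ω => f (Y ω)) ≪ m' := by
  have := h.map hf.measurable
  rw [Measure.map_map hf.measurable hY] at this
  exact this.trans hf.absolutelyContinuous

/-- The joint law lives where `p(t) ≠ 0`, and there `mT` may be exchanged for the law of `T`. After
that any measurable `g` can be pushed through without a reference measure on its range. -/
theorem ac_prod_map [IsFiniteMeasure P] [SigmaFinite mY] [SigmaFinite mT] (hY : Measurable Y)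
    (hT : Measurable T) (h : P.map (fun ω => (Y ω, T ω)) ≪ mY.prod mT) {g : β → γ}
    (hg : Measurable g) :
    P.map (fun ω => (Y ω, g (T ω))) ≪ mY.prod (P.map fun ω => g (T ω)) := by
  have hac := ac_snd hY hT h
  have h1 : P.map (fun ω => (Y ω, T ω)) ≪ mY.prod (P.map T) := by
    rw [map_eq_withDensity_dens hac, prod_withDensity_right (by fun_prop)]
    refine Measure.AbsolutelyContinuous.mk fun s hs h0 => ?_
    have h2 : ∀ᵐ z ∂mY.prod mT, ENNReal.ofReal (dens P T mT z.2) ≠ 0 → z ∉ s :=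
      (ae_withDensity_iff (by fun_prop)).1 (measure_eq_zero_iff_ae_notMem.1 h0)
    have h3 : ∀ᵐ t ∂P.map T, dens P T mT t ≠ 0 :=
      (ae_map_iff_dens hac).2 (Filter.Eventually.of_forall fun _ h => h)
    refine measure_eq_zero_iff_ae_notMem.2 ?_
    rw [ae_map_iff (by fun_prop) hs.compl]
    have h4 : ∀ᵐ ω ∂P, ENNReal.ofReal (dens P T mT (T ω)) ≠ 0 → (Y ω, T ω) ∉ s :=
      ae_of_ae_map (f := fun ω => (Y ω, T ω)) (by fun_prop) (h.ae_le h2)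
    filter_upwards [h4, ae_of_ae_map hT.aemeasurable h3] with ω h5 h6
    refine h5 ?_
    rw [ne_eq, ENNReal.ofReal_eq_zero, not_le]
    exact lt_of_le_of_ne (dens_nonneg _ _ _ _) (Ne.symm h6)
  have h2 := h1.map (f := Prod.map id g) (measurable_id.prodMap hg)
  rw [Measure.map_map (measurable_id.prodMap hg) (hY.prodMk hT),
    ← Measure.map_prod_map _ _ measurable_id hg, Measure.map_id, Measure.map_map hg hT] at h2
  exact h2

theorem lintegral_of_indepFun [IsProbabilityMeasure P] (hY : Measurable Y) (hT : Measurable T)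
    (hi : IndepFun Y T P) {F : α × β → ℝ≥0∞} (hF : Measurable F) :
    ∫⁻ ω, F (Y ω, T ω) ∂P = ∫⁻ t, ∫⁻ ω, F (Y ω, t) ∂P ∂P.map T := by
  have e := (indepFun_iff_map_prod_eq_prod_map_map hY.aemeasurable hT.aemeasurable).1 hi
  rw [← lintegral_map hF (hY.prodMk hT), e]
  have : IsProbabilityMeasure (P.map T) := Measure.isProbabilityMeasure_map hT.aemeasurable
  rw [lintegral_prod_symm' _ hF]
  refine lintegral_congr fun t => ?_
  rw [lintegral_map (by fun_prop) hY]

/-- Change of measure from a variable `Y` to a fixed value `y`, in the presence of a variable `E`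
that is independent of all others. -/
theorem lintegral_condDens_of_indepFun [IsProbabilityMeasure P] [SigmaFinite mY]
    {E : Ω → γ} (hY : Measurable Y) (hT : Measurable T) (hE : Measurable E)
    (h : P.map (fun ω => (Y ω, T ω)) ≪ mY.prod (P.map T))
    (hi : IndepFun (fun ω => (Y ω, T ω)) E P) {F : α × β × γ → ℝ≥0∞} (hF : Measurable F) :
    ∫⁻ ω, F (Y ω, T ω, E ω) ∂P =
      ∫⁻ y, ∫⁻ ω, F (y, T ω, E ω) * econdDens P Y T mY (P.map T) y (T ω) ∂P ∂mY := by
  have : IsProbabilityMeasure (P.map T) := Measure.isProbabilityMeasure_map hT.aemeasurable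
  have : IsProbabilityMeasure (P.map E) := Measure.isProbabilityMeasure_map hE.aemeasurable
  have hF' : Measurable fun x : (α × β) × γ => F (x.1.1, x.1.2, x.2) := by fun_prop
  have e1 := lintegral_of_indepFun (hY.prodMk hT) hE hi hF'
  have hi2 : IndepFun T E P := hi.comp measurable_snd measurable_id
  have hK : Measurable fun x : β × γ =>
      ∫⁻ y, F (y, x.1, x.2) * econdDens P Y T mY (P.map T) y x.1 ∂mY := by fun_prop
  have e2 := lintegral_of_indepFun hT hE hi2 hK
  simp only at e1 e2
  have e3 := lintegral_lintegral_swap (μ := P) (ν := mY) (f := fun ω y =>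
    F (y, T ω, E ω) * econdDens P Y T mY (P.map T) y (T ω)) (by fun_prop)
  rw [e1, ← e3, e2]
  refine lintegral_congr fun c => ?_
  exact lintegral_condDens (φ := fun y t => F (y, t, c)) hY hT h (by fun_prop)

end Swap

/-! ### Joint densities and ignorability in a causal model -/

section CausalLemmas

open scoped ENNReal

universe u

namespace EbfArgs

variable {V U : Type*} [DecidableEq V] (d : EbfArgs V) (G : Digraph (V ⊕ U))

omit [DecidableEq V] in
theorem B_notMem_S : d.B ∉ d.S := fun h => Finset.disjoint_left.1 d.disjoint_RS d.B_mem h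

theorem B_mem_compl [Fintype V] : d.B ∈ d.Sᶜ := Finset.mem_compl.2 d.B_notMem_S

open Classical in
theorem O_sub : d.O G ⊆ d.R := Finset.sdiff_subset.trans (Finset.filter_subset _ _)

theorem C_sub : d.C G ⊆ d.R := Finset.sdiff_subset

theorem Wt_sub : d.Wt G ⊆ d.W := Finset.sdiff_subset

theorem Zt_sub : d.Zt G ⊆ d.Z := Finset.sdiff_subset

theorem Ws_sub : d.Ws G ⊆ d.W := Finset.inter_subset_right

theorem Zs_sub : d.Zs G ⊆ d.Z := Finset.inter_subset_right

theorem R_sub_compl [Fintype V] : d.R ⊆ d.Sᶜ := fun _ hv =>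
  Finset.mem_compl.2 fun h => Finset.disjoint_left.1 d.disjoint_RS hv h

theorem notMem_de_of_mem_Wt {v : V} (hv : v ∈ d.Wt G) : v ∉ d.de G := by
  intro h
  simp only [Wt, Ws, Finset.mem_sdiff, Finset.mem_inter, not_and] at hv
  exact hv.2 h hv.1

theorem notMem_de_of_mem_Zt {v : V} (hv : v ∈ d.Zt G) : v ∉ d.de G := by
  intro h
  simp only [Zt, Zs, Finset.mem_sdiff, Finset.mem_inter, not_and] at hv
  exact hv.2 h hv.1

theorem notMem_de_of_mem_C {v : V} (hv : v ∈ d.C G) : v ∉ d.de G := by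
  intro h
  simp only [C, O, Finset.mem_sdiff, Finset.mem_union, Finset.mem_singleton] at hv
  tauto

theorem out_sub : d.out G ⊆ d.O G ∪ (d.Wt G ∪ (d.Zt G ∪ d.C G)) := by
  intro v hv
  simp only [out, O, Wt, Zt, C, Ws, Zs, Finset.mem_sdiff, Finset.mem_union, Finset.mem_inter,
    Finset.mem_singleton] at hv ⊢
  tauto

end EbfArgs

namespace CausalModel

variable {V U : Type*} [Fintype V] [DecidableEq V] [Fintype U] {G : Digraph (V ⊕ U)}
  {X : V → Type u} [∀ v, MeasurableSpace (X v)]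
  (M : CausalModel G X) (μ : ∀ v, Measure (X v)) [∀ v, SigmaFinite (μ v)] (d : EbfArgs V)
  (a : ∀ v, X v) (Us : Finset U)

/-- The joint law of all variables of the kernel operation is absolutely continuous. -/
theorem ac_obs_of_hasJointDensity (h : M.HasJointDensity μ d.S a) :
    M.P.map (fun ω => (M.lat d.S a Us ω, M.obs d.S a (d.O G) ω, M.obs d.S a d.W ω,
      M.obs d.S a d.Z ω, M.obs1 d.S a d.B ω, M.obs d.S a (d.C G) ω)) ≪
    (refM M.ν Us).prod ((refM μ (d.O G)).prod ((refM μ d.W).prod ((refM μ d.Z).prod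
      ((μ d.B).prod (refM μ (d.C G)))))) := by
  classical
  have hR := d.R_sub_compl
  have hO : d.O G ⊆ d.Sᶜ := (d.O_sub G).trans hR
  have hW : d.W ⊆ d.Sᶜ \ d.O G := by
    intro v hv
    simp only [EbfArgs.O, Finset.mem_sdiff, Finset.mem_union]
    exact ⟨hR (d.W_sub hv), by tauto⟩
  have hZ : d.Z ⊆ (d.Sᶜ \ d.O G) \ d.W := by
    intro v hv
    have := Finset.disjoint_right.1 d.disjoint_WZ hv
    simp only [EbfArgs.O, Finset.mem_sdiff, Finset.mem_union]
    exact ⟨⟨hR (d.Z_sub hv), by tauto⟩, this⟩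
  have hB : d.B ∈ ((d.Sᶜ \ d.O G) \ d.W) \ d.Z := by
    have h1 := d.B_notMem_W
    have h2 := d.B_notMem_Z
    have h3 := d.B_mem_compl
    simp only [EbfArgs.O, Finset.mem_sdiff, Finset.mem_union, Finset.mem_singleton]
    tauto
  have hC : d.C G ⊆ (((d.Sᶜ \ d.O G) \ d.W) \ d.Z) \ {d.B} := by
    intro v hv
    have h1 := hR (d.C_sub G hv)
    simp only [EbfArgs.C, Finset.mem_sdiff, Finset.mem_union, Finset.mem_singleton] at hv ⊢
    tauto
  -- The blocks `O`, `W`, `Z`, `B` are split off from `Sᶜ` one after another; the last restriction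
  -- forgets everything outside `R`.
  have q := quasiMeasurePreserving_restrict₂_prod μ hO
    (quasiMeasurePreserving_restrict₂_prod μ hW (quasiMeasurePreserving_restrict₂_prod μ hZ
      (quasiMeasurePreserving_apply_prod μ hB (quasiMeasurePreserving_restrict₂ μ hC))))
  have q' := (Measure.measurePreserving_swap.quasiMeasurePreserving).comp
    (QuasiMeasurePreserving.prodMap q (quasiMeasurePreserving_restrict₂ M.ν (Finset.subset_univ Us)))
  exact ac_of_quasiMeasurePreserving ((M.measurable_obs d.S a d.Sᶜ).prodMk
    (M.measurable_lat d.S a Finset.univ)) h q'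

/-- The value of the non-descendants as a function of all variables other than `B`. -/
def nonDescOf (S : Finset V) (B : V)
    (y : Blk X (Sᶜ \ {B}) × Blk M.XU Finset.univ) : M.NonDesc B
  | ⟨.inl v, h⟩ => if hv : v ∈ S then a v else
      y.1 ⟨v, by
        simp only [Finset.mem_sdiff, Finset.mem_compl, Finset.mem_singleton]
        exact ⟨hv, fun e => h.2 (e ▸ rfl)⟩⟩
  | ⟨.inr k, _⟩ => y.2 ⟨k, Finset.mem_univ k⟩

theorem measurable_nonDescOf (S : Finset V) (B : V) : Measurable (M.nonDescOf a S B) := by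
  refine measurable_pi_lambda _ fun i => ?_
  obtain ⟨i, h⟩ := i
  cases i with
  | inl v =>
    by_cases hv : v ∈ S
    · have e : (fun y => M.nonDescOf a S B y ⟨.inl v, h⟩) = fun _ => a v :=
        funext fun y => dif_pos hv
      rw [e]
      exact measurable_const
    · have hv' : v ∈ Sᶜ \ {B} := by
        simp only [Finset.mem_sdiff, Finset.mem_compl, Finset.mem_singleton]
        exact ⟨hv, fun e => h.2 (e ▸ rfl)⟩
      have e : (fun y => M.nonDescOf a S B y ⟨.inl v, h⟩) = fun y => y.1 ⟨v, hv'⟩ :=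
        funext fun y => dif_neg hv
      rw [e]
      exact (measurable_pi_apply (⟨v, hv'⟩ : (Sᶜ \ {B} : Finset V))).comp measurable_fst
  | inr k =>
    exact (measurable_pi_apply (⟨k, Finset.mem_univ k⟩ : (Finset.univ : Finset U))).comp
      measurable_snd

theorem nonDescOf_obs (S : Finset V) (B : V) (ω : M.Ω) :
    M.nonDescOf a S B (M.obs S a (Sᶜ \ {B}) ω, M.lat S a Finset.univ ω) = M.nonDesc S B a ω := by
  funext i
  obtain ⟨i, h⟩ := i
  cases i with
  | inl v =>
    by_cases hv : v ∈ S
    · exact (dif_pos hv).trans (M.po_inl_of_mem a hv ω).symm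
    · exact dif_neg hv
  | inr k => rfl

/-- The other non-descendants are a function of all variables except `B`, constant on `S`, so
`ac_prod_map` applies. Their own law serves as reference measure because some coordinates may be
constants. -/
theorem ac_nonDesc {S : Finset V} {B : V} (hB : B ∉ S) (h : M.HasJointDensity μ S a) :
    M.P.map (fun ω => (M.obs1 S a B ω, M.nonDesc S B a ω)) ≪
      (μ B).prod (M.P.map (M.nonDesc S B a)) := by
  have q := quasiMeasurePreserving_apply_prod μ (Finset.mem_compl.2 hB)
    (Measure.QuasiMeasurePreserving.id _)
  have q' := (measurePreserving_prodAssoc _ _ _).quasiMeasurePreserving.comp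
    (QuasiMeasurePreserving.prodMap q (Measure.QuasiMeasurePreserving.id (refM M.ν Finset.univ)))
  have hac := ac_of_quasiMeasurePreserving ((M.measurable_obs S a Sᶜ).prodMk
    (M.measurable_lat S a Finset.univ)) h q'
  have := ac_prod_map (M.measurable_obs1 S a B) ((M.measurable_obs S a (Sᶜ \ {B})).prodMk
    (M.measurable_lat S a Finset.univ)) hac (M.measurable_nonDescOf a S B)
  simpa only [nonDescOf_obs] using this

/-- The intervention on `B` has no effect on non-descendants. -/
theorem obs_insert_of_notMem_de {A : Finset V} (hA : A ⊆ d.R) (hde : ∀ v ∈ A, v ∉ d.de G)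
    (b : X d.B) : M.obs (insert d.B d.S) (Function.update a d.B b) A = M.obs d.S a A := by
  funext ω v
  refine M.po_insert_of_not_reachAvoiding a d.B_notMem_S b ω _ fun hr => hde v v.2 ?_
  simp only [EbfArgs.de, Finset.mem_filter]
  exact ⟨hA v.2, hr.cadmgDesc d.B_mem (hA v.2)⟩

variable [∀ v, StandardBorelSpace (X v)]

/-- The joint law of the outcomes, of the treatment and of the conditioning variables of
`Ignorability`, in terms of potential outcomes. -/
theorem lintegral_obs_eq_of_ignorability (hd : M.HasJointDensity μ d.S a)
    (hi : M.Ignorability d a Us)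
    {mT : Measure (Blk M.XU Us × Blk X (d.Wt G) × Blk X (d.Zt G) × Blk X (d.C G))} [SigmaFinite mT]
    (hac : M.P.map (fun ω => (M.obs1 d.S a d.B ω, (M.lat d.S a Us ω, M.obs d.S a (d.Wt G) ω,
      M.obs d.S a (d.Zt G) ω, M.obs d.S a (d.C G) ω))) ≪ (μ d.B).prod mT)
    {φ : X d.B × Blk X (d.O G) × Blk M.XU Us × Blk X (d.Wt G) × Blk X (d.Zt G) × Blk X (d.C G) →
      ℝ≥0∞} (hφ : Measurable φ) :
    ∫⁻ ω, φ (M.obs1 d.S a d.B ω, M.obs d.S a (d.O G) ω, M.lat d.S a Us ω,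
        M.obs d.S a (d.Wt G) ω, M.obs d.S a (d.Zt G) ω, M.obs d.S a (d.C G) ω) ∂M.P =
      ∫⁻ b, ∫⁻ ω, φ (b, M.obs (insert d.B d.S) (Function.update a d.B b) (d.O G) ω,
          M.lat d.S a Us ω, M.obs d.S a (d.Wt G) ω, M.obs d.S a (d.Zt G) ω,
          M.obs d.S a (d.C G) ω) *
        econdDens M.P (M.obs1 d.S a d.B) (fun ω => (M.lat d.S a Us ω, M.obs d.S a (d.Wt G) ω,
          M.obs d.S a (d.Zt G) ω, M.obs d.S a (d.C G) ω)) (μ d.B) mT b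
          (M.lat d.S a Us ω, M.obs d.S a (d.Wt G) ω, M.obs d.S a (d.Zt G) ω,
          M.obs d.S a (d.C G) ω) ∂M.P ∂μ d.B := by
  have hB := d.B_notMem_S
  have hmN := M.measurable_nonDesc d.S d.B a
  have hmE := M.measurable_descErr d.B
  have hmB := M.measurable_obs1 d.S a d.B
  have hmT : Measurable fun ω => (M.lat d.S a Us ω, M.obs d.S a (d.Wt G) ω,
      M.obs d.S a (d.Zt G) ω, M.obs d.S a (d.C G) ω) :=
    (M.measurable_lat d.S a Us).prodMk ((M.measurable_obs d.S a (d.Wt G)).prodMk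
      ((M.measurable_obs d.S a (d.Zt G)).prodMk (M.measurable_obs d.S a (d.C G))))
  let H : X d.B × M.NonDesc d.B × M.DescErr d.B → ∀ i : V ⊕ U, State X M.XU i := fun x =>
    M.hybrid d.S d.B a x.1 x.2.1 x.2.2
  have hH : ∀ i, Measurable fun x => H x i := M.measurable_hybrid d.S d.B a
  let gU : X d.B × M.NonDesc d.B × M.DescErr d.B → Blk M.XU Us := fun x k => H x (.inr k)
  have hgU : Measurable gU := measurable_pi_lambda _ fun k => hH (.inr k)
  let gA : ∀ A : Finset V, X d.B × M.NonDesc d.B × M.DescErr d.B → Blk X A :=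
    fun A x v => H x (.inl v)
  have hgA : ∀ A, Measurable (gA A) := fun A => measurable_pi_lambda _ fun v => hH (.inl v)
  let gO := gA (d.O G)
  have hgO : Measurable gO := hgA _
  -- The conditioning variables must depend on `b` here, because `U*` may contain descendants of
  -- `B`.
  let gT : X d.B × M.NonDesc d.B × M.DescErr d.B →
      Blk M.XU Us × Blk X (d.Wt G) × Blk X (d.Zt G) × Blk X (d.C G) := fun x =>
    (gU x, gA _ x, gA _ x, gA _ x)
  have hgT : Measurable gT := hgU.prodMk ((hgA _).prodMk ((hgA _).prodMk (hgA _)))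
  have hOb : ∀ b ω, M.obs (insert d.B d.S) (Function.update a d.B b) (d.O G) ω =
      gO (b, M.nonDesc d.S d.B a ω, M.descErr d.B ω) := fun b ω =>
    funext fun v => (M.hybrid_eq_po a hB b ω (.inl v)).symm
  have hTself : ∀ ω, (M.lat d.S a Us ω, M.obs d.S a (d.Wt G) ω,
      M.obs d.S a (d.Zt G) ω, M.obs d.S a (d.C G) ω) =
      gT (M.obs1 d.S a d.B ω, M.nonDesc d.S d.B a ω, M.descErr d.B ω) := fun ω =>
    Prod.ext (funext fun k => (M.hybrid_self a hB ω (.inr k)).symm)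
      (Prod.ext (funext fun v => (M.hybrid_self a hB ω (.inl v)).symm)
        (Prod.ext (funext fun v => (M.hybrid_self a hB ω (.inl v)).symm)
          (funext fun v => (M.hybrid_self a hB ω (.inl v)).symm)))
  have hOself : ∀ ω, M.obs d.S a (d.O G) ω =
      gO (M.obs1 d.S a d.B ω, M.nonDesc d.S d.B a ω, M.descErr d.B ω) := fun ω =>
    funext fun v => (M.hybrid_self a hB ω (.inl v)).symm
  have hac' := M.ac_nonDesc μ a hB hd
  have hind := M.indepFun_descErr (S := d.S) (B := d.B) a
  have : IsProbabilityMeasure (M.P.map (M.nonDesc d.S d.B a)) :=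
    Measure.isProbabilityMeasure_map hmN.aemeasurable
  -- One change of measure serves twice: with the outcome frozen at `b₀` it gives the off-diagonal
  -- identity, with the outcome following `B` it gives the diagonal one.
  refine lintegral_of_ignorability
    (Ob := fun b ω => M.obs (insert d.B d.S) (Function.update a d.B b) (d.O G) ω)
    (Tb := fun b ω => gT (b, M.nonDesc d.S d.B a ω, M.descErr d.B ω))
    (ρ := fun b ω => econdDens M.P (M.obs1 d.S a d.B) (M.nonDesc d.S d.B a) (μ d.B)
      (M.P.map (M.nonDesc d.S d.B a)) b (M.nonDesc d.S d.B a ω))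
    hmB hmT ?_ ?_ ?_ hac (fun b₀ φ hφ => ?_) (fun φ hφ => ?_) hi hφ
  · have : (Function.uncurry fun b ω =>
        M.obs (insert d.B d.S) (Function.update a d.B b) (d.O G) ω) =
        fun x : X d.B × M.Ω => gO (x.1, M.nonDesc d.S d.B a x.2, M.descErr d.B x.2) :=
      funext fun x => hOb x.1 x.2
    rw [this]
    fun_prop
  · simp only [Function.uncurry_def]
    fun_prop
  · simp only [Function.uncurry_def]
    fun_prop
  · have := lintegral_condDens_of_indepFun hmB hmN hmE hac' hind
      (F := fun x => φ (x.1, gO (b₀, x.2.1, x.2.2), gT x)) (by fun_prop)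
    simpa only [hOb, hTself] using this
  · have := lintegral_condDens_of_indepFun hmB hmN hmE hac' hind
      (F := fun x => φ (x.1, gO x, gT x)) (by fun_prop)
    simpa only [hOb, hTself, hOself] using this

end CausalModel

end CausalLemmas

/-! ### Fubini for mixtures over the latent variables -/

section Fubini

open scoped ENNReal

variable {Ω α β γ δ : Type*} [MeasurableSpace Ω] [MeasurableSpace α] [MeasurableSpace β]
  [MeasurableSpace γ] [MeasurableSpace δ]
  {P : Measure Ω} {Y : Ω → α} {T : Ω → β} {mY : Measure α} {mT : Measure β}

theorem ae_prod_map_iff_dens [IsFiniteMeasure P] [SigmaFinite mY] [SigmaFinite mT]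
    (h : P.map T ≪ mT) {p : α × β → Prop} :
    (∀ᵐ z ∂mY.prod (P.map T), p z) ↔ ∀ᵐ z ∂mY.prod mT, dens P T mT z.2 ≠ 0 → p z := by
  rw [map_eq_withDensity_dens h, prod_withDensity_right (by fun_prop),
    ae_withDensity_iff (by fun_prop)]
  refine Filter.eventually_congr (Filter.Eventually.of_forall fun z => ?_)
  have := dens_nonneg P T mT z.2
  simp only [ne_eq, ENNReal.ofReal_eq_zero, not_le]
  exact ⟨fun h h' => h (lt_of_le_of_ne this (Ne.symm h')), fun h h' => h h'.ne'⟩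

/-- Uniqueness of conditional densities. -/
theorem ae_eq_of_lintegral_lintegral_eq [IsFiniteMeasure P] [SigmaFinite mY] (hT : Measurable T)
    {f g : α → β → ℝ≥0∞} (hf : Measurable (Function.uncurry f)) (hg : Measurable (Function.uncurry g))
    (h : ∀ φ : α → β → ℝ≥0∞, Measurable (Function.uncurry φ) →
      ∫⁻ ω, ∫⁻ y, φ y (T ω) * f y (T ω) ∂mY ∂P = ∫⁻ ω, ∫⁻ y, φ y (T ω) * g y (T ω) ∂mY ∂P) :
    ∀ᵐ z ∂mY.prod (P.map T), f z.1 z.2 = g z.1 z.2 := by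
  have : IsFiniteMeasure (P.map T) := inferInstance
  refine eq_of_withDensity_lintegral_eq (f := fun z : α × β => f z.1 z.2)
    (g := fun z : α × β => g z.1 z.2)
    hf hg fun φ hφ => ?_
  rw [lintegral_prod_symm' _ (by fun_prop), lintegral_prod_symm' _ (by fun_prop),
    lintegral_map (by fun_prop) hT, lintegral_map (by fun_prop) hT]
  exact h (fun y t => φ (y, t)) hφ

/-- `ac_prod_map` on each side. Completeness yields statements for almost all `(b, x)` and then
almost all `u`, separately; this carries them over to the joint law. -/
theorem ac_prod_self [IsFiniteMeasure P] [SigmaFinite mY] [SigmaFinite mT] (hY : Measurable Y)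
    (hT : Measurable T) (h : P.map (fun ω => (Y ω, T ω)) ≪ mY.prod mT) :
    P.map (fun ω => (Y ω, T ω)) ≪ (P.map Y).prod (P.map T) := by
  have h1 := ac_prod_map hY hT h measurable_id
  have h2 := ac_of_quasiMeasurePreserving (hY.prodMk hT) h1
    Measure.measurePreserving_swap.quasiMeasurePreserving
  have h3 := ac_prod_map hT hY h2 measurable_id
  exact ac_of_quasiMeasurePreserving (hT.prodMk hY) h3
    Measure.measurePreserving_swap.quasiMeasurePreserving

theorem ae_ae_swap_of_ae_prod [SFinite mY] [SFinite mT] {p : α × β → Prop}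
    (h : ∀ᵐ z ∂mY.prod mT, p z) : ∀ᵐ t ∂mT, ∀ᵐ y ∂mY, p (y, t) :=
  Measure.ae_ae_of_ae_prod
    ((Measure.measurePreserving_swap (μ := mT) (ν := mY)).quasiMeasurePreserving.ae h)

theorem quasiMeasurePreserving_insert_middle (ma : Measure α) (mb : Measure β) (mc : Measure γ)
    [SFinite ma] [SFinite mb] [SFinite mc] :
    Measure.QuasiMeasurePreserving (fun z : (α × γ) × β => (z.1.1, z.2, z.1.2))
      ((ma.prod mc).prod mb) (ma.prod (mb.prod mc)) :=
  (QuasiMeasurePreserving.prodMap (Measure.QuasiMeasurePreserving.id ma)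
    (Measure.measurePreserving_swap (μ := mc) (ν := mb)).quasiMeasurePreserving).comp
    (measurePreserving_prodAssoc ma mc mb).quasiMeasurePreserving

/-- Fubini's theorem for a signed function `h` and a mixture `D = ∫ b(·, u) l(u) du`. -/
theorem integral_mixture {m₁ : Measure α} {m₂ : Measure β} {mU : Measure γ} [SigmaFinite m₁]
    [SigmaFinite m₂] [SigmaFinite mU] {h : α → β → ℝ} (hh : Measurable (Function.uncurry h))
    {b : β → γ → ℝ} (hb : Measurable (Function.uncurry b)) (hb0 : ∀ r u, 0 ≤ b r u)
    {l : γ → ℝ} (hl : Measurable l) (hl0 : ∀ u, 0 ≤ l u) {D : β → ℝ} (hD0 : ∀ r, 0 ≤ D r)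
    (hD : ∀ᵐ r ∂m₂, ENNReal.ofReal (D r) = ∫⁻ u, ENNReal.ofReal (b r u) * ENNReal.ofReal (l u) ∂mU)
    (hint : Integrable (fun r : α × β => h r.1 r.2 * D r.2) (m₁.prod m₂)) :
    Integrable (fun u => (∫ r₁, ∫ r₂, h r₁ r₂ * b r₂ u ∂m₂ ∂m₁) * l u) mU ∧
      ∫ u, (∫ r₁, ∫ r₂, h r₁ r₂ * b r₂ u ∂m₂ ∂m₁) * l u ∂mU =
        ∫ r₁, ∫ r₂, h r₁ r₂ * D r₂ ∂m₂ ∂m₁ := by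
  have hD' : ∀ᵐ r ∂m₁.prod m₂,
      ENNReal.ofReal (D r.2) = ∫⁻ u, ENNReal.ofReal (b r.2 u) * ENNReal.ofReal (l u) ∂mU :=
    Measure.quasiMeasurePreserving_snd.ae hD
  have hF : Measurable fun z : (α × β) × γ => h z.1.1 z.1.2 * (b z.1.2 z.2 * l z.2) := by fun_prop
  -- Since `b` and `l` are nonnegative, integrating the absolute value over `u` first gives `|h| D`,
  -- so `hint` already is integrability of the full integrand.
  have hFi : Integrable (fun z : (α × β) × γ => h z.1.1 z.1.2 * (b z.1.2 z.2 * l z.2))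
      ((m₁.prod m₂).prod mU) := by
    refine ⟨hF.aestronglyMeasurable, ?_⟩
    rw [HasFiniteIntegral, lintegral_prod _ hF.enorm.aemeasurable]
    refine lt_of_le_of_lt (le_of_eq (lintegral_congr_ae ?_)) hint.2
    filter_upwards [hD'] with r hr
    rw [enorm_mul, Real.enorm_of_nonneg (hD0 _), hr, ← lintegral_const_mul _ (by fun_prop)]
    refine lintegral_congr fun u => ?_
    rw [enorm_mul, Real.enorm_of_nonneg (mul_nonneg (hb0 _ _) (hl0 _)),
      ENNReal.ofReal_mul (hb0 _ _)]
  -- Integrability of `h b` alone follows by dividing by `l u`; where `l u = 0` both sides vanish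
  -- and it is not needed.
  have e1 : ∀ᵐ u ∂mU, ∫ r, h r.1 r.2 * (b r.2 u * l u) ∂m₁.prod m₂ =
      (∫ r₁, ∫ r₂, h r₁ r₂ * b r₂ u ∂m₂ ∂m₁) * l u := by
    filter_upwards [hFi.prod_left_ae] with u hu
    by_cases h0 : l u = 0
    · simp [h0]
    · have hi : Integrable (fun r : α × β => h r.1 r.2 * b r.2 u) (m₁.prod m₂) := by
        have := hu.mul_const (l u)⁻¹
        refine this.congr (Filter.Eventually.of_forall fun r => ?_)
        simp only
        field_simp
      rw [← integral_prod _ hi, ← integral_mul_const]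
      refine integral_congr_ae (Filter.Eventually.of_forall fun r => ?_)
      simp only
      ring
  have e2 : ∀ᵐ r ∂m₁.prod m₂, ∫ u, h r.1 r.2 * (b r.2 u * l u) ∂mU = h r.1 r.2 * D r.2 := by
    filter_upwards [hD'] with r hr
    rw [integral_const_mul]
    congr 1
    rw [integral_eq_lintegral_of_nonneg_ae
      (Filter.Eventually.of_forall fun u => mul_nonneg (hb0 _ _) (hl0 _)) (by fun_prop)]
    simp_rw [ENNReal.ofReal_mul (hb0 _ _)]
    rw [← hr, ENNReal.toReal_ofReal (hD0 _)]
  refine ⟨hFi.integral_prod_right.congr e1, ?_⟩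
  rw [← integral_congr_ae e1, ← integral_prod_symm _ hFi, integral_prod _ hFi,
    integral_congr_ae e2, integral_prod _ hint]

/-- Where `l` does not vanish the signed sum equals `A ≥ 0`, so the mixture is nonnegative. This is
why the `ENNReal.ofReal` in the identifying formulas truncates nothing. -/
theorem lintegral_eq_ofReal_integral_mixture {m₁ : Measure α} {m₂ : Measure β} {mU : Measure γ}
    [SigmaFinite m₁] [SigmaFinite m₂] [SigmaFinite mU] {h : α → β → ℝ}
    (hh : Measurable (Function.uncurry h))
    {b : β → γ → ℝ} (hb : Measurable (Function.uncurry b)) (hb0 : ∀ r u, 0 ≤ b r u)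
    {l : γ → ℝ} (hl : Measurable l) (hl0 : ∀ u, 0 ≤ l u) {D : β → ℝ} (hD0 : ∀ r, 0 ≤ D r)
    (hD : ∀ᵐ r ∂m₂, ENNReal.ofReal (D r) = ∫⁻ u, ENNReal.ofReal (b r u) * ENNReal.ofReal (l u) ∂mU)
    (hint : Integrable (fun r : α × β => h r.1 r.2 * D r.2) (m₁.prod m₂))
    {A : γ → ℝ} (hA0 : ∀ u, 0 ≤ A u)
    (hA : ∀ᵐ u ∂mU, l u ≠ 0 → A u - ∫ r₁, ∫ r₂, h r₁ r₂ * b r₂ u ∂m₂ ∂m₁ = 0) :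
    ∫⁻ u, ENNReal.ofReal (A u) * ENNReal.ofReal (l u) ∂mU =
      ENNReal.ofReal (∫ r₁, ∫ r₂, h r₁ r₂ * D r₂ ∂m₂ ∂m₁) := by
  obtain ⟨h1, h2⟩ := integral_mixture hh hb hb0 hl hl0 hD0 hD hint
  have e : ∀ᵐ u ∂mU, (∫ r₁, ∫ r₂, h r₁ r₂ * b r₂ u ∂m₂ ∂m₁) * l u = A u * l u := by
    filter_upwards [hA] with u hu
    by_cases h0 : l u = 0
    · simp [h0]
    · rw [sub_eq_zero.1 (hu h0)]
  rw [← h2, integral_congr_ae e, ofReal_integral_eq_lintegral_ofReal (h1.congr e)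
    (Filter.Eventually.of_forall fun u => mul_nonneg (hA0 u) (hl0 u))]
  exact lintegral_congr fun u => (ENNReal.ofReal_mul (hA0 u)).symm

end Fubini

/-! ### Completeness forces the residual to vanish -/

section Residual

open scoped ENNReal

variable {Ω 𝓨 𝓑 𝓧 𝓚 𝓤 α β : Type*} [MeasurableSpace Ω] [MeasurableSpace 𝓨] [MeasurableSpace 𝓑]
  [MeasurableSpace 𝓧] [MeasurableSpace 𝓚] [MeasurableSpace 𝓤] [MeasurableSpace α]
  [MeasurableSpace β] {P : Measure Ω} [IsProbabilityMeasure P]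

/-- The residual `A - ∑ ∑ h b` of a bridge function. -/
noncomputable def bridgeResidual (m₁ : Measure α) (m₂ : Measure β) (A : 𝓨 → 𝓑 × 𝓧 → 𝓤 → ℝ)
    (h : 𝓨 → 𝓑 × 𝓧 → α → β → ℝ) (b : β → 𝓑 × 𝓧 → 𝓤 → ℝ) (y : 𝓨) (t : 𝓑 × 𝓧) (u : 𝓤) : ℝ :=
  A y t u - ∫ r₁, ∫ r₂, h y t r₁ r₂ * b r₂ t u ∂m₂ ∂m₁

theorem measurable_bridgeResidual {m₁ : Measure α} {m₂ : Measure β} [SigmaFinite m₁]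
    [SigmaFinite m₂] {A : 𝓨 → 𝓑 × 𝓧 → 𝓤 → ℝ}
    {h : 𝓨 → 𝓑 × 𝓧 → α → β → ℝ} {b : β → 𝓑 × 𝓧 → 𝓤 → ℝ}
    (hA : Measurable fun z : 𝓨 × (𝓑 × 𝓧) × 𝓤 => A z.1 z.2.1 z.2.2)
    (hh : Measurable fun z : 𝓨 × (𝓑 × 𝓧) × α × β => h z.1 z.2.1 z.2.2.1 z.2.2.2)
    (hb : Measurable fun z : β × (𝓑 × 𝓧) × 𝓤 => b z.1 z.2.1 z.2.2) :
    Measurable fun z : 𝓨 × (𝓑 × 𝓧) × 𝓤 => bridgeResidual m₁ m₂ A h b z.1 z.2.1 z.2.2 := by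
  refine hA.sub ?_
  have h1 : Measurable fun z : ((𝓨 × (𝓑 × 𝓧) × 𝓤) × α) × β =>
      h z.1.1.1 z.1.1.2.1 z.1.2 z.2 * b z.2 z.1.1.2.1 z.1.1.2.2 :=
    (hh.comp (f := fun z : ((𝓨 × (𝓑 × 𝓧) × 𝓤) × α) × β => (z.1.1.1, z.1.1.2.1, z.1.2, z.2))
      (by fun_prop)).mul
    (hb.comp (f := fun z : ((𝓨 × (𝓑 × 𝓧) × 𝓤) × α) × β => (z.2, z.1.1.2.1, z.1.1.2.2))
      (by fun_prop))
  have h2 := (h1.stronglyMeasurable.integral_prod_right' (ν := m₂))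
  exact (h2.integral_prod_right' (ν := m₁)).measurable

/-- By completeness the residual of a bridge function vanishes. -/
theorem ae_bridgeResidual_eq_zero {m₁ : Measure α} {m₂ : Measure β} {mY : Measure 𝓨}
    {mB : Measure 𝓑} {mX : Measure 𝓧} {mK : Measure 𝓚} {mU : Measure 𝓤} [SigmaFinite m₁]
    [SigmaFinite m₂] [SigmaFinite mY] [SigmaFinite mB] [SigmaFinite mX] [SigmaFinite mK]
    [SigmaFinite mU] {B : Ω → 𝓑} {X : Ω → 𝓧} {K : Ω → 𝓚} {U : Ω → 𝓤}
    (hBXac : P.map (fun ω => (B ω, X ω)) ≪ mB.prod mX)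
    (hBKXac : P.map (fun ω => (B ω, K ω, X ω)) ≪ mB.prod (mK.prod mX))
    (hKac : P.map K ≪ mK)
    {A : 𝓨 → 𝓑 × 𝓧 → 𝓤 → ℝ} {h : 𝓨 → 𝓑 × 𝓧 → α → β → ℝ} {b : β → 𝓑 × 𝓧 → 𝓤 → ℝ}
    (hA : Measurable fun z : 𝓨 × (𝓑 × 𝓧) × 𝓤 => A z.1 z.2.1 z.2.2)
    (hh : Measurable fun z : 𝓨 × (𝓑 × 𝓧) × α × β => h z.1 z.2.1 z.2.2.1 z.2.2.2)
    (hb : Measurable fun z : β × (𝓑 × 𝓧) × 𝓤 => b z.1 z.2.1 z.2.2)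
    (hA0 : ∀ y t u, 0 ≤ A y t u) (hb0 : ∀ r t u, 0 ≤ b r t u)
    {D : β → 𝓚 → 𝓑 × 𝓧 → ℝ} (hD0 : ∀ r k t, 0 ≤ D r k t)
    (hD : ∀ᵐ z ∂m₂.prod (P.map fun ω => (B ω, K ω, X ω)),
      ENNReal.ofReal (D z.1 z.2.2.1 (z.2.1, z.2.2.2)) =
        ∫⁻ u, ENNReal.ofReal (b z.1 (z.2.1, z.2.2.2) u) *
          econdDens P U (fun ω => (B ω, K ω, X ω)) mU (mB.prod (mK.prod mX)) u z.2 ∂mU)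
    {L : 𝓨 → 𝓚 → 𝓑 × 𝓧 → ℝ} (hL0 : ∀ y k t, 0 ≤ L y k t)
    (hL : ∀ᵐ z ∂mY.prod (P.map fun ω => (B ω, K ω, X ω)),
      ENNReal.ofReal (L z.1 z.2.2.1 (z.2.1, z.2.2.2)) =
        ∫⁻ u, ENNReal.ofReal (A z.1 (z.2.1, z.2.2.2) u) *
          econdDens P U (fun ω => (B ω, K ω, X ω)) mU (mB.prod (mK.prod mX)) u z.2 ∂mU)
    (hbridge : ∀ᵐ z ∂mY.prod (mB.prod mX), ∀ᵐ k ∂mK,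
      Integrable (fun r : α × β => h z.1 z.2 r.1 r.2 * D r.2 k z.2) (m₁.prod m₂) ∧
      ∫ r₁, ∫ r₂, h z.1 z.2 r₁ r₂ * D r₂ k z.2 ∂m₂ ∂m₁ = L z.1 k z.2)
    (hLp : ∀ᵐ z ∂mY.prod (mB.prod mX),
      MemLp (bridgeResidual m₁ m₂ A h b z.1 z.2) 2 (P.map U))
    (hcomp : ∀ᵐ t ∂P.map (fun ω => (B ω, X ω)), ∀ g : 𝓤 → ℝ, Measurable g → MemLp g 2 (P.map U) →
      (∀ᵐ k ∂P.map K, Integrable (fun u => g u * condDens P U (fun ω => (B ω, K ω, X ω)) mU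
        (mB.prod (mK.prod mX)) u (t.1, k, t.2)) mU) →
      ((∀ᵐ k ∂P.map K, ∫ u, g u * condDens P U (fun ω => (B ω, K ω, X ω)) mU
        (mB.prod (mK.prod mX)) u (t.1, k, t.2) ∂mU = 0) ↔ ∀ᵐ u ∂P.map U, g u = 0)) :
    ∀ᵐ t ∂P.map (fun ω => (B ω, X ω)), ∀ᵐ y ∂mY, ∀ᵐ u ∂P.map U,
      bridgeResidual m₁ m₂ A h b y t u = 0 := by
  have hR := measurable_bridgeResidual (m₁ := m₁) (m₂ := m₂) hA hh hb
  rw [ae_prod_map_iff_dens hBKXac] at hD hL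
  have q := quasiMeasurePreserving_insert_middle mB mK mX
  have hD1 : ∀ᵐ t ∂mB.prod mX, ∀ᵐ k ∂mK, ∀ᵐ r ∂m₂, _ :=
    Measure.ae_ae_of_ae_prod (q.ae (ae_ae_swap_of_ae_prod hD))
  have q2 : Measure.QuasiMeasurePreserving
      (fun z : (𝓨 × 𝓑 × 𝓧) × 𝓚 => (z.1.1, (z.1.2.1, z.2, z.1.2.2)))
      ((mY.prod (mB.prod mX)).prod mK) (mY.prod (mB.prod (mK.prod mX))) :=
    (QuasiMeasurePreserving.prodMap (Measure.QuasiMeasurePreserving.id mY) q).comp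
      (measurePreserving_prodAssoc mY (mB.prod mX) mK).quasiMeasurePreserving
  have hL1 := Measure.ae_ae_of_ae_prod (q2.ae hL)
  have hD2 : ∀ᵐ z ∂mY.prod (mB.prod mX), _ := Measure.quasiMeasurePreserving_snd.ae hD1
  -- Against `p(u|b,k,x)` the term `A` integrates to `L` by `hL`, and the double sum integrates to
  -- `∑∑ h D`, which is `L` by the bridge equation. For outcome bridges `K` is `Z`, for treatment
  -- bridges `K` is `W`.
  have key : ∀ᵐ z ∂mY.prod (mB.prod mX), MemLp (bridgeResidual m₁ m₂ A h b z.1 z.2) 2 (P.map U) ∧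
      ∀ᵐ k ∂mK, Integrable (fun u => bridgeResidual m₁ m₂ A h b z.1 z.2 u *
        condDens P U (fun ω => (B ω, K ω, X ω)) mU (mB.prod (mK.prod mX)) u
          (z.2.1, k, z.2.2)) mU ∧
      ∫ u, bridgeResidual m₁ m₂ A h b z.1 z.2 u *
        condDens P U (fun ω => (B ω, K ω, X ω)) mU (mB.prod (mK.prod mX)) u
          (z.2.1, k, z.2.2) ∂mU = 0 := by
    filter_upwards [hbridge, hLp, hD2, hL1] with z hz hzLp hzD hzL
    refine ⟨hzLp, ?_⟩
    filter_upwards [hz, hzD, hzL] with k hk hkD hkL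
    set l : 𝓤 → ℝ := fun u => condDens P U (fun ω => (B ω, K ω, X ω)) mU
      (mB.prod (mK.prod mX)) u (z.2.1, k, z.2.2) with hl
    have hlm : Measurable l := by fun_prop
    have hl0 : ∀ u, 0 ≤ l u := fun u => condDens_nonneg _ _ _ _ _ _ _
    -- Where the conditioning density vanishes, `condDens` is `0` by convention and there is nothing
    -- to show.
    by_cases h0 : dens P (fun ω => (B ω, K ω, X ω)) (mB.prod (mK.prod mX)) (z.2.1, k, z.2.2) = 0
    · have : (fun u => bridgeResidual m₁ m₂ A h b z.1 z.2 u * l u) = fun _ => 0 :=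
        funext fun u => mul_eq_zero_of_right _ (condDens_eq_zero _ _ _ _ _ h0 u)
      rw [this]
      simp
    have hkL := hkL h0
    have hkD : ∀ᵐ r ∂m₂, ENNReal.ofReal (D r k z.2) =
        ∫⁻ u, ENNReal.ofReal (b r z.2 u) * ENNReal.ofReal (l u) ∂mU := by
      filter_upwards [hkD] with r hr using hr h0
    have hhz : Measurable (Function.uncurry (h z.1 z.2)) :=
      hh.comp (f := fun r : α × β => (z.1, z.2, r.1, r.2)) (by fun_prop)
    have hbz : Measurable (Function.uncurry fun r u => b r z.2 u) :=
      hb.comp (f := fun r : β × 𝓤 => (r.1, z.2, r.2)) (by fun_prop)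
    have hAz : Measurable fun u => A z.1 z.2 u :=
      hA.comp (f := fun u : 𝓤 => (z.1, z.2, u)) (by fun_prop)
    obtain ⟨i1, i2⟩ := integral_mixture hhz hbz (fun r u => hb0 r z.2 u) hlm hl0
      (fun r => hD0 r k z.2) hkD hk.1
    have hAl : Integrable (fun u => A z.1 z.2 u * l u) mU := by
      refine ⟨by fun_prop, ?_⟩
      rw [HasFiniteIntegral]
      refine lt_of_le_of_lt (le_of_eq ?_) (ENNReal.ofReal_lt_top (r := L z.1 k z.2))
      rw [hkL]
      refine lintegral_congr fun u => ?_
      rw [Real.enorm_of_nonneg (mul_nonneg (hA0 _ _ _) (hl0 _)), ENNReal.ofReal_mul (hA0 _ _ _)]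
      rfl
    have hAi : ∫ u, A z.1 z.2 u * l u ∂mU = L z.1 k z.2 := by
      rw [integral_eq_lintegral_of_nonneg_ae
        (Filter.Eventually.of_forall fun u => mul_nonneg (hA0 _ _ _) (hl0 _)) hAl.1]
      simp_rw [ENNReal.ofReal_mul (hA0 _ _ _)]
      exact (congrArg ENNReal.toReal hkL.symm).trans (ENNReal.toReal_ofReal (hL0 _ _ _))
    have hsub : (fun u => bridgeResidual m₁ m₂ A h b z.1 z.2 u * l u) = fun u =>
        A z.1 z.2 u * l u - (∫ r₁, ∫ r₂, h z.1 z.2 r₁ r₂ * b r₂ z.2 u ∂m₂ ∂m₁) * l u :=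
      funext fun u => sub_mul _ _ _
    constructor
    · rw [hsub]
      exact hAl.sub i1
    · rw [hsub, integral_sub hAl i1, hAi, i2, hk.2, sub_self]
  -- Completeness fixes `(b, x)` outside a null set of its law and only then ranges over test
  -- functions, so `(b, x)` has to be quantified before `y`.
  have key' := hBXac.ae_le (ae_ae_swap_of_ae_prod key)
  filter_upwards [hcomp, key'] with t ht ht'
  filter_upwards [ht'] with y hy
  have hg : Measurable (bridgeResidual m₁ m₂ A h b y t) :=
    hR.comp (f := fun u : 𝓤 => (y, t, u)) (by fun_prop)
  refine (ht _ hg hy.1 ?_).1 ?_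
  · filter_upwards [hKac.ae_le hy.2] with k hk using hk.1
  · filter_upwards [hKac.ae_le hy.2] with k hk using hk.2

/-- Joint form of the vanishing of a residual. -/
theorem ae_prod_of_ae_ae_ae {mY : Measure 𝓨} [SigmaFinite mY] {ν : Measure (𝓑 × 𝓧)} {ρ : Measure 𝓤}
    [SFinite ν] [SFinite ρ] {R : 𝓨 → 𝓑 × 𝓧 → 𝓤 → ℝ}
    (hR : Measurable fun z : 𝓨 × (𝓑 × 𝓧) × 𝓤 => R z.1 z.2.1 z.2.2)
    (h : ∀ᵐ t ∂ν, ∀ᵐ y ∂mY, ∀ᵐ u ∂ρ, R y t u = 0) :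
    ∀ᵐ z ∂mY.prod (ν.prod ρ), R z.1 z.2.1 z.2.2 = 0 := by
  have h1 : ∀ᵐ t ∂ν, ∀ᵐ z ∂mY.prod ρ, R z.1 t z.2 = 0 := by
    filter_upwards [h] with t ht
    refine (Measure.ae_prod_iff_ae_ae ?_).2 ht
    exact hR.comp (f := fun z : 𝓨 × 𝓤 => (z.1, t, z.2)) (by fun_prop) (measurableSet_singleton 0)
  have h2 : ∀ᵐ z ∂ν.prod (mY.prod ρ), R z.2.1 z.1 z.2.2 = 0 := by
    refine (Measure.ae_prod_iff_ae_ae ?_).2 h1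
    exact hR.comp (f := fun z : (𝓑 × 𝓧) × 𝓨 × 𝓤 => (z.2.1, z.1, z.2.2)) (by fun_prop)
      (measurableSet_singleton 0)
  have q : Measure.QuasiMeasurePreserving (fun z : 𝓨 × (𝓑 × 𝓧) × 𝓤 => (z.2.1, z.1, z.2.2))
      (mY.prod (ν.prod ρ)) (ν.prod (mY.prod ρ)) :=
    (quasiMeasurePreserving_insert_middle ν mY ρ).comp
      (Measure.measurePreserving_swap (μ := mY) (ν := ν.prod ρ)).quasiMeasurePreserving
  exact q.ae h2

end Residual

/-! ### Positivity, inverse weighting and mixture representations -/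

section Mixtures

open scoped ENNReal

variable {Ω α β γ δ : Type*} [MeasurableSpace Ω] [MeasurableSpace α] [MeasurableSpace β]
  [MeasurableSpace γ] [MeasurableSpace δ]
  {P : Measure Ω} {Y : Ω → α} {T : Ω → β} {mY : Measure α} {mT : Measure β}

/-- Neither numerator nor denominator vanishes at a sampled point. Dividing by `p(Y|T)` at the
sample needs no positivity; a free value `y` does. -/
theorem ae_econdDens_ne_zero [IsFiniteMeasure P] [SigmaFinite mY] [SigmaFinite mT]
    (hY : Measurable Y) (hT : Measurable T)
    (h : P.map (fun ω => (Y ω, T ω)) ≪ mY.prod mT) :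
    ∀ᵐ z ∂P.map (fun ω => (Y ω, T ω)), econdDens P Y T mY mT z.1 z.2 ≠ 0 := by
  have hm : Measurable fun z : α × β => dens P T mT z.2 := (measurable_dens P T mT).comp measurable_snd
  have h1 : ∀ᵐ z ∂P.map (fun ω => (Y ω, T ω)), dens P T mT z.2 ≠ 0 := by
    rw [ae_map_iff (p := fun z : α × β => dens P T mT z.2 ≠ 0) (hY.prodMk hT).aemeasurable
      (hm (measurableSet_singleton 0)).compl]
    exact ae_of_ae_map hT.aemeasurable
      ((ae_map_iff_dens (ac_snd hY hT h)).2 (Filter.Eventually.of_forall fun _ h => h))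
  have h2 : ∀ᵐ z ∂P.map (fun ω => (Y ω, T ω)),
      dens P (fun ω => (Y ω, T ω)) (mY.prod mT) z ≠ 0 :=
    (ae_map_iff_dens h).2 (Filter.Eventually.of_forall fun _ h => h)
  filter_upwards [h1, h2] with z h1 h2
  rw [econdDens, ne_eq, ENNReal.ofReal_eq_zero, not_le]
  exact div_pos (lt_of_le_of_ne (dens_nonneg _ _ _ _) (Ne.symm h2))
    (lt_of_le_of_ne (dens_nonneg _ _ _ _) (Ne.symm h1))

/-- A positive conditional density makes the product of the reference measure and the marginal
absolutely continuous with respect to the joint law. -/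
theorem prod_map_ac_of_condDens_pos [IsFiniteMeasure P] [SigmaFinite mY] [SigmaFinite mT]
    (hY : Measurable Y) (hT : Measurable T) (h : P.map (fun ω => (Y ω, T ω)) ≪ mY.prod mT)
    (hpos : ∀ᵐ y ∂mY, ∀ᵐ t ∂P.map T, 0 < condDens P Y T mY mT y t) :
    mY.prod (P.map T) ≪ P.map (fun ω => (Y ω, T ω)) := by
  have hne : ∀ᵐ z ∂mY.prod (P.map T), 0 < condDens P Y T mY mT z.1 z.2 :=
    (Measure.ae_prod_iff_ae_ae (measurableSet_lt (by fun_prop) (by fun_prop))).2 hpos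
  refine Measure.AbsolutelyContinuous.mk fun s hs h0 => ?_
  have hi : Measurable (s.indicator (1 : α × β → ℝ≥0∞)) := measurable_one.indicator hs
  have e1 := lintegral_condDens hY hT h (φ := fun y t => s.indicator 1 (y, t)) (by exact hi)
  rw [← lintegral_map (f := s.indicator (1 : α × β → ℝ≥0∞)) hi (hY.prodMk hT),
    lintegral_indicator_one hs, h0, ← lintegral_map (f := fun t => ∫⁻ y,
      s.indicator 1 (y, t) * econdDens P Y T mY mT y t ∂mY) (by fun_prop) hT,
    ← lintegral_prod_symm' (fun z : α × β => s.indicator 1 z * econdDens P Y T mY mT z.1 z.2)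
      (by fun_prop), eq_comm, lintegral_eq_zero_iff (by fun_prop)] at e1
  rw [measure_eq_zero_iff_ae_notMem]
  filter_upwards [e1, hne] with z h1 h2 hz
  simp only [hz, Set.indicator_of_mem, Pi.one_apply, one_mul, Pi.zero_apply, econdDens,
    ENNReal.ofReal_eq_zero] at h1
  linarith

/-- Positivity given `T` passes to positivity given a function of `T`. Stated as absolute continuity
it is a mere push-forward. -/
theorem prod_map_comp_ac [IsFiniteMeasure P] [SigmaFinite mY] (hY : Measurable Y)
    (hT : Measurable T) (h : mY.prod (P.map T) ≪ P.map (fun ω => (Y ω, T ω))) {g : β → γ}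
    (hg : Measurable g) :
    mY.prod (P.map fun ω => g (T ω)) ≪ P.map (fun ω => (Y ω, g (T ω))) := by
  have h2 := h.map (f := Prod.map id g) (measurable_id.prodMap hg)
  rw [Measure.map_map (measurable_id.prodMap hg) (hY.prodMk hT),
    ← Measure.map_prod_map _ _ measurable_id hg, Measure.map_id, Measure.map_map hg hT] at h2
  exact h2

/-- Inverse probability weighting. -/
theorem lintegral_mul_inv_condDens [IsFiniteMeasure P] [SigmaFinite mY] [SigmaFinite mT]
    (hY : Measurable Y) (hT : Measurable T) (h : P.map (fun ω => (Y ω, T ω)) ≪ mY.prod mT)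
    (hne : ∀ᵐ z ∂mY.prod (P.map T), econdDens P Y T mY mT z.1 z.2 ≠ 0)
    {φ : α × β → ℝ≥0∞} (hφ : Measurable φ) :
    ∫⁻ ω, φ (Y ω, T ω) * (econdDens P Y T mY mT (Y ω) (T ω))⁻¹ ∂P =
      ∫⁻ ω, ∫⁻ y, φ (y, T ω) ∂mY ∂P := by
  rw [lintegral_condDens hY hT h
    (φ := fun y t => φ (y, t) * (econdDens P Y T mY mT y t)⁻¹) (by fun_prop),
    ← lintegral_map (f := fun t => ∫⁻ y, φ (y, t) * (econdDens P Y T mY mT y t)⁻¹ *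
      econdDens P Y T mY mT y t ∂mY) (by fun_prop) hT,
    ← lintegral_map (f := fun t => ∫⁻ y, φ (y, t) ∂mY) (by fun_prop) hT,
    ← lintegral_prod_symm' (fun z : α × β => φ z) hφ,
    ← lintegral_prod_symm' (fun z : α × β => φ z * (econdDens P Y T mY mT z.1 z.2)⁻¹ *
      econdDens P Y T mY mT z.1 z.2) (by fun_prop)]
  refine lintegral_congr_ae ?_
  filter_upwards [hne] with z hz
  rw [mul_assoc, ENNReal.inv_mul_cancel hz (econdDens_ne_top _ _ _ _ _ _ _), mul_one]

theorem lintegral_mul_lintegral_swap [SFinite mY] [SFinite mT] {φ : α → ℝ≥0∞} {k : α → β → ℝ≥0∞}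
    {l : β → ℝ≥0∞} (hφ : Measurable φ) (hk : Measurable (Function.uncurry k)) (hl : Measurable l) :
    ∫⁻ u, (∫⁻ y, φ y * k y u ∂mY) * l u ∂mT = ∫⁻ y, φ y * ∫⁻ u, k y u * l u ∂mT ∂mY := by
  have e1 : ∀ u, (∫⁻ y, φ y * k y u ∂mY) * l u = ∫⁻ y, φ y * k y u * l u ∂mY := fun u =>
    (lintegral_mul_const _ (by fun_prop)).symm
  simp_rw [e1]
  rw [lintegral_lintegral_swap (by fun_prop)]
  refine lintegral_congr fun y => ?_
  rw [← lintegral_const_mul _ (by fun_prop)]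
  simp_rw [mul_assoc]

/-- A conditional density is a mixture over a latent variable. -/
theorem ae_eq_lintegral_latent [IsFiniteMeasure P] [SigmaFinite mY] [SigmaFinite mT]
    {mU : Measure γ} [SigmaFinite mU] {U : Ω → γ} (hU : Measurable U) (hT : Measurable T)
    (h : P.map (fun ω => (U ω, T ω)) ≪ mU.prod mT) {p : α × β → ℝ≥0∞} (hp : Measurable p)
    {k : α × γ × β → ℝ≥0∞} (hk : Measurable k)
    (hpk : ∀ φ : α × β → ℝ≥0∞, Measurable φ → ∫⁻ ω, ∫⁻ y, φ (y, T ω) * p (y, T ω) ∂mY ∂P =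
      ∫⁻ ω, ∫⁻ y, φ (y, T ω) * k (y, U ω, T ω) ∂mY ∂P) :
    ∀ᵐ z ∂mY.prod (P.map T), p z =
      ∫⁻ u, k (z.1, u, z.2) * econdDens P U T mU mT u z.2 ∂mU := by
  refine ae_eq_of_lintegral_lintegral_eq (f := fun y t => p (y, t)) (g := fun y t =>
    ∫⁻ u, k (y, u, t) * econdDens P U T mU mT u t ∂mU) hT hp (by fun_prop) fun φ hφ => ?_
  rw [hpk (fun z => φ z.1 z.2) hφ, lintegral_condDens (φ := fun u t => ∫⁻ y, φ y t * k (y, u, t) ∂mY)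
    hU hT h (by fun_prop)]
  refine lintegral_congr fun ω => ?_
  exact lintegral_mul_lintegral_swap (φ := fun y => φ y (T ω)) (k := fun y u => k (y, u, T ω))
    (by fun_prop) (by simp only [Function.uncurry_def]; fun_prop) (by fun_prop)

/-- A density is a mixture over a latent variable. -/
theorem ae_eq_lintegral_latent_dens [IsFiniteMeasure P] [SigmaFinite mY] [SigmaFinite mT]
    {mU : Measure γ} [SigmaFinite mU] {U : Ω → γ} (hU : Measurable U) (hT : Measurable T)
    (h : P.map (fun ω => (U ω, T ω)) ≪ mU.prod mT) {p : α × β → ℝ≥0∞} (hp : Measurable p)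
    {k : α × γ × β → ℝ≥0∞} (hk : Measurable k)
    (hpk : ∀ φ : α × β → ℝ≥0∞, Measurable φ → ∫⁻ z, φ z * p z ∂mY.prod mT =
      ∫⁻ ω, ∫⁻ y, φ (y, T ω) * k (y, U ω, T ω) ∂mY ∂P) :
    ∀ᵐ z ∂mY.prod mT, p z =
      ∫⁻ u, k (z.1, u, z.2) * ENNReal.ofReal
        (dens P (fun ω => (U ω, T ω)) (mU.prod mT) (u, z.2)) ∂mU := by
  have hd : Measurable (dens P (fun ω => (U ω, T ω)) (mU.prod mT)) := measurable_dens _ _ _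
  refine eq_of_withDensity_lintegral_eq hp (by fun_prop) fun φ hφ => ?_
  rw [hpk φ hφ, lintegral_comp_dens (φ := fun x : γ × β => ∫⁻ y, φ (y, x.2) * k (y, x.1, x.2) ∂mY)
    (hU.prodMk hT) h (by fun_prop), lintegral_prod_symm' _ (by fun_prop),
    lintegral_prod_symm' _ (by fun_prop)]
  refine lintegral_congr fun t => ?_
  exact lintegral_mul_lintegral_swap (φ := fun y => φ (y, t)) (k := fun y u => k (y, u, t))
    (by fun_prop) (by simp only [Function.uncurry_def]; fun_prop) (by fun_prop)

/-- Integration against a mixture that is represented by a bridge function. -/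
theorem lintegral_latent_eq_of_residual {𝓠 ε : Type*} [MeasurableSpace 𝓠] [MeasurableSpace ε]
    [IsFiniteMeasure P] [SigmaFinite mT] {mQ : Measure 𝓠} [SigmaFinite mQ]
    {mU : Measure γ} [SigmaFinite mU] {m₁ : Measure δ} {m₂ : Measure ε} [SigmaFinite m₁]
    [SigmaFinite m₂] {U : Ω → γ} (hU : Measurable U) (hT : Measurable T)
    (h : P.map (fun ω => (U ω, T ω)) ≪ mU.prod mT)
    {A : 𝓠 × γ × β → ℝ} (hA : Measurable A) (hA0 : ∀ z, 0 ≤ A z)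
    {b : ε × γ × β → ℝ} (hb : Measurable b) (hb0 : ∀ z, 0 ≤ b z)
    {D : ε × β → ℝ} (hD0 : ∀ z, 0 ≤ D z)
    (hD : ∀ᵐ z ∂m₂.prod mT, ENNReal.ofReal (D z) = ∫⁻ u, ENNReal.ofReal (b (z.1, u, z.2)) *
      ENNReal.ofReal (dens P (fun ω => (U ω, T ω)) (mU.prod mT) (u, z.2)) ∂mU)
    {g : 𝓠 × β → δ → ε → ℝ} (hg : Measurable fun z : (𝓠 × β) × δ × ε => g z.1 z.2.1 z.2.2)
    (hgD : ∀ᵐ z ∂mQ.prod mT, Integrable (fun r : δ × ε => g z r.1 r.2 * D (r.2, z.2)) (m₁.prod m₂))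
    (hR : ∀ᵐ z ∂mQ.prod (P.map fun ω => (U ω, T ω)),
      A z - ∫ r₁, ∫ r₂, g (z.1, z.2.2) r₁ r₂ * b (r₂, z.2) ∂m₂ ∂m₁ = 0)
    {φ : 𝓠 × β → ℝ≥0∞} (hφ : Measurable φ) :
    ∫⁻ ω, ∫⁻ q, φ (q, T ω) * ENNReal.ofReal (A (q, U ω, T ω)) ∂mQ ∂P =
      ∫⁻ z, φ z * ENNReal.ofReal (∫ r₁, ∫ r₂, g z r₁ r₂ * D (r₂, z.2) ∂m₂ ∂m₁) ∂mQ.prod mT := by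
  have hd : Measurable (dens P (fun ω => (U ω, T ω)) (mU.prod mT)) := measurable_dens _ _ _
  -- The residual is known to vanish for the law of `(U, T)`; for the reference measure this means
  -- where `p(u,t) ≠ 0`, and the weight `p(u,t)` removes the rest.
  rw [ae_prod_map_iff_dens h] at hR
  have q : Measure.QuasiMeasurePreserving (fun z : (𝓠 × β) × γ => (z.1.1, z.2, z.1.2))
    ((mQ.prod mT).prod mU) (mQ.prod (mU.prod mT)) := quasiMeasurePreserving_insert_middle mQ mU mT
  have hR1 : ∀ᵐ z ∂mQ.prod mT, ∀ᵐ u ∂mU, _ := Measure.ae_ae_of_ae_prod (q.ae hR)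
  have hD1 : ∀ᵐ z ∂mQ.prod mT, ∀ᵐ r ∂m₂, _ :=
    Measure.quasiMeasurePreserving_snd.ae (ae_ae_swap_of_ae_prod hD)
  have key : ∀ᵐ z ∂mQ.prod mT, ENNReal.ofReal (∫ r₁, ∫ r₂, g z r₁ r₂ * D (r₂, z.2) ∂m₂ ∂m₁) =
      ∫⁻ u, ENNReal.ofReal (A (z.1, u, z.2)) *
        ENNReal.ofReal (dens P (fun ω => (U ω, T ω)) (mU.prod mT) (u, z.2)) ∂mU := by
    filter_upwards [hR1, hD1, hgD] with z h1 h2 h3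
    refine (lintegral_eq_ofReal_integral_mixture (h := g z)
      (b := fun r u => b (r, u, z.2)) (D := fun r => D (r, z.2))
      (hg.comp (f := fun r : δ × ε => (z, r.1, r.2)) (by fun_prop))
      (by simp only [Function.uncurry_def]; fun_prop) (fun _ _ => hb0 _) (by fun_prop)
      (fun u => dens_nonneg _ _ _ _) (fun _ => hD0 _) h2 h3 (fun u => hA0 _) ?_).symm
    filter_upwards [h1] with u hu h0 using hu h0
  have e : ∫⁻ z, φ z * ENNReal.ofReal (∫ r₁, ∫ r₂, g z r₁ r₂ * D (r₂, z.2) ∂m₂ ∂m₁) ∂mQ.prod mT =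
      ∫⁻ z, φ z * ∫⁻ u, ENNReal.ofReal (A (z.1, u, z.2)) *
        ENNReal.ofReal (dens P (fun ω => (U ω, T ω)) (mU.prod mT) (u, z.2)) ∂mU ∂mQ.prod mT := by
    refine lintegral_congr_ae ?_
    filter_upwards [key] with z hz
    rw [hz]
  rw [e, lintegral_comp_dens (φ := fun x : γ × β => ∫⁻ q, φ (q, x.2) *
    ENNReal.ofReal (A (q, x.1, x.2)) ∂mQ) (hU.prodMk hT) h (by fun_prop),
    lintegral_prod_symm' _ (by fun_prop), lintegral_prod_symm' _ (by fun_prop)]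
  refine lintegral_congr fun t => ?_
  exact lintegral_mul_lintegral_swap (φ := fun q => φ (q, t))
    (k := fun q u => ENNReal.ofReal (A (q, u, t)))
    (by fun_prop) (by simp only [Function.uncurry_def]; fun_prop) (by fun_prop)

/-- Integrating a conditional density over a part of the variables. -/
theorem ae_ofReal_integral_condDens [IsFiniteMeasure P] [SigmaFinite mY] [SigmaFinite mT]
    (hY : Measurable Y) (hT : Measurable T) (h : P.map (fun ω => (Y ω, T ω)) ≪ mY.prod mT)
    {m₁ : Measure γ} {m₂ : Measure δ} [SigmaFinite m₁] [SigmaFinite m₂] {g : γ × δ → α}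
    (hg : MeasurePreserving g (m₁.prod m₂) mY) :
    ∀ᵐ z ∂m₁.prod (P.map T), ENNReal.ofReal (∫ r, condDens P Y T mY mT (g (z.1, r)) z.2 ∂m₂) =
      ∫⁻ r, econdDens P Y T mY mT (g (z.1, r)) z.2 ∂m₂ := by
  have hgm := hg.measurable
  -- The total mass is that of `P`, so the inner integral is finite almost everywhere and the
  -- Bochner integral is not the default value `0`.
  have h1 : ∫⁻ z, ∫⁻ r, econdDens P Y T mY mT (g (z.1, r)) z.2 ∂m₂ ∂m₁.prod (P.map T) ≠ ∞ := by
    rw [lintegral_prod_symm' _ (by fun_prop), lintegral_map (by fun_prop) hT]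
    have e := lintegral_condDens hY hT h (φ := fun _ _ => 1) (by fun_prop)
    simp only [one_mul, lintegral_one] at e
    have e2 : ∀ ω, ∫⁻ y, econdDens P Y T mY mT y (T ω) ∂mY =
        ∫⁻ x, ∫⁻ y, econdDens P Y T mY mT (g (x, y)) (T ω) ∂m₂ ∂m₁ := fun ω => by
      rw [← hg.lintegral_comp (by fun_prop), lintegral_prod _ (by fun_prop)]
    simp_rw [← e2]
    rw [← e]
    exact measure_ne_top _ _
  filter_upwards [ae_lt_top (by fun_prop) h1] with z hz
  refine ofReal_integral_eq_lintegral_ofReal ⟨Measurable.aestronglyMeasurable (by fun_prop), ?_⟩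
    (Filter.Eventually.of_forall fun _ => condDens_nonneg _ _ _ _ _ _ _)
  rw [HasFiniteIntegral]
  refine lt_of_le_of_lt (le_of_eq (lintegral_congr fun r => ?_)) hz
  exact Real.enorm_of_nonneg (condDens_nonneg _ _ _ _ _ _ _)

/-- The part `r (Y)` is integrated by summing the conditional density of the whole `Y` over the
complementary part, which is the form in which the bridge equations are summed over `w*` or `z*`. -/
theorem lintegral_condDens_glue [IsFiniteMeasure P] [SigmaFinite mY] [SigmaFinite mT]
    (hY : Measurable Y) (hT : Measurable T) (h : P.map (fun ω => (Y ω, T ω)) ≪ mY.prod mT)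
    {m₁ : Measure γ} {m₂ : Measure δ} [SigmaFinite m₁] [SigmaFinite m₂] {g : γ × δ → α}
    (hg : MeasurePreserving g (m₁.prod m₂) mY) {r : α → γ} (hr : Measurable r)
    (hrg : ∀ x y, r (g (x, y)) = x) {φ : γ × β → ℝ≥0∞} (hφ : Measurable φ) :
    ∫⁻ ω, φ (r (Y ω), T ω) ∂P =
      ∫⁻ ω, ∫⁻ x, φ (x, T ω) * ∫⁻ y, econdDens P Y T mY mT (g (x, y)) (T ω) ∂m₂ ∂m₁ ∂P := by
  have hgm := hg.measurable
  rw [lintegral_condDens hY hT h (φ := fun y t => φ (r y, t)) (by fun_prop)]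
  refine lintegral_congr fun ω => ?_
  rw [← hg.lintegral_comp (by fun_prop), lintegral_prod _ (by fun_prop)]
  refine lintegral_congr fun x => ?_
  rw [← lintegral_const_mul _ (by fun_prop)]
  simp_rw [hrg]

end Mixtures

/-! ### Abstract systems of proxy variables -/

section ProxySystem

set_option linter.unusedSectionVars false

open scoped ENNReal

section Select

variable {α β γ δ : Type*} [MeasurableSpace α] [MeasurableSpace β] [MeasurableSpace γ]
  [MeasurableSpace δ] {ma : Measure α} {mb : Measure β} {mc : Measure γ} {md : Measure δ}

/-- With `qmp_pull` this describes selections and permutations of the factors of a nested product: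
here the first factor stays in place. -/
theorem qmp_keep [SFinite ma] [SFinite mb] [SFinite mc] {f : β → γ}
    (hf : Measure.QuasiMeasurePreserving f mb mc) :
    Measure.QuasiMeasurePreserving (fun p : α × β => (p.1, f p.2)) (ma.prod mb) (ma.prod mc) :=
  QuasiMeasurePreserving.prodMap (Measure.QuasiMeasurePreserving.id ma) hf

/-- The factor that `f` has brought to the front of the tail is moved past the head. -/
theorem qmp_pull [SFinite ma] [SFinite mb] [SFinite mc] [SFinite md] {f : δ → α × γ}
    (hf : Measure.QuasiMeasurePreserving f md (ma.prod mc)) :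
    Measure.QuasiMeasurePreserving (fun p : β × δ => ((f p.2).1, (p.1, (f p.2).2)))
      (mb.prod md) (ma.prod (mb.prod mc)) :=
  ((measurePreserving_prodAssoc ma mb mc).quasiMeasurePreserving.comp
    ((QuasiMeasurePreserving.prodMap
      (Measure.measurePreserving_swap (μ := mb) (ν := ma)).quasiMeasurePreserving
      (Measure.QuasiMeasurePreserving.id mc)).comp
      ((measurePreserving_prodAssoc mb ma mc).symm
        MeasurableEquiv.prodAssoc).quasiMeasurePreserving)).comp (qmp_keep hf)

end Select

variable {Ω 𝓞 𝓦 𝓦₁ 𝓩 𝓩₁ 𝓑 𝓤 𝓧 : Type*} [MeasurableSpace Ω] [MeasurableSpace 𝓞] [MeasurableSpace 𝓦]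
  [MeasurableSpace 𝓦₁] [MeasurableSpace 𝓩] [MeasurableSpace 𝓩₁] [MeasurableSpace 𝓑]
  [MeasurableSpace 𝓤] [MeasurableSpace 𝓧]

/-- Random variables with a joint density: outcome `O`, treatment `B`, outcome-inducing proxies
`W`, treatment-inducing proxies `Z`, latent confounders `U`, covariates `X`, and parts `W1` and `Z1`
of the proxies. -/
structure ProxyVars (P : Measure Ω) (O : Ω → 𝓞) (W : Ω → 𝓦) (W1 : Ω → 𝓦₁) (Z : Ω → 𝓩)
    (Z1 : Ω → 𝓩₁) (B : Ω → 𝓑) (U : Ω → 𝓤) (X : Ω → 𝓧) (rW : 𝓦 → 𝓦₁)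
    (rZ : 𝓩 → 𝓩₁) (mO : Measure 𝓞) (mW : Measure 𝓦) (mW1 : Measure 𝓦₁) (mZ : Measure 𝓩)
    (mZ1 : Measure 𝓩₁) (mB : Measure 𝓑) (mU : Measure 𝓤) (mX : Measure 𝓧) : Prop where
  measurable_O : Measurable O
  measurable_W : Measurable W
  measurable_Z : Measurable Z
  measurable_B : Measurable B
  measurable_U : Measurable U
  measurable_X : Measurable X
  W1_eq : ∀ ω, W1 ω = rW (W ω)
  Z1_eq : ∀ ω, Z1 ω = rZ (Z ω)
  qmp_rW : Measure.QuasiMeasurePreserving rW mW mW1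
  qmp_rZ : Measure.QuasiMeasurePreserving rZ mZ mZ1
  ac : P.map (fun ω => (U ω, O ω, W ω, Z ω, B ω, X ω)) ≪
    mU.prod (mO.prod (mW.prod (mZ.prod (mB.prod mX))))

/-- A system of proxies: the parts `W1` and `Z1` of the proxies are not affected by the treatment,
and `Ob b` is the potential outcome. The conditional independences are stated in terms of
integrals. -/
structure ProxySystem (P : Measure Ω) (O : Ω → 𝓞) (W : Ω → 𝓦) (W1 : Ω → 𝓦₁) (Z : Ω → 𝓩)
    (Z1 : Ω → 𝓩₁) (B : Ω → 𝓑) (U : Ω → 𝓤) (X : Ω → 𝓧) (Ob : 𝓑 → Ω → 𝓞) (rW : 𝓦 → 𝓦₁)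
    (rZ : 𝓩 → 𝓩₁) (mO : Measure 𝓞) (mW : Measure 𝓦) (mW1 : Measure 𝓦₁) (mZ : Measure 𝓩)
    (mZ1 : Measure 𝓩₁) (mB : Measure 𝓑) (mU : Measure 𝓤) (mX : Measure 𝓧) : Prop extends
    ProxyVars P O W W1 Z Z1 B U X rW rZ mO mW mW1 mZ mZ1 mB mU mX where
  /-- `W ⟂ (Z, B) | U, X` -/
  lintegral_W : ∀ φ : 𝓦 × 𝓩 × 𝓑 × 𝓤 × 𝓧 → ℝ≥0∞, Measurable φ →
    ∫⁻ ω, φ (W ω, Z ω, B ω, U ω, X ω) ∂P = ∫⁻ ω, ∫⁻ w, φ (w, Z ω, B ω, U ω, X ω) *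
      econdDens P W (fun ω => (U ω, X ω)) mW (mU.prod mX) w (U ω, X ω) ∂mW ∂P
  lintegral_W1 : ∀ φ : 𝓦₁ × 𝓩 × 𝓑 × 𝓤 × 𝓧 → ℝ≥0∞, Measurable φ →
    ∫⁻ ω, φ (W1 ω, Z ω, B ω, U ω, X ω) ∂P = ∫⁻ ω, ∫⁻ w, φ (w, Z ω, B ω, U ω, X ω) *
      econdDens P W1 (fun ω => (U ω, X ω)) mW1 (mU.prod mX) w (U ω, X ω) ∂mW1 ∂P
  /-- `O ⟂ Z | W1, B, U, X` -/
  lintegral_O : ∀ φ : 𝓞 × 𝓩 × 𝓦₁ × 𝓑 × 𝓤 × 𝓧 → ℝ≥0∞, Measurable φ →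
    ∫⁻ ω, φ (O ω, Z ω, W1 ω, B ω, U ω, X ω) ∂P =
      ∫⁻ ω, ∫⁻ o, φ (o, Z ω, W1 ω, B ω, U ω, X ω) *
        econdDens P O (fun ω => (W1 ω, B ω, U ω, X ω)) mO (mW1.prod (mB.prod (mU.prod mX))) o
          (W1 ω, B ω, U ω, X ω) ∂mO ∂P
  /-- `O b ⟂ B | U, W1, Z1, X` -/
  lintegral_B : ∀ φ : 𝓑 × 𝓞 × 𝓤 × 𝓦₁ × 𝓩₁ × 𝓧 → ℝ≥0∞, Measurable φ →
    ∫⁻ ω, φ (B ω, O ω, U ω, W1 ω, Z1 ω, X ω) ∂P =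
      ∫⁻ b, ∫⁻ ω, φ (b, Ob b ω, U ω, W1 ω, Z1 ω, X ω) *
        econdDens P B (fun ω => (U ω, W1 ω, Z1 ω, X ω)) mB (mU.prod (mW1.prod (mZ1.prod mX))) b
          (U ω, W1 ω, Z1 ω, X ω) ∂P ∂mB
  /-- positivity of `p(b | U, W1, Z1, X)` -/
  pos : ∀ᵐ b ∂mB, ∀ᵐ t ∂P.map (fun ω => (U ω, W1 ω, Z1 ω, X ω)),
    0 < condDens P B (fun ω => (U ω, W1 ω, Z1 ω, X ω)) mB (mU.prod (mW1.prod (mZ1.prod mX))) b t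

namespace ProxyVars

variable {P : Measure Ω} {O : Ω → 𝓞} {W : Ω → 𝓦} {W1 : Ω → 𝓦₁} {Z : Ω → 𝓩}
  {Z1 : Ω → 𝓩₁} {B : Ω → 𝓑} {U : Ω → 𝓤} {X : Ω → 𝓧} {rW : 𝓦 → 𝓦₁}
  {rZ : 𝓩 → 𝓩₁} {mO : Measure 𝓞} {mW : Measure 𝓦} {mW1 : Measure 𝓦₁} {mZ : Measure 𝓩}
  {mZ1 : Measure 𝓩₁} {mB : Measure 𝓑} {mU : Measure 𝓤} {mX : Measure 𝓧}
  [SigmaFinite mO] [SigmaFinite mW] [SigmaFinite mW1] [SigmaFinite mZ] [SigmaFinite mZ1]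
  [SigmaFinite mB] [SigmaFinite mU] [SigmaFinite mX]
  (h : ProxyVars P O W W1 Z Z1 B U X rW rZ mO mW mW1 mZ mZ1 mB mU mX)

include h

omit [SigmaFinite mO] [SigmaFinite mW] [SigmaFinite mW1] [SigmaFinite mZ] [SigmaFinite mZ1]
  [SigmaFinite mB] [SigmaFinite mU] [SigmaFinite mX]

theorem measurable_W1 : Measurable W1 := by
  have := h.qmp_rW.measurable.comp h.measurable_W
  rwa [show W1 = rW ∘ W from funext h.W1_eq]

theorem measurable_Z1 : Measurable Z1 := by
  have := h.qmp_rZ.measurable.comp h.measurable_Z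
  rwa [show Z1 = rZ ∘ Z from funext h.Z1_eq]

theorem measurable_all : Measurable fun ω => (U ω, O ω, W ω, Z ω, B ω, X ω) :=
  h.measurable_U.prodMk (h.measurable_O.prodMk (h.measurable_W.prodMk
    (h.measurable_Z.prodMk (h.measurable_B.prodMk h.measurable_X))))

theorem measurable_all₁ : Measurable fun ω => (U ω, O ω, W1 ω, Z ω, B ω, X ω) :=
  h.measurable_U.prodMk (h.measurable_O.prodMk (h.measurable_W1.prodMk
    (h.measurable_Z.prodMk (h.measurable_B.prodMk h.measurable_X))))

theorem measurable_all₂ : Measurable fun ω => (U ω, O ω, W ω, Z1 ω, B ω, X ω) :=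
  h.measurable_U.prodMk (h.measurable_O.prodMk (h.measurable_W.prodMk
    (h.measurable_Z1.prodMk (h.measurable_B.prodMk h.measurable_X))))

theorem measurable_all₁₁ : Measurable fun ω => (U ω, O ω, W1 ω, Z1 ω, B ω, X ω) :=
  h.measurable_U.prodMk (h.measurable_O.prodMk (h.measurable_W1.prodMk
    (h.measurable_Z1.prodMk (h.measurable_B.prodMk h.measurable_X))))

variable [SigmaFinite mO] [SigmaFinite mW] [SigmaFinite mW1] [SigmaFinite mZ] [SigmaFinite mZ1]
  [SigmaFinite mB] [SigmaFinite mU] [SigmaFinite mX]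

theorem ac₁ : P.map (fun ω => (U ω, O ω, W1 ω, Z ω, B ω, X ω)) ≪
    mU.prod (mO.prod (mW1.prod (mZ.prod (mB.prod mX)))) := by
  have := ac_of_quasiMeasurePreserving h.measurable_all h.ac (qmp_keep (qmp_keep
    (QuasiMeasurePreserving.prodMap h.qmp_rW
      (Measure.QuasiMeasurePreserving.id (mZ.prod (mB.prod mX))))))
  simp only [h.W1_eq]
  exact this

theorem ac₂ : P.map (fun ω => (U ω, O ω, W ω, Z1 ω, B ω, X ω)) ≪
    mU.prod (mO.prod (mW.prod (mZ1.prod (mB.prod mX)))) := by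
  have := ac_of_quasiMeasurePreserving h.measurable_all h.ac (qmp_keep (qmp_keep (qmp_keep
    (QuasiMeasurePreserving.prodMap h.qmp_rZ
      (Measure.QuasiMeasurePreserving.id (mB.prod mX))))))
  simp only [h.Z1_eq]
  exact this

theorem ac₁₁ : P.map (fun ω => (U ω, O ω, W1 ω, Z1 ω, B ω, X ω)) ≪
    mU.prod (mO.prod (mW1.prod (mZ1.prod (mB.prod mX)))) := by
  have := ac_of_quasiMeasurePreserving h.measurable_all₁ h.ac₁ (qmp_keep (qmp_keep (qmp_keep
    (QuasiMeasurePreserving.prodMap h.qmp_rZ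
      (Measure.QuasiMeasurePreserving.id (mB.prod mX))))))
  simp only [h.Z1_eq]
  exact this

/-- This and the statements up to `ac_WBX` are selections of coordinates from the joint law of all
variables, each spelled out by `qmp_keep`, `qmp_pull` and projections. -/
theorem ac_WUX : P.map (fun ω => (W ω, U ω, X ω)) ≪ mW.prod (mU.prod mX) :=
  ac_of_quasiMeasurePreserving h.measurable_all h.ac
    ((qmp_keep (qmp_keep (((Measure.quasiMeasurePreserving_snd).comp
      Measure.quasiMeasurePreserving_snd).comp Measure.quasiMeasurePreserving_snd))).comp (qmp_pull
      (qmp_pull (Measure.QuasiMeasurePreserving.id _))))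

theorem ac_W1UX : P.map (fun ω => (W1 ω, U ω, X ω)) ≪ mW1.prod (mU.prod mX) :=
  ac_of_quasiMeasurePreserving h.measurable_all₁ h.ac₁
    ((qmp_keep (qmp_keep (((Measure.quasiMeasurePreserving_snd).comp
      Measure.quasiMeasurePreserving_snd).comp Measure.quasiMeasurePreserving_snd))).comp (qmp_pull
      (qmp_pull (Measure.QuasiMeasurePreserving.id _))))

theorem ac_OW1BUX : P.map (fun ω => (O ω, W1 ω, B ω, U ω, X ω)) ≪ mO.prod (mW1.prod (mB.prod
      (mU.prod mX))) :=
  ac_of_quasiMeasurePreserving h.measurable_all₁ h.ac₁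
    ((qmp_keep ((qmp_keep ((qmp_keep (qmp_keep (Measure.quasiMeasurePreserving_snd))).comp
      (qmp_pull (qmp_pull (Measure.QuasiMeasurePreserving.id _))))).comp (qmp_pull
      (Measure.QuasiMeasurePreserving.id _)))).comp (qmp_pull (Measure.QuasiMeasurePreserving.id
      _)))

theorem ac_OWZBX : P.map (fun ω => (O ω, W ω, Z ω, B ω, X ω)) ≪ mO.prod (mW.prod (mZ.prod (mB.prod
      mX))) :=
  ac_of_quasiMeasurePreserving h.measurable_all h.ac
    (Measure.quasiMeasurePreserving_snd)

theorem ac_UBZX : P.map (fun ω => (U ω, B ω, Z ω, X ω)) ≪ mU.prod (mB.prod (mZ.prod mX)) :=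
  ac_of_quasiMeasurePreserving h.measurable_all h.ac
    (qmp_keep (((qmp_pull (Measure.QuasiMeasurePreserving.id _)).comp
      Measure.quasiMeasurePreserving_snd).comp Measure.quasiMeasurePreserving_snd))

theorem ac_WZBX : P.map (fun ω => (W ω, Z ω, B ω, X ω)) ≪ mW.prod (mZ.prod (mB.prod mX)) :=
  ac_of_quasiMeasurePreserving h.measurable_all h.ac
    ((Measure.quasiMeasurePreserving_snd).comp Measure.quasiMeasurePreserving_snd)

theorem ac_WZ1X : P.map (fun ω => (W ω, Z1 ω, X ω)) ≪ mW.prod (mZ1.prod mX) :=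
  ac_of_quasiMeasurePreserving h.measurable_all₂ h.ac₂
    (((qmp_keep (qmp_keep (Measure.quasiMeasurePreserving_snd))).comp
      Measure.quasiMeasurePreserving_snd).comp Measure.quasiMeasurePreserving_snd)

theorem ac_UZ1X : P.map (fun ω => (U ω, Z1 ω, X ω)) ≪ mU.prod (mZ1.prod mX) :=
  ac_of_quasiMeasurePreserving h.measurable_all₂ h.ac₂
    (qmp_keep (((qmp_keep (Measure.quasiMeasurePreserving_snd)).comp
      Measure.quasiMeasurePreserving_snd).comp Measure.quasiMeasurePreserving_snd))

theorem ac_BX : P.map (fun ω => (B ω, X ω)) ≪ mB.prod mX :=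
  ac_of_quasiMeasurePreserving h.measurable_all h.ac
    ((((Measure.quasiMeasurePreserving_snd).comp Measure.quasiMeasurePreserving_snd).comp
      Measure.quasiMeasurePreserving_snd).comp Measure.quasiMeasurePreserving_snd)

theorem ac_BZX : P.map (fun ω => (B ω, Z ω, X ω)) ≪ mB.prod (mZ.prod mX) :=
  ac_of_quasiMeasurePreserving h.measurable_all h.ac
    ((((qmp_pull (Measure.QuasiMeasurePreserving.id _)).comp
      Measure.quasiMeasurePreserving_snd).comp Measure.quasiMeasurePreserving_snd).comp
      Measure.quasiMeasurePreserving_snd)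

theorem ac_Z : P.map Z ≪ mZ :=
  ac_of_quasiMeasurePreserving h.measurable_all h.ac
    ((((Measure.quasiMeasurePreserving_fst).comp Measure.quasiMeasurePreserving_snd).comp
      Measure.quasiMeasurePreserving_snd).comp Measure.quasiMeasurePreserving_snd)

theorem ac_BUW1Z1X : P.map (fun ω => (B ω, U ω, W1 ω, Z1 ω, X ω)) ≪ mB.prod (mU.prod (mW1.prod
      (mZ1.prod mX))) :=
  ac_of_quasiMeasurePreserving h.measurable_all₁₁ h.ac₁₁
    ((qmp_keep (qmp_keep (Measure.quasiMeasurePreserving_snd))).comp (qmp_pull (qmp_pull (qmp_pull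
      (qmp_pull (Measure.QuasiMeasurePreserving.id _))))))

theorem ac_BUX : P.map (fun ω => (B ω, U ω, X ω)) ≪ mB.prod (mU.prod mX) :=
  ac_of_quasiMeasurePreserving h.measurable_all h.ac
    ((qmp_keep (qmp_keep (((Measure.quasiMeasurePreserving_snd).comp
      Measure.quasiMeasurePreserving_snd).comp Measure.quasiMeasurePreserving_snd))).comp (qmp_pull
      (qmp_pull (qmp_pull (qmp_pull (Measure.QuasiMeasurePreserving.id _))))))

theorem ac_Z1UX : P.map (fun ω => (Z1 ω, U ω, X ω)) ≪ mZ1.prod (mU.prod mX) :=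
  ac_of_quasiMeasurePreserving h.measurable_all₂ h.ac₂
    ((qmp_keep (qmp_keep (((Measure.quasiMeasurePreserving_snd).comp
      Measure.quasiMeasurePreserving_snd).comp Measure.quasiMeasurePreserving_snd))).comp (qmp_pull
      (qmp_pull (qmp_pull (Measure.QuasiMeasurePreserving.id _)))))

theorem ac_ZBUX : P.map (fun ω => (Z ω, B ω, U ω, X ω)) ≪ mZ.prod (mB.prod (mU.prod mX)) :=
  ac_of_quasiMeasurePreserving h.measurable_all h.ac
    ((qmp_keep ((qmp_keep (qmp_keep ((Measure.quasiMeasurePreserving_snd).comp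
      Measure.quasiMeasurePreserving_snd))).comp (qmp_pull (qmp_pull (qmp_pull
      (Measure.QuasiMeasurePreserving.id _)))))).comp (qmp_pull (qmp_pull (qmp_pull
      (Measure.QuasiMeasurePreserving.id _)))))

theorem ac_UBWX : P.map (fun ω => (U ω, B ω, W ω, X ω)) ≪ mU.prod (mB.prod (mW.prod mX)) :=
  ac_of_quasiMeasurePreserving h.measurable_all h.ac
    (qmp_keep (((qmp_keep (qmp_keep (Measure.quasiMeasurePreserving_snd))).comp (qmp_pull (qmp_pull
      (Measure.QuasiMeasurePreserving.id _)))).comp Measure.quasiMeasurePreserving_snd))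

theorem ac_W : P.map W ≪ mW :=
  ac_of_quasiMeasurePreserving h.measurable_all h.ac
    (((Measure.quasiMeasurePreserving_fst).comp Measure.quasiMeasurePreserving_snd).comp
      Measure.quasiMeasurePreserving_snd)

theorem ac_BWX : P.map (fun ω => (B ω, W ω, X ω)) ≪ mB.prod (mW.prod mX) :=
  ac_of_quasiMeasurePreserving h.measurable_all h.ac
    ((((qmp_keep (qmp_keep (Measure.quasiMeasurePreserving_snd))).comp (qmp_pull (qmp_pull
      (Measure.QuasiMeasurePreserving.id _)))).comp Measure.quasiMeasurePreserving_snd).comp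
      Measure.quasiMeasurePreserving_snd)

theorem ac_ZWBX : P.map (fun ω => (Z ω, W ω, B ω, X ω)) ≪ mZ.prod (mW.prod (mB.prod mX)) :=
  ac_of_quasiMeasurePreserving h.measurable_all h.ac
    (((qmp_pull (Measure.QuasiMeasurePreserving.id _)).comp
      Measure.quasiMeasurePreserving_snd).comp Measure.quasiMeasurePreserving_snd)

theorem ac_ZWX : P.map (fun ω => (Z ω, W ω, X ω)) ≪ mZ.prod (mW.prod mX) :=
  ac_of_quasiMeasurePreserving h.measurable_all h.ac
    ((((qmp_keep (qmp_keep (Measure.quasiMeasurePreserving_snd))).comp (qmp_pull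
      (Measure.QuasiMeasurePreserving.id _))).comp Measure.quasiMeasurePreserving_snd).comp
      Measure.quasiMeasurePreserving_snd)

theorem ac_OW1ZBX : P.map (fun ω => (O ω, W1 ω, Z ω, B ω, X ω)) ≪ mO.prod (mW1.prod (mZ.prod
      (mB.prod mX))) :=
  ac_of_quasiMeasurePreserving h.measurable_all₁ h.ac₁
    (Measure.quasiMeasurePreserving_snd)

theorem ac_UOW1BX : P.map (fun ω => (U ω, O ω, W1 ω, B ω, X ω)) ≪ mU.prod (mO.prod (mW1.prod
      (mB.prod mX))) :=
  ac_of_quasiMeasurePreserving h.measurable_all₁ h.ac₁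
    (qmp_keep (qmp_keep (qmp_keep (Measure.quasiMeasurePreserving_snd))))

theorem ac_UX : P.map (fun ω => (U ω, X ω)) ≪ mU.prod mX :=
  ac_of_quasiMeasurePreserving h.measurable_all h.ac
    (qmp_keep ((((Measure.quasiMeasurePreserving_snd).comp Measure.quasiMeasurePreserving_snd).comp
      Measure.quasiMeasurePreserving_snd).comp Measure.quasiMeasurePreserving_snd))

theorem ac_UBX : P.map (fun ω => (U ω, B ω, X ω)) ≪ mU.prod (mB.prod mX) :=
  ac_of_quasiMeasurePreserving h.measurable_all h.ac
    (qmp_keep (((Measure.quasiMeasurePreserving_snd).comp Measure.quasiMeasurePreserving_snd).comp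
      Measure.quasiMeasurePreserving_snd))

theorem ac_WBX : P.map (fun ω => (W ω, B ω, X ω)) ≪ mW.prod (mB.prod mX) :=
  ac_of_quasiMeasurePreserving h.measurable_all h.ac
    (((qmp_keep (Measure.quasiMeasurePreserving_snd)).comp Measure.quasiMeasurePreserving_snd).comp
      Measure.quasiMeasurePreserving_snd)

theorem ac_OW1_BUX : P.map (fun ω => ((O ω, W1 ω), B ω, U ω, X ω)) ≪
    (mO.prod mW1).prod (mB.prod (mU.prod mX)) :=
  ac_of_quasiMeasurePreserving (h.measurable_O.prodMk (h.measurable_W1.prodMk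
    (h.measurable_B.prodMk (h.measurable_U.prodMk h.measurable_X)))) h.ac_OW1BUX
    ((measurePreserving_prodAssoc mO mW1 _).symm MeasurableEquiv.prodAssoc).quasiMeasurePreserving

theorem ac_OW_ZBX : P.map (fun ω => ((O ω, W ω), Z ω, B ω, X ω)) ≪
    (mO.prod mW).prod (mZ.prod (mB.prod mX)) :=
  ac_of_quasiMeasurePreserving (h.measurable_O.prodMk (h.measurable_W.prodMk
    (h.measurable_Z.prodMk (h.measurable_B.prodMk h.measurable_X)))) h.ac_OWZBX
    ((measurePreserving_prodAssoc mO mW _).symm MeasurableEquiv.prodAssoc).quasiMeasurePreserving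

end ProxyVars

end ProxySystem

/-! ### Consequences of the conditional independences, and the law of the potential outcomes -/

section ProxyIdentities

set_option linter.unusedSectionVars false

open scoped ENNReal

variable {Ω 𝓞 𝓦 𝓦₁ 𝓩 𝓩₁ 𝓑 𝓤 𝓧 : Type*} [MeasurableSpace Ω] [MeasurableSpace 𝓞] [MeasurableSpace 𝓦]
  [MeasurableSpace 𝓦₁] [MeasurableSpace 𝓩] [MeasurableSpace 𝓩₁] [MeasurableSpace 𝓑]
  [MeasurableSpace 𝓤] [MeasurableSpace 𝓧]

namespace ProxySystem

variable {P : Measure Ω} [IsProbabilityMeasure P] {O : Ω → 𝓞} {W : Ω → 𝓦} {W1 : Ω → 𝓦₁} {Z : Ω → 𝓩}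
  {Z1 : Ω → 𝓩₁} {B : Ω → 𝓑} {U : Ω → 𝓤} {X : Ω → 𝓧} {Ob : 𝓑 → Ω → 𝓞} {rW : 𝓦 → 𝓦₁}
  {rZ : 𝓩 → 𝓩₁} {mO : Measure 𝓞} {mW : Measure 𝓦} {mW1 : Measure 𝓦₁} {mZ : Measure 𝓩}
  {mZ1 : Measure 𝓩₁} {mB : Measure 𝓑} {mU : Measure 𝓤} {mX : Measure 𝓧}
  [SigmaFinite mO] [SigmaFinite mW] [SigmaFinite mW1] [SigmaFinite mZ] [SigmaFinite mZ1]
  [SigmaFinite mB] [SigmaFinite mU] [SigmaFinite mX]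
  (h : ProxySystem P O W W1 Z Z1 B U X Ob rW rZ mO mW mW1 mZ mZ1 mB mU mX)

include h

/-- Latent positivity with the proxies forgotten. A property that holds almost surely at `(B, U, X)`
may be used at a free value `b` together with sampled `(U, X)`. -/
theorem prod_map_UX_ac : mB.prod (P.map fun ω => (U ω, X ω)) ≪
    P.map (fun ω => (B ω, U ω, X ω)) := by
  have hT : Measurable fun ω => (U ω, W1 ω, Z1 ω, X ω) :=
    h.measurable_U.prodMk (h.measurable_W1.prodMk (h.measurable_Z1.prodMk h.measurable_X))
  have h1 := prod_map_ac_of_condDens_pos h.measurable_B hT h.ac_BUW1Z1X h.pos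
  exact prod_map_comp_ac h.measurable_B hT h1 (g := fun t => (t.1, t.2.2.2)) (by fun_prop)

theorem prod_map_X_ac : mB.prod (P.map X) ≪ P.map (fun ω => (B ω, X ω)) :=
  prod_map_comp_ac h.measurable_B (h.measurable_U.prodMk h.measurable_X) h.prod_map_UX_ac
    (g := Prod.snd) measurable_snd

theorem ae_econdDens_BUX_ne_zero : ∀ᵐ z ∂mB.prod (P.map fun ω => (U ω, X ω)),
    econdDens P B (fun ω => (U ω, X ω)) mB (mU.prod mX) z.1 z.2 ≠ 0 :=
  h.prod_map_UX_ac.ae_le (ae_econdDens_ne_zero h.measurable_B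
    (h.measurable_U.prodMk h.measurable_X) h.ac_BUX)

/-- The chain rule `p(o,w̃|b,u,x) = p(o|w̃,b,u,x) p(w̃|b,u,x)`, where `W ⟂ B | U,X` removes `b` from
the last factor. -/
theorem econdDens_OW1_eq : ∀ᵐ z ∂(mO.prod mW1).prod (P.map fun ω => (B ω, U ω, X ω)),
    econdDens P (fun ω => (O ω, W1 ω)) (fun ω => (B ω, U ω, X ω)) (mO.prod mW1)
      (mB.prod (mU.prod mX)) z.1 z.2 =
    econdDens P O (fun ω => (W1 ω, B ω, U ω, X ω)) mO (mW1.prod (mB.prod (mU.prod mX))) z.1.1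
      (z.1.2, z.2) * econdDens P W1 (fun ω => (U ω, X ω)) mW1 (mU.prod mX) z.1.2 z.2.2 := by
  have hO := h.measurable_O
  have hW := h.measurable_W1
  have hT : Measurable fun ω => (B ω, U ω, X ω) :=
    h.measurable_B.prodMk (h.measurable_U.prodMk h.measurable_X)
  refine ae_eq_of_lintegral_lintegral_eq
    (f := fun y t => econdDens P (fun ω => (O ω, W1 ω)) (fun ω => (B ω, U ω, X ω)) (mO.prod mW1)
      (mB.prod (mU.prod mX)) y t)
    (g := fun y t => econdDens P O (fun ω => (W1 ω, B ω, U ω, X ω)) mO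
      (mW1.prod (mB.prod (mU.prod mX))) y.1 (y.2, t) *
      econdDens P W1 (fun ω => (U ω, X ω)) mW1 (mU.prod mX) y.2 t.2) hT
    (by simp only [Function.uncurry_def]; fun_prop)
    (by simp only [Function.uncurry_def]; fun_prop) fun φ hφ => ?_
  rw [← lintegral_condDens (hO.prodMk hW) hT h.ac_OW1_BUX hφ]
  have e1 := h.lintegral_O (fun x => φ (x.1, x.2.2.1) x.2.2.2) (by fun_prop)
  have e2 := h.lintegral_W1 (fun x => ∫⁻ o, φ (o, x.1) x.2.2 *
    econdDens P O (fun ω => (W1 ω, B ω, U ω, X ω)) mO (mW1.prod (mB.prod (mU.prod mX))) o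
      (x.1, x.2.2) ∂mO) (by fun_prop)
  simp only at e1 e2
  rw [e1, e2]
  refine lintegral_congr fun ω => ?_
  rw [lintegral_prod_symm' _ (by fun_prop)]
  refine lintegral_congr fun w => ?_
  rw [← lintegral_mul_const _ (by fun_prop)]
  simp_rw [mul_assoc]

/-- `(O, W1) ⟂ Z | B, U, X`. -/
theorem lintegral_OW1 {φ : (𝓞 × 𝓦₁) × 𝓩 × 𝓑 × 𝓤 × 𝓧 → ℝ≥0∞} (hφ : Measurable φ) :
    ∫⁻ ω, φ ((O ω, W1 ω), Z ω, B ω, U ω, X ω) ∂P =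
      ∫⁻ ω, ∫⁻ y, φ (y, Z ω, B ω, U ω, X ω) *
        econdDens P (fun ω => (O ω, W1 ω)) (fun ω => (B ω, U ω, X ω)) (mO.prod mW1)
          (mB.prod (mU.prod mX)) y (B ω, U ω, X ω) ∂mO.prod mW1 ∂P := by
  have hT : Measurable fun ω => (B ω, U ω, X ω) :=
    h.measurable_B.prodMk (h.measurable_U.prodMk h.measurable_X)
  -- `Z` can be carried along: the law of `O` given `W1, B, U, X` ignores it, and so does the law of
  -- `W1` given `U, X`.
  have e1 := h.lintegral_O (fun x => φ ((x.1, x.2.2.1), x.2.1, x.2.2.2)) (by fun_prop)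
  have e2 := h.lintegral_W1 (fun x => ∫⁻ o, φ ((o, x.1), x.2) *
    econdDens P O (fun ω => (W1 ω, B ω, U ω, X ω)) mO (mW1.prod (mB.prod (mU.prod mX))) o
      (x.1, x.2.2) ∂mO) (by fun_prop)
  simp only at e1 e2
  rw [e1, e2]
  have hae := ae_of_ae_map hT.aemeasurable (ae_ae_swap_of_ae_prod h.econdDens_OW1_eq)
  refine lintegral_congr_ae ?_
  filter_upwards [hae] with ω hω
  have e3 : ∫⁻ y, φ (y, Z ω, B ω, U ω, X ω) *
        econdDens P (fun ω => (O ω, W1 ω)) (fun ω => (B ω, U ω, X ω)) (mO.prod mW1)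
          (mB.prod (mU.prod mX)) y (B ω, U ω, X ω) ∂mO.prod mW1 =
      ∫⁻ y, φ (y, Z ω, B ω, U ω, X ω) *
        (econdDens P O (fun ω => (W1 ω, B ω, U ω, X ω)) mO (mW1.prod (mB.prod (mU.prod mX))) y.1
      (y.2, B ω, U ω, X ω) * econdDens P W1 (fun ω => (U ω, X ω)) mW1 (mU.prod mX) y.2
        (U ω, X ω)) ∂mO.prod mW1 := by
    refine lintegral_congr_ae ?_
    filter_upwards [hω] with y hy
    rw [hy]
  rw [e3, lintegral_prod_symm' _ (by fun_prop)]
  refine lintegral_congr fun w => ?_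
  rw [← lintegral_mul_const _ (by fun_prop)]
  simp_rw [mul_assoc]

/-- The law of the potential outcomes is a mixture over the latent variables. -/
theorem lintegral_Ob {φ : 𝓑 × 𝓞 × 𝓦₁ × 𝓩₁ × 𝓧 → ℝ≥0∞} (hφ : Measurable φ) :
    ∫⁻ b, ∫⁻ ω, φ (b, Ob b ω, W1 ω, Z1 ω, X ω) ∂P ∂mB =
      ∫⁻ ω, ∫⁻ b, ∫⁻ y, φ (b, y.1, y.2, Z1 ω, X ω) *
        econdDens P (fun ω => (O ω, W1 ω)) (fun ω => (B ω, U ω, X ω)) (mO.prod mW1)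
          (mB.prod (mU.prod mX)) y (b, U ω, X ω) ∂mO.prod mW1 ∂mB ∂P := by
  have hB := h.measurable_B
  have hUX := h.measurable_U.prodMk h.measurable_X
  have hZ1 := h.measurable_Z1
  have hrZ := h.qmp_rZ.measurable
  have hT : Measurable fun ω => (U ω, W1 ω, Z1 ω, X ω) :=
    h.measurable_U.prodMk (h.measurable_W1.prodMk (h.measurable_Z1.prodMk h.measurable_X))
  let e : 𝓑 → 𝓤 × 𝓦₁ × 𝓩₁ × 𝓧 → ℝ≥0∞ :=
    econdDens P B (fun ω => (U ω, W1 ω, Z1 ω, X ω)) mB (mU.prod (mW1.prod (mZ1.prod mX)))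
  have he : Measurable (Function.uncurry e) := by
    simp only [Function.uncurry_def, e]; fun_prop
  have hne : ∀ᵐ z ∂mB.prod (P.map fun ω => (U ω, W1 ω, Z1 ω, X ω)), e z.1 z.2 ≠ 0 :=
    (prod_map_ac_of_condDens_pos hB hT h.ac_BUW1Z1X h.pos).ae_le
      (ae_econdDens_ne_zero hB hT h.ac_BUW1Z1X)
  let κ : 𝓞 → 𝓦₁ × 𝓑 × 𝓤 × 𝓧 → ℝ≥0∞ :=
    econdDens P O (fun ω => (W1 ω, B ω, U ω, X ω)) mO (mW1.prod (mB.prod (mU.prod mX)))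
  have hκ : Measurable (Function.uncurry κ) := by
    simp only [Function.uncurry_def, κ]; fun_prop
  -- The inverse weight cancels the factor `p(b|U,W1,Z1,X)` from ignorability, leaving the plain law
  -- of the potential outcomes.
  have e1 := h.lintegral_B (fun x => φ (x.1, x.2.1, x.2.2.2.1, x.2.2.2.2.1, x.2.2.2.2.2) *
    (e x.1 x.2.2)⁻¹) (by fun_prop)
  have e1' : ∫⁻ b, ∫⁻ ω, φ (b, Ob b ω, W1 ω, Z1 ω, X ω) * (e b (U ω, W1 ω, Z1 ω, X ω))⁻¹ *
      e b (U ω, W1 ω, Z1 ω, X ω) ∂P ∂mB = ∫⁻ b, ∫⁻ ω, φ (b, Ob b ω, W1 ω, Z1 ω, X ω) ∂P ∂mB := by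
    refine lintegral_congr_ae ?_
    filter_upwards [Measure.ae_ae_of_ae_prod hne] with b hb
    refine lintegral_congr_ae ?_
    filter_upwards [ae_of_ae_map hT.aemeasurable hb] with ω hω
    rw [mul_assoc, ENNReal.inv_mul_cancel hω (econdDens_ne_top _ _ _ _ _ _ _), mul_one]
  have e2 := h.lintegral_O (fun x => φ (x.2.2.2.1, x.1, x.2.2.1, rZ x.2.1, x.2.2.2.2.2) *
    (e x.2.2.2.1 (x.2.2.2.2.1, x.2.2.1, rZ x.2.1, x.2.2.2.2.2))⁻¹) (by fun_prop)
  -- Once `O` has been replaced by its conditional density, the same weight turns the sampled `B`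
  -- into a free variable; the density of `O` now stands at a fixed `b`.
  have e3 := lintegral_mul_inv_condDens hB hT h.ac_BUW1Z1X hne
    (φ := fun x => ∫⁻ o, φ (x.1, o, x.2.2.1, x.2.2.2.1, x.2.2.2.2) *
      κ o (x.2.2.1, x.1, x.2.1, x.2.2.2.2) ∂mO) (by fun_prop)
  have e4 := h.lintegral_W1 (fun x => ∫⁻ b, ∫⁻ o, φ (b, o, x.1, rZ x.2.1, x.2.2.2.2) *
    κ o (x.1, b, x.2.2.2) ∂mO ∂mB) (by fun_prop)
  simp only [← h.Z1_eq] at e1 e2 e3 e4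
  refine (e1'.symm.trans e1.symm).trans (e2.trans ?_)
  have e5 : ∫⁻ ω, ∫⁻ o, φ (B ω, o, W1 ω, Z1 ω, X ω) * (e (B ω) (U ω, W1 ω, Z1 ω, X ω))⁻¹ *
      κ o (W1 ω, B ω, U ω, X ω) ∂mO ∂P = ∫⁻ ω, (∫⁻ o, φ (B ω, o, W1 ω, Z1 ω, X ω) *
      κ o (W1 ω, B ω, U ω, X ω) ∂mO) * (e (B ω) (U ω, W1 ω, Z1 ω, X ω))⁻¹ ∂P := by
    refine lintegral_congr fun ω => ?_
    rw [← lintegral_mul_const _ (by fun_prop)]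
    refine lintegral_congr fun o => ?_
    ring
  refine e5.trans (e3.trans (e4.trans ?_))
  -- The chain rule holds along the law of `(B, U, X)`, but is needed with `b` free; positivity
  -- bridges the two.
  have hae := ae_of_ae_map hUX.aemeasurable (ae_ae_swap_of_ae_prod
    (h.prod_map_UX_ac.ae_le (ae_ae_swap_of_ae_prod h.econdDens_OW1_eq)))
  refine lintegral_congr_ae ?_
  filter_upwards [hae] with ω hω
  have e6 : ∫⁻ b, ∫⁻ y, φ (b, y.1, y.2, Z1 ω, X ω) *
        econdDens P (fun ω => (O ω, W1 ω)) (fun ω => (B ω, U ω, X ω)) (mO.prod mW1)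
          (mB.prod (mU.prod mX)) y (b, U ω, X ω) ∂mO.prod mW1 ∂mB =
      ∫⁻ b, ∫⁻ w, ∫⁻ o, φ (b, o, w, Z1 ω, X ω) * (κ o (w, b, U ω, X ω) *
        econdDens P W1 (fun ω => (U ω, X ω)) mW1 (mU.prod mX) w (U ω, X ω)) ∂mO ∂mW1 ∂mB := by
    refine lintegral_congr_ae ?_
    filter_upwards [hω] with b hb
    rw [← lintegral_prod_symm' (fun y : 𝓞 × 𝓦₁ => φ (b, y.1, y.2, Z1 ω, X ω) *
      (κ y.1 (y.2, b, U ω, X ω) *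
        econdDens P W1 (fun ω => (U ω, X ω)) mW1 (mU.prod mX) y.2 (U ω, X ω))) (by fun_prop)]
    refine lintegral_congr_ae ?_
    filter_upwards [hb] with y hy
    rw [hy]
  rw [e6, lintegral_lintegral_swap (by fun_prop)]
  refine lintegral_congr fun w => ?_
  rw [← lintegral_mul_const _ (by fun_prop)]
  refine lintegral_congr fun b => ?_
  rw [← lintegral_mul_const _ (by fun_prop)]
  simp_rw [mul_assoc]

end ProxySystem

end ProxyIdentities

/-! ### Outcome bridge functions -/

section OutcomeBridge

set_option linter.unusedSectionVars false

/-- A bridge equation holds for almost every value of the whole block. To sum it over the descending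
part, it is needed for almost every value of that part with the rest fixed first. -/
theorem ae_ae_ae_glue {α β γ δ ε : Type*} [MeasurableSpace α] [MeasurableSpace β]
    [MeasurableSpace γ] [MeasurableSpace δ] [MeasurableSpace ε] {mY : Measure α} {mT : Measure β}
    {mK : Measure γ} {m₁ : Measure δ} {mY' : Measure ε} [SFinite mY] [SFinite mT] [SFinite mK]
    [SFinite m₁] [SFinite mY'] {g : α × δ → ε}
    (hg : Measure.QuasiMeasurePreserving g (mY.prod m₁) mY') {p : ε × γ × β → Prop}
    (h : ∀ᵐ t ∂mY'.prod (mK.prod mT), p t) :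
    ∀ᵐ z ∂mY.prod mT, ∀ᵐ k ∂mK, ∀ᵐ r ∂m₁, p (g (z.1, r), k, z.2) := by
  have q := (QuasiMeasurePreserving.prodMap hg
    (Measure.QuasiMeasurePreserving.id (mK.prod mT))).comp
    ((((measurePreserving_prodAssoc mY m₁ (mK.prod mT)).symm
      MeasurableEquiv.prodAssoc).quasiMeasurePreserving.comp
      (quasiMeasurePreserving_insert_middle mY m₁ (mK.prod mT))).comp
      (QuasiMeasurePreserving.prodMap (quasiMeasurePreserving_insert_middle mY mK mT)
        (Measure.QuasiMeasurePreserving.id m₁)))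
  filter_upwards [Measure.ae_ae_of_ae_prod (Measure.ae_ae_of_ae_prod (q.ae h))] with z hz using hz

theorem ae_prod_map_comp {Ω α β γ : Type*} [MeasurableSpace Ω] [MeasurableSpace α]
    [MeasurableSpace β] [MeasurableSpace γ] {P : Measure Ω} [IsFiniteMeasure P] {T : Ω → β}
    {mY : Measure α} [SFinite mY] (hT : Measurable T) {e : β → γ} (he : Measurable e)
    {p : α × γ → Prop} (h : ∀ᵐ z ∂mY.prod (P.map fun ω => e (T ω)), p z) :
    ∀ᵐ z ∂mY.prod (P.map T), p (z.1, e z.2) := by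
  have q : Measure.QuasiMeasurePreserving e (P.map T) (P.map fun ω => e (T ω)) :=
    ⟨he, by rw [Measure.map_map he hT]; rfl⟩
  exact (qmp_keep q).ae h

variable {𝓦₂ : Type*} [MeasurableSpace 𝓦₂]

open scoped ENNReal

variable {Ω 𝓞 𝓦 𝓦₁ 𝓩 𝓩₁ 𝓑 𝓤 𝓧 : Type*} [MeasurableSpace Ω] [MeasurableSpace 𝓞] [MeasurableSpace 𝓦]
  [MeasurableSpace 𝓦₁] [MeasurableSpace 𝓩] [MeasurableSpace 𝓩₁] [MeasurableSpace 𝓑]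
  [MeasurableSpace 𝓤] [MeasurableSpace 𝓧]

namespace ProxySystem

variable {P : Measure Ω} [IsProbabilityMeasure P] {O : Ω → 𝓞} {W : Ω → 𝓦} {W1 : Ω → 𝓦₁} {Z : Ω → 𝓩}
  {Z1 : Ω → 𝓩₁} {B : Ω → 𝓑} {U : Ω → 𝓤} {X : Ω → 𝓧} {Ob : 𝓑 → Ω → 𝓞} {rW : 𝓦 → 𝓦₁}
  {rZ : 𝓩 → 𝓩₁} {mO : Measure 𝓞} {mW : Measure 𝓦} {mW1 : Measure 𝓦₁} {mZ : Measure 𝓩}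
  {mZ1 : Measure 𝓩₁} {mB : Measure 𝓑} {mU : Measure 𝓤} {mX : Measure 𝓧}
  [SigmaFinite mO] [SigmaFinite mW] [SigmaFinite mW1] [SigmaFinite mZ] [SigmaFinite mZ1]
  [SigmaFinite mB] [SigmaFinite mU] [SigmaFinite mX]
  (h : ProxySystem P O W W1 Z Z1 B U X Ob rW rZ mO mW mW1 mZ mZ1 mB mU mX)

include h

variable {mW2 : Measure 𝓦₂} [SigmaFinite mW2] {gW : 𝓦₁ × 𝓦₂ → 𝓦}
  (hg : MeasurePreserving gW (mW1.prod mW2) mW) (hrg : ∀ x y, rW (gW (x, y)) = x)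
  {H : 𝓞 → 𝓦 → 𝓦 → 𝓑 → 𝓧 → ℝ}
  (hH : Measurable fun t : 𝓞 × 𝓦 × 𝓦 × 𝓑 × 𝓧 => H t.1 t.2.1 t.2.2.1 t.2.2.2.1 t.2.2.2.2)

/-- `p(w | z, b, x)` is a mixture of `p(w | u, x)`. -/
theorem econdDens_W_eq : ∀ᵐ z ∂mW.prod (P.map fun ω => (B ω, Z ω, X ω)),
    econdDens P W (fun ω => (Z ω, B ω, X ω)) mW (mZ.prod (mB.prod mX)) z.1
      (z.2.2.1, z.2.1, z.2.2.2) =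
    ∫⁻ u, econdDens P W (fun ω => (U ω, X ω)) mW (mU.prod mX) z.1 (u, z.2.2.2) *
      econdDens P U (fun ω => (B ω, Z ω, X ω)) mU (mB.prod (mZ.prod mX)) u z.2 ∂mU := by
  have hT : Measurable fun ω => (B ω, Z ω, X ω) :=
    h.measurable_B.prodMk (h.measurable_Z.prodMk h.measurable_X)
  refine ae_eq_lintegral_latent h.measurable_U hT h.ac_UBZX
    (p := fun z => econdDens P W (fun ω => (Z ω, B ω, X ω)) mW (mZ.prod (mB.prod mX)) z.1
      (z.2.2.1, z.2.1, z.2.2.2))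
    (k := fun z => econdDens P W (fun ω => (U ω, X ω)) mW (mU.prod mX) z.1 (z.2.1, z.2.2.2.2))
    (by fun_prop) (by fun_prop) fun φ hφ => ?_
  have e1 := lintegral_condDens h.measurable_W
    (h.measurable_Z.prodMk (h.measurable_B.prodMk h.measurable_X)) h.ac_WZBX
    (φ := fun w t => φ (w, t.2.1, t.1, t.2.2)) (by simp only [Function.uncurry_def]; fun_prop)
  exact e1.symm.trans (h.lintegral_W (fun x => φ (x.1, x.2.2.1, x.2.1, x.2.2.2.2)) (by fun_prop))

include hg hrg

/-- `p(o, w̃ | z, b, x)` is a mixture of `p(o, w̃ | b, u, x)`. -/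
theorem lintegral_econdDens_OW_eq : ∀ᵐ z ∂(mO.prod mW1).prod (P.map fun ω => (B ω, Z ω, X ω)),
    ∫⁻ r, econdDens P (fun ω => (O ω, W ω)) (fun ω => (Z ω, B ω, X ω)) (mO.prod mW)
      (mZ.prod (mB.prod mX)) (z.1.1, gW (z.1.2, r)) (z.2.2.1, z.2.1, z.2.2.2) ∂mW2 =
    ∫⁻ u, econdDens P (fun ω => (O ω, W1 ω)) (fun ω => (B ω, U ω, X ω)) (mO.prod mW1)
        (mB.prod (mU.prod mX)) z.1 (z.2.1, u, z.2.2.2) *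
      econdDens P U (fun ω => (B ω, Z ω, X ω)) mU (mB.prod (mZ.prod mX)) u z.2 ∂mU := by
  have hT : Measurable fun ω => (B ω, Z ω, X ω) :=
    h.measurable_B.prodMk (h.measurable_Z.prodMk h.measurable_X)
  have hgm := hg.measurable
  have hrW := h.qmp_rW.measurable
  have hpk : ∀ φ : (𝓞 × 𝓦₁) × 𝓑 × 𝓩 × 𝓧 → ℝ≥0∞, Measurable φ →
      ∫⁻ ω, ∫⁻ y, φ (y, B ω, Z ω, X ω) * (∫⁻ r, econdDens P (fun ω => (O ω, W ω))
        (fun ω => (Z ω, B ω, X ω)) (mO.prod mW) (mZ.prod (mB.prod mX)) (y.1, gW (y.2, r))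
          (Z ω, B ω, X ω) ∂mW2) ∂mO.prod mW1 ∂P =
      ∫⁻ ω, ∫⁻ y, φ (y, B ω, Z ω, X ω) * econdDens P (fun ω => (O ω, W1 ω))
        (fun ω => (B ω, U ω, X ω)) (mO.prod mW1) (mB.prod (mU.prod mX)) y (B ω, U ω, X ω)
          ∂mO.prod mW1 ∂P := by
    intro φ hφ
    have hg' : MeasurePreserving (fun p : (𝓞 × 𝓦₁) × 𝓦₂ => (p.1.1, gW (p.1.2, p.2)))
        ((mO.prod mW1).prod mW2) (mO.prod mW) :=
      ((MeasurePreserving.id mO).prod hg).comp (measurePreserving_prodAssoc mO mW1 mW2)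
    have e1 := lintegral_condDens_glue (h.measurable_O.prodMk h.measurable_W)
      (h.measurable_Z.prodMk (h.measurable_B.prodMk h.measurable_X)) h.ac_OW_ZBX hg'
      (r := fun y => (y.1, rW y.2)) (by fun_prop) (fun x y => Prod.ext rfl (hrg _ _))
      (φ := fun x => φ (x.1, x.2.2.1, x.2.1, x.2.2.2)) (by fun_prop)
    have e2 := h.lintegral_OW1 (φ := fun x => φ (x.1, x.2.2.1, x.2.1, x.2.2.2.2)) (by fun_prop)
    simp only [← h.W1_eq] at e1 e2
    exact e1.symm.trans e2
  have key := ae_eq_lintegral_latent h.measurable_U hT h.ac_UBZX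
    (p := fun z => ∫⁻ r, econdDens P (fun ω => (O ω, W ω)) (fun ω => (Z ω, B ω, X ω)) (mO.prod mW)
      (mZ.prod (mB.prod mX)) (z.1.1, gW (z.1.2, r)) (z.2.2.1, z.2.1, z.2.2.2) ∂mW2)
    (k := fun z => econdDens P (fun ω => (O ω, W1 ω)) (fun ω => (B ω, U ω, X ω)) (mO.prod mW1)
      (mB.prod (mU.prod mX)) z.1 (z.2.2.1, z.2.1, z.2.2.2.2))
    (by fun_prop) (by fun_prop) hpk
  exact key

include hH

/-- By completeness of `Z` the residual of an outcome bridge function vanishes. -/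
theorem outcome_residual_eq_zero
    (hbridge : ∀ᵐ t ∂(mO.prod mW).prod (mZ.prod (mB.prod mX)),
      ∫ w', H t.1.1 t.1.2 w' t.2.2.1 t.2.2.2 * condDens P W (fun ω => (Z ω, B ω, X ω)) mW
          (mZ.prod (mB.prod mX)) w' (t.2.1, t.2.2.1, t.2.2.2) ∂mW =
        condDens P (fun ω => (O ω, W ω)) (fun ω => (Z ω, B ω, X ω)) (mO.prod mW)
          (mZ.prod (mB.prod mX)) t.1 t.2)
    (hint : ∀ᵐ t ∂(mO.prod mW1).prod (mB.prod mX), ∀ᵐ z ∂mZ, Integrable (fun r : 𝓦₂ × 𝓦 =>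
      H t.1.1 (gW (t.1.2, r.1)) r.2 t.2.1 t.2.2 * condDens P W (fun ω => (Z ω, B ω, X ω)) mW
          (mZ.prod (mB.prod mX)) r.2 (z, t.2.1, t.2.2)) (mW2.prod mW))
    (hLp : ∀ᵐ t ∂(mO.prod mW1).prod (mB.prod mX), MemLp (fun u =>
      condDens P (fun ω => (O ω, W1 ω)) (fun ω => (B ω, U ω, X ω)) (mO.prod mW1)
        (mB.prod (mU.prod mX)) t.1 (t.2.1, u, t.2.2) -
        ∫ ws, ∫ w', H t.1.1 (gW (t.1.2, ws)) w' t.2.1 t.2.2 *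
          condDens P W (fun ω => (U ω, X ω)) mW (mU.prod mX) w' (u, t.2.2) ∂mW ∂mW2) 2 (P.map U))
    (hcomp : ∀ᵐ t ∂P.map (fun ω => (B ω, X ω)), ∀ g : 𝓤 → ℝ, Measurable g → MemLp g 2 (P.map U) →
      (∀ᵐ k ∂P.map Z, Integrable (fun u => g u * condDens P U (fun ω => (B ω, Z ω, X ω)) mU
        (mB.prod (mZ.prod mX)) u (t.1, k, t.2)) mU) →
      ((∀ᵐ k ∂P.map Z, ∫ u, g u * condDens P U (fun ω => (B ω, Z ω, X ω)) mU
        (mB.prod (mZ.prod mX)) u (t.1, k, t.2) ∂mU = 0) ↔ ∀ᵐ u ∂P.map U, g u = 0)) :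
    ∀ᵐ z ∂(mO.prod mW1).prod ((mB.prod (P.map X)).prod (P.map U)),
      condDens P (fun ω => (O ω, W1 ω)) (fun ω => (B ω, U ω, X ω)) (mO.prod mW1)
        (mB.prod (mU.prod mX)) z.1 (z.2.1.1, z.2.2, z.2.1.2) -
        ∫ ws, ∫ w', H z.1.1 (gW (z.1.2, ws)) w' z.2.1.1 z.2.1.2 *
          condDens P W (fun ω => (U ω, X ω)) mW (mU.prod mX) w' (z.2.2, z.2.1.2) ∂mW ∂mW2 = 0 := by
  have hgm := hg.measurable
  have hT : Measurable fun ω => (B ω, Z ω, X ω) :=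
    h.measurable_B.prodMk (h.measurable_Z.prodMk h.measurable_X)
  let A : 𝓞 × 𝓦₁ → 𝓑 × 𝓧 → 𝓤 → ℝ := fun y t u =>
    condDens P (fun ω => (O ω, W1 ω)) (fun ω => (B ω, U ω, X ω)) (mO.prod mW1)
      (mB.prod (mU.prod mX)) y (t.1, u, t.2)
  let F : 𝓞 × 𝓦₁ → 𝓑 × 𝓧 → 𝓦₂ → 𝓦 → ℝ := fun y t r₁ r₂ => H y.1 (gW (y.2, r₁)) r₂ t.1 t.2
  let b : 𝓦 → 𝓑 × 𝓧 → 𝓤 → ℝ := fun r t u =>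
    condDens P W (fun ω => (U ω, X ω)) mW (mU.prod mX) r (u, t.2)
  have hA : Measurable fun z : (𝓞 × 𝓦₁) × (𝓑 × 𝓧) × 𝓤 => A z.1 z.2.1 z.2.2 := by fun_prop
  have hF : Measurable fun z : (𝓞 × 𝓦₁) × (𝓑 × 𝓧) × 𝓦₂ × 𝓦 => F z.1 z.2.1 z.2.2.1 z.2.2.2 :=
    hH.comp (f := fun z : (𝓞 × 𝓦₁) × (𝓑 × 𝓧) × 𝓦₂ × 𝓦 =>
      (z.1.1, gW (z.1.2, z.2.2.1), z.2.2.2, z.2.1.1, z.2.1.2)) (by fun_prop)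
  have hb : Measurable fun z : 𝓦 × (𝓑 × 𝓧) × 𝓤 => b z.1 z.2.1 z.2.2 := by fun_prop
  have hg' : MeasurePreserving (fun p : (𝓞 × 𝓦₁) × 𝓦₂ => (p.1.1, gW (p.1.2, p.2)))
      ((mO.prod mW1).prod mW2) (mO.prod mW) :=
    ((MeasurePreserving.id mO).prod hg).comp (measurePreserving_prodAssoc mO mW1 mW2)
  have hL1 := ae_ofReal_integral_condDens (h.measurable_O.prodMk h.measurable_W)
    (h.measurable_Z.prodMk (h.measurable_B.prodMk h.measurable_X)) h.ac_OW_ZBX hg'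
  have hL2 := ae_prod_map_comp (e := fun t : 𝓑 × 𝓩 × 𝓧 => (t.2.1, t.1, t.2.2)) hT (by fun_prop) hL1
  have hbr := ae_ae_ae_glue hg'.quasiMeasurePreserving hbridge
  have hBX : P.map (fun ω => (B ω, X ω)) ≪ mB.prod mX := h.ac_BX
  -- Here `D` is `p(w'|z,b,x)`, and `L` is `p(o,w̃|z,b,x)` written as the sum over `w*` of the right
  -- side of the bridge equation.
  have key := ae_bridgeResidual_eq_zero (m₁ := mW2) (m₂ := mW) (mY := mO.prod mW1) (A := A)
    (h := F) (b := b)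
    (D := fun r k t => condDens P W (fun ω => (Z ω, B ω, X ω)) mW
          (mZ.prod (mB.prod mX)) r (k, t.1, t.2))
    (L := fun y k t => ∫ r, condDens P (fun ω => (O ω, W ω)) (fun ω => (Z ω, B ω, X ω))
      (mO.prod mW) (mZ.prod (mB.prod mX)) (y.1, gW (y.2, r)) (k, t.1, t.2) ∂mW2)
    hBX h.ac_BZX h.ac_Z hA hF hb (fun _ _ _ => condDens_nonneg _ _ _ _ _ _ _)
    (fun _ _ _ => condDens_nonneg _ _ _ _ _ _ _) (fun _ _ _ => condDens_nonneg _ _ _ _ _ _ _)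
    h.econdDens_W_eq
    (fun _ _ _ => integral_nonneg fun _ => condDens_nonneg _ _ _ _ _ _ _)
    ?_ ?_ hLp hcomp
  -- Completeness speaks of the law of `(B, X)`, but the formula averages over `X` at a fixed `b`.
  -- Positivity passes to the product of the reference measure of `b` and the law of `X`.
  · exact ae_prod_of_ae_ae_ae (measurable_bridgeResidual hA hF hb) (h.prod_map_X_ac.ae_le key)
  · filter_upwards [hL2, h.lintegral_econdDens_OW_eq hg hrg] with z h1 h2
    exact h1.trans h2
  · filter_upwards [hint, hbr] with z h1 h2
    filter_upwards [h1, h2] with k h1 h2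
    exact ⟨h1, integral_congr_ae h2⟩

/-- The law of the potential outcomes in terms of an outcome bridge function. -/
theorem lintegral_Ob_eq_outcome
    (hR : ∀ᵐ z ∂(mO.prod mW1).prod ((mB.prod (P.map X)).prod (P.map U)),
      condDens P (fun ω => (O ω, W1 ω)) (fun ω => (B ω, U ω, X ω)) (mO.prod mW1)
        (mB.prod (mU.prod mX)) z.1 (z.2.1.1, z.2.2, z.2.1.2) -
        ∫ ws, ∫ w', H z.1.1 (gW (z.1.2, ws)) w' z.2.1.1 z.2.1.2 *
          condDens P W (fun ω => (U ω, X ω)) mW (mU.prod mX) w' (z.2.2, z.2.1.2) ∂mW ∂mW2 = 0)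
    (hint : ∀ᵐ t ∂(mO.prod mW1).prod (mB.prod mX), ∀ᵐ z ∂mZ1, Integrable (fun r : 𝓦₂ × 𝓦 =>
      H t.1.1 (gW (t.1.2, r.1)) r.2 t.2.1 t.2.2 * dens P (fun ω => (W ω, Z1 ω, X ω))
        (mW.prod (mZ1.prod mX)) (r.2, z, t.2.2)) (mW2.prod mW))
    {φ : 𝓑 × 𝓞 × 𝓦₁ × 𝓩₁ × 𝓧 → ℝ≥0∞} (hφ : Measurable φ) :
    ∫⁻ b, ∫⁻ ω, φ (b, Ob b ω, W1 ω, Z1 ω, X ω) ∂P ∂mB =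
      ∫⁻ z, φ z * ENNReal.ofReal (∫ ws, ∫ w', H z.2.1 (gW (z.2.2.1, ws)) w' z.1 z.2.2.2.2 *
        dens P (fun ω => (W ω, Z1 ω, X ω)) (mW.prod (mZ1.prod mX)) (w', z.2.2.2.1, z.2.2.2.2)
          ∂mW ∂mW2) ∂mB.prod (mO.prod (mW1.prod (mZ1.prod mX))) := by
  have hgm := hg.measurable
  have hUX := h.measurable_U.prodMk h.measurable_X
  have hV : Measurable fun ω => (Z1 ω, X ω) := h.measurable_Z1.prodMk h.measurable_X
  have hUV := h.measurable_U.prodMk hV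
  have hrZ := h.qmp_rZ.measurable
  have hd := measurable_dens P (fun ω => (W ω, Z1 ω, X ω)) (mW.prod (mZ1.prod mX))
  rw [h.lintegral_Ob hφ]
  have e1 : ∀ ω, ∫⁻ b, ∫⁻ y, φ (b, y.1, y.2, Z1 ω, X ω) *
        econdDens P (fun ω => (O ω, W1 ω)) (fun ω => (B ω, U ω, X ω)) (mO.prod mW1)
          (mB.prod (mU.prod mX)) y (b, U ω, X ω) ∂mO.prod mW1 ∂mB =
      ∫⁻ q, φ (q.1, q.2.1, q.2.2, Z1 ω, X ω) * ENNReal.ofReal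
        (condDens P (fun ω => (O ω, W1 ω)) (fun ω => (B ω, U ω, X ω)) (mO.prod mW1)
          (mB.prod (mU.prod mX)) q.2 (q.1, U ω, X ω)) ∂mB.prod (mO.prod mW1) := fun ω =>
    (lintegral_prod (fun q : 𝓑 × 𝓞 × 𝓦₁ => φ (q.1, q.2.1, q.2.2, Z1 ω, X ω) * ENNReal.ofReal
        (condDens P (fun ω => (O ω, W1 ω)) (fun ω => (B ω, U ω, X ω)) (mO.prod mW1)
          (mB.prod (mU.prod mX)) q.2 (q.1, U ω, X ω))) (by fun_prop)).symm
  simp_rw [e1]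
  -- `p(w,z̃,x) = ∫ p(w|u,x) p(u,z̃,x) du`, because `W ⟂ Z̃ | U,X`.
  have hD : ∀ᵐ z ∂mW.prod (mZ1.prod mX), ENNReal.ofReal
      (dens P (fun ω => (W ω, Z1 ω, X ω)) (mW.prod (mZ1.prod mX)) z) =
      ∫⁻ u, ENNReal.ofReal (condDens P W (fun ω => (U ω, X ω)) mW (mU.prod mX) z.1 (u, z.2.2)) *
        ENNReal.ofReal (dens P (fun ω => (U ω, Z1 ω, X ω)) (mU.prod (mZ1.prod mX)) (u, z.2)) ∂mU := by
    refine ae_eq_lintegral_latent_dens h.measurable_U hV h.ac_UZ1X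
      (k := fun z => ENNReal.ofReal
        (condDens P W (fun ω => (U ω, X ω)) mW (mU.prod mX) z.1 (z.2.1, z.2.2.2)))
      (by fun_prop) (by fun_prop) fun φ hφ => ?_
    have e2 := h.lintegral_W (fun x => φ (x.1, rZ x.2.1, x.2.2.2.2)) (by fun_prop)
    simp only [← h.Z1_eq] at e2
    exact (lintegral_comp_dens (h.measurable_W.prodMk hV) h.ac_WZ1X hφ).symm.trans e2
  -- The residual vanishes for `X` and `U` drawn independently from their marginals, hence also
  -- along their joint law.
  have hXU : P.map (fun ω => (X ω, U ω)) ≪ (P.map X).prod (P.map U) :=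
    ac_of_quasiMeasurePreserving hUX (ac_prod_self h.measurable_U h.measurable_X h.ac_UX)
      Measure.measurePreserving_swap.quasiMeasurePreserving
  have q1 : Measure.QuasiMeasurePreserving (fun v : 𝓤 × 𝓩₁ × 𝓧 => (v.2.2, v.1))
      (P.map fun ω => (U ω, Z1 ω, X ω)) ((P.map X).prod (P.map U)) :=
    ⟨by fun_prop, by rw [Measure.map_map (by fun_prop) hUV]; exact hXU⟩
  have q2 : Measure.QuasiMeasurePreserving
      (fun z : (𝓑 × 𝓞 × 𝓦₁) × 𝓤 × 𝓩₁ × 𝓧 => (z.1.2, (z.1.1, z.2.2.2), z.2.1))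
      ((mB.prod (mO.prod mW1)).prod (P.map fun ω => (U ω, Z1 ω, X ω)))
      ((mO.prod mW1).prod ((mB.prod (P.map X)).prod (P.map U))) :=
    (qmp_keep ((measurePreserving_prodAssoc mB (P.map X) (P.map U)).symm
      MeasurableEquiv.prodAssoc).quasiMeasurePreserving).comp
      ((measurePreserving_prodAssoc (mO.prod mW1) mB _).quasiMeasurePreserving.comp
        (QuasiMeasurePreserving.prodMap
          (Measure.measurePreserving_swap (μ := mB) (ν := mO.prod mW1)).quasiMeasurePreserving q1))
  have hG : Measurable fun z : ((𝓑 × 𝓞 × 𝓦₁) × 𝓩₁ × 𝓧) × 𝓦₂ × 𝓦 =>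
      H z.1.1.2.1 (gW (z.1.1.2.2, z.2.1)) z.2.2 z.1.1.1 z.1.2.2 :=
    hH.comp (f := fun z : ((𝓑 × 𝓞 × 𝓦₁) × 𝓩₁ × 𝓧) × 𝓦₂ × 𝓦 =>
      (z.1.1.2.1, gW (z.1.1.2.2, z.2.1), z.2.2, z.1.1.1, z.1.2.2)) (by fun_prop)
  have hint' : ∀ᵐ z ∂(mB.prod (mO.prod mW1)).prod (mZ1.prod mX), Integrable (fun r : 𝓦₂ × 𝓦 =>
      H z.1.2.1 (gW (z.1.2.2, r.1)) r.2 z.1.1 z.2.2 * dens P (fun ω => (W ω, Z1 ω, X ω))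
        (mW.prod (mZ1.prod mX)) (r.2, z.2)) (mW2.prod mW) := by
    have hm : MeasurableSet {z : ((𝓞 × 𝓦₁) × 𝓑 × 𝓧) × 𝓩₁ | Integrable (fun r : 𝓦₂ × 𝓦 =>
      H z.1.1.1 (gW (z.1.1.2, r.1)) r.2 z.1.2.1 z.1.2.2 * dens P (fun ω => (W ω, Z1 ω, X ω))
        (mW.prod (mZ1.prod mX)) (r.2, z.2, z.1.2.2)) (mW2.prod mW)} := by
      refine measurableSet_integrable (f := fun (z : ((𝓞 × 𝓦₁) × 𝓑 × 𝓧) × 𝓩₁) (r : 𝓦₂ × 𝓦) =>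
        H z.1.1.1 (gW (z.1.1.2, r.1)) r.2 z.1.2.1 z.1.2.2 * dens P (fun ω => (W ω, Z1 ω, X ω))
          (mW.prod (mZ1.prod mX)) (r.2, z.2, z.1.2.2)) ?_
      refine Measurable.stronglyMeasurable ?_
      simp only [Function.uncurry_def]
      exact (hH.comp (f := fun p : (((𝓞 × 𝓦₁) × 𝓑 × 𝓧) × 𝓩₁) × 𝓦₂ × 𝓦 =>
        (p.1.1.1.1, gW (p.1.1.1.2, p.2.1), p.2.2, p.1.1.2.1, p.1.1.2.2)) (by fun_prop)).mul
        (by fun_prop)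
    have hi := (Measure.ae_prod_iff_ae_ae hm).2 hint
    have q3 : Measure.QuasiMeasurePreserving
        (fun z : (𝓑 × 𝓞 × 𝓦₁) × 𝓩₁ × 𝓧 => ((z.1.2, (z.1.1, z.2.2)), z.2.1))
        ((mB.prod (mO.prod mW1)).prod (mZ1.prod mX))
        (((mO.prod mW1).prod (mB.prod mX)).prod mZ1) :=
      (QuasiMeasurePreserving.prodMap (measurePreserving_prodAssoc (mO.prod mW1) mB
          mX).quasiMeasurePreserving (Measure.QuasiMeasurePreserving.id mZ1)).comp
        (((measurePreserving_prodAssoc ((mO.prod mW1).prod mB) mX mZ1).symm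
          MeasurableEquiv.prodAssoc).quasiMeasurePreserving.comp
          (QuasiMeasurePreserving.prodMap
          (Measure.measurePreserving_swap (μ := mB) (ν := mO.prod mW1)).quasiMeasurePreserving
          (Measure.measurePreserving_swap (μ := mZ1) (ν := mX)).quasiMeasurePreserving))
    exact q3.ae hi
  have e3 := lintegral_latent_eq_of_residual (mQ := mB.prod (mO.prod mW1)) (m₁ := mW2) (m₂ := mW)
    h.measurable_U hV h.ac_UZ1X
    (A := fun z => condDens P (fun ω => (O ω, W1 ω)) (fun ω => (B ω, U ω, X ω)) (mO.prod mW1)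
      (mB.prod (mU.prod mX)) z.1.2 (z.1.1, z.2.1, z.2.2.2))
    (b := fun z => condDens P W (fun ω => (U ω, X ω)) mW (mU.prod mX) z.1 (z.2.1, z.2.2.2))
    (D := dens P (fun ω => (W ω, Z1 ω, X ω)) (mW.prod (mZ1.prod mX)))
    (g := fun z r₁ r₂ => H z.1.2.1 (gW (z.1.2.2, r₁)) r₂ z.1.1 z.2.2)
    (φ := fun z => φ (z.1.1, z.1.2.1, z.1.2.2, z.2)) (by fun_prop)
    (fun _ => condDens_nonneg _ _ _ _ _ _ _) (by fun_prop)
    (fun _ => condDens_nonneg _ _ _ _ _ _ _) (fun _ => dens_nonneg _ _ _ _) hD hG hint'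
    (q2.ae hR) (by fun_prop)
  refine e3.trans ?_
  have q4 : MeasurePreserving
      (fun z : (𝓑 × 𝓞 × 𝓦₁) × 𝓩₁ × 𝓧 => (z.1.1, z.1.2.1, z.1.2.2, z.2))
      ((mB.prod (mO.prod mW1)).prod (mZ1.prod mX))
      (mB.prod (mO.prod (mW1.prod (mZ1.prod mX)))) :=
    ((MeasurePreserving.id mB).prod (measurePreserving_prodAssoc mO mW1 (mZ1.prod mX))).comp
      (measurePreserving_prodAssoc mB (mO.prod mW1) (mZ1.prod mX))
  have hI : Measurable fun z : 𝓑 × 𝓞 × 𝓦₁ × 𝓩₁ × 𝓧 =>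
      ∫ ws, ∫ w', H z.2.1 (gW (z.2.2.1, ws)) w' z.1 z.2.2.2.2 *
        dens P (fun ω => (W ω, Z1 ω, X ω)) (mW.prod (mZ1.prod mX)) (w', z.2.2.2.1, z.2.2.2.2)
          ∂mW ∂mW2 := by
    have h1 : Measurable fun p : ((𝓑 × 𝓞 × 𝓦₁ × 𝓩₁ × 𝓧) × 𝓦₂) × 𝓦 =>
        H p.1.1.2.1 (gW (p.1.1.2.2.1, p.1.2)) p.2 p.1.1.1 p.1.1.2.2.2.2 *
        dens P (fun ω => (W ω, Z1 ω, X ω)) (mW.prod (mZ1.prod mX))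
          (p.2, p.1.1.2.2.2.1, p.1.1.2.2.2.2) :=
      (hH.comp (f := fun p : ((𝓑 × 𝓞 × 𝓦₁ × 𝓩₁ × 𝓧) × 𝓦₂) × 𝓦 =>
        (p.1.1.2.1, gW (p.1.1.2.2.1, p.1.2), p.2, p.1.1.1, p.1.1.2.2.2.2)) (by fun_prop)).mul
        (by fun_prop)
    exact ((h1.stronglyMeasurable.integral_prod_right' (ν := mW)).integral_prod_right'
      (ν := mW2)).measurable
  exact q4.lintegral_comp (f := fun z => φ z * ENNReal.ofReal (∫ ws, ∫ w',
    H z.2.1 (gW (z.2.2.1, ws)) w' z.1 z.2.2.2.2 * dens P (fun ω => (W ω, Z1 ω, X ω))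
      (mW.prod (mZ1.prod mX)) (w', z.2.2.2.1, z.2.2.2.2) ∂mW ∂mW2)) (by fun_prop)

end ProxySystem

end OutcomeBridge

/-! ### Treatment bridge functions -/

section TreatmentBridge

set_option linter.unusedSectionVars false

section Symm

open scoped ENNReal

variable {Ω α β γ : Type*} [MeasurableSpace Ω] [MeasurableSpace α] [MeasurableSpace β]
  [MeasurableSpace γ] {P : Measure Ω} [IsFiniteMeasure P] {Y : Ω → α} {T : Ω → β} {K : Ω → γ}
  {mY : Measure α} {mT : Measure β} {mK : Measure γ} [SigmaFinite mY] [SigmaFinite mT]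
  [SigmaFinite mK]

/-- Symmetry of conditional independence. -/
theorem lintegral_condDens_symm (hK : Measurable K) (hT : Measurable T)
    (hac : P.map (fun ω => (K ω, T ω)) ≪ mK.prod mT) {k : α × β → ℝ≥0∞} (hk : Measurable k)
    (hci : ∀ φ : α × γ × β → ℝ≥0∞, Measurable φ → ∫⁻ ω, φ (Y ω, K ω, T ω) ∂P =
      ∫⁻ ω, ∫⁻ y, φ (y, K ω, T ω) * k (y, T ω) ∂mY ∂P)
    {φ : α × γ × β → ℝ≥0∞} (hφ : Measurable φ) :
    ∫⁻ ω, φ (Y ω, K ω, T ω) ∂P =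
      ∫⁻ ω, ∫⁻ c, φ (Y ω, c, T ω) * econdDens P K T mK mT c (T ω) ∂mK ∂P := by
  have e2 := lintegral_condDens hK hT hac (φ := fun c t => ∫⁻ y, φ (y, c, t) * k (y, t) ∂mY)
    (by simp only [Function.uncurry_def]; fun_prop)
  have e3 := hci (fun x => ∫⁻ c, φ (x.1, c, x.2.2) * econdDens P K T mK mT c x.2.2 ∂mK)
    (by fun_prop)
  refine ((hci φ hφ).trans e2).trans (Eq.trans ?_ e3.symm)
  refine lintegral_congr fun ω => ?_
  have e4 : ∀ c, (∫⁻ y, φ (y, c, T ω) * k (y, T ω) ∂mY) * econdDens P K T mK mT c (T ω) =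
      ∫⁻ y, φ (y, c, T ω) * k (y, T ω) * econdDens P K T mK mT c (T ω) ∂mY := fun c =>
    (lintegral_mul_const _ (by fun_prop)).symm
  simp_rw [e4]
  rw [lintegral_lintegral_swap (by fun_prop)]
  refine lintegral_congr fun y => ?_
  rw [← lintegral_mul_const _ (by fun_prop)]
  refine lintegral_congr fun c => ?_
  ring

/-- Given `T`, the law of `K` does not change when `Y` is known, so weighting by `1 / p(K|T)` frees
`K` even in the presence of `Y`. -/
theorem lintegral_mul_inv_condDens_symm (hK : Measurable K) (hT : Measurable T)
    (hac : P.map (fun ω => (K ω, T ω)) ≪ mK.prod mT)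
    (hne : ∀ᵐ z ∂mK.prod (P.map T), econdDens P K T mK mT z.1 z.2 ≠ 0)
    {k : α × β → ℝ≥0∞} (hk : Measurable k)
    (hci : ∀ φ : α × γ × β → ℝ≥0∞, Measurable φ → ∫⁻ ω, φ (Y ω, K ω, T ω) ∂P =
      ∫⁻ ω, ∫⁻ y, φ (y, K ω, T ω) * k (y, T ω) ∂mY ∂P)
    {φ : α × γ × β → ℝ≥0∞} (hφ : Measurable φ) :
    ∫⁻ ω, φ (Y ω, K ω, T ω) * (econdDens P K T mK mT (K ω) (T ω))⁻¹ ∂P =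
      ∫⁻ ω, ∫⁻ c, φ (Y ω, c, T ω) ∂mK ∂P := by
  have e1 := lintegral_condDens_symm hK hT hac hk hci
    (φ := fun x => φ x * (econdDens P K T mK mT x.2.1 x.2.2)⁻¹) (by fun_prop)
  refine e1.trans (lintegral_congr_ae ?_)
  filter_upwards [ae_of_ae_map hT.aemeasurable (ae_ae_swap_of_ae_prod hne)] with ω hω
  refine lintegral_congr_ae ?_
  filter_upwards [hω] with c hc
  rw [mul_assoc, ENNReal.inv_mul_cancel hc (econdDens_ne_top _ _ _ _ _ _ _), mul_one]

theorem measurePreserving_prod_left_comm (ma : Measure α) (mb : Measure β) (mc : Measure γ)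
    [SFinite ma] [SFinite mb] [SFinite mc] :
    MeasurePreserving (fun p : β × α × γ => (p.2.1, p.1, p.2.2))
      (mb.prod (ma.prod mc)) (ma.prod (mb.prod mc)) :=
  (measurePreserving_prodAssoc ma mb mc).comp
    (((Measure.measurePreserving_swap (μ := mb) (ν := ma)).prod (MeasurePreserving.id mc)).comp
      ((measurePreserving_prodAssoc mb ma mc).symm MeasurableEquiv.prodAssoc))

end Symm

variable {𝓩₂ : Type*} [MeasurableSpace 𝓩₂]

open scoped ENNReal

variable {Ω 𝓞 𝓦 𝓦₁ 𝓩 𝓩₁ 𝓑 𝓤 𝓧 : Type*} [MeasurableSpace Ω] [MeasurableSpace 𝓞] [MeasurableSpace 𝓦]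
  [MeasurableSpace 𝓦₁] [MeasurableSpace 𝓩] [MeasurableSpace 𝓩₁] [MeasurableSpace 𝓑]
  [MeasurableSpace 𝓤] [MeasurableSpace 𝓧]

namespace ProxySystem

variable {P : Measure Ω} [IsProbabilityMeasure P] {O : Ω → 𝓞} {W : Ω → 𝓦} {W1 : Ω → 𝓦₁} {Z : Ω → 𝓩}
  {Z1 : Ω → 𝓩₁} {B : Ω → 𝓑} {U : Ω → 𝓤} {X : Ω → 𝓧} {Ob : 𝓑 → Ω → 𝓞} {rW : 𝓦 → 𝓦₁}
  {rZ : 𝓩 → 𝓩₁} {mO : Measure 𝓞} {mW : Measure 𝓦} {mW1 : Measure 𝓦₁} {mZ : Measure 𝓩}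
  {mZ1 : Measure 𝓩₁} {mB : Measure 𝓑} {mU : Measure 𝓤} {mX : Measure 𝓧}
  [SigmaFinite mO] [SigmaFinite mW] [SigmaFinite mW1] [SigmaFinite mZ] [SigmaFinite mZ1]
  [SigmaFinite mB] [SigmaFinite mU] [SigmaFinite mX]
  (h : ProxySystem P O W W1 Z Z1 B U X Ob rW rZ mO mW mW1 mZ mZ1 mB mU mX)

include h

/-- `W ⟂ Z | B, U, X`. -/
theorem lintegral_Z {φ : 𝓦 × 𝓩 × 𝓑 × 𝓤 × 𝓧 → ℝ≥0∞} (hφ : Measurable φ) :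
    ∫⁻ ω, φ (W ω, Z ω, B ω, U ω, X ω) ∂P = ∫⁻ ω, ∫⁻ z, φ (W ω, z, B ω, U ω, X ω) *
      econdDens P Z (fun ω => (B ω, U ω, X ω)) mZ (mB.prod (mU.prod mX)) z (B ω, U ω, X ω)
        ∂mZ ∂P :=
  lintegral_condDens_symm h.measurable_Z
    (h.measurable_B.prodMk (h.measurable_U.prodMk h.measurable_X)) h.ac_ZBUX
    (k := fun x => econdDens P W (fun ω => (U ω, X ω)) mW (mU.prod mX) x.1 x.2.2) (by fun_prop)
    h.lintegral_W hφ

/-- `(O, W1) ⟂ Z | B, U, X`. -/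
theorem lintegral_Z_OW1 {φ : (𝓞 × 𝓦₁) × 𝓩 × 𝓑 × 𝓤 × 𝓧 → ℝ≥0∞} (hφ : Measurable φ) :
    ∫⁻ ω, φ ((O ω, W1 ω), Z ω, B ω, U ω, X ω) ∂P =
      ∫⁻ ω, ∫⁻ z, φ ((O ω, W1 ω), z, B ω, U ω, X ω) *
        econdDens P Z (fun ω => (B ω, U ω, X ω)) mZ (mB.prod (mU.prod mX)) z (B ω, U ω, X ω)
          ∂mZ ∂P :=
  lintegral_condDens_symm h.measurable_Z
    (h.measurable_B.prodMk (h.measurable_U.prodMk h.measurable_X)) h.ac_ZBUX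
    (k := fun x => econdDens P (fun ω => (O ω, W1 ω)) (fun ω => (B ω, U ω, X ω)) (mO.prod mW1)
      (mB.prod (mU.prod mX)) x.1 x.2) (by fun_prop) (fun _ => h.lintegral_OW1) hφ

/-- At the sample `p(B|U,X)` is positive. Without that, a real quotient by zero is `0` while the
extended inverse is `∞`. -/
theorem ae_ofReal_weight_eq : ∀ᵐ ω ∂P, ∀ z, ENNReal.ofReal
    (condDens P Z1 (fun ω => (U ω, X ω)) mZ1 (mU.prod mX) z (U ω, X ω) /
      condDens P B (fun ω => (U ω, X ω)) mB (mU.prod mX) (B ω) (U ω, X ω)) =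
    econdDens P Z1 (fun ω => (U ω, X ω)) mZ1 (mU.prod mX) z (U ω, X ω) *
      (econdDens P B (fun ω => (U ω, X ω)) mB (mU.prod mX) (B ω) (U ω, X ω))⁻¹ := by
  have hUX := h.measurable_U.prodMk h.measurable_X
  filter_upwards [ae_of_ae_map (h.measurable_B.prodMk hUX).aemeasurable
    (ae_econdDens_ne_zero h.measurable_B hUX h.ac_BUX)] with ω hω z
  rw [econdDens, ne_eq, ENNReal.ofReal_eq_zero, not_le] at hω
  rw [ENNReal.ofReal_div_of_pos hω]
  rfl

/-- `p(z | w, b, x)` is a mixture of `p(z | b, u, x)`. -/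
theorem econdDens_Z_eq : ∀ᵐ z ∂mZ.prod (P.map fun ω => (B ω, W ω, X ω)),
    econdDens P Z (fun ω => (W ω, B ω, X ω)) mZ (mW.prod (mB.prod mX)) z.1
      (z.2.2.1, z.2.1, z.2.2.2) =
    ∫⁻ u, econdDens P Z (fun ω => (B ω, U ω, X ω)) mZ (mB.prod (mU.prod mX)) z.1
        (z.2.1, u, z.2.2.2) *
      econdDens P U (fun ω => (B ω, W ω, X ω)) mU (mB.prod (mW.prod mX)) u z.2 ∂mU := by
  have hT : Measurable fun ω => (B ω, W ω, X ω) :=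
    h.measurable_B.prodMk (h.measurable_W.prodMk h.measurable_X)
  have hpk : ∀ φ : 𝓩 × 𝓑 × 𝓦 × 𝓧 → ℝ≥0∞, Measurable φ →
      ∫⁻ ω, ∫⁻ z, φ (z, B ω, W ω, X ω) * econdDens P Z (fun ω => (W ω, B ω, X ω)) mZ
        (mW.prod (mB.prod mX)) z (W ω, B ω, X ω) ∂mZ ∂P =
      ∫⁻ ω, ∫⁻ z, φ (z, B ω, W ω, X ω) * econdDens P Z (fun ω => (B ω, U ω, X ω)) mZ
        (mB.prod (mU.prod mX)) z (B ω, U ω, X ω) ∂mZ ∂P := by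
    intro φ hφ
    have e1 := lintegral_condDens h.measurable_Z
      (h.measurable_W.prodMk (h.measurable_B.prodMk h.measurable_X)) h.ac_ZWBX
      (φ := fun w t => φ (w, t.2.1, t.1, t.2.2)) (by simp only [Function.uncurry_def]; fun_prop)
    exact e1.symm.trans
      (h.lintegral_Z (φ := fun x => φ (x.2.1, x.2.2.1, x.1, x.2.2.2.2)) (by fun_prop))
  have key := ae_eq_lintegral_latent h.measurable_U hT h.ac_UBWX
    (p := fun z => econdDens P Z (fun ω => (W ω, B ω, X ω)) mZ (mW.prod (mB.prod mX)) z.1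
      (z.2.2.1, z.2.1, z.2.2.2))
    (k := fun z => econdDens P Z (fun ω => (B ω, U ω, X ω)) mZ (mB.prod (mU.prod mX)) z.1
      (z.2.2.1, z.2.1, z.2.2.2.2))
    (by fun_prop) (by fun_prop) hpk
  exact key

/-- The law of the potential outcomes by inverse probability weighting. -/
theorem lintegral_Ob_eq_weight {φ : 𝓑 × 𝓞 × 𝓦₁ × 𝓩₁ × 𝓧 → ℝ≥0∞} (hφ : Measurable φ) :
    ∫⁻ b, ∫⁻ ω, φ (b, Ob b ω, W1 ω, Z1 ω, X ω) ∂P ∂mB =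
      ∫⁻ ω, ∫⁻ z, φ (B ω, O ω, W1 ω, z, X ω) * ENNReal.ofReal
        (condDens P Z1 (fun ω => (U ω, X ω)) mZ1 (mU.prod mX) z (U ω, X ω) /
          condDens P B (fun ω => (U ω, X ω)) mB (mU.prod mX) (B ω) (U ω, X ω)) ∂mZ1 ∂P := by
  have hUX := h.measurable_U.prodMk h.measurable_X
  rw [h.lintegral_Ob hφ]
  let α : 𝓞 × 𝓦₁ → 𝓑 × 𝓤 × 𝓧 → ℝ≥0∞ := econdDens P (fun ω => (O ω, W1 ω))
    (fun ω => (B ω, U ω, X ω)) (mO.prod mW1) (mB.prod (mU.prod mX))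
  have hα : Measurable (Function.uncurry α) := by
    simp only [Function.uncurry_def, α]; fun_prop
  let ζ : 𝓩₁ → 𝓤 × 𝓧 → ℝ≥0∞ := econdDens P Z1 (fun ω => (U ω, X ω)) mZ1 (mU.prod mX)
  have hζ : Measurable (Function.uncurry ζ) := by
    simp only [Function.uncurry_def, ζ]; fun_prop
  let e : 𝓑 → 𝓤 × 𝓧 → ℝ≥0∞ := econdDens P B (fun ω => (U ω, X ω)) mB (mU.prod mX)
  have he : Measurable (Function.uncurry e) := by
    simp only [Function.uncurry_def, e]; fun_prop
  have e1 := lintegral_condDens h.measurable_Z1 hUX h.ac_Z1UX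
    (φ := fun z t => ∫⁻ b, ∫⁻ y, φ (b, y.1, y.2, z, t.2) * α y (b, t.1, t.2) ∂mO.prod mW1 ∂mB)
    (by simp only [Function.uncurry_def]; fun_prop)
  have e2 : ∫⁻ ω, ∫⁻ z, φ (B ω, O ω, W1 ω, z, X ω) * ENNReal.ofReal
        (condDens P Z1 (fun ω => (U ω, X ω)) mZ1 (mU.prod mX) z (U ω, X ω) /
          condDens P B (fun ω => (U ω, X ω)) mB (mU.prod mX) (B ω) (U ω, X ω)) ∂mZ1 ∂P =
      ∫⁻ ω, (∫⁻ z, φ (B ω, O ω, W1 ω, z, X ω) * ζ z (U ω, X ω) ∂mZ1) *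
        (e (B ω) (U ω, X ω))⁻¹ ∂P := by
    refine lintegral_congr_ae ?_
    filter_upwards [h.ae_ofReal_weight_eq] with ω hω
    rw [← lintegral_mul_const _ (by fun_prop)]
    refine lintegral_congr fun z => ?_
    rw [hω, mul_assoc]
  have e3 := h.lintegral_OW1 (φ := fun x => (∫⁻ z, φ (x.2.2.1, x.1.1, x.1.2, z, x.2.2.2.2) *
    ζ z x.2.2.2 ∂mZ1) * (e x.2.2.1 x.2.2.2)⁻¹) (by fun_prop)
  have e4 := lintegral_mul_inv_condDens h.measurable_B hUX h.ac_BUX h.ae_econdDens_BUX_ne_zero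
    (φ := fun x => ∫⁻ y, (∫⁻ z, φ (x.1, y.1, y.2, z, x.2.2) * ζ z x.2 ∂mZ1) * α y x
      ∂mO.prod mW1) (by fun_prop)
  simp only at e1 e2 e3 e4
  -- Both sides reduce to the integral of `φ(b,o,w̃,z̃,x) p(o,w̃|b,u,x) p(z̃|u,x)` over free `b, o,
  -- w̃, z̃`, averaged over `(U, X)`.
  rw [e2]
  refine e1.trans (Eq.trans ?_ (e3.trans (Eq.trans ?_ e4)).symm)
  · refine lintegral_congr fun ω => ?_
    have e5 : ∀ z, (∫⁻ b, ∫⁻ y, φ (b, y.1, y.2, z, X ω) * α y (b, U ω, X ω) ∂mO.prod mW1 ∂mB) *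
        ζ z (U ω, X ω) = ∫⁻ b, ∫⁻ y, φ (b, y.1, y.2, z, X ω) * ζ z (U ω, X ω) * α y (b, U ω, X ω)
          ∂mO.prod mW1 ∂mB := fun z => by
      rw [← lintegral_mul_const _ (by fun_prop)]
      refine lintegral_congr fun b => ?_
      rw [← lintegral_mul_const _ (by fun_prop)]
      refine lintegral_congr fun y => ?_
      ring
    refine (lintegral_congr e5).trans ?_
    rw [lintegral_lintegral_swap (by fun_prop)]
    refine lintegral_congr fun b => ?_
    rw [lintegral_lintegral_swap (by fun_prop)]
    refine lintegral_congr fun y => ?_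
    rw [lintegral_mul_const _ (by fun_prop)]
  · refine lintegral_congr fun ω => ?_
    rw [← lintegral_mul_const _ (by fun_prop)]
    refine lintegral_congr fun y => ?_
    ring

variable {mZ2 : Measure 𝓩₂} [SigmaFinite mZ2] {gZ : 𝓩₁ × 𝓩₂ → 𝓩}
  (hg : MeasurePreserving gZ (mZ1.prod mZ2) mZ) (hrg : ∀ x y, rZ (gZ (x, y)) = x)
  {Q : 𝓩 → 𝓩 → 𝓑 → 𝓧 → ℝ}
  (hQ : Measurable fun t : 𝓩 × 𝓩 × 𝓑 × 𝓧 => Q t.1 t.2.1 t.2.2.1 t.2.2.2)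
  (hpos : ∀ᵐ b ∂mB, ∀ᵐ t ∂P.map (fun ω => (W ω, X ω)),
    0 < condDens P B (fun ω => (W ω, X ω)) mB (mW.prod mX) b t)

include hg hrg hpos

/-- `p(z̃ | w, x) / p(b | w, x)` is a mixture of `p(z̃ | u, x) / p(b | u, x)`. -/
theorem ofReal_integral_condDens_Z_div_eq :
    ∀ᵐ z ∂mZ1.prod (P.map fun ω => (B ω, W ω, X ω)),
    ENNReal.ofReal (∫ r, condDens P Z (fun ω => (W ω, X ω)) mZ (mW.prod mX) (gZ (z.1, r))
      (z.2.2.1, z.2.2.2) / condDens P B (fun ω => (W ω, X ω)) mB (mW.prod mX) z.2.1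
        (z.2.2.1, z.2.2.2) ∂mZ2) =
    ∫⁻ u, ENNReal.ofReal (condDens P Z1 (fun ω => (U ω, X ω)) mZ1 (mU.prod mX) z.1 (u, z.2.2.2) /
          condDens P B (fun ω => (U ω, X ω)) mB (mU.prod mX) z.2.1 (u, z.2.2.2)) *
      econdDens P U (fun ω => (B ω, W ω, X ω)) mU (mB.prod (mW.prod mX)) u z.2 ∂mU := by
  have hT : Measurable fun ω => (B ω, W ω, X ω) :=
    h.measurable_B.prodMk (h.measurable_W.prodMk h.measurable_X)
  have hUX := h.measurable_U.prodMk h.measurable_X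
  have hWX := h.measurable_W.prodMk h.measurable_X
  have hgm := hg.measurable
  have hrZ := h.qmp_rZ.measurable
  let ζ : 𝓩₁ → 𝓤 × 𝓧 → ℝ≥0∞ := econdDens P Z1 (fun ω => (U ω, X ω)) mZ1 (mU.prod mX)
  have hζ : Measurable (Function.uncurry ζ) := by
    simp only [Function.uncurry_def, ζ]; fun_prop
  let e : 𝓑 → 𝓤 × 𝓧 → ℝ≥0∞ := econdDens P B (fun ω => (U ω, X ω)) mB (mU.prod mX)
  have he : Measurable (Function.uncurry e) := by
    simp only [Function.uncurry_def, e]; fun_prop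
  let e' : 𝓑 → 𝓦 × 𝓧 → ℝ≥0∞ := econdDens P B (fun ω => (W ω, X ω)) mB (mW.prod mX)
  have he' : Measurable (Function.uncurry e') := by
    simp only [Function.uncurry_def, e']; fun_prop
  let ξ : 𝓩₁ → 𝓦 × 𝓧 → ℝ≥0∞ := fun z t =>
    ∫⁻ r, econdDens P Z (fun ω => (W ω, X ω)) mZ (mW.prod mX) (gZ (z, r)) t ∂mZ2
  have hξ : Measurable (Function.uncurry ξ) := by
    simp only [Function.uncurry_def, ξ]; fun_prop
  have hL : Measurable fun z : 𝓩₁ × 𝓑 × 𝓦 × 𝓧 => ENNReal.ofReal (∫ r, condDens P Z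
      (fun ω => (W ω, X ω)) mZ (mW.prod mX) (gZ (z.1, r)) (z.2.2.1, z.2.2.2) /
        condDens P B (fun ω => (W ω, X ω)) mB (mW.prod mX) z.2.1 (z.2.2.1, z.2.2.2) ∂mZ2) := by
    have h1 : Measurable fun p : (𝓩₁ × 𝓑 × 𝓦 × 𝓧) × 𝓩₂ => condDens P Z
      (fun ω => (W ω, X ω)) mZ (mW.prod mX) (gZ (p.1.1, p.2)) (p.1.2.2.1, p.1.2.2.2) /
        condDens P B (fun ω => (W ω, X ω)) mB (mW.prod mX) p.1.2.1 (p.1.2.2.1, p.1.2.2.2) := by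
      fun_prop
    exact (h1.stronglyMeasurable.integral_prod_right' (ν := mZ2)).measurable.ennreal_ofReal
  have hneW : ∀ᵐ z ∂mB.prod (P.map fun ω => (W ω, X ω)), e' z.1 z.2 ≠ 0 := by
    have hm : MeasurableSet {z : 𝓑 × 𝓦 × 𝓧 |
      0 < condDens P B (fun ω => (W ω, X ω)) mB (mW.prod mX) z.1 z.2} :=
      measurableSet_lt (by fun_prop) (by fun_prop)
    filter_upwards [(Measure.ae_prod_iff_ae_ae hm).2 hpos] with z hz
    simpa only [e', econdDens, ne_eq, ENNReal.ofReal_eq_zero, not_le] using hz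
  -- Both sides are the expectation of `∫ φ(Z̃,b,W,X) db`. On the left the weights are those given
  -- `(W, X)`; on the right those given `(U, X)`, where `W` is independent of `B` and of `Z̃`.
  have hpk : ∀ φ : 𝓩₁ × 𝓑 × 𝓦 × 𝓧 → ℝ≥0∞, Measurable φ →
      ∫⁻ ω, ∫⁻ z, φ (z, B ω, W ω, X ω) * ENNReal.ofReal (∫ r, condDens P Z
        (fun ω => (W ω, X ω)) mZ (mW.prod mX) (gZ (z, r)) (W ω, X ω) /
        condDens P B (fun ω => (W ω, X ω)) mB (mW.prod mX) (B ω) (W ω, X ω) ∂mZ2) ∂mZ1 ∂P =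
      ∫⁻ ω, ∫⁻ z, φ (z, B ω, W ω, X ω) * ENNReal.ofReal
        (condDens P Z1 (fun ω => (U ω, X ω)) mZ1 (mU.prod mX) z (U ω, X ω) /
          condDens P B (fun ω => (U ω, X ω)) mB (mU.prod mX) (B ω) (U ω, X ω)) ∂mZ1 ∂P := by
    intro φ hφ
    have f1 := lintegral_condDens_glue h.measurable_Z hWX h.ac_ZWX hg hrZ hrg
      (φ := fun x => ∫⁻ b, φ (x.1, b, x.2) ∂mB) (by fun_prop)
    simp only [← h.Z1_eq] at f1
    have f2 := lintegral_mul_inv_condDens h.measurable_B hWX h.ac_BWX hneW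
      (φ := fun x => ∫⁻ z, φ (z, x) * ξ z x.2 ∂mZ1) (by fun_prop)
    have hae := ae_of_ae_map hWX.aemeasurable (ae_ae_swap_of_ae_prod
      (ae_ofReal_integral_condDens h.measurable_Z hWX h.ac_ZWX hg))
    have hae' := ae_of_ae_map (h.measurable_B.prodMk hWX).aemeasurable
      (ae_econdDens_ne_zero h.measurable_B hWX h.ac_BWX)
    have f3 : ∫⁻ ω, ∫⁻ z, φ (z, B ω, W ω, X ω) * ENNReal.ofReal (∫ r, condDens P Z
        (fun ω => (W ω, X ω)) mZ (mW.prod mX) (gZ (z, r)) (W ω, X ω) /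
        condDens P B (fun ω => (W ω, X ω)) mB (mW.prod mX) (B ω) (W ω, X ω) ∂mZ2) ∂mZ1 ∂P =
      ∫⁻ ω, (∫⁻ z, φ (z, B ω, W ω, X ω) * ξ z (W ω, X ω) ∂mZ1) * (e' (B ω) (W ω, X ω))⁻¹ ∂P := by
      refine lintegral_congr_ae ?_
      filter_upwards [hae, hae'] with ω h1 h2
      rw [← lintegral_mul_const _ (by fun_prop)]
      refine lintegral_congr_ae ?_
      filter_upwards [h1] with z hz
      rw [econdDens, ne_eq, ENNReal.ofReal_eq_zero, not_le] at h2
      rw [integral_div, ENNReal.ofReal_div_of_pos h2, hz, mul_assoc]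
      rfl
    have f4 : ∫⁻ ω, ∫⁻ b, ∫⁻ z, φ (z, b, W ω, X ω) * ξ z (W ω, X ω) ∂mZ1 ∂mB ∂P =
        ∫⁻ ω, ∫⁻ z, (∫⁻ b, φ (z, b, W ω, X ω) ∂mB) * ξ z (W ω, X ω) ∂mZ1 ∂P := by
      refine lintegral_congr fun ω => ?_
      rw [lintegral_lintegral_swap (by fun_prop)]
      refine lintegral_congr fun z => ?_
      rw [lintegral_mul_const _ (by fun_prop)]
    have g1 : ∫⁻ ω, ∫⁻ z, φ (z, B ω, W ω, X ω) * ENNReal.ofReal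
        (condDens P Z1 (fun ω => (U ω, X ω)) mZ1 (mU.prod mX) z (U ω, X ω) /
          condDens P B (fun ω => (U ω, X ω)) mB (mU.prod mX) (B ω) (U ω, X ω)) ∂mZ1 ∂P =
      ∫⁻ ω, (∫⁻ z, φ (z, B ω, W ω, X ω) * ζ z (U ω, X ω) ∂mZ1) * (e (B ω) (U ω, X ω))⁻¹ ∂P := by
      refine lintegral_congr_ae ?_
      filter_upwards [h.ae_ofReal_weight_eq] with ω hω
      rw [← lintegral_mul_const _ (by fun_prop)]
      refine lintegral_congr fun z => ?_
      rw [hω, mul_assoc]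
    have g2 := lintegral_mul_inv_condDens_symm (Y := W) (mY := mW) h.measurable_B hUX h.ac_BUX
      h.ae_econdDens_BUX_ne_zero
      (k := fun x => econdDens P W (fun ω => (U ω, X ω)) mW (mU.prod mX) x.1 x.2) (by fun_prop)
      (fun ψ hψ => h.lintegral_W (fun x => ψ (x.1, x.2.2)) (by fun_prop))
      (φ := fun x => ∫⁻ z, φ (z, x.2.1, x.1, x.2.2.2) * ζ z x.2.2 ∂mZ1) (by fun_prop)
    have g3 := lintegral_condDens_symm (Y := W) (mY := mW) h.measurable_Z1 hUX h.ac_Z1UX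
      (k := fun x => econdDens P W (fun ω => (U ω, X ω)) mW (mU.prod mX) x.1 x.2) (by fun_prop)
      (fun ψ hψ => by
        have := h.lintegral_W (fun x => ψ (x.1, rZ x.2.1, x.2.2.2)) (by fun_prop)
        simpa only [← h.Z1_eq] using this)
      (φ := fun x => ∫⁻ b, φ (x.2.1, b, x.1, x.2.2.2) ∂mB) (by fun_prop)
    have g4 : ∫⁻ ω, ∫⁻ b, ∫⁻ z, φ (z, b, W ω, X ω) * ζ z (U ω, X ω) ∂mZ1 ∂mB ∂P =
        ∫⁻ ω, ∫⁻ z, (∫⁻ b, φ (z, b, W ω, X ω) ∂mB) * ζ z (U ω, X ω) ∂mZ1 ∂P := by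
      refine lintegral_congr fun ω => ?_
      rw [lintegral_lintegral_swap (by fun_prop)]
      refine lintegral_congr fun z => ?_
      rw [lintegral_mul_const _ (by fun_prop)]
    exact (f3.trans (f2.trans (f4.trans f1.symm))).trans (g3.trans (g4.symm.trans (g2.symm.trans g1.symm)))
  have key := ae_eq_lintegral_latent h.measurable_U hT h.ac_UBWX hL
    (k := fun z => ENNReal.ofReal
      (condDens P Z1 (fun ω => (U ω, X ω)) mZ1 (mU.prod mX) z.1 (z.2.1, z.2.2.2.2) /
          condDens P B (fun ω => (U ω, X ω)) mB (mU.prod mX) z.2.2.1 (z.2.1, z.2.2.2.2)))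
    (by fun_prop) hpk
  exact key

include hQ

/-- By completeness of `W` the residual of a treatment bridge function vanishes. -/
theorem treatment_residual_eq_zero
    (hbridge : ∀ᵐ t ∂mZ.prod (mW.prod (mB.prod mX)),
      ∫ z', Q t.1 z' t.2.2.1 t.2.2.2 * condDens P Z (fun ω => (W ω, B ω, X ω)) mZ
          (mW.prod (mB.prod mX)) z' (t.2.1, t.2.2.1, t.2.2.2) ∂mZ =
        condDens P Z (fun ω => (W ω, X ω)) mZ (mW.prod mX) t.1 (t.2.1, t.2.2.2) /
          condDens P B (fun ω => (W ω, X ω)) mB (mW.prod mX) t.2.2.1 (t.2.1, t.2.2.2))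
    (hint : ∀ᵐ t ∂mZ1.prod (mB.prod mX), ∀ᵐ w ∂mW, Integrable (fun r : 𝓩₂ × 𝓩 =>
      Q (gZ (t.1, r.1)) r.2 t.2.1 t.2.2 * condDens P Z (fun ω => (W ω, B ω, X ω)) mZ
          (mW.prod (mB.prod mX)) r.2 (w, t.2.1, t.2.2)) (mZ2.prod mZ))
    (hLp : ∀ᵐ t ∂mZ1.prod (mB.prod mX), MemLp (fun u =>
      condDens P Z1 (fun ω => (U ω, X ω)) mZ1 (mU.prod mX) t.1 (u, t.2.2) /
          condDens P B (fun ω => (U ω, X ω)) mB (mU.prod mX) t.2.1 (u, t.2.2) -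
        ∫ zs, ∫ z', Q (gZ (t.1, zs)) z' t.2.1 t.2.2 *
          condDens P Z (fun ω => (B ω, U ω, X ω)) mZ (mB.prod (mU.prod mX)) z'
            (t.2.1, u, t.2.2) ∂mZ ∂mZ2) 2 (P.map U))
    (hcomp : ∀ᵐ t ∂P.map (fun ω => (B ω, X ω)), ∀ g : 𝓤 → ℝ, Measurable g → MemLp g 2 (P.map U) →
      (∀ᵐ k ∂P.map W, Integrable (fun u => g u * condDens P U (fun ω => (B ω, W ω, X ω)) mU
        (mB.prod (mW.prod mX)) u (t.1, k, t.2)) mU) →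
      ((∀ᵐ k ∂P.map W, ∫ u, g u * condDens P U (fun ω => (B ω, W ω, X ω)) mU
        (mB.prod (mW.prod mX)) u (t.1, k, t.2) ∂mU = 0) ↔ ∀ᵐ u ∂P.map U, g u = 0)) :
    ∀ᵐ z ∂mZ1.prod ((P.map fun ω => (B ω, X ω)).prod (P.map U)),
      condDens P Z1 (fun ω => (U ω, X ω)) mZ1 (mU.prod mX) z.1 (z.2.2, z.2.1.2) /
          condDens P B (fun ω => (U ω, X ω)) mB (mU.prod mX) z.2.1.1 (z.2.2, z.2.1.2) -
        ∫ zs, ∫ z', Q (gZ (z.1, zs)) z' z.2.1.1 z.2.1.2 *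
          condDens P Z (fun ω => (B ω, U ω, X ω)) mZ (mB.prod (mU.prod mX)) z'
            (z.2.1.1, z.2.2, z.2.1.2) ∂mZ ∂mZ2 = 0 := by
  have hgm := hg.measurable
  let A : 𝓩₁ → 𝓑 × 𝓧 → 𝓤 → ℝ := fun y t u =>
    condDens P Z1 (fun ω => (U ω, X ω)) mZ1 (mU.prod mX) y (u, t.2) /
      condDens P B (fun ω => (U ω, X ω)) mB (mU.prod mX) t.1 (u, t.2)
  let F : 𝓩₁ → 𝓑 × 𝓧 → 𝓩₂ → 𝓩 → ℝ := fun y t r₁ r₂ => Q (gZ (y, r₁)) r₂ t.1 t.2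
  let b : 𝓩 → 𝓑 × 𝓧 → 𝓤 → ℝ := fun r t u =>
    condDens P Z (fun ω => (B ω, U ω, X ω)) mZ (mB.prod (mU.prod mX)) r (t.1, u, t.2)
  have hA : Measurable fun z : 𝓩₁ × (𝓑 × 𝓧) × 𝓤 => A z.1 z.2.1 z.2.2 := by fun_prop
  have hF : Measurable fun z : 𝓩₁ × (𝓑 × 𝓧) × 𝓩₂ × 𝓩 => F z.1 z.2.1 z.2.2.1 z.2.2.2 :=
    hQ.comp (f := fun z : 𝓩₁ × (𝓑 × 𝓧) × 𝓩₂ × 𝓩 =>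
      (gZ (z.1, z.2.2.1), z.2.2.2, z.2.1.1, z.2.1.2)) (by fun_prop)
  have hb : Measurable fun z : 𝓩 × (𝓑 × 𝓧) × 𝓤 => b z.1 z.2.1 z.2.2 := by fun_prop
  have hbr := ae_ae_ae_glue hg.quasiMeasurePreserving hbridge
  have hBX : P.map (fun ω => (B ω, X ω)) ≪ mB.prod mX := h.ac_BX
  -- The roles of the proxies are exchanged: completeness is in `W`, `D` is `p(z'|w,b,x)`, and `L`
  -- is `p(z̃|w,x)/p(b|w,x)`.
  have key := ae_bridgeResidual_eq_zero (m₁ := mZ2) (m₂ := mZ) (mY := mZ1) (A := A)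
    (h := F) (b := b)
    (D := fun r k t => condDens P Z (fun ω => (W ω, B ω, X ω)) mZ
          (mW.prod (mB.prod mX)) r (k, t.1, t.2))
    (L := fun y k t => ∫ r, condDens P Z (fun ω => (W ω, X ω)) mZ (mW.prod mX) (gZ (y, r))
      (k, t.2) / condDens P B (fun ω => (W ω, X ω)) mB (mW.prod mX) t.1 (k, t.2) ∂mZ2)
    hBX h.ac_BWX h.ac_W hA hF hb
    (fun _ _ _ => div_nonneg (condDens_nonneg _ _ _ _ _ _ _) (condDens_nonneg _ _ _ _ _ _ _))
    (fun _ _ _ => condDens_nonneg _ _ _ _ _ _ _) (fun _ _ _ => condDens_nonneg _ _ _ _ _ _ _)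
    h.econdDens_Z_eq
    (fun _ _ _ => integral_nonneg fun _ =>
      div_nonneg (condDens_nonneg _ _ _ _ _ _ _) (condDens_nonneg _ _ _ _ _ _ _))
    (h.ofReal_integral_condDens_Z_div_eq hg hrg hpos) ?_ hLp hcomp
  -- The law of `(B, X)` can stay: the weighted formula evaluates the residual at the sampled
  -- treatment.
  · exact ae_prod_of_ae_ae_ae (measurable_bridgeResidual hA hF hb) key
  · filter_upwards [hint, hbr] with z h1 h2
    filter_upwards [h1, h2] with k h1 h2
    exact ⟨h1, integral_congr_ae h2⟩

omit hrg hpos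

/-- The law of the potential outcomes in terms of a treatment bridge function. -/
theorem lintegral_Ob_eq_treatment
    (hR : ∀ᵐ z ∂mZ1.prod ((P.map fun ω => (B ω, X ω)).prod (P.map U)),
      condDens P Z1 (fun ω => (U ω, X ω)) mZ1 (mU.prod mX) z.1 (z.2.2, z.2.1.2) /
          condDens P B (fun ω => (U ω, X ω)) mB (mU.prod mX) z.2.1.1 (z.2.2, z.2.1.2) -
        ∫ zs, ∫ z', Q (gZ (z.1, zs)) z' z.2.1.1 z.2.1.2 *
          condDens P Z (fun ω => (B ω, U ω, X ω)) mZ (mB.prod (mU.prod mX)) z'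
            (z.2.1.1, z.2.2, z.2.1.2) ∂mZ ∂mZ2 = 0)
    (hint : ∀ᵐ t ∂mZ1.prod (mB.prod mX), ∀ᵐ y ∂mO.prod mW1, Integrable (fun r : 𝓩₂ × 𝓩 =>
      Q (gZ (t.1, r.1)) r.2 t.2.1 t.2.2 * dens P (fun ω => (O ω, W1 ω, Z ω, B ω, X ω))
        (mO.prod (mW1.prod (mZ.prod (mB.prod mX)))) (y.1, y.2, r.2, t.2.1, t.2.2)) (mZ2.prod mZ))
    {φ : 𝓑 × 𝓞 × 𝓦₁ × 𝓩₁ × 𝓧 → ℝ≥0∞} (hφ : Measurable φ) :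
    ∫⁻ b, ∫⁻ ω, φ (b, Ob b ω, W1 ω, Z1 ω, X ω) ∂P ∂mB =
      ∫⁻ z, φ z * ENNReal.ofReal (∫ zs, ∫ z', Q (gZ (z.2.2.2.1, zs)) z' z.1 z.2.2.2.2 *
        dens P (fun ω => (O ω, W1 ω, Z ω, B ω, X ω)) (mO.prod (mW1.prod (mZ.prod (mB.prod mX))))
          (z.2.1, z.2.2.1, z', z.1, z.2.2.2.2) ∂mZ ∂mZ2)
        ∂mB.prod (mO.prod (mW1.prod (mZ1.prod mX))) := by
  have hgm := hg.measurable
  have hBX := h.measurable_B.prodMk h.measurable_X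
  have hV : Measurable fun ω => (O ω, W1 ω, B ω, X ω) :=
    h.measurable_O.prodMk (h.measurable_W1.prodMk hBX)
  have hUV := h.measurable_U.prodMk hV
  have hd := measurable_dens P (fun ω => (O ω, W1 ω, Z ω, B ω, X ω))
    (mO.prod (mW1.prod (mZ.prod (mB.prod mX))))
  rw [h.lintegral_Ob_eq_weight hφ]
  have q0 : MeasurePreserving (fun z : 𝓩 × 𝓞 × 𝓦₁ × 𝓑 × 𝓧 => (z.2.1, z.2.2.1, z.1, z.2.2.2))
      (mZ.prod (mO.prod (mW1.prod (mB.prod mX)))) (mO.prod (mW1.prod (mZ.prod (mB.prod mX)))) :=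
    ((MeasurePreserving.id mO).prod (measurePreserving_prod_left_comm mW1 mZ (mB.prod mX))).comp
      (measurePreserving_prod_left_comm mO mZ (mW1.prod (mB.prod mX)))
  -- `p(o,w̃,z,b,x) = ∫ p(z|b,u,x) p(u,o,w̃,b,x) du`, because `(O, W̃) ⟂ Z | B,U,X`.
  have hD : ∀ᵐ z ∂mZ.prod (mO.prod (mW1.prod (mB.prod mX))), ENNReal.ofReal
      (dens P (fun ω => (O ω, W1 ω, Z ω, B ω, X ω)) (mO.prod (mW1.prod (mZ.prod (mB.prod mX))))
        (z.2.1, z.2.2.1, z.1, z.2.2.2)) =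
      ∫⁻ u, ENNReal.ofReal (condDens P Z (fun ω => (B ω, U ω, X ω)) mZ (mB.prod (mU.prod mX)) z.1
          (z.2.2.2.1, u, z.2.2.2.2)) *
        ENNReal.ofReal (dens P (fun ω => (U ω, O ω, W1 ω, B ω, X ω))
          (mU.prod (mO.prod (mW1.prod (mB.prod mX)))) (u, z.2)) ∂mU := by
    refine ae_eq_lintegral_latent_dens h.measurable_U hV h.ac_UOW1BX
      (p := fun z => ENNReal.ofReal (dens P (fun ω => (O ω, W1 ω, Z ω, B ω, X ω))
        (mO.prod (mW1.prod (mZ.prod (mB.prod mX)))) (z.2.1, z.2.2.1, z.1, z.2.2.2)))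
      (k := fun z => ENNReal.ofReal (condDens P Z (fun ω => (B ω, U ω, X ω)) mZ
        (mB.prod (mU.prod mX)) z.1 (z.2.2.2.2.1, z.2.1, z.2.2.2.2.2)))
      (by fun_prop) (by fun_prop) fun φ hφ => ?_
    have e1 := lintegral_comp_dens (h.measurable_O.prodMk (h.measurable_W1.prodMk
      (h.measurable_Z.prodMk hBX))) h.ac_OW1ZBX (φ := fun x => φ (x.2.2.1, x.1, x.2.1, x.2.2.2))
      (by fun_prop)
    have e2 := q0.lintegral_comp (f := fun x => φ (x.2.2.1, x.1, x.2.1, x.2.2.2) *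
      ENNReal.ofReal (dens P (fun ω => (O ω, W1 ω, Z ω, B ω, X ω))
        (mO.prod (mW1.prod (mZ.prod (mB.prod mX)))) x)) (by fun_prop)
    have e3 := h.lintegral_Z_OW1 (φ := fun x => φ (x.2.1, x.1.1, x.1.2, x.2.2.1, x.2.2.2.2))
      (by fun_prop)
    exact e2.trans (e1.symm.trans e3)
  have hBXU : P.map (fun ω => ((B ω, X ω), U ω)) ≪ (P.map fun ω => (B ω, X ω)).prod (P.map U) :=
    ac_of_quasiMeasurePreserving (h.measurable_U.prodMk hBX)
      (ac_prod_self h.measurable_U hBX h.ac_UBX)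
      Measure.measurePreserving_swap.quasiMeasurePreserving
  have q1 : Measure.QuasiMeasurePreserving (fun v : 𝓤 × 𝓞 × 𝓦₁ × 𝓑 × 𝓧 => (v.2.2.2, v.1))
      (P.map fun ω => (U ω, O ω, W1 ω, B ω, X ω)) ((P.map fun ω => (B ω, X ω)).prod (P.map U)) :=
    ⟨by fun_prop, by rw [Measure.map_map (by fun_prop) hUV]; exact hBXU⟩
  have hG : Measurable fun z : (𝓩₁ × 𝓞 × 𝓦₁ × 𝓑 × 𝓧) × 𝓩₂ × 𝓩 =>
      Q (gZ (z.1.1, z.2.1)) z.2.2 z.1.2.2.2.1 z.1.2.2.2.2 :=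
    hQ.comp (f := fun z : (𝓩₁ × 𝓞 × 𝓦₁ × 𝓑 × 𝓧) × 𝓩₂ × 𝓩 =>
      (gZ (z.1.1, z.2.1), z.2.2, z.1.2.2.2.1, z.1.2.2.2.2)) (by fun_prop)
  have hint' : ∀ᵐ z ∂mZ1.prod (mO.prod (mW1.prod (mB.prod mX))), Integrable (fun r : 𝓩₂ × 𝓩 =>
      Q (gZ (z.1, r.1)) r.2 z.2.2.2.1 z.2.2.2.2 * dens P (fun ω => (O ω, W1 ω, Z ω, B ω, X ω))
        (mO.prod (mW1.prod (mZ.prod (mB.prod mX)))) (z.2.1, z.2.2.1, r.2, z.2.2.2))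
          (mZ2.prod mZ) := by
    have hm : MeasurableSet {z : (𝓩₁ × 𝓑 × 𝓧) × 𝓞 × 𝓦₁ | Integrable (fun r : 𝓩₂ × 𝓩 =>
      Q (gZ (z.1.1, r.1)) r.2 z.1.2.1 z.1.2.2 * dens P (fun ω => (O ω, W1 ω, Z ω, B ω, X ω))
        (mO.prod (mW1.prod (mZ.prod (mB.prod mX)))) (z.2.1, z.2.2, r.2, z.1.2.1, z.1.2.2))
          (mZ2.prod mZ)} := by
      refine measurableSet_integrable (f := fun (z : (𝓩₁ × 𝓑 × 𝓧) × 𝓞 × 𝓦₁) (r : 𝓩₂ × 𝓩) =>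
        Q (gZ (z.1.1, r.1)) r.2 z.1.2.1 z.1.2.2 * dens P (fun ω => (O ω, W1 ω, Z ω, B ω, X ω))
        (mO.prod (mW1.prod (mZ.prod (mB.prod mX)))) (z.2.1, z.2.2, r.2, z.1.2.1, z.1.2.2)) ?_
      refine Measurable.stronglyMeasurable ?_
      simp only [Function.uncurry_def]
      exact (hQ.comp (f := fun p : ((𝓩₁ × 𝓑 × 𝓧) × 𝓞 × 𝓦₁) × 𝓩₂ × 𝓩 =>
        (gZ (p.1.1.1, p.2.1), p.2.2, p.1.1.2.1, p.1.1.2.2)) (by fun_prop)).mul (by fun_prop)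
    have hi := (Measure.ae_prod_iff_ae_ae hm).2 hint
    have q3 : Measure.QuasiMeasurePreserving
        (fun z : 𝓩₁ × 𝓞 × 𝓦₁ × 𝓑 × 𝓧 => ((z.1, z.2.2.2), (z.2.1, z.2.2.1)))
        (mZ1.prod (mO.prod (mW1.prod (mB.prod mX))))
        ((mZ1.prod (mB.prod mX)).prod (mO.prod mW1)) :=
      ((measurePreserving_prodAssoc mZ1 (mB.prod mX) (mO.prod mW1)).symm
          MeasurableEquiv.prodAssoc).quasiMeasurePreserving.comp
        (qmp_keep (Measure.measurePreserving_swap.quasiMeasurePreserving.comp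
          ((measurePreserving_prodAssoc mO mW1 (mB.prod mX)).symm
            MeasurableEquiv.prodAssoc).quasiMeasurePreserving))
    exact q3.ae hi
  have e3 := lintegral_latent_eq_of_residual (mQ := mZ1) (m₁ := mZ2) (m₂ := mZ)
    h.measurable_U hV h.ac_UOW1BX
    (A := fun z => condDens P Z1 (fun ω => (U ω, X ω)) mZ1 (mU.prod mX) z.1
        (z.2.1, z.2.2.2.2.2) /
      condDens P B (fun ω => (U ω, X ω)) mB (mU.prod mX) z.2.2.2.2.1 (z.2.1, z.2.2.2.2.2))
    (b := fun z => condDens P Z (fun ω => (B ω, U ω, X ω)) mZ (mB.prod (mU.prod mX)) z.1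
      (z.2.2.2.2.1, z.2.1, z.2.2.2.2.2))
    (D := fun z => dens P (fun ω => (O ω, W1 ω, Z ω, B ω, X ω))
      (mO.prod (mW1.prod (mZ.prod (mB.prod mX)))) (z.2.1, z.2.2.1, z.1, z.2.2.2))
    (g := fun z r₁ r₂ => Q (gZ (z.1, r₁)) r₂ z.2.2.2.1 z.2.2.2.2)
    (φ := fun z => φ (z.2.2.2.1, z.2.1, z.2.2.1, z.1, z.2.2.2.2)) (by fun_prop)
    (fun _ => div_nonneg (condDens_nonneg _ _ _ _ _ _ _) (condDens_nonneg _ _ _ _ _ _ _))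
    (by fun_prop) (fun _ => condDens_nonneg _ _ _ _ _ _ _) (fun _ => dens_nonneg _ _ _ _) hD hG
    hint' ((qmp_keep q1).ae hR) (by fun_prop)
  refine e3.trans ?_
  have q4 : MeasurePreserving
      (fun z : 𝓩₁ × 𝓞 × 𝓦₁ × 𝓑 × 𝓧 => (z.2.2.2.1, z.2.1, z.2.2.1, z.1, z.2.2.2.2))
      (mZ1.prod (mO.prod (mW1.prod (mB.prod mX))))
      (mB.prod (mO.prod (mW1.prod (mZ1.prod mX)))) :=
    (measurePreserving_prod_left_comm mB mO (mW1.prod (mZ1.prod mX))).comp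
      (((MeasurePreserving.id mO).prod ((measurePreserving_prod_left_comm mB mW1
        (mZ1.prod mX)).comp ((MeasurePreserving.id mW1).prod
          (measurePreserving_prod_left_comm mB mZ1 mX)))).comp
      (((MeasurePreserving.id mO).prod (measurePreserving_prod_left_comm mW1 mZ1
        (mB.prod mX))).comp
        (measurePreserving_prod_left_comm mO mZ1 (mW1.prod (mB.prod mX)))))
  have hI : Measurable fun z : 𝓑 × 𝓞 × 𝓦₁ × 𝓩₁ × 𝓧 =>
      ∫ zs, ∫ z', Q (gZ (z.2.2.2.1, zs)) z' z.1 z.2.2.2.2 *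
        dens P (fun ω => (O ω, W1 ω, Z ω, B ω, X ω)) (mO.prod (mW1.prod (mZ.prod (mB.prod mX))))
          (z.2.1, z.2.2.1, z', z.1, z.2.2.2.2) ∂mZ ∂mZ2 := by
    have h1 : Measurable fun p : ((𝓑 × 𝓞 × 𝓦₁ × 𝓩₁ × 𝓧) × 𝓩₂) × 𝓩 =>
        Q (gZ (p.1.1.2.2.2.1, p.1.2)) p.2 p.1.1.1 p.1.1.2.2.2.2 *
        dens P (fun ω => (O ω, W1 ω, Z ω, B ω, X ω)) (mO.prod (mW1.prod (mZ.prod (mB.prod mX))))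
          (p.1.1.2.1, p.1.1.2.2.1, p.2, p.1.1.1, p.1.1.2.2.2.2) :=
      (hQ.comp (f := fun p : ((𝓑 × 𝓞 × 𝓦₁ × 𝓩₁ × 𝓧) × 𝓩₂) × 𝓩 =>
        (gZ (p.1.1.2.2.2.1, p.1.2), p.2, p.1.1.1, p.1.1.2.2.2.2)) (by fun_prop)).mul
        (by fun_prop)
    exact ((h1.stronglyMeasurable.integral_prod_right' (ν := mZ)).integral_prod_right'
      (ν := mZ2)).measurable
  exact q4.lintegral_comp (f := fun z => φ z * ENNReal.ofReal (∫ zs, ∫ z',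
    Q (gZ (z.2.2.2.1, zs)) z' z.1 z.2.2.2.2 *
      dens P (fun ω => (O ω, W1 ω, Z ω, B ω, X ω)) (mO.prod (mW1.prod (mZ.prod (mB.prod mX))))
          (z.2.1, z.2.2.1, z', z.1, z.2.2.2.2) ∂mZ ∂mZ2)) (by fun_prop)

end ProxySystem

end TreatmentBridge

/-! ### The identifying formulas for a causal model -/

section Formula

open scoped ENNReal

universe u

set_option linter.unusedSectionVars false

theorem measurable_integral_integral_mul {α β γ : Type*} [MeasurableSpace α] [MeasurableSpace β]
    [MeasurableSpace γ] {m₁ : Measure β} {m₂ : Measure γ} [SFinite m₁] [SFinite m₂]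
    {f g : α → β → γ → ℝ} (hf : Measurable fun z : α × β × γ => f z.1 z.2.1 z.2.2)
    (hg : Measurable fun z : α × β × γ => g z.1 z.2.1 z.2.2) :
    Measurable fun a => ∫ r₁, ∫ r₂, f a r₁ r₂ * g a r₁ r₂ ∂m₂ ∂m₁ := by
  have h1 : Measurable fun p : (α × β) × γ => f p.1.1 p.1.2 p.2 * g p.1.1 p.1.2 p.2 :=
    (hf.mul hg).comp (g := fun z : α × β × γ => f z.1 z.2.1 z.2.2 * g z.1 z.2.1 z.2.2)
      (f := fun p : (α × β) × γ => (p.1.1, p.1.2, p.2)) (by fun_prop)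
  exact ((h1.stronglyMeasurable.integral_prod_right' (ν := m₂)).integral_prod_right'
      (ν := m₁)).measurable

namespace CausalModel

variable {V U : Type*} [Fintype V] [DecidableEq V] [Fintype U] {G : Digraph (V ⊕ U)}
  {X : V → Type u} [∀ v, MeasurableSpace (X v)]
  {M : CausalModel G X} {μ : ∀ v, Measure (X v)} {d : EbfArgs V}
  {a : ∀ v, X v} {Us : Finset U}

/-- Potential outcomes are measurable jointly in `b` and `ω` because `hybrid` expresses them through
randomness that does not involve `b`. -/
theorem measurable_obs_insert (A : Finset V) : Measurable (Function.uncurry fun b ω =>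
    M.obs (insert d.B d.S) (Function.update a d.B b) A ω) := by
  have hmN := M.measurable_nonDesc d.S d.B a
  have hmE := M.measurable_descErr d.B
  have hH : ∀ i, Measurable fun x : X d.B × M.NonDesc d.B × M.DescErr d.B =>
      M.hybrid d.S d.B a x.1 x.2.1 x.2.2 i := M.measurable_hybrid d.S d.B a
  have e : (Function.uncurry fun b ω =>
      M.obs (insert d.B d.S) (Function.update a d.B b) A ω) = fun (x : X d.B × M.Ω) (v : A) =>
      (M.hybrid d.S d.B a x.1 (M.nonDesc d.S d.B a x.2) (M.descErr d.B x.2) (.inl v) : X v) :=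
    funext fun x => funext fun v => (M.hybrid_eq_po a d.B_notMem_S x.1 x.2 (.inl v)).symm
  rw [e]
  refine measurable_pi_lambda _ fun v => ?_
  exact (hH (.inl v)).comp (f := fun x : X d.B × M.Ω =>
    (x.1, M.nonDesc d.S d.B a x.2, M.descErr d.B x.2)) (by fun_prop)

variable [∀ v, SigmaFinite (μ v)]

theorem HasJointDensity.proxyVars (hd : M.HasJointDensity μ d.S a) (Us : Finset U) :
    ProxyVars M.P (M.obs d.S a (d.O G)) (M.obs d.S a d.W) (M.obs d.S a (d.Wt G)) (M.obs d.S a d.Z)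
      (M.obs d.S a (d.Zt G)) (M.obs1 d.S a d.B) (M.lat d.S a Us) (M.obs d.S a (d.C G))
      (Finset.restrict₂ (π := X) (d.Wt_sub G)) (Finset.restrict₂ (π := X) (d.Zt_sub G))
      (refM μ (d.O G)) (refM μ d.W) (refM μ (d.Wt G)) (refM μ d.Z) (refM μ (d.Zt G)) (μ d.B)
      (refM M.ν Us) (refM μ (d.C G)) where
  measurable_O := M.measurable_obs _ _ _
  measurable_W := M.measurable_obs _ _ _
  measurable_Z := M.measurable_obs _ _ _
  measurable_B := M.measurable_obs1 _ _ _
  measurable_U := M.measurable_lat _ _ _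
  measurable_X := M.measurable_obs _ _ _
  W1_eq _ := rfl
  Z1_eq _ := rfl
  qmp_rW := quasiMeasurePreserving_restrict₂ μ _
  qmp_rZ := quasiMeasurePreserving_restrict₂ μ _
  ac := M.ac_obs_of_hasJointDensity μ d a Us hd

theorem measurePreserving_glue_W : MeasurePreserving
    (fun p : Blk X (d.Wt G) × Blk X (d.Ws G) => glue (d.W_sub_union G) p.1 p.2)
    ((refM μ (d.Wt G)).prod (refM μ (d.Ws G))) (refM μ d.W) :=
  measurePreserving_glue μ _ (d.Wt_sub G) (d.Ws_sub G) Finset.sdiff_disjoint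

theorem measurePreserving_glue_Z : MeasurePreserving
    (fun p : Blk X (d.Zt G) × Blk X (d.Zs G) => glue (d.Z_sub_union G) p.1 p.2)
    ((refM μ (d.Zt G)).prod (refM μ (d.Zs G))) (refM μ d.Z) :=
  measurePreserving_glue μ _ (d.Zt_sub G) (d.Zs_sub G) Finset.sdiff_disjoint

/-- The output law from an identity of integrals. -/
theorem outLaw_eq_withDensity [∀ v, StandardBorelSpace (X v)]
    {g : X d.B × Blk X (d.O G) × Blk X (d.Wt G) × Blk X (d.Zt G) × Blk X (d.C G) → ℝ≥0∞}
    (hg : Measurable g)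
    (h : ∀ φ : X d.B × Blk X (d.O G) × Blk X (d.Wt G) × Blk X (d.Zt G) × Blk X (d.C G) → ℝ≥0∞,
      Measurable φ → ∫⁻ b, ∫⁻ ω, φ (b, M.obs (insert d.B d.S) (Function.update a d.B b) (d.O G) ω,
          M.obs d.S a (d.Wt G) ω, M.obs d.S a (d.Zt G) ω, M.obs d.S a (d.C G) ω) ∂M.P ∂μ d.B =
        ∫⁻ z, φ z * g z ∂(μ d.B).prod (outRef μ G d)) :
    ∀ᵐ b ∂μ d.B, M.outLaw d a b = (outRef μ G d).withDensity fun t => g (b, t) := by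
  have hσ : SigmaFinite (outRef μ G d) := by unfold outRef; infer_instance
  have hY : Measurable (Function.uncurry fun b ω =>
      (M.obs (insert d.B d.S) (Function.update a d.B b) (d.O G) ω,
        M.obs d.S a (d.Wt G) ω, M.obs d.S a (d.Zt G) ω, M.obs d.S a (d.C G) ω)) := by
    have h1 := measurable_obs_insert (M := M) (d := d) (a := a) (d.O G)
    have h2 := M.measurable_obs d.S a (d.Wt G)
    have h3 := M.measurable_obs d.S a (d.Zt G)
    have h4 := M.measurable_obs d.S a (d.C G)
    simp only [Function.uncurry_def] at h1 ⊢
    fun_prop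
  -- `W̃`, `Z̃` and the covariates do not descend from `B`, so only the block `O` feels the
  -- intervention on `B`.
  have hlaw : ∀ b, M.outLaw d a b = M.P.map fun ω =>
      (M.obs (insert d.B d.S) (Function.update a d.B b) (d.O G) ω,
        M.obs d.S a (d.Wt G) ω, M.obs d.S a (d.Zt G) ω, M.obs d.S a (d.C G) ω) := fun b => by
    simp only [outLaw]
    rw [M.obs_insert_of_notMem_de d a ((d.Wt_sub G).trans d.W_sub)
        (fun v hv => d.notMem_de_of_mem_Wt G hv),
      M.obs_insert_of_notMem_de d a ((d.Zt_sub G).trans d.Z_sub)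
        (fun v hv => d.notMem_de_of_mem_Zt G hv),
      M.obs_insert_of_notMem_de d a (d.C_sub G) (fun v hv => d.notMem_de_of_mem_C G hv)]
  have hYb : ∀ b, Measurable fun ω =>
      (M.obs (insert d.B d.S) (Function.update a d.B b) (d.O G) ω,
        M.obs d.S a (d.Wt G) ω, M.obs d.S a (d.Zt G) ω, M.obs d.S a (d.C G) ω) := fun b =>
    hY.comp measurable_prodMk_left
  have hs1 : ∀ b s, MeasurableSet s → M.outLaw d a b s = ∫⁻ ω, s.indicator (fun _ => 1)
      (M.obs (insert d.B d.S) (Function.update a d.B b) (d.O G) ω,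
        M.obs d.S a (d.Wt G) ω, M.obs d.S a (d.Zt G) ω, M.obs d.S a (d.C G) ω) ∂M.P := by
    intro b s hs
    rw [hlaw, ← lintegral_map (measurable_const.indicator hs) (hYb b)]
    exact (lintegral_indicator_one hs).symm
  have hs2 : ∀ b s, MeasurableSet s → (outRef μ G d).withDensity (fun t => g (b, t)) s =
      ∫⁻ t, s.indicator (fun _ => 1) t * g (b, t) ∂outRef μ G d := by
    intro b s hs
    rw [withDensity_apply _ hs, ← lintegral_indicator hs]
    refine lintegral_congr fun t => ?_
    by_cases ht : t ∈ s <;> simp [ht]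
  have hi : ∀ b, IsFiniteMeasure (M.outLaw d a b) := fun b => by
    rw [hlaw]; infer_instance
  refine ae_eq_of_forall_setLIntegral_apply_eq (fun s hs => ?_) (fun s hs => ?_)
    fun s A hs hA => ?_
  · simp_rw [hs1 _ s hs]
    have : Measurable fun p : X d.B × M.Ω => s.indicator (fun _ => (1 : ℝ≥0∞))
      (M.obs (insert d.B d.S) (Function.update a d.B p.1) (d.O G) p.2,
        M.obs d.S a (d.Wt G) p.2, M.obs d.S a (d.Zt G) p.2, M.obs d.S a (d.C G) p.2) :=
      (measurable_const.indicator hs).comp hY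
    exact this.lintegral_prod_right'
  · simp_rw [hs2 _ s hs]
    have hi : Measurable (s.indicator (fun _ => (1 : ℝ≥0∞))) := measurable_const.indicator hs
    fun_prop
  · simp_rw [hs1 _ s hs, hs2 _ s hs]
    have hi : Measurable (s.indicator (fun _ => (1 : ℝ≥0∞))) := measurable_const.indicator hs
    have hA' : Measurable (A.indicator (fun _ => (1 : ℝ≥0∞))) := measurable_const.indicator hA
    have e := h (fun z => A.indicator (fun _ => 1) z.1 * s.indicator (fun _ => 1) z.2) (by fun_prop)
    rw [lintegral_prod _ (by fun_prop)] at e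
    rw [← lintegral_indicator hA, ← lintegral_indicator hA]
    refine Eq.trans (lintegral_congr fun b => ?_) (e.trans (lintegral_congr fun b => ?_))
    · by_cases hb : b ∈ A <;> simp [hb]
    · by_cases hb : b ∈ A <;> simp [hb]

namespace EbfCommon

variable [∀ v, StandardBorelSpace (X v)] (hc : M.EbfCommon μ d a Us)

include hc

/-- Each conditional independence becomes an integral identity by
`lintegral_condDens_of_condIndepFun`, the one for `W̃` after composing the outcome proxy condition
with a restriction. Ignorability enters through the diagonal argument instead. -/
theorem proxySystem :
    ProxySystem M.P (M.obs d.S a (d.O G)) (M.obs d.S a d.W) (M.obs d.S a (d.Wt G))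
      (M.obs d.S a d.Z) (M.obs d.S a (d.Zt G)) (M.obs1 d.S a d.B) (M.lat d.S a Us)
      (M.obs d.S a (d.C G)) (fun b => M.obs (insert d.B d.S) (Function.update a d.B b) (d.O G))
      (Finset.restrict₂ (π := X) (d.Wt_sub G)) (Finset.restrict₂ (π := X) (d.Zt_sub G))
      (refM μ (d.O G)) (refM μ d.W) (refM μ (d.Wt G)) (refM μ d.Z) (refM μ (d.Zt G)) (μ d.B)
      (refM M.ν Us) (refM μ (d.C G)) := by
  have hp := hc.density.proxyVars Us
  have hZB := hp.measurable_Z.prodMk hp.measurable_B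
  have hUX := hp.measurable_U.prodMk hp.measurable_X
  have hT := hp.measurable_W1.prodMk (hp.measurable_B.prodMk hUX)
  have hres : Measurable (Finset.restrict₂ (π := X) (d.Wt_sub G)) := hp.qmp_rW.measurable
  refine { hp with
    lintegral_W := fun φ hφ => ?_
    lintegral_W1 := fun φ hφ => ?_
    lintegral_O := fun φ hφ => ?_
    lintegral_B := fun φ hφ => ?_
    pos := hc.positivity }
  · exact lintegral_condDens_of_condIndepFun hp.measurable_W hUX hZB hp.ac_WUX hc.outcomeProxy
      (φ := fun w v t => φ (w, v.1, v.2, t)) (by fun_prop)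
  · exact lintegral_condDens_of_condIndepFun hp.measurable_W1 hUX hZB hp.ac_W1UX
      (hc.outcomeProxy.comp hres measurable_id)
      (φ := fun w v t => φ (w, v.1, v.2, t)) (by fun_prop)
  · exact lintegral_condDens_of_condIndepFun hp.measurable_O hT hp.measurable_Z hp.ac_OW1BUX
      hc.treatmentProxy (φ := fun w v t => φ (w, v, t)) (by fun_prop)
  · exact M.lintegral_obs_eq_of_ignorability μ d a Us hc.density hc.ignorability hp.ac_BUW1Z1X hφ

/-- The identifying formula of an outcome bridge function. -/
theorem outLaw_eq_outcome {h : OutcomeFun X G d} (hb : M.IsOutcomeBridge μ d a h)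
    (hi : M.OutcomeIntegrable μ d a Us h) (hcomp : M.Complete μ d a Us d.Z) :
    ∀ᵐ b ∂μ d.B, M.outLaw d a b = (outRef μ G d).withDensity fun t =>
      ENNReal.ofReal (∫ ws, ∫ w', h t.1 (glue (d.W_sub_union G) t.2.1 ws) w' b t.2.2.2 *
        M.densWZt μ d a w' t.2.2.1 t.2.2.2 ∂refM μ d.W ∂refM μ (d.Ws G)) := by
  have hp := hc.proxySystem
  have hgl := measurePreserving_glue_W (μ := μ) (d := d) (G := G)
  have hgm := hgl.measurable
  have hR := hp.outcome_residual_eq_zero hgl (fun x y => restrict₂_glue_left _ _ x y) hb.1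
    (hb.2.mono fun t ht => ht.2) (hi.mono fun t ht => ht.1) (hi.mono fun t ht => ht.2.2) hcomp
  have hF := fun φ hφ => hp.lintegral_Ob_eq_outcome hgl (fun x y => restrict₂_glue_left _ _ x y)
    hb.1 hR (hi.mono fun t ht => ht.2.1) (φ := φ) hφ
  have hd := measurable_dens M.P
    (fun ω => (M.obs d.S a d.W ω, M.obs d.S a (d.Zt G) ω, M.obs d.S a (d.C G) ω))
    ((refM μ d.W).prod ((refM μ (d.Zt G)).prod (refM μ (d.C G))))
  have hm : Measurable fun z : X d.B × Blk X (d.O G) × Blk X (d.Wt G) × Blk X (d.Zt G) ×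
      Blk X (d.C G) => ∫ ws, ∫ w', h z.2.1 (glue (d.W_sub_union G) z.2.2.1 ws) w' z.1 z.2.2.2.2 *
        M.densWZt μ d a w' z.2.2.2.1 z.2.2.2.2 ∂refM μ d.W ∂refM μ (d.Ws G) := by
    refine measurable_integral_integral_mul (hb.1.comp (f := fun p : (X d.B × Blk X (d.O G) ×
        Blk X (d.Wt G) × Blk X (d.Zt G) × Blk X (d.C G)) × Blk X (d.Ws G) × Blk X d.W =>
      (p.1.2.1, glue (d.W_sub_union G) p.1.2.2.1 p.2.1, p.2.2, p.1.1, p.1.2.2.2.2))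
        (by fun_prop)) ?_
    unfold densWZt
    fun_prop
  filter_upwards [outLaw_eq_withDensity hm.ennreal_ofReal hF] with b hb
  rw [hb]

/-- The identifying formula of a treatment bridge function. -/
theorem outLaw_eq_treatment {q : TreatmentFun X G d} (hb : M.IsTreatmentBridge μ d a q)
    (hi : M.TreatmentIntegrable μ d a Us q) (hcomp : M.Complete μ d a Us d.W) :
    ∀ᵐ b ∂μ d.B, M.outLaw d a b = (outRef μ G d).withDensity fun t =>
      ENNReal.ofReal (∫ zs, ∫ z', q (glue (d.Z_sub_union G) t.2.2.1 zs) z' b t.2.2.2 *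
        M.densOWtZ μ d a t.1 t.2.1 z' b t.2.2.2 ∂refM μ d.Z ∂refM μ (d.Zs G)) := by
  have hp := hc.proxySystem
  have hgl := measurePreserving_glue_Z (μ := μ) (d := d) (G := G)
  have hgm := hgl.measurable
  have hR := hp.treatment_residual_eq_zero hgl (fun x y => restrict₂_glue_left _ _ x y) hb.2.1
    hb.1 (hb.2.2.mono fun t ht => ht.2) (hi.mono fun t ht => ht.1)
    (hi.mono fun t ht => ht.2.2) hcomp
  have hF := fun φ hφ => hp.lintegral_Ob_eq_treatment hgl hb.2.1 hR
    (hi.mono fun t ht => ht.2.1) (φ := φ) hφ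
  have hd := measurable_dens M.P (fun ω => (M.obs d.S a (d.O G) ω, M.obs d.S a (d.Wt G) ω,
      M.obs d.S a d.Z ω, M.obs1 d.S a d.B ω, M.obs d.S a (d.C G) ω))
    ((refM μ (d.O G)).prod ((refM μ (d.Wt G)).prod ((refM μ d.Z).prod
      ((μ d.B).prod (refM μ (d.C G))))))
  have hm : Measurable fun z : X d.B × Blk X (d.O G) × Blk X (d.Wt G) × Blk X (d.Zt G) ×
      Blk X (d.C G) => ∫ zs, ∫ z', q (glue (d.Z_sub_union G) z.2.2.2.1 zs) z' z.1 z.2.2.2.2 *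
        M.densOWtZ μ d a z.2.1 z.2.2.1 z' z.1 z.2.2.2.2 ∂refM μ d.Z ∂refM μ (d.Zs G) := by
    refine measurable_integral_integral_mul (hb.2.1.comp (f := fun p : (X d.B × Blk X (d.O G) ×
        Blk X (d.Wt G) × Blk X (d.Zt G) × Blk X (d.C G)) × Blk X (d.Zs G) × Blk X d.Z =>
      (glue (d.Z_sub_union G) p.1.2.2.2.1 p.2.1, p.2.2, p.1.1, p.1.2.2.2.2)) (by fun_prop)) ?_
    unfold densOWtZ
    fun_prop
  filter_upwards [outLaw_eq_withDensity hm.ennreal_ofReal hF] with b hb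
  rw [hb]

end EbfCommon

end CausalModel

end Formula

/-! ### Marginal densities and bounded kernels -/

section BridgeComparison

set_option linter.unusedSectionVars false

section Densities

open scoped ENNReal

variable {Ω α β γ δ : Type*} [MeasurableSpace Ω] [MeasurableSpace α] [MeasurableSpace β]
  [MeasurableSpace γ] [MeasurableSpace δ]
  {P : Measure Ω} [IsProbabilityMeasure P] {Y : Ω → α} {T : Ω → β} {mY : Measure α} {mT : Measure β}
  [SigmaFinite mY] [SigmaFinite mT]

/-- The mass is `1` where `p(t) ≠ 0`, and `0` elsewhere by convention. The bound is thus available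
for the reference measure, not only for the law of `T`. -/
theorem ae_lintegral_econdDens_le_one (hY : Measurable Y) (hT : Measurable T)
    (h : P.map (fun ω => (Y ω, T ω)) ≪ mY.prod mT) :
    ∀ᵐ t ∂mT, ∫⁻ y, econdDens P Y T mY mT y t ∂mY ≤ 1 := by
  have h1 : (fun t => ∫⁻ y, econdDens P Y T mY mT y t ∂mY) =ᵐ[P.map T] fun _ => 1 := by
    refine eq_of_withDensity_lintegral_eq (by fun_prop) (by fun_prop) fun φ hφ => ?_
    rw [lintegral_map (by fun_prop) hT, lintegral_map (by fun_prop) hT]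
    have e := lintegral_condDens hY hT h (φ := fun _ t => φ t)
      (by simp only [Function.uncurry_def]; fun_prop)
    simp only [mul_one]
    rw [e]
    refine lintegral_congr fun ω => ?_
    rw [lintegral_const_mul _ (by fun_prop)]
  filter_upwards [(ae_map_iff_dens (ac_snd hY hT h)).1 h1] with t ht
  by_cases h0 : dens P T mT t = 0
  · simp [econdDens, condDens_eq_zero P Y T mY mT h0]
  · exact (ht h0).le

/-- Where `p(t) = 0` the joint density vanishes too, by `dens_eq_zero_of_snd`, so no guard is
needed. -/
theorem ae_condDens_mul_dens (hY : Measurable Y) (hT : Measurable T)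
    (h : P.map (fun ω => (Y ω, T ω)) ≪ mY.prod mT) :
    ∀ᵐ z ∂mY.prod mT, condDens P Y T mY mT z.1 z.2 * dens P T mT z.2 =
      dens P (fun ω => (Y ω, T ω)) (mY.prod mT) z := by
  have hd1 := measurable_dens P T mT
  have hd2 := measurable_dens P (fun ω => (Y ω, T ω)) (mY.prod mT)
  have h1 : ∀ᵐ z ∂mT.prod mY, condDens P Y T mY mT z.2 z.1 * dens P T mT z.1 =
      dens P (fun ω => (Y ω, T ω)) (mY.prod mT) (z.2, z.1) := by
    refine (Measure.ae_prod_iff_ae_ae (measurableSet_eq_fun (by fun_prop) (by fun_prop))).2 ?_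
    filter_upwards [dens_eq_zero_of_snd hY hT h] with t ht
    by_cases h0 : dens P T mT t = 0
    · filter_upwards [ht h0] with y hy
      rw [hy, h0, mul_zero]
    · exact Filter.Eventually.of_forall fun y => div_mul_cancel₀ _ h0
  exact (Measure.measurePreserving_swap (μ := mY) (ν := mT)).quasiMeasurePreserving.ae h1

/-- Change of variables along `e`, of which `f` is a left inverse; it serves to reorder the
arguments of a joint density. -/
theorem ae_dens_comp_eq (hY : Measurable Y) (h : P.map Y ≪ mY) {f : α → β} (hf : Measurable f)
    (h' : P.map (fun ω => f (Y ω)) ≪ mT) {e : β → α} (he : MeasurePreserving e mT mY)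
    (hfe : ∀ t, f (e t) = t) :
    ∀ᵐ t ∂mT, dens P (fun ω => f (Y ω)) mT t = dens P Y mY (e t) := by
  have hem := he.measurable
  have hd1 := measurable_dens P (fun ω => f (Y ω)) mT
  have hd2 := measurable_dens P Y mY
  have h1 : (fun t => ENNReal.ofReal (dens P (fun ω => f (Y ω)) mT t)) =ᵐ[mT]
      fun t => ENNReal.ofReal (dens P Y mY (e t)) := by
    refine eq_of_withDensity_lintegral_eq (by fun_prop) (by fun_prop) fun φ hφ => ?_
    refine (lintegral_comp_dens (hf.comp hY) h' hφ).symm.trans ?_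
    have e2 := he.lintegral_comp (f := fun y => φ (f y) * ENNReal.ofReal (dens P Y mY y))
      (by fun_prop)
    simp only [hfe] at e2
    rw [e2]
    exact lintegral_comp_dens hY h (φ := fun y => φ (f y)) (by fun_prop)
  filter_upwards [h1] with t ht
  exact (ENNReal.ofReal_eq_ofReal_iff (dens_nonneg _ _ _ _) (dens_nonneg _ _ _ _)).1 ht

/-- Marginal densities. -/
theorem ae_dens_comp_eq_integral (hY : Measurable Y) (h : P.map Y ≪ mY) {f : α → β}
    (hf : Measurable f) (h' : P.map (fun ω => f (Y ω)) ≪ mT) {m₂ : Measure δ} [SigmaFinite m₂]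
    {e : β × δ → α} (he : MeasurePreserving e (mT.prod m₂) mY) (hfe : ∀ t r, f (e (t, r)) = t) :
    ∀ᵐ t ∂mT, ∫ r, dens P Y mY (e (t, r)) ∂m₂ = dens P (fun ω => f (Y ω)) mT t := by
  have hem := he.measurable
  have hd1 := measurable_dens P (fun ω => f (Y ω)) mT
  have hd2 := measurable_dens P Y mY
  have h1 : (fun t => ENNReal.ofReal (dens P (fun ω => f (Y ω)) mT t)) =ᵐ[mT]
      fun t => ∫⁻ r, ENNReal.ofReal (dens P Y mY (e (t, r))) ∂m₂ := by
    refine eq_of_withDensity_lintegral_eq (by fun_prop) (by fun_prop) fun φ hφ => ?_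
    refine (lintegral_comp_dens (hf.comp hY) h' hφ).symm.trans ?_
    have e2 := he.lintegral_comp (f := fun y => φ (f y) * ENNReal.ofReal (dens P Y mY y))
      (by fun_prop)
    rw [lintegral_prod _ (by fun_prop)] at e2
    simp only [hfe] at e2
    have e3 := lintegral_comp_dens hY h (φ := fun y => φ (f y)) (by fun_prop)
    refine e3.trans (e2.symm.trans (lintegral_congr fun t => ?_))
    rw [lintegral_const_mul _ (by fun_prop)]
  filter_upwards [h1] with t ht
  rw [integral_eq_lintegral_of_nonneg_ae (Filter.Eventually.of_forall fun r => dens_nonneg _ _ _ _)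
    (Measurable.aestronglyMeasurable (by fun_prop)), ← ht, ENNReal.toReal_ofReal (dens_nonneg _ _ _ _)]

/-- An integral operator with bounded kernel has bounded values. -/
theorem memLp_integral_integral_mul {m₁ : Measure α} {m₂ : Measure β} [SigmaFinite m₁]
    [SigmaFinite m₂] {ρ : Measure γ} [IsFiniteMeasure ρ] {F : α → β → ℝ}
    (hF : Measurable (Function.uncurry F)) {b : β → γ → ℝ} (hb : Measurable (Function.uncurry b))
    (hb0 : ∀ r u, 0 ≤ b r u) {K : NNReal} (hK : ∀ᵐ r ∂m₂, ∫⁻ x, ‖F x r‖ₑ ∂m₁ ≤ K)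
    (hb1 : ∀ᵐ u ∂ρ, ∫⁻ r, ENNReal.ofReal (b r u) ∂m₂ ≤ 1) (p : ℝ≥0∞) :
    MemLp (fun u => ∫ r₁, ∫ r₂, F r₁ r₂ * b r₂ u ∂m₂ ∂m₁) p ρ := by
  have hm : Measurable fun u => ∫ r₁, ∫ r₂, F r₁ r₂ * b r₂ u ∂m₂ ∂m₁ :=
    measurable_integral_integral_mul (f := fun _ => F) (g := fun u _ r => b r u)
      (by simp only [Function.uncurry_def] at hF; fun_prop)
      (by simp only [Function.uncurry_def] at hb; fun_prop)
  refine MemLp.of_bound hm.aestronglyMeasurable (K : ℝ) ?_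
  filter_upwards [hb1] with u hu
  have h1 : ‖∫ r₁, ∫ r₂, F r₁ r₂ * b r₂ u ∂m₂ ∂m₁‖ₑ ≤ K := calc
    _ ≤ ∫⁻ r₁, ‖∫ r₂, F r₁ r₂ * b r₂ u ∂m₂‖ₑ ∂m₁ := enorm_integral_le_lintegral_enorm _
    _ ≤ ∫⁻ r₁, ∫⁻ r₂, ‖F r₁ r₂ * b r₂ u‖ₑ ∂m₂ ∂m₁ :=
      lintegral_mono fun r₁ => enorm_integral_le_lintegral_enorm _
    _ = ∫⁻ r₂, ∫⁻ r₁, ‖F r₁ r₂ * b r₂ u‖ₑ ∂m₁ ∂m₂ := lintegral_lintegral_swap (by fun_prop)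
    _ = ∫⁻ r₂, (∫⁻ r₁, ‖F r₁ r₂‖ₑ ∂m₁) * ENNReal.ofReal (b r₂ u) ∂m₂ := by
      refine lintegral_congr fun r₂ => ?_
      rw [← lintegral_mul_const _ (by fun_prop)]
      refine lintegral_congr fun r₁ => ?_
      rw [enorm_mul, Real.enorm_of_nonneg (hb0 _ _)]
    _ ≤ ∫⁻ r₂, K * ENNReal.ofReal (b r₂ u) ∂m₂ := by
      refine lintegral_mono_ae ?_
      filter_upwards [hK] with r hr using mul_le_mul_left hr _
    _ = K * ∫⁻ r₂, ENNReal.ofReal (b r₂ u) ∂m₂ := lintegral_const_mul _ (by fun_prop)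
    _ ≤ K := (mul_le_mul_right hu _).trans (mul_one _).le
  exact_mod_cast enorm_le_coe.1 h1

/-- Fubini's theorem for two bounded kernels. -/
theorem integral_integral_bounded_swap {mα : Measure α} {mβ : Measure β} {mγ : Measure γ}
    {mδ : Measure δ} [SigmaFinite mα] [SigmaFinite mβ] [SigmaFinite mγ] [SigmaFinite mδ]
    {F : γ → α → ℝ} (hF : Measurable (Function.uncurry F)) {E : δ → β → ℝ}
    (hE : Measurable (Function.uncurry E)) {r : α × β → ℝ} (hr : Measurable r) (hr0 : ∀ z, 0 ≤ r z)
    (hrf : ∫⁻ z, ENNReal.ofReal (r z) ∂mα.prod mβ ≠ ∞) {K K' : NNReal}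
    (hK : ∀ᵐ x ∂mα, ∫⁻ c, ‖F c x‖ₑ ∂mγ ≤ K) (hK' : ∀ᵐ y ∂mβ, ∫⁻ c, ‖E c y‖ₑ ∂mδ ≤ K')
    {D₁ : α → ℝ} {D₂ : β → ℝ} (hD₁ : ∀ᵐ x ∂mα, ∫ c, ∫ y, E c y * r (x, y) ∂mβ ∂mδ = D₁ x)
    (hD₂ : ∀ᵐ y ∂mβ, ∫ c, ∫ x, F c x * r (x, y) ∂mα ∂mγ = D₂ y) :
    ∫ c, ∫ x, F c x * D₁ x ∂mα ∂mγ = ∫ c, ∫ y, E c y * D₂ y ∂mβ ∂mδ := by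
  -- Both sides of the claim are the integral of this one function. Its absolute integral is at most
  -- `K K'` times the mass of `r`.
  let Φ : (γ × α) × δ × β → ℝ := fun z => F z.1.1 z.1.2 * (E z.2.1 z.2.2 * r (z.1.2, z.2.2))
  have hΦ : Measurable Φ := by fun_prop
  have hb1 : ∀ x, ∫⁻ q : δ × β, ‖E q.1 q.2 * r (x, q.2)‖ₑ ∂mδ.prod mβ ≤
      K' * ∫⁻ y, ENNReal.ofReal (r (x, y)) ∂mβ := fun x => by
    rw [lintegral_prod_symm' _ (by fun_prop), ← lintegral_const_mul _ (by fun_prop)]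
    refine lintegral_mono_ae ?_
    filter_upwards [hK'] with y hy
    simp only [enorm_mul, Real.enorm_of_nonneg (hr0 _)]
    rw [lintegral_mul_const _ (by fun_prop)]
    exact mul_le_mul_left hy _
  have hb2 : ∀ y, ∫⁻ p : γ × α, ‖F p.1 p.2 * r (p.2, y)‖ₑ ∂mγ.prod mα ≤
      K * ∫⁻ x, ENNReal.ofReal (r (x, y)) ∂mα := fun y => by
    rw [lintegral_prod_symm' _ (by fun_prop), ← lintegral_const_mul _ (by fun_prop)]
    refine lintegral_mono_ae ?_
    filter_upwards [hK] with x hx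
    simp only [enorm_mul, Real.enorm_of_nonneg (hr0 _)]
    rw [lintegral_mul_const _ (by fun_prop)]
    exact mul_le_mul_left hx _
  have hΦi : Integrable Φ ((mγ.prod mα).prod (mδ.prod mβ)) := by
    refine ⟨hΦ.aestronglyMeasurable, ?_⟩
    rw [HasFiniteIntegral, lintegral_prod _ hΦ.enorm.aemeasurable]
    refine lt_of_le_of_lt ?_ (ENNReal.mul_lt_top (ENNReal.coe_lt_top (r := K * K')) hrf.lt_top)
    calc ∫⁻ p, ∫⁻ q, ‖Φ (p, q)‖ₑ ∂mδ.prod mβ ∂mγ.prod mα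
        ≤ ∫⁻ p : γ × α, ‖F p.1 p.2‖ₑ * (K' * ∫⁻ y, ENNReal.ofReal (r (p.2, y)) ∂mβ)
          ∂mγ.prod mα := by
          refine lintegral_mono fun p => ?_
          simp only [Φ, enorm_mul (F _ _)]
          rw [lintegral_const_mul _ (by fun_prop)]
          exact mul_le_mul_right (hb1 p.2) _
      _ = ∫⁻ x, (∫⁻ c, ‖F c x‖ₑ ∂mγ) * (K' * ∫⁻ y, ENNReal.ofReal (r (x, y)) ∂mβ) ∂mα := by
          rw [lintegral_prod_symm' _ (by fun_prop)]
          refine lintegral_congr fun x => ?_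
          dsimp only
          rw [lintegral_mul_const _ (by fun_prop)]
      _ ≤ ∫⁻ x, K * (K' * ∫⁻ y, ENNReal.ofReal (r (x, y)) ∂mβ) ∂mα := by
          refine lintegral_mono_ae ?_
          filter_upwards [hK] with x hx using mul_le_mul_left hx _
      _ = ↑(K * K') * ∫⁻ z, ENNReal.ofReal (r z) ∂mα.prod mβ := by
          rw [lintegral_const_mul _ (by fun_prop), lintegral_const_mul _ (by fun_prop),
            lintegral_prod _ (by fun_prop), ENNReal.coe_mul, mul_assoc]
  have hrx : ∀ᵐ x ∂mα, ∫⁻ y, ENNReal.ofReal (r (x, y)) ∂mβ < ∞ := by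
    rw [lintegral_prod _ (by fun_prop)] at hrf
    exact ae_lt_top (by fun_prop) hrf
  have hry : ∀ᵐ y ∂mβ, ∫⁻ x, ENNReal.ofReal (r (x, y)) ∂mα < ∞ := by
    rw [lintegral_prod_symm' _ (by fun_prop)] at hrf
    exact ae_lt_top (by fun_prop) hrf
  have e1 : ∀ᵐ p ∂mγ.prod mα, ∫ q, Φ (p, q) ∂mδ.prod mβ = F p.1 p.2 * D₁ p.2 := by
    have h1 : ∀ᵐ x ∂mα, ∫ q : δ × β, E q.1 q.2 * r (x, q.2) ∂mδ.prod mβ = D₁ x := by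
      filter_upwards [hrx, hD₁] with x hx hx'
      rw [← hx']
      exact integral_prod _ ⟨Measurable.aestronglyMeasurable (by fun_prop),
        lt_of_le_of_lt (hb1 x) (ENNReal.mul_lt_top ENNReal.coe_lt_top hx)⟩
    filter_upwards [Measure.quasiMeasurePreserving_snd.ae h1] with p hp
    rw [← hp]
    exact integral_const_mul (F p.1 p.2) fun q : δ × β => E q.1 q.2 * r (p.2, q.2)
  have e2 : ∀ᵐ q ∂mδ.prod mβ, ∫ p, Φ (p, q) ∂mγ.prod mα = E q.1 q.2 * D₂ q.2 := by
    have h1 : ∀ᵐ y ∂mβ, ∫ p : γ × α, F p.1 p.2 * r (p.2, y) ∂mγ.prod mα = D₂ y := by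
      filter_upwards [hry, hD₂] with y hy hy'
      rw [← hy']
      exact integral_prod _ ⟨Measurable.aestronglyMeasurable (by fun_prop),
        lt_of_le_of_lt (hb2 y) (ENNReal.mul_lt_top ENNReal.coe_lt_top hy)⟩
    filter_upwards [Measure.quasiMeasurePreserving_snd.ae h1] with q hq
    rw [← hq, ← integral_const_mul]
    refine integral_congr_ae (Filter.Eventually.of_forall fun p => ?_)
    simp only [Φ]
    ring
  have i1 : Integrable (fun p : γ × α => F p.1 p.2 * D₁ p.2) (mγ.prod mα) :=
    hΦi.integral_prod_left.congr e1
  have i2 : Integrable (fun q : δ × β => E q.1 q.2 * D₂ q.2) (mδ.prod mβ) :=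
    hΦi.integral_prod_right.congr e2
  rw [← integral_prod (fun p : γ × α => F p.1 p.2 * D₁ p.2) i1,
    ← integral_prod (fun q : δ × β => E q.1 q.2 * D₂ q.2) i2, ← integral_congr_ae e1,
    ← integral_congr_ae e2, ← integral_prod _ hΦi, integral_prod_symm _ hΦi]

end Densities

end BridgeComparison

/-! ### Agreement of the outcome formula and the treatment formula -/

section MixedBridges

set_option linter.unusedSectionVars false

open scoped ENNReal

variable {Ω 𝓞 𝓦 𝓦₁ 𝓦₂ 𝓩 𝓩₁ 𝓩₂ 𝓑 𝓤 𝓧 : Type*} [MeasurableSpace Ω] [MeasurableSpace 𝓞]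
  [MeasurableSpace 𝓦] [MeasurableSpace 𝓦₁] [MeasurableSpace 𝓦₂] [MeasurableSpace 𝓩]
  [MeasurableSpace 𝓩₁] [MeasurableSpace 𝓩₂] [MeasurableSpace 𝓑] [MeasurableSpace 𝓤]
  [MeasurableSpace 𝓧]

namespace ProxyVars

variable {P : Measure Ω} [IsProbabilityMeasure P] {O : Ω → 𝓞} {W : Ω → 𝓦} {W1 : Ω → 𝓦₁} {Z : Ω → 𝓩}
  {Z1 : Ω → 𝓩₁} {B : Ω → 𝓑} {U : Ω → 𝓤} {X : Ω → 𝓧} {rW : 𝓦 → 𝓦₁}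
  {rZ : 𝓩 → 𝓩₁} {mO : Measure 𝓞} {mW : Measure 𝓦} {mW1 : Measure 𝓦₁} {mZ : Measure 𝓩}
  {mZ1 : Measure 𝓩₁} {mB : Measure 𝓑} {mU : Measure 𝓤} {mX : Measure 𝓧}
  [SigmaFinite mO] [SigmaFinite mW] [SigmaFinite mW1] [SigmaFinite mZ] [SigmaFinite mZ1]
  [SigmaFinite mB] [SigmaFinite mU] [SigmaFinite mX]
  (h : ProxyVars P O W W1 Z Z1 B U X rW rZ mO mW mW1 mZ mZ1 mB mU mX)

include h

/-- The bridge equation of an outcome bridge function in terms of joint densities. -/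
theorem outcome_bridge_dens {mW2 : Measure 𝓦₂} [SigmaFinite mW2] {gW : 𝓦₁ × 𝓦₂ → 𝓦}
    (hg : MeasurePreserving gW (mW1.prod mW2) mW) (hrg : ∀ x y, rW (gW (x, y)) = x)
    {H : 𝓞 → 𝓦 → 𝓦 → 𝓑 → 𝓧 → ℝ}
    (hbridge : ∀ᵐ t ∂(mO.prod mW).prod (mZ.prod (mB.prod mX)),
      ∫ w', H t.1.1 t.1.2 w' t.2.2.1 t.2.2.2 * condDens P W (fun ω => (Z ω, B ω, X ω)) mW
          (mZ.prod (mB.prod mX)) w' (t.2.1, t.2.2.1, t.2.2.2) ∂mW =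
        condDens P (fun ω => (O ω, W ω)) (fun ω => (Z ω, B ω, X ω)) (mO.prod mW)
          (mZ.prod (mB.prod mX)) t.1 t.2) :
    ∀ᵐ t ∂(mO.prod mW1).prod (mB.prod mX), ∀ᵐ z ∂mZ,
      ∫ ws, ∫ w', H t.1.1 (gW (t.1.2, ws)) w' t.2.1 t.2.2 *
        dens P (fun ω => (W ω, Z ω, B ω, X ω)) (mW.prod (mZ.prod (mB.prod mX))) (w', z, t.2)
          ∂mW ∂mW2 =
      dens P (fun ω => (O ω, W1 ω, Z ω, B ω, X ω)) (mO.prod (mW1.prod (mZ.prod (mB.prod mX))))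
        (t.1.1, t.1.2, z, t.2) := by
  have hgm := hg.measurable
  have hrW := h.qmp_rW.measurable
  have hT : Measurable fun ω => (Z ω, B ω, X ω) :=
    h.measurable_Z.prodMk (h.measurable_B.prodMk h.measurable_X)
  have hOW := h.measurable_O.prodMk h.measurable_W
  have hg' : MeasurePreserving (fun p : (𝓞 × 𝓦₁) × 𝓦₂ => (p.1.1, gW (p.1.2, p.2)))
      ((mO.prod mW1).prod mW2) (mO.prod mW) :=
    ((MeasurePreserving.id mO).prod hg).comp (measurePreserving_prodAssoc mO mW1 mW2)
  -- The bridge equation multiplied by `p(z,b,x)`; the sum over `w*` comes afterwards and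
  -- marginalizes the right side.
  have h1 : ∀ᵐ t ∂(mO.prod mW).prod (mZ.prod (mB.prod mX)),
      ∫ w', H t.1.1 t.1.2 w' t.2.2.1 t.2.2.2 *
        dens P (fun ω => (W ω, Z ω, B ω, X ω)) (mW.prod (mZ.prod (mB.prod mX))) (w', t.2) ∂mW =
      dens P (fun ω => ((O ω, W ω), Z ω, B ω, X ω))
        ((mO.prod mW).prod (mZ.prod (mB.prod mX))) t := by
    filter_upwards [hbridge, ae_condDens_mul_dens hOW hT h.ac_OW_ZBX,
      Measure.quasiMeasurePreserving_snd.ae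
        (ae_ae_swap_of_ae_prod (ae_condDens_mul_dens h.measurable_W hT h.ac_WZBX))] with t e1 e2 e3
    rw [← e2, ← e1, ← integral_mul_const]
    refine integral_congr_ae ?_
    filter_upwards [e3] with w' hw
    rw [← hw, mul_assoc]
  have he : MeasurePreserving (fun p : (𝓞 × 𝓦₁ × 𝓩 × 𝓑 × 𝓧) × 𝓦₂ =>
      ((p.1.1, gW (p.1.2.1, p.2)), p.1.2.2))
      ((mO.prod (mW1.prod (mZ.prod (mB.prod mX)))).prod mW2)
      ((mO.prod mW).prod (mZ.prod (mB.prod mX))) := by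
    have q1 : MeasurePreserving (fun p : (𝓞 × 𝓦₁) × (𝓩 × 𝓑 × 𝓧) × 𝓦₂ =>
        ((p.1.1, gW (p.1.2, p.2.2)), p.2.1))
        ((mO.prod mW1).prod ((mZ.prod (mB.prod mX)).prod mW2))
        ((mO.prod mW).prod (mZ.prod (mB.prod mX))) :=
      (hg'.prod (MeasurePreserving.id (mZ.prod (mB.prod mX)))).comp
        (((measurePreserving_prodAssoc (mO.prod mW1) mW2 (mZ.prod (mB.prod mX))).symm
          MeasurableEquiv.prodAssoc).comp ((MeasurePreserving.id (mO.prod mW1)).prod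
            Measure.measurePreserving_swap))
    exact q1.comp ((measurePreserving_prodAssoc (mO.prod mW1) (mZ.prod (mB.prod mX)) mW2).comp
      ((((measurePreserving_prodAssoc mO mW1 (mZ.prod (mB.prod mX))).symm
        MeasurableEquiv.prodAssoc)).prod (MeasurePreserving.id mW2)))
  have h2 := ae_dens_comp_eq_integral (hOW.prodMk hT) h.ac_OW_ZBX
    (f := fun y : (𝓞 × 𝓦) × 𝓩 × 𝓑 × 𝓧 => (y.1.1, rW y.1.2, y.2))
    (mT := mO.prod (mW1.prod (mZ.prod (mB.prod mX)))) (by fun_prop)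
    (by simp only [← h.W1_eq]; exact h.ac_OW1ZBX) he
    (fun t r => by simp only [hrg])
  simp only [← h.W1_eq] at h2
  have q : Measure.QuasiMeasurePreserving (fun p : ((𝓞 × 𝓦₁) × 𝓑 × 𝓧) × 𝓩 =>
      (p.1.1.1, p.1.1.2, p.2, p.1.2)) (((mO.prod mW1).prod (mB.prod mX)).prod mZ)
      (mO.prod (mW1.prod (mZ.prod (mB.prod mX)))) :=
    (measurePreserving_prodAssoc mO mW1 (mZ.prod (mB.prod mX))).quasiMeasurePreserving.comp
      (quasiMeasurePreserving_insert_middle (mO.prod mW1) mZ (mB.prod mX))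
  filter_upwards [ae_ae_ae_glue hg'.quasiMeasurePreserving h1, Measure.ae_ae_of_ae_prod (q.ae h2)]
    with t e1 e2
  filter_upwards [e1, e2] with z e1 e2
  rw [← e2]
  exact integral_congr_ae e1

/-- The bridge equation of a treatment bridge function in terms of joint densities. -/
theorem treatment_bridge_dens {mZ2 : Measure 𝓩₂} [SigmaFinite mZ2] {gZ : 𝓩₁ × 𝓩₂ → 𝓩}
    (hg : MeasurePreserving gZ (mZ1.prod mZ2) mZ) (hrg : ∀ x y, rZ (gZ (x, y)) = x)
    {Q : 𝓩 → 𝓩 → 𝓑 → 𝓧 → ℝ}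
    (hpos : ∀ᵐ b ∂mB, ∀ᵐ t ∂P.map (fun ω => (W ω, X ω)),
      0 < condDens P B (fun ω => (W ω, X ω)) mB (mW.prod mX) b t)
    (hbridge : ∀ᵐ t ∂mZ.prod (mW.prod (mB.prod mX)),
      ∫ z', Q t.1 z' t.2.2.1 t.2.2.2 * condDens P Z (fun ω => (W ω, B ω, X ω)) mZ
          (mW.prod (mB.prod mX)) z' (t.2.1, t.2.2.1, t.2.2.2) ∂mZ =
        condDens P Z (fun ω => (W ω, X ω)) mZ (mW.prod mX) t.1 (t.2.1, t.2.2.2) /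
          condDens P B (fun ω => (W ω, X ω)) mB (mW.prod mX) t.2.2.1 (t.2.1, t.2.2.2)) :
    ∀ᵐ t ∂mZ1.prod (mB.prod mX), ∀ᵐ w ∂mW,
      ∫ zs, ∫ z', Q (gZ (t.1, zs)) z' t.2.1 t.2.2 *
        dens P (fun ω => (W ω, Z ω, B ω, X ω)) (mW.prod (mZ.prod (mB.prod mX))) (w, z', t.2)
          ∂mZ ∂mZ2 =
      dens P (fun ω => (W ω, Z1 ω, X ω)) (mW.prod (mZ1.prod mX)) (w, t.1, t.2.2) := by
  have hgm := hg.measurable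
  have hrZ := h.qmp_rZ.measurable
  have hWX := h.measurable_W.prodMk h.measurable_X
  have hZBX : Measurable fun ω => (Z ω, B ω, X ω) :=
    h.measurable_Z.prodMk (h.measurable_B.prodMk h.measurable_X)
  have hT : Measurable fun ω => (W ω, B ω, X ω) :=
    h.measurable_W.prodMk (h.measurable_B.prodMk h.measurable_X)
  -- `p(w, b, x) = p(b | w, x) p(w, x)`
  have hB : ∀ᵐ t ∂mW.prod (mB.prod mX),
      dens P (fun ω => (W ω, B ω, X ω)) (mW.prod (mB.prod mX)) t =
        condDens P B (fun ω => (W ω, X ω)) mB (mW.prod mX) t.2.1 (t.1, t.2.2) *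
          dens P (fun ω => (W ω, X ω)) (mW.prod mX) (t.1, t.2.2) := by
    have e1 := ae_dens_comp_eq (h.measurable_B.prodMk hWX) h.ac_BWX
      (f := fun y : 𝓑 × 𝓦 × 𝓧 => (y.2.1, y.1, y.2.2)) (mT := mW.prod (mB.prod mX)) (by fun_prop)
      h.ac_WBX (measurePreserving_prod_left_comm mB mW mX) (fun t => rfl)
    filter_upwards [e1, (measurePreserving_prod_left_comm mB mW mX).quasiMeasurePreserving.ae
      (ae_condDens_mul_dens h.measurable_B hWX h.ac_BWX)] with t e1 e2
    exact e1.trans e2.symm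
  have hpos' : ∀ᵐ t ∂mW.prod (mB.prod mX),
      dens P (fun ω => (W ω, X ω)) (mW.prod mX) (t.1, t.2.2) ≠ 0 →
        condDens P B (fun ω => (W ω, X ω)) mB (mW.prod mX) t.2.1 (t.1, t.2.2) ≠ 0 := by
    have hm : MeasurableSet {z : 𝓑 × 𝓦 × 𝓧 |
        0 < condDens P B (fun ω => (W ω, X ω)) mB (mW.prod mX) z.1 z.2} :=
      measurableSet_lt (by fun_prop) (by fun_prop)
    filter_upwards [(measurePreserving_prod_left_comm mB mW mX).quasiMeasurePreserving.ae
      ((ae_prod_map_iff_dens (ac_snd h.measurable_B hWX h.ac_BWX)).1 ((Measure.ae_prod_iff_ae_ae hm).2 hpos))] with t ht h0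
    exact (ht h0).ne'
  have hswap : ∀ᵐ t ∂mW.prod (mB.prod mX), ∀ᵐ z ∂mZ,
      dens P (fun ω => (Z ω, W ω, B ω, X ω)) (mZ.prod (mW.prod (mB.prod mX))) (z, t) =
        dens P (fun ω => (W ω, Z ω, B ω, X ω)) (mW.prod (mZ.prod (mB.prod mX))) (t.1, z, t.2) :=
    ae_ae_swap_of_ae_prod (ae_dens_comp_eq (h.measurable_W.prodMk hZBX) h.ac_WZBX
      (f := fun y : 𝓦 × 𝓩 × 𝓑 × 𝓧 => (y.2.1, y.1, y.2.2)) (mT := mZ.prod (mW.prod (mB.prod mX)))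
      (by fun_prop) h.ac_ZWBX (measurePreserving_prod_left_comm mW mZ (mB.prod mX)) (fun t => rfl))
  have q0 : Measure.QuasiMeasurePreserving (fun p : 𝓩 × 𝓦 × 𝓑 × 𝓧 => (p.1, p.2.1, p.2.2.2))
      (mZ.prod (mW.prod (mB.prod mX))) (mZ.prod (mW.prod mX)) :=
    qmp_keep (qmp_keep Measure.quasiMeasurePreserving_snd)
  have h1 : ∀ᵐ t ∂mZ.prod (mW.prod (mB.prod mX)),
      ∫ z', Q t.1 z' t.2.2.1 t.2.2.2 *
        dens P (fun ω => (W ω, Z ω, B ω, X ω)) (mW.prod (mZ.prod (mB.prod mX)))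
          (t.2.1, z', t.2.2) ∂mZ =
      dens P (fun ω => (Z ω, W ω, X ω)) (mZ.prod (mW.prod mX)) (t.1, t.2.1, t.2.2.2) := by
    filter_upwards [hbridge, q0.ae (ae_condDens_mul_dens h.measurable_Z hWX h.ac_ZWX),
      Measure.quasiMeasurePreserving_snd.ae
        (ae_ae_swap_of_ae_prod (ae_condDens_mul_dens h.measurable_Z hT h.ac_ZWBX)),
      Measure.quasiMeasurePreserving_snd.ae hB, Measure.quasiMeasurePreserving_snd.ae hpos',
      Measure.quasiMeasurePreserving_snd.ae hswap] with t e1 e2 e3 e4 e5 e6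
    have f1 : ∫ z', Q t.1 z' t.2.2.1 t.2.2.2 *
        dens P (fun ω => (W ω, Z ω, B ω, X ω)) (mW.prod (mZ.prod (mB.prod mX)))
          (t.2.1, z', t.2.2) ∂mZ =
      (∫ z', Q t.1 z' t.2.2.1 t.2.2.2 * condDens P Z (fun ω => (W ω, B ω, X ω)) mZ
          (mW.prod (mB.prod mX)) z' (t.2.1, t.2.2.1, t.2.2.2) ∂mZ) *
        dens P (fun ω => (W ω, B ω, X ω)) (mW.prod (mB.prod mX)) t.2 := by
      rw [← integral_mul_const]
      refine integral_congr_ae ?_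
      filter_upwards [e3, e6] with z' h3 h6
      rw [← h6, ← h3, mul_assoc]
    rw [f1, e1, e4, ← e2]
    -- From `p(w,b,x) = p(b|w,x) p(w,x)` the denominator `p(b|w,x)` cancels, being nonzero wherever
    -- `p(w,x)` is.
    by_cases h0 : dens P (fun ω => (W ω, X ω)) (mW.prod mX) (t.2.1, t.2.2.2) = 0
    · rw [h0, mul_zero, mul_zero, mul_zero]
    · rw [← mul_assoc, div_mul_cancel₀ _ (e5 h0)]
  have he : MeasurePreserving (fun p : (𝓦 × 𝓩₁ × 𝓧) × 𝓩₂ => (gZ (p.1.2.1, p.2), p.1.1, p.1.2.2))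
      ((mW.prod (mZ1.prod mX)).prod mZ2) (mZ.prod (mW.prod mX)) := by
    have q1 : MeasurePreserving (fun p : 𝓩₁ × (𝓦 × 𝓧) × 𝓩₂ => (gZ (p.1, p.2.2), p.2.1))
        (mZ1.prod ((mW.prod mX).prod mZ2)) (mZ.prod (mW.prod mX)) :=
      (hg.prod (MeasurePreserving.id (mW.prod mX))).comp
        (((measurePreserving_prodAssoc mZ1 mZ2 (mW.prod mX)).symm
          MeasurableEquiv.prodAssoc).comp ((MeasurePreserving.id mZ1).prod
            Measure.measurePreserving_swap))
    exact q1.comp ((measurePreserving_prodAssoc mZ1 (mW.prod mX) mZ2).comp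
      ((measurePreserving_prod_left_comm mZ1 mW mX).prod (MeasurePreserving.id mZ2)))
  have h2 := ae_dens_comp_eq_integral (h.measurable_Z.prodMk hWX) h.ac_ZWX
    (f := fun y : 𝓩 × 𝓦 × 𝓧 => (y.2.1, rZ y.1, y.2.2))
    (mT := mW.prod (mZ1.prod mX)) (by fun_prop)
    (by simp only [← h.Z1_eq]; exact h.ac_WZ1X) he
    (fun t r => by simp only [hrg])
  simp only [← h.Z1_eq] at h2
  have q : Measure.QuasiMeasurePreserving (fun p : (𝓩₁ × 𝓑 × 𝓧) × 𝓦 =>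
      (p.2, p.1.1, p.1.2.2)) ((mZ1.prod (mB.prod mX)).prod mW) (mW.prod (mZ1.prod mX)) :=
    (qmp_keep (qmp_keep Measure.quasiMeasurePreserving_snd)).comp
      Measure.measurePreserving_swap.quasiMeasurePreserving
  filter_upwards [ae_ae_ae_glue hg.quasiMeasurePreserving h1, Measure.ae_ae_of_ae_prod (q.ae h2)]
    with t e1 e2
  filter_upwards [e1, e2] with w e1 e2
  rw [← e2]
  exact integral_congr_ae e1

/-- The identifying formulas of a bounded outcome bridge function and of a bounded treatment bridge
function agree. -/
theorem outcome_eq_treatment {mW2 : Measure 𝓦₂} [SigmaFinite mW2] {gW : 𝓦₁ × 𝓦₂ → 𝓦}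
    (hgW : MeasurePreserving gW (mW1.prod mW2) mW) (hrgW : ∀ x y, rW (gW (x, y)) = x)
    {H : 𝓞 → 𝓦 → 𝓦 → 𝓑 → 𝓧 → ℝ}
    (hH : Measurable fun t : 𝓞 × 𝓦 × 𝓦 × 𝓑 × 𝓧 => H t.1 t.2.1 t.2.2.1 t.2.2.2.1 t.2.2.2.2)
    (hHb : ∀ᵐ t ∂(mO.prod mW).prod (mZ.prod (mB.prod mX)),
      ∫ w', H t.1.1 t.1.2 w' t.2.2.1 t.2.2.2 * condDens P W (fun ω => (Z ω, B ω, X ω)) mW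
          (mZ.prod (mB.prod mX)) w' (t.2.1, t.2.2.1, t.2.2.2) ∂mW =
        condDens P (fun ω => (O ω, W ω)) (fun ω => (Z ω, B ω, X ω)) (mO.prod mW)
          (mZ.prod (mB.prod mX)) t.1 t.2)
    (hHK : ∀ᵐ t ∂(mO.prod mW1).prod (mB.prod mX), ∃ K : NNReal, ∀ᵐ w' ∂mW,
      ∫⁻ ws, ‖H t.1.1 (gW (t.1.2, ws)) w' t.2.1 t.2.2‖ₑ ∂mW2 ≤ K)
    {mZ2 : Measure 𝓩₂} [SigmaFinite mZ2] {gZ : 𝓩₁ × 𝓩₂ → 𝓩}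
    (hgZ : MeasurePreserving gZ (mZ1.prod mZ2) mZ) (hrgZ : ∀ x y, rZ (gZ (x, y)) = x)
    {Q : 𝓩 → 𝓩 → 𝓑 → 𝓧 → ℝ}
    (hQ : Measurable fun t : 𝓩 × 𝓩 × 𝓑 × 𝓧 => Q t.1 t.2.1 t.2.2.1 t.2.2.2)
    (hpos : ∀ᵐ b ∂mB, ∀ᵐ t ∂P.map (fun ω => (W ω, X ω)),
      0 < condDens P B (fun ω => (W ω, X ω)) mB (mW.prod mX) b t)
    (hQb : ∀ᵐ t ∂mZ.prod (mW.prod (mB.prod mX)),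
      ∫ z', Q t.1 z' t.2.2.1 t.2.2.2 * condDens P Z (fun ω => (W ω, B ω, X ω)) mZ
          (mW.prod (mB.prod mX)) z' (t.2.1, t.2.2.1, t.2.2.2) ∂mZ =
        condDens P Z (fun ω => (W ω, X ω)) mZ (mW.prod mX) t.1 (t.2.1, t.2.2.2) /
          condDens P B (fun ω => (W ω, X ω)) mB (mW.prod mX) t.2.2.1 (t.2.1, t.2.2.2))
    (hQK : ∀ᵐ t ∂mZ1.prod (mB.prod mX), ∃ K : NNReal, ∀ᵐ z' ∂mZ,
      ∫⁻ zs, ‖Q (gZ (t.1, zs)) z' t.2.1 t.2.2‖ₑ ∂mZ2 ≤ K) :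
    ∀ᵐ t ∂mB.prod (mO.prod (mW1.prod (mZ1.prod mX))),
      ∫ ws, ∫ w', H t.2.1 (gW (t.2.2.1, ws)) w' t.1 t.2.2.2.2 *
        dens P (fun ω => (W ω, Z1 ω, X ω)) (mW.prod (mZ1.prod mX)) (w', t.2.2.2.1, t.2.2.2.2)
          ∂mW ∂mW2 =
      ∫ zs, ∫ z', Q (gZ (t.2.2.2.1, zs)) z' t.1 t.2.2.2.2 *
        dens P (fun ω => (O ω, W1 ω, Z ω, B ω, X ω)) (mO.prod (mW1.prod (mZ.prod (mB.prod mX))))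
          (t.2.1, t.2.2.1, z', t.1, t.2.2.2.2) ∂mZ ∂mZ2 := by
  have hWm := hgW.measurable
  have hZm := hgZ.measurable
  have hd := measurable_dens P (fun ω => (W ω, Z ω, B ω, X ω)) (mW.prod (mZ.prod (mB.prod mX)))
  have hZBX : Measurable fun ω => (Z ω, B ω, X ω) :=
    h.measurable_Z.prodMk (h.measurable_B.prodMk h.measurable_X)
  -- The total mass is `1`, so the slice of `p(w,z,b,x)` at almost every `(b, x)` is finite, as
  -- Fubini with bounded kernels requires.
  have hfin : ∀ᵐ t ∂mB.prod mX, ∫⁻ y, ENNReal.ofReal (dens P (fun ω => (W ω, Z ω, B ω, X ω))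
      (mW.prod (mZ.prod (mB.prod mX))) (y.1, y.2, t)) ∂mW.prod mZ < ∞ := by
    refine ae_lt_top (by fun_prop) (ne_of_lt ?_)
    have e1 := lintegral_comp_dens (h.measurable_W.prodMk hZBX) h.ac_WZBX (φ := fun _ => 1)
      measurable_const
    have e2 := (measurePreserving_prodAssoc mW mZ (mB.prod mX)).lintegral_comp
      (f := fun y => ENNReal.ofReal (dens P (fun ω => (W ω, Z ω, B ω, X ω))
        (mW.prod (mZ.prod (mB.prod mX))) y)) (by fun_prop)
    rw [lintegral_prod_symm' _ (by fun_prop)] at e2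
    simp only [one_mul, lintegral_one, measure_univ] at e1
    exact (e2.trans e1.symm).trans_lt ENNReal.one_lt_top
  have q1 : Measure.QuasiMeasurePreserving (fun t : 𝓑 × 𝓞 × 𝓦₁ × 𝓩₁ × 𝓧 =>
      ((t.2.1, t.2.2.1), t.1, t.2.2.2.2)) (mB.prod (mO.prod (mW1.prod (mZ1.prod mX))))
      ((mO.prod mW1).prod (mB.prod mX)) :=
    ((measurePreserving_prodAssoc mO mW1 (mB.prod mX)).symm
      MeasurableEquiv.prodAssoc).quasiMeasurePreserving.comp
      ((qmp_keep ((qmp_keep (qmp_keep Measure.quasiMeasurePreserving_snd)).comp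
        (qmp_pull (Measure.QuasiMeasurePreserving.id _)))).comp
        (qmp_pull (Measure.QuasiMeasurePreserving.id _)))
  have q2 : Measure.QuasiMeasurePreserving (fun t : 𝓑 × 𝓞 × 𝓦₁ × 𝓩₁ × 𝓧 =>
      (t.2.2.2.1, t.1, t.2.2.2.2)) (mB.prod (mO.prod (mW1.prod (mZ1.prod mX))))
      (mZ1.prod (mB.prod mX)) :=
    (qmp_keep (qmp_keep (Measure.quasiMeasurePreserving_snd.comp
      Measure.quasiMeasurePreserving_snd))).comp
      (qmp_pull (qmp_pull (qmp_pull (Measure.QuasiMeasurePreserving.id _))))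
  have q3 : Measure.QuasiMeasurePreserving (fun t : 𝓑 × 𝓞 × 𝓦₁ × 𝓩₁ × 𝓧 =>
      (t.1, t.2.2.2.2)) (mB.prod (mO.prod (mW1.prod (mZ1.prod mX)))) (mB.prod mX) :=
    qmp_keep ((Measure.quasiMeasurePreserving_snd.comp
      Measure.quasiMeasurePreserving_snd).comp Measure.quasiMeasurePreserving_snd)
  filter_upwards [q1.ae (h.outcome_bridge_dens hgW hrgW hHb), q1.ae hHK,
    q2.ae (h.treatment_bridge_dens hgZ hrgZ hpos hQb), q2.ae hQK, q3.ae hfin]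
    with t e1 ⟨K, hK⟩ e2 ⟨K', hK'⟩ e3
  exact integral_integral_bounded_swap
    (F := fun ws w' => H t.2.1 (gW (t.2.2.1, ws)) w' t.1 t.2.2.2.2)
    (hH.comp (f := fun p : 𝓦₂ × 𝓦 => (t.2.1, gW (t.2.2.1, p.1), p.2, t.1, t.2.2.2.2))
      (by fun_prop))
    (E := fun zs z' => Q (gZ (t.2.2.2.1, zs)) z' t.1 t.2.2.2.2)
    (hQ.comp (f := fun p : 𝓩₂ × 𝓩 => (gZ (t.2.2.2.1, p.1), p.2, t.1, t.2.2.2.2)) (by fun_prop))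
    (r := fun y => dens P (fun ω => (W ω, Z ω, B ω, X ω)) (mW.prod (mZ.prod (mB.prod mX)))
      (y.1, y.2, t.1, t.2.2.2.2)) (by fun_prop) (fun _ => dens_nonneg _ _ _ _) e3.ne hK hK' e2 e1

end ProxyVars

end MixedBridges

/-! ### Two causal models with the same input kernel -/

section Comparison

open scoped ENNReal

universe u

set_option linter.unusedSectionVars false

theorem dens_congr {Ω Ω' α : Type*} [MeasurableSpace Ω] [MeasurableSpace Ω'] [MeasurableSpace α]
    {P : Measure Ω} {P' : Measure Ω'} {Y : Ω → α} {Y' : Ω' → α} (m : Measure α)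
    (h : P.map Y = P'.map Y') : dens P Y m = dens P' Y' m := by
  funext y
  rw [dens, dens, pdf, pdf, h]

theorem condDens_congr {Ω Ω' α β : Type*} [MeasurableSpace Ω] [MeasurableSpace Ω']
    [MeasurableSpace α] [MeasurableSpace β] {P : Measure Ω} {P' : Measure Ω'} {Y : Ω → α}
    {Y' : Ω' → α} {T : Ω → β} {T' : Ω' → β} (mY : Measure α) (mT : Measure β)
    (h : P.map (fun ω => (Y ω, T ω)) = P'.map (fun ω => (Y' ω, T' ω))) (hT : P.map T = P'.map T') :
    condDens P Y T mY mT = condDens P' Y' T' mY mT := by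
  funext y t
  rw [condDens, condDens, dens_congr _ h, dens_congr _ hT]

namespace CausalModel

variable {V U : Type*} [Fintype V] [DecidableEq V] [Fintype U] {G : Digraph (V ⊕ U)}
  {X : V → Type u} [∀ v, MeasurableSpace (X v)]
  {M M₁ M₂ : CausalModel G X} {μ : ∀ v, Measure (X v)} {d : EbfArgs V}
  {a : ∀ v, X v} {Us Us₁ Us₂ : Finset U}

theorem glue_obs {A A' C : Finset V} (hC : C ⊆ A ∪ A') (I : Finset V) (ω : M.Ω) :
    glue hC (M.obs I a A ω) (M.obs I a A' ω) = M.obs I a C ω := by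
  funext v
  by_cases hv : (v : V) ∈ A <;> simp [glue, hv, obs]

/-- The four blocks cover the output variables, so equality of the joint laws of the blocks implies
equality of the output kernels. -/
theorem kernel_out_eq_map (b : X d.B) :
    M.kernel (insert d.B d.S) (Function.update a d.B b) (d.out G) = (M.outLaw d a b).map fun y =>
      glue (d.out_sub G) y.1 (glue (Finset.Subset.refl _) y.2.1
        (glue (Finset.Subset.refl _) y.2.2.1 y.2.2.2)) := by
  have h1 := measurable_glue (X := X) (d.out_sub G)
  have h2 := measurable_glue (X := X) (Finset.Subset.refl (d.Wt G ∪ (d.Zt G ∪ d.C G)))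
  have h3 := measurable_glue (X := X) (Finset.Subset.refl (d.Zt G ∪ d.C G))
  rw [outLaw, Measure.map_map (by fun_prop) ((M.measurable_obs _ _ _).prodMk
    ((M.measurable_obs _ _ _).prodMk ((M.measurable_obs _ _ _).prodMk (M.measurable_obs _ _ _))))]
  simp only [kernel, Function.comp_def, glue_obs]

section Transfer

variable (hk : M₁.kernel d.S a d.R = M₂.kernel d.S a d.R)

include hk

/-- Everything in the bridge equations and in the formulas is a law of a function of the block `R`,
hence shared by the two models. -/
theorem map_comp_obs_eq {α : Type*} [MeasurableSpace α] {f : Blk X d.R → α} (hf : Measurable f) :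
    M₁.P.map (fun ω => f (M₁.obs d.S a d.R ω)) = M₂.P.map (fun ω => f (M₂.obs d.S a d.R ω)) := by
  have h1 := Measure.map_map (μ := M₁.P) hf (M₁.measurable_obs d.S a d.R)
  have h2 := Measure.map_map (μ := M₂.P) hf (M₂.measurable_obs d.S a d.R)
  exact h1.symm.trans ((congrArg (Measure.map f) hk).trans h2)

theorem densWgZ_eq : M₁.densWgZ μ d a = M₂.densWgZ μ d a := by
  have h := condDens_congr (refM μ d.W) ((refM μ d.Z).prod ((μ d.B).prod (refM μ (d.C G))))
    (map_comp_obs_eq hk (f := fun y => (Finset.restrict₂ (π := X) d.W_sub y,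
      Finset.restrict₂ (π := X) d.Z_sub y, y ⟨d.B, d.B_mem⟩, Finset.restrict₂ (π := X) (d.C_sub G) y))
      (by fun_prop))
    (map_comp_obs_eq hk (f := fun y => (Finset.restrict₂ (π := X) d.Z_sub y,
      y ⟨d.B, d.B_mem⟩, Finset.restrict₂ (π := X) (d.C_sub G) y)) (by fun_prop))
  funext w z b x
  exact congrFun (congrFun h w) (z, b, x)

theorem densWZt_eq : M₁.densWZt μ d a = M₂.densWZt μ d a := by
  have h := dens_congr ((refM μ d.W).prod ((refM μ (d.Zt G)).prod (refM μ (d.C G))))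
    (map_comp_obs_eq hk (f := fun y => (Finset.restrict₂ (π := X) d.W_sub y,
      Finset.restrict₂ (π := X) ((d.Zt_sub G).trans d.Z_sub) y, Finset.restrict₂ (π := X) (d.C_sub G) y))
      (by fun_prop))
  funext w z x
  exact congrFun h (w, z, x)

theorem densZgW_eq : M₁.densZgW μ d a = M₂.densZgW μ d a := by
  have h := condDens_congr (refM μ d.Z) ((refM μ d.W).prod ((μ d.B).prod (refM μ (d.C G))))
    (map_comp_obs_eq hk (f := fun y => (Finset.restrict₂ (π := X) d.Z_sub y,
      Finset.restrict₂ (π := X) d.W_sub y, y ⟨d.B, d.B_mem⟩, Finset.restrict₂ (π := X) (d.C_sub G) y))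
      (by fun_prop))
    (map_comp_obs_eq hk (f := fun y => (Finset.restrict₂ (π := X) d.W_sub y,
      y ⟨d.B, d.B_mem⟩, Finset.restrict₂ (π := X) (d.C_sub G) y)) (by fun_prop))
  funext z w b x
  exact congrFun (congrFun h z) (w, b, x)

theorem map_WC_eq :
    M₁.P.map (fun ω => (M₁.obs d.S a d.W ω, M₁.obs d.S a (d.C G) ω)) =
      M₂.P.map (fun ω => (M₂.obs d.S a d.W ω, M₂.obs d.S a (d.C G) ω)) :=
  map_comp_obs_eq hk (f := fun y => (Finset.restrict₂ (π := X) d.W_sub y,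
    Finset.restrict₂ (π := X) (d.C_sub G) y)) (by fun_prop)

theorem densBgW_eq : M₁.densBgW μ d a = M₂.densBgW μ d a := by
  have h := condDens_congr (μ d.B) ((refM μ d.W).prod (refM μ (d.C G)))
    (map_comp_obs_eq hk (f := fun y => (y ⟨d.B, d.B_mem⟩, Finset.restrict₂ (π := X) d.W_sub y,
      Finset.restrict₂ (π := X) (d.C_sub G) y)) (by fun_prop)) (map_WC_eq hk)
  funext b w x
  exact congrFun (congrFun h b) (w, x)

theorem densOWtZ_eq : M₁.densOWtZ μ d a = M₂.densOWtZ μ d a := by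
  have h := dens_congr ((refM μ (d.O G)).prod ((refM μ (d.Wt G)).prod ((refM μ d.Z).prod
      ((μ d.B).prod (refM μ (d.C G))))))
    (map_comp_obs_eq hk (f := fun y => (Finset.restrict₂ (π := X) (d.O_sub G) y,
      Finset.restrict₂ (π := X) ((d.Wt_sub G).trans d.W_sub) y, Finset.restrict₂ (π := X) d.Z_sub y,
      y ⟨d.B, d.B_mem⟩, Finset.restrict₂ (π := X) (d.C_sub G) y)) (by fun_prop))
  funext o w z b x
  exact congrFun h (o, w, z, b, x)

/-- Being a bridge function involves no latent variable, so it depends on the input kernel alone. -/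
theorem IsOutcomeBridge.congr {h : OutcomeFun X G d} (hb : M₁.IsOutcomeBridge μ d a h) :
    M₂.IsOutcomeBridge μ d a h := by
  have e := condDens_congr ((refM μ (d.O G)).prod (refM μ d.W))
    ((refM μ d.Z).prod ((μ d.B).prod (refM μ (d.C G))))
    (map_comp_obs_eq hk (f := fun y => ((Finset.restrict₂ (π := X) (d.O_sub G) y,
      Finset.restrict₂ (π := X) d.W_sub y), Finset.restrict₂ (π := X) d.Z_sub y,
      y ⟨d.B, d.B_mem⟩, Finset.restrict₂ (π := X) (d.C_sub G) y)) (by fun_prop))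
    (map_comp_obs_eq hk (f := fun y => (Finset.restrict₂ (π := X) d.Z_sub y,
      y ⟨d.B, d.B_mem⟩, Finset.restrict₂ (π := X) (d.C_sub G) y)) (by fun_prop))
  refine ⟨hb.1, ?_⟩
  rw [← densWgZ_eq hk]
  filter_upwards [hb.2] with t ht
  exact ⟨ht.1, ht.2.trans (congrFun (congrFun e t.1) t.2)⟩

theorem IsTreatmentBridge.congr {q : TreatmentFun X G d} (hb : M₁.IsTreatmentBridge μ d a q) :
    M₂.IsTreatmentBridge μ d a q := by
  have e := condDens_congr (refM μ d.Z) ((refM μ d.W).prod (refM μ (d.C G)))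
    (map_comp_obs_eq hk (f := fun y => (Finset.restrict₂ (π := X) d.Z_sub y,
      Finset.restrict₂ (π := X) d.W_sub y, Finset.restrict₂ (π := X) (d.C_sub G) y)) (by fun_prop))
    (map_WC_eq hk)
  refine ⟨?_, hb.2.1, ?_⟩
  · rw [← densBgW_eq hk, ← map_WC_eq hk]
    exact hb.1
  · rw [← densZgW_eq hk, ← densBgW_eq hk]
    filter_upwards [hb.2.2] with t ht
    refine ⟨ht.1, ht.2.trans ?_⟩
    congr 1
    exact congrFun (congrFun e t.1) (t.2.1, t.2.2.2)

end Transfer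

variable [∀ v, SigmaFinite (μ v)]

/-- The delicate point is the residual, which involves the latent variables of `M₂`. It is the
residual of `h₂` plus the double sum of `h₂` minus that of `h₁`. The two sums are bounded in `u`,
since the kernels are bounded and `p(w'|u,x)` has mass at most one, so the difference stays in `L²`
although `p(o,w̃|b,u,x)` is not controlled by itself. -/
theorem outcomeIntegrable_of_bounded (hd : M₂.HasJointDensity μ d.S a)
    (hk : M₁.kernel d.S a d.R = M₂.kernel d.S a d.R) {h₁ h₂ : OutcomeFun X G d}
    (hm₁ : Measurable fun t : Blk X (d.O G) × Blk X d.W × Blk X d.W × X d.B × Blk X (d.C G) =>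
      h₁ t.1 t.2.1 t.2.2.1 t.2.2.2.1 t.2.2.2.2)
    (hm₂ : Measurable fun t : Blk X (d.O G) × Blk X d.W × Blk X d.W × X d.B × Blk X (d.C G) =>
      h₂ t.1 t.2.1 t.2.2.1 t.2.2.2.1 t.2.2.2.2)
    (hi₁ : M₁.OutcomeIntegrable μ d a Us₁ h₁) (hi₂ : M₂.OutcomeIntegrable μ d a Us₂ h₂)
    (hK₁ : OutcomeBounded μ d h₁) (hK₂ : OutcomeBounded μ d h₂) :
    M₂.OutcomeIntegrable μ d a Us₂ h₁ := by
  have hp := hd.proxyVars Us₂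
  have hgm := (measurePreserving_glue_W (μ := μ) (d := d) (G := G)).measurable
  have hU : M₂.P.map (M₂.lat d.S a Us₂) ≪ refM M₂.ν Us₂ :=
    ac_fst hp.measurable_U hp.measurable_X hp.ac_UX
  have h1 : ∀ᵐ x ∂refM μ (d.C G), ∀ᵐ u ∂M₂.P.map (M₂.lat d.S a Us₂),
      ∫⁻ w, econdDens M₂.P (M₂.obs d.S a d.W)
        (fun ω => (M₂.lat d.S a Us₂ ω, M₂.obs d.S a (d.C G) ω))
        (refM μ d.W) ((refM M₂.ν Us₂).prod (refM μ (d.C G))) w (u, x) ∂refM μ d.W ≤ 1 := by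
    filter_upwards [ae_ae_swap_of_ae_prod (ae_lintegral_econdDens_le_one hp.measurable_W
      (hp.measurable_U.prodMk hp.measurable_X) hp.ac_WUX)] with x hx using hU.ae_le hx
  have q : Measure.QuasiMeasurePreserving
      (fun t : (Blk X (d.O G) × Blk X (d.Wt G)) × X d.B × Blk X (d.C G) => t.2.2)
      (((refM μ (d.O G)).prod (refM μ (d.Wt G))).prod ((μ d.B).prod (refM μ (d.C G))))
      (refM μ (d.C G)) :=
    Measure.quasiMeasurePreserving_snd.comp Measure.quasiMeasurePreserving_snd
  filter_upwards [hi₁, hi₂, hK₁, hK₂, q.ae h1] with t i₁ i₂ ⟨K₁, k₁⟩ ⟨K₂, k₂⟩ hx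
  have hI : ∀ (h : OutcomeFun X G d) (K : NNReal), (Measurable fun t : Blk X (d.O G) × Blk X d.W ×
        Blk X d.W × X d.B × Blk X (d.C G) => h t.1 t.2.1 t.2.2.1 t.2.2.2.1 t.2.2.2.2) →
      (∀ᵐ w' ∂refM μ d.W, ∫⁻ ws, ‖h t.1.1 (glue (d.W_sub_union G) t.1.2 ws) w' t.2.1 t.2.2‖ₑ
        ∂refM μ (d.Ws G) ≤ K) →
      MemLp (fun u => ∫ ws, ∫ w', h t.1.1 (glue (d.W_sub_union G) t.1.2 ws) w' t.2.1 t.2.2 *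
        condDens M₂.P (M₂.obs d.S a d.W) (fun ω => (M₂.lat d.S a Us₂ ω, M₂.obs d.S a (d.C G) ω))
          (refM μ d.W) ((refM M₂.ν Us₂).prod (refM μ (d.C G))) w' (u, t.2.2)
        ∂refM μ d.W ∂refM μ (d.Ws G)) 2 (M₂.P.map (M₂.lat d.S a Us₂)) := by
    intro h K hm hK
    refine memLp_integral_integral_mul
      (F := fun ws w' => h t.1.1 (glue (d.W_sub_union G) t.1.2 ws) w' t.2.1 t.2.2)
      (b := fun w' u => condDens M₂.P (M₂.obs d.S a d.W)
        (fun ω => (M₂.lat d.S a Us₂ ω, M₂.obs d.S a (d.C G) ω))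
          (refM μ d.W) ((refM M₂.ν Us₂).prod (refM μ (d.C G))) w' (u, t.2.2))
      ?_ ?_ (fun _ _ => condDens_nonneg _ _ _ _ _ _ _) hK hx 2
    · exact hm.comp (f := fun p : Blk X (d.Ws G) × Blk X d.W =>
        (t.1.1, glue (d.W_sub_union G) t.1.2 p.1, p.2, t.2.1, t.2.2)) (by fun_prop)
    · simp only [Function.uncurry_def]
      fun_prop
  refine ⟨?_, ?_, ?_⟩
  · rw [← densWgZ_eq hk]; exact i₁.1
  · rw [← densWZt_eq hk]; exact i₁.2.1
  · have e := (i₂.2.2.add (hI h₂ K₂ hm₂ k₂)).sub (hI h₁ K₁ hm₁ k₁)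
    refine e.ae_eq (Filter.Eventually.of_forall fun u => ?_)
    simp only [Pi.add_apply, Pi.sub_apply, outcomeResidual]
    ring

/-- As for outcome bridges: the residual of `q₂` absorbs the uncontrolled quotient
`p(z̃|u,x)/p(b|u,x)`, and the two bounded sums account for the difference. -/
theorem treatmentIntegrable_of_bounded (hd : M₂.HasJointDensity μ d.S a)
    (hk : M₁.kernel d.S a d.R = M₂.kernel d.S a d.R) {q₁ q₂ : TreatmentFun X G d}
    (hm₁ : Measurable fun t : Blk X d.Z × Blk X d.Z × X d.B × Blk X (d.C G) =>
      q₁ t.1 t.2.1 t.2.2.1 t.2.2.2)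
    (hm₂ : Measurable fun t : Blk X d.Z × Blk X d.Z × X d.B × Blk X (d.C G) =>
      q₂ t.1 t.2.1 t.2.2.1 t.2.2.2)
    (hi₁ : M₁.TreatmentIntegrable μ d a Us₁ q₁) (hi₂ : M₂.TreatmentIntegrable μ d a Us₂ q₂)
    (hK₁ : TreatmentBounded μ d q₁) (hK₂ : TreatmentBounded μ d q₂) :
    M₂.TreatmentIntegrable μ d a Us₂ q₁ := by
  have hp := hd.proxyVars Us₂
  have hgm := (measurePreserving_glue_Z (μ := μ) (d := d) (G := G)).measurable
  have hU : M₂.P.map (M₂.lat d.S a Us₂) ≪ refM M₂.ν Us₂ :=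
    ac_fst hp.measurable_U hp.measurable_X hp.ac_UX
  have h1 : ∀ᵐ t ∂(μ d.B).prod (refM μ (d.C G)), ∀ᵐ u ∂M₂.P.map (M₂.lat d.S a Us₂),
      ∫⁻ z, econdDens M₂.P (M₂.obs d.S a d.Z)
        (fun ω => (M₂.obs1 d.S a d.B ω, M₂.lat d.S a Us₂ ω, M₂.obs d.S a (d.C G) ω))
        (refM μ d.Z) ((μ d.B).prod ((refM M₂.ν Us₂).prod (refM μ (d.C G)))) z (t.1, u, t.2)
          ∂refM μ d.Z ≤ 1 := by
    filter_upwards [Measure.ae_ae_of_ae_prod ((quasiMeasurePreserving_insert_middle (μ d.B)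
      (refM M₂.ν Us₂) (refM μ (d.C G))).ae (ae_lintegral_econdDens_le_one hp.measurable_Z
      (hp.measurable_B.prodMk (hp.measurable_U.prodMk hp.measurable_X)) hp.ac_ZBUX))]
      with t ht using hU.ae_le ht
  filter_upwards [hi₁, hi₂, hK₁, hK₂, Measure.quasiMeasurePreserving_snd.ae h1]
    with t i₁ i₂ ⟨K₁, k₁⟩ ⟨K₂, k₂⟩ hx
  have hI : ∀ (q : TreatmentFun X G d) (K : NNReal),
      (Measurable fun t : Blk X d.Z × Blk X d.Z × X d.B × Blk X (d.C G) =>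
        q t.1 t.2.1 t.2.2.1 t.2.2.2) →
      (∀ᵐ z' ∂refM μ d.Z, ∫⁻ zs, ‖q (glue (d.Z_sub_union G) t.1 zs) z' t.2.1 t.2.2‖ₑ
        ∂refM μ (d.Zs G) ≤ K) →
      MemLp (fun u => ∫ zs, ∫ z', q (glue (d.Z_sub_union G) t.1 zs) z' t.2.1 t.2.2 *
        condDens M₂.P (M₂.obs d.S a d.Z)
          (fun ω => (M₂.obs1 d.S a d.B ω, M₂.lat d.S a Us₂ ω, M₂.obs d.S a (d.C G) ω))
          (refM μ d.Z) ((μ d.B).prod ((refM M₂.ν Us₂).prod (refM μ (d.C G)))) z' (t.2.1, u, t.2.2)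
        ∂refM μ d.Z ∂refM μ (d.Zs G)) 2 (M₂.P.map (M₂.lat d.S a Us₂)) := by
    intro q K hm hK
    refine memLp_integral_integral_mul
      (F := fun zs z' => q (glue (d.Z_sub_union G) t.1 zs) z' t.2.1 t.2.2)
      (b := fun z' u => condDens M₂.P (M₂.obs d.S a d.Z)
        (fun ω => (M₂.obs1 d.S a d.B ω, M₂.lat d.S a Us₂ ω, M₂.obs d.S a (d.C G) ω))
          (refM μ d.Z) ((μ d.B).prod ((refM M₂.ν Us₂).prod (refM μ (d.C G)))) z' (t.2.1, u, t.2.2))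
      ?_ ?_ (fun _ _ => condDens_nonneg _ _ _ _ _ _ _) hK hx 2
    · exact hm.comp (f := fun p : Blk X (d.Zs G) × Blk X d.Z =>
        (glue (d.Z_sub_union G) t.1 p.1, p.2, t.2.1, t.2.2)) (by fun_prop)
    · simp only [Function.uncurry_def]
      fun_prop
  refine ⟨?_, ?_, ?_⟩
  · rw [← densZgW_eq hk]; exact i₁.1
  · rw [← densOWtZ_eq hk]; exact i₁.2.1
  · have e := (i₂.2.2.add (hI q₂ K₂ hm₂ k₂)).sub (hI q₁ K₁ hm₁ k₁)
    refine e.ae_eq (Filter.Eventually.of_forall fun u => ?_)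
    simp only [Pi.add_apply, Pi.sub_apply, treatmentResidual]
    ring

variable [∀ v, StandardBorelSpace (X v)]

/-- The bridge function `h₁` is used in both models. The function `h₂` only helps to show that `h₁`
is sufficiently integrable in `M₂`. -/
theorem outLaw_eq_of_outcome (hk : M₁.kernel d.S a d.R = M₂.kernel d.S a d.R)
    (hc₁ : M₁.EbfCommon μ d a Us₁) (hc₂ : M₂.EbfCommon μ d a Us₂) {h₁ h₂ : OutcomeFun X G d}
    (hb₁ : M₁.IsOutcomeBridge μ d a h₁) (hb₂ : M₂.IsOutcomeBridge μ d a h₂)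
    (hi₁ : M₁.OutcomeIntegrable μ d a Us₁ h₁) (hi₂ : M₂.OutcomeIntegrable μ d a Us₂ h₂)
    (hK₁ : OutcomeBounded μ d h₁) (hK₂ : OutcomeBounded μ d h₂)
    (hcomp₁ : M₁.Complete μ d a Us₁ d.Z) (hcomp₂ : M₂.Complete μ d a Us₂ d.Z) :
    ∀ᵐ b ∂μ d.B, M₁.outLaw d a b = M₂.outLaw d a b := by
  filter_upwards [hc₁.outLaw_eq_outcome hb₁ hi₁ hcomp₁, hc₂.outLaw_eq_outcome (hb₁.congr hk)
    (outcomeIntegrable_of_bounded hc₂.density hk hb₁.1 hb₂.1 hi₁ hi₂ hK₁ hK₂) hcomp₂] with b e₁ e₂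
  rw [e₁, e₂, densWZt_eq hk]

theorem outLaw_eq_of_treatment (hk : M₁.kernel d.S a d.R = M₂.kernel d.S a d.R)
    (hc₁ : M₁.EbfCommon μ d a Us₁) (hc₂ : M₂.EbfCommon μ d a Us₂) {q₁ q₂ : TreatmentFun X G d}
    (hb₁ : M₁.IsTreatmentBridge μ d a q₁) (hb₂ : M₂.IsTreatmentBridge μ d a q₂)
    (hi₁ : M₁.TreatmentIntegrable μ d a Us₁ q₁) (hi₂ : M₂.TreatmentIntegrable μ d a Us₂ q₂)
    (hK₁ : TreatmentBounded μ d q₁) (hK₂ : TreatmentBounded μ d q₂)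
    (hcomp₁ : M₁.Complete μ d a Us₁ d.W) (hcomp₂ : M₂.Complete μ d a Us₂ d.W) :
    ∀ᵐ b ∂μ d.B, M₁.outLaw d a b = M₂.outLaw d a b := by
  filter_upwards [hc₁.outLaw_eq_treatment hb₁ hi₁ hcomp₁, hc₂.outLaw_eq_treatment (hb₁.congr hk)
    (treatmentIntegrable_of_bounded hc₂.density hk hb₁.2.1 hb₂.2.1 hi₁ hi₂ hK₁ hK₂) hcomp₂]
    with b e₁ e₂
  rw [e₁, e₂, densOWtZ_eq hk]

/-- Each model keeps its own formula, and `q` is transferred to `M₁` merely as a solution of its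
bridge equation. There the two formulas agree by `outcome_eq_treatment`, which uses neither
completeness nor conditional independence. -/
theorem outLaw_eq_of_outcome_of_treatment (hk : M₁.kernel d.S a d.R = M₂.kernel d.S a d.R)
    (hc₁ : M₁.EbfCommon μ d a Us₁) (hc₂ : M₂.EbfCommon μ d a Us₂) {h : OutcomeFun X G d}
    {q : TreatmentFun X G d}
    (hb₁ : M₁.IsOutcomeBridge μ d a h) (hb₂ : M₂.IsTreatmentBridge μ d a q)
    (hi₁ : M₁.OutcomeIntegrable μ d a Us₁ h) (hi₂ : M₂.TreatmentIntegrable μ d a Us₂ q)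
    (hK₁ : OutcomeBounded μ d h) (hK₂ : TreatmentBounded μ d q)
    (hcomp₁ : M₁.Complete μ d a Us₁ d.Z) (hcomp₂ : M₂.Complete μ d a Us₂ d.W) :
    ∀ᵐ b ∂μ d.B, M₁.outLaw d a b = M₂.outLaw d a b := by
  have hq := hb₂.congr hk.symm
  have e := (hc₁.density.proxyVars Us₁).outcome_eq_treatment measurePreserving_glue_W
    (fun x y => restrict₂_glue_left _ _ x y) hb₁.1 (hb₁.2.mono fun t ht => ht.2) hK₁
    measurePreserving_glue_Z (fun x y => restrict₂_glue_left _ _ x y) hq.2.1 hq.1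
    (hq.2.2.mono fun t ht => ht.2) hK₂
  filter_upwards [hc₁.outLaw_eq_outcome hb₁ hi₁ hcomp₁, hc₂.outLaw_eq_treatment hb₂ hi₂ hcomp₂,
    Measure.ae_ae_of_ae_prod e] with b e₁ e₂ e₃
  rw [e₁, e₂, ← densOWtZ_eq hk]
  refine withDensity_congr_ae ?_
  filter_upwards [e₃] with t ht
  exact congrArg ENNReal.ofReal ht

/-- Two models with the same input kernel have the same output kernel. -/
theorem outLaw_eq_of_ebfConditions (h₁ : M₁.EbfConditions μ d a) (h₂ : M₂.EbfConditions μ d a)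
    (hk : M₁.kernel d.S a d.R = M₂.kernel d.S a d.R) :
    ∀ᵐ b ∂μ d.B, M₁.outLaw d a b = M₂.outLaw d a b := by
  obtain ⟨Us₁, hc₁, ⟨⟨f₁, hb₁, hi₁, hK₁⟩, hcomp₁⟩ | ⟨⟨f₁, hb₁, hi₁, hK₁⟩, hcomp₁⟩⟩ := h₁ <;>
  obtain ⟨Us₂, hc₂, ⟨⟨f₂, hb₂, hi₂, hK₂⟩, hcomp₂⟩ | ⟨⟨f₂, hb₂, hi₂, hK₂⟩, hcomp₂⟩⟩ := h₂
  · exact outLaw_eq_of_outcome hk hc₁ hc₂ hb₁ hb₂ hi₁ hi₂ hK₁ hK₂ hcomp₁ hcomp₂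
  · exact outLaw_eq_of_outcome_of_treatment hk hc₁ hc₂ hb₁ hb₂ hi₁ hi₂ hK₁ hK₂ hcomp₁ hcomp₂
  · filter_upwards [outLaw_eq_of_outcome_of_treatment hk.symm hc₂ hc₁ hb₂ hb₁ hi₂ hi₁ hK₂ hK₁
      hcomp₂ hcomp₁] with b hb using hb.symm
  · exact outLaw_eq_of_treatment hk hc₁ hc₂ hb₁ hb₂ hi₁ hi₂ hK₁ hK₂ hcomp₁ hcomp₂

end CausalModel

end Comparison

/-- Validity of the extended bridge function kernel operation. -/
theorem mainTheorem9 {V U : Type*} [Fintype V] [DecidableEq V] [Fintype U]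
    (G : Digraph (V ⊕ U)) (X : V → Type*) [∀ v, MeasurableSpace (X v)] [∀ v, StandardBorelSpace (X v)]
    (μ : ∀ v, Measure (X v)) [∀ v, SigmaFinite (μ v)] (d : EbfArgs V) :
    -- any two models that satisfy the conditions and share the input kernel share the output kernel
    (∀ (M₁ M₂ : CausalModel G X) (s : ∀ v, X v),
      M₁.EbfConditions μ d s → M₂.EbfConditions μ d s →
      M₁.kernel d.S s d.R = M₂.kernel d.S s d.R →
      ∀ᵐ b ∂μ d.B,
        M₁.kernel (insert d.B d.S) (Function.update s d.B b) (d.out G) =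
          M₂.kernel (insert d.B d.S) (Function.update s d.B b) (d.out G)) ∧
    -- every sufficiently integrable bridge function yields an identifying formula
    (∀ (M : CausalModel G X) (s : ∀ v, X v) (Us : Finset U), M.EbfCommon μ d s Us →
      (∀ h : CausalModel.OutcomeFun X G d,
        M.IsOutcomeBridge μ d s h → M.OutcomeIntegrable μ d s Us h → M.Complete μ d s Us d.Z →
        ∀ᵐ b ∂μ d.B, M.outLaw d s b = (CausalModel.outRef μ G d).withDensity fun t =>
          ENNReal.ofReal (∫ ws, ∫ w', h t.1 (glue (d.W_sub_union G) t.2.1 ws) w' b t.2.2.2 *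
            M.densWZt μ d s w' t.2.2.1 t.2.2.2 ∂refM μ d.W ∂refM μ (d.Ws G))) ∧
      (∀ q : CausalModel.TreatmentFun X G d,
        M.IsTreatmentBridge μ d s q → M.TreatmentIntegrable μ d s Us q →
        M.Complete μ d s Us d.W →
        ∀ᵐ b ∂μ d.B, M.outLaw d s b = (CausalModel.outRef μ G d).withDensity fun t =>
          ENNReal.ofReal (∫ zs, ∫ z', q (glue (d.Z_sub_union G) t.2.2.1 zs) z' b t.2.2.2 *
            M.densOWtZ μ d s t.1 t.2.1 z' b t.2.2.2 ∂refM μ d.Z ∂refM μ (d.Zs G)))) := by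
  refine ⟨fun M₁ M₂ s h₁ h₂ hk => ?_, fun M s Us hc => ⟨fun h hb hi hcomp =>
    hc.outLaw_eq_outcome hb hi hcomp, fun q hb hi hcomp => hc.outLaw_eq_treatment hb hi hcomp⟩⟩
  filter_upwards [CausalModel.outLaw_eq_of_ebfConditions h₁ h₂ hk] with b hb
  rw [CausalModel.kernel_out_eq_map, CausalModel.kernel_out_eq_map, hb]
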